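/- An instance of \textsc{Maximum Node-Disjoint Paths} is a pair $\mathcal I=(G,\mathcal M)$, where $G$ is a finite undirected graph without loops on $n$ vertices and $\mathcal M\subseteq\binom{V(G)}{2}$ is a set of demand pairs. A feasible solution is a family of pairwise vertex-disjoint paths of $G$ (disjoint also at their endpoints), each of which joins the two vertices of a demand pair in $\mathcal M$; its value is the number of its paths, and $\mathrm{OPT}(\mathcal I)$ is the maximum value of a feasible solution. The tree-depth $\mathrm{td}(G)$ is the least height, counted in vertices, of a rooted forest on the vertex set $V(G)$ in which any two vertices adjacent in $G$ are in ancestor–descendant relation. **Theorem.** There are a deterministic algorithm and a constant $c$ such that, for every instance $\mathcal I=(G,\mathcal M)$ and every rational $\varepsilon=p/q$ with integers $0<p<q$, the algorithm, given $(G,\mathcal M,p,q)$, outputs a feasible solution of value at least $(1-\varepsilon)\,\mathrm{OPT}(\mathcal I)$ in at most $$2^{\,c\cdot 2^{\mathrm{td}(G)}/\varepsilon}\cdot (n+1)^{c}$$ steps, that is, in time $2^{O(2^{\mathrm{td}}/\varepsilon)}\,n^{O(1)}$. The tree-depth is not part of the input. (Steps are counted on a unit-cost random access machine over the natural numbers with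 addition, truncated subtraction and indirect addressing.) -/

import Mathlib

/-! ### Node-disjoint paths -/

/-- `l` is the vertex sequence of a path of `G` whose two endpoints form a demand pair of `M`. -/
def IsRoutingPath {V : Type*} (G : SimpleGraph V) (M : Set (Sym2 V)) (l : List V) : Prop :=
  ∃ (s t : V) (w : G.Walk s t), w.IsPath ∧ s(s, t) ∈ M ∧ w.support = l

/-- A feasible solution: a list of pairwise vertex-disjoint paths of `G` (endpoints included), each
joining the two vertices of a demand pair of `M`. As paths are non-empty, disjoint paths route
different demands, so the length of the list is the number of routed demands. -/
structure IsFeasible {V : Type*} (G : SimpleGraph V) (M : Set (Sym2 V)) (L : List (List V)) :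
    Prop where
  path : ∀ l ∈ L, IsRoutingPath G M l
  disjoint : L.Pairwise List.Disjoint

/-- The maximum number of demands of `M` that can be routed in `G` by vertex-disjoint paths. -/
noncomputable def mndpOpt {V : Type*} (G : SimpleGraph V) (M : Set (Sym2 V)) : ℕ :=
  sSup {k | ∃ L : List (List V), IsFeasible G M L ∧ L.length = k}

theorem IsFeasible.length_le {V : Type*} [Fintype V] {G : SimpleGraph V} {M : Set (Sym2 V)}
    {L : List (List V)} (h : IsFeasible G M L) : L.length ≤ Fintype.card V := by
  have hn : L.flatten.Nodup := by
    rw [List.nodup_flatten]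
    refine ⟨fun l hl => ?_, h.disjoint⟩
    obtain ⟨s, t, w, hw, -, rfl⟩ := h.path l hl
    exact hw.support_nodup
  have hpos : ∀ x ∈ L.map List.length, 1 ≤ x := by
    intro x hx
    obtain ⟨l, hl, rfl⟩ := List.mem_map.1 hx
    obtain ⟨s, t, w, hw, -, rfl⟩ := h.path l hl
    simp
  have h1 : L.length ≤ L.flatten.length := by
    rw [List.length_flatten]
    simpa using List.card_nsmul_le_sum (L.map List.length) 1 hpos
  exact h1.trans hn.length_le_card

/-- On a finite graph the supremum in `mndpOpt` is attained: it is a true maximum. -/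
theorem mndpOpt_isGreatest {V : Type*} [Fintype V] (G : SimpleGraph V) (M : Set (Sym2 V)) :
    IsGreatest {k | ∃ L : List (List V), IsFeasible G M L ∧ L.length = k} (mndpOpt G M) := by
  have hne : {k | ∃ L : List (List V), IsFeasible G M L ∧ L.length = k}.Nonempty :=
    ⟨0, [], ⟨by simp, by simp⟩, rfl⟩
  have hbdd : BddAbove {k | ∃ L : List (List V), IsFeasible G M L ∧ L.length = k} := by
    refine ⟨Fintype.card V, ?_⟩
    rintro k ⟨L, hL, rfl⟩
    exact hL.length_le
  exact ⟨Nat.sSup_mem hne hbdd, fun k hk => le_csSup hbdd hk⟩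

/-! ### Tree-depth -/

/-- An elimination forest of `G`: a rooted forest on the vertex set of `G`, given by its parent
function, such that any two adjacent vertices of `G` are in ancestor-descendant relation.
`depth v` is the number of vertices on the way from `v` up to its root; it is determined by `parent`
and its existence says that `parent` has no cycle. -/
structure EliminationForest {V : Type*} (G : SimpleGraph V) where
  parent : V → Option V
  depth : V → ℕ
  depth_root : ∀ v, parent v = none → depth v = 1
  depth_child : ∀ v u, parent v = some u → depth v = depth u + 1
  adj_comparable : ∀ u v, G.Adj u v →
    Relation.ReflTransGen (fun x y => parent y = some x) u v ∨
      Relation.ReflTransGen (fun x y => parent y = some x) v u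

/-- The tree-depth of `G`: the least height (number of vertices on a longest root-to-leaf path) of an
elimination forest of `G`. A single vertex has tree-depth 1, the empty graph tree-depth 0. -/
noncomputable def treeDepth {V : Type*} (G : SimpleGraph V) : ℕ :=
  sInf {d | ∃ F : EliminationForest G, ∀ v, F.depth v ≤ d}

/-- The infimum in `treeDepth` is over a non-empty set. -/
theorem treeDepth_set_nonempty {n : ℕ} (G : SimpleGraph (Fin n)) :
    {d | ∃ F : EliminationForest G, ∀ v, F.depth v ≤ d}.Nonempty := by
  let par : Fin n → Option (Fin n) := fun v =>
    if v.1 = 0 then none else some ⟨v.1 - 1, by omega⟩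
  have key : ∀ (k : ℕ) (u v : Fin n), v.1 = u.1 + k →
      Relation.ReflTransGen (fun x y => par y = some x) u v := by
    intro k
    induction k with
    | zero =>
      intro u v h
      have : u = v := Fin.ext (by omega)
      subst this
      exact .refl
    | succ k ih =>
      intro u v h
      refine Relation.ReflTransGen.tail (ih u ⟨v.1 - 1, by omega⟩ (by simp only; omega)) ?_
      have : v.1 ≠ 0 := by omega
      simp [par, this]
  refine ⟨n, ⟨par, fun v => v.1 + 1, ?_, ?_, ?_⟩, fun v => v.2⟩
  · intro v hv
    by_contra hne
    have : v.1 ≠ 0 := by omega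
    simp [par, this] at hv
  · intro v u hv
    by_cases h0 : v.1 = 0
    · simp [par, h0] at hv
    · simp only [par, h0, if_false, Option.some.injEq] at hv
      subst hv
      simp only
      omega
  · intro u v _
    rcases le_total u.1 v.1 with h | h
    · exact Or.inl (key (v.1 - u.1) u v (by omega))
    · exact Or.inr (key (u.1 - v.1) v u (by omega))

/-! ### The machine model

A unit-cost random access machine over the natural numbers, with addition, truncated subtraction and
indirect addressing (no multiplication), whose programs are written with structured control flow.
A program mentions finitely many scalar variables and finitely many arrays; an array has a cell for
every natural number and is accessed at computed indices. -/

/-- Memory contents: `var x` is the value of the variable `x`, `arr k i` that of cell `i` of the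
array `k`. -/
structure RamState where
  var : ℕ → ℕ
  arr : ℕ → ℕ → ℕ

/-- Expressions: constants, variables, array cells at a computed index, sums, differences. -/
inductive RamExpr : Type
  | const (c : ℕ)
  | var (x : ℕ)
  | get (k : ℕ) (i : RamExpr)
  | add (e f : RamExpr)
  | sub (e f : RamExpr)

/-- The value of an expression (`sub` is truncated at zero). -/
def RamExpr.eval (s : RamState) : RamExpr → ℕ
  | .const c => c
  | .var x => s.var x
  | .get k i => s.arr k (i.eval s)
  | .add e f => e.eval s + f.eval s
  | .sub e f => e.eval s - f.eval s

/-- The number of steps to evaluate an expression: one for each operation and each operand. -/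
def RamExpr.cost : RamExpr → ℕ
  | .const _ => 1
  | .var _ => 1
  | .get _ i => i.cost + 1
  | .add e f => e.cost + f.cost + 1
  | .sub e f => e.cost + f.cost + 1

/-- Programs. `ite e a b` runs `a` if `e` is non-zero and `b` otherwise; `loop e a` repeats `a` as
long as `e` is non-zero. -/
inductive RamProg : Type
  | skip
  | setVar (x : ℕ) (e : RamExpr)
  | setArr (k : ℕ) (i e : RamExpr)
  | seq (a b : RamProg)
  | ite (e : RamExpr) (a b : RamProg)
  | loop (e : RamExpr) (a : RamProg)

/-- `Exec P s t s'`: started in state `s`, the program `P` halts in state `s'` after `t` steps. -/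
inductive Exec : RamProg → RamState → ℕ → RamState → Prop
  | skip (s : RamState) : Exec .skip s 1 s
  | setVar (x : ℕ) (e : RamExpr) (s : RamState) :
      Exec (.setVar x e) s (e.cost + 1) ⟨Function.update s.var x (e.eval s), s.arr⟩
  | setArr (k : ℕ) (i e : RamExpr) (s : RamState) :
      Exec (.setArr k i e) s (i.cost + e.cost + 1)
        ⟨s.var, Function.update s.arr k (Function.update (s.arr k) (i.eval s) (e.eval s))⟩
  | seq {a b : RamProg} {s₁ s₂ s₃ : RamState} {t₁ t₂ : ℕ} :
      Exec a s₁ t₁ s₂ → Exec b s₂ t₂ s₃ → Exec (.seq a b) s₁ (t₁ + t₂) s₃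
  | ite_true {e : RamExpr} {a b : RamProg} {s s' : RamState} {t : ℕ} :
      e.eval s ≠ 0 → Exec a s t s' → Exec (.ite e a b) s (e.cost + 1 + t) s'
  | ite_false {e : RamExpr} {a b : RamProg} {s s' : RamState} {t : ℕ} :
      e.eval s = 0 → Exec b s t s' → Exec (.ite e a b) s (e.cost + 1 + t) s'
  | loop_done {e : RamExpr} {a : RamProg} {s : RamState} :
      e.eval s = 0 → Exec (.loop e a) s (e.cost + 1) s
  | loop_step {e : RamExpr} {a : RamProg} {s₁ s₂ s₃ : RamState} {t₁ t₂ : ℕ} :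
      e.eval s₁ ≠ 0 → Exec a s₁ t₁ s₂ → Exec (.loop e a) s₂ t₂ s₃ →
        Exec (.loop e a) s₁ (e.cost + 1 + t₁ + t₂) s₃

/-- The machine is deterministic: result and running time are determined by the program and the
initial state. -/
theorem Exec.deterministic {P : RamProg} {s s₁ s₂ : RamState} {t₁ t₂ : ℕ}
    (h₁ : Exec P s t₁ s₁) (h₂ : Exec P s t₂ s₂) : t₁ = t₂ ∧ s₁ = s₂ := by
  induction h₁ generalizing t₂ s₂ with
  | skip s => cases h₂; exact ⟨rfl, rfl⟩
  | setVar x e s => cases h₂; exact ⟨rfl, rfl⟩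
  | setArr k i e s => cases h₂; exact ⟨rfl, rfl⟩
  | seq _ _ iha ihb =>
    cases h₂ with
    | seq ha hb =>
      obtain ⟨rfl, rfl⟩ := iha ha
      obtain ⟨rfl, rfl⟩ := ihb hb
      exact ⟨rfl, rfl⟩
  | ite_true he _ ih =>
    cases h₂ with
    | ite_true _ h => obtain ⟨rfl, rfl⟩ := ih h; exact ⟨rfl, rfl⟩
    | ite_false he' _ => exact absurd he' he
  | ite_false he _ ih =>
    cases h₂ with
    | ite_true he' _ => exact absurd he he'
    | ite_false _ h => obtain ⟨rfl, rfl⟩ := ih h; exact ⟨rfl, rfl⟩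
  | loop_done he =>
    cases h₂ with
    | loop_done _ => exact ⟨rfl, rfl⟩
    | loop_step he' _ _ => exact absurd he he'
  | loop_step he _ _ iha ihb =>
    cases h₂ with
    | loop_done he' => exact absurd he' he
    | loop_step _ ha hb =>
      obtain ⟨rfl, rfl⟩ := iha ha
      obtain ⟨rfl, rfl⟩ := ihb hb
      exact ⟨rfl, rfl⟩

/-! ### Input and output format -/

open Classical in
/-- The initial memory for the graph `G` on the vertices `0, …, n - 1`, the demand pairs `M` and the
error `ε = p / q`: the variables `0, 1, 2` hold `n, p, q`; cell `u * n + v` of array `0` holds `1` if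
`u` and `v` are adjacent, that of array `1` holds `1` if `{u, v}` is a demand pair; all else is `0`. -/
noncomputable def mndpInput {n : ℕ} (G : SimpleGraph (Fin n)) (M : Set (Sym2 (Fin n))) (p q : ℕ) :
    RamState where
  var x := if x = 0 then n else if x = 1 then p else if x = 2 then q else 0
  arr k i :=
    if k = 0 then (if ∃ u v : Fin n, i = u.1 * n + v.1 ∧ G.Adj u v then 1 else 0)
    else if k = 1 then (if ∃ u v : Fin n, i = u.1 * n + v.1 ∧ s(u, v) ∈ M then 1 else 0)
    else 0

/-- The memory `s` holds the list of vertex lists `L` as output: variable `3` holds the number of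
lists, cell `i` of array `2` the length of the `i`-th list, and cell `i * n + j` of array `3` the
`j`-th entry of the `i`-th list. -/
def IsOutput {n : ℕ} (s : RamState) (L : List (List (Fin n))) : Prop :=
  s.var 3 = L.length ∧
    ∀ (i : ℕ) (hi : i < L.length), s.arr 2 i = L[i].length ∧
      ∀ (j : ℕ) (hj : j < L[i].length), s.arr 3 (i * n + j) = (L[i][j]).1

/-! Approximation. Let `Q` be the least integer with `Q ≥ 1/ε`, and suppose first that a bound `d`
on the tree-depth is known; put `N = 2 Q 2^d`. A path in a set of tree-depth `h` has fewer than
`2^h` vertices (`TdLe.length_lt`), since a root cuts it into two paths of smaller depth. Hence `k`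
disjoint paths in a component `K` of tree-depth at most `h` occupy at most `k 2^h` vertices. Search
`K` for the largest packing that uses at most `N` vertices, with `k` paths, say. If `(k + 1) 2^h ≤
N`, a packing of `k + 1` paths would have been found, so `k` is optimal for `K`; output it and
discard `K`. Otherwise the optimum of `K` is at least `N / 2^h`, and a root of `K` is deleted, which
lowers the tree-depth of `K` and costs at most one path (`maxPacking_le_erase`); the loss is charged
to the optimum of `K` (`BCmd.handle_spec`).

In round `i` all components have tree-depth at most `h = d - i`, so each loss is paid by `2 Q 2^i`
paths; the components are disjoint, so the round loses at most `OPT / (2 Q 2^i)` paths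
(`BCmd.level_spec`). The geometric series sums to at most `OPT / Q ≤ ε OPT` (`BCmd.solve_spec`), and
after `d` rounds nothing is left.

Searching. A word lists the vertices of the paths one after the other, each letter saying whether it
starts a new path. Words whose steps are edges and whose paths have demanded ends are recognised by
a small automaton; the difficulty is to find one without a repeated vertex. To a word of length `m`
attach the square of the Vandermonde determinant of its vertices. It is positive if the vertices are
distinct and zero otherwise, so the sum over all words is non-zero exactly if a packing exists
(`WordSpec.weight_ne_zero_iff`); squares exclude cancellation and make the method deterministic.
Laplace expansion along the newest row turns the sum into a dynamic program over the automaton state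
and two sets of remaining columns (`WordSpec.weight_words_succ`), with `4^m` pairs of sets for `m ≤
N`. A word itself is recovered letter by letter, asking each time whether a word with the given
beginning exists (`BCmd.extract_spec`).

Recognising tree-depth. `obst` computes, in all components at once, a small vertex set of tree-depth
more than `h` inside each component of tree-depth more than `h`. Given the obstruction `X` at level
`h`, a root witnessing tree-depth at most `h + 1` must lie in `X`, as otherwise `X` survives its
deletion; so only boundedly many candidates must be tried, each by a recursive call. If all fail,
`X` together with one obstruction for each failed candidate, made connected by shortest paths to a
fixed vertex of the component, is the obstruction at level `h + 1`; should such a shortest path have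
`2^(h+1)` vertices, it is an obstruction by itself (`clos_gens_spec`, `obst_spec`). The sizes
satisfy `b' ≈ 4 b² 2^(h+1)`, and both sizes and numbers of calls stay `2^O(2^h)` (`obstBound_succ`,
`BCmd.tickCount_le`). The same test supplies the roots that are deleted above.

Running time. Everything is written in a language whose loops run up to one number `B`, with
compilation costing a polynomial in `B` (`BCmd.runs_compile`, `PolyBounded.cmd`). The choice `B =
4^N (n + 2)` makes all tables large enough. The tree-depth is not known, so `d = 0, 1, 2, …` is
tried until the test succeeds, which happens at `d = td` at the latest; the last bound dominates,
and `Q ≤ 2/ε` gives the claimed time (`exists_time_bound`, `time_le`). -/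

/-! ### Bounded expressions and programs

A small language all of whose loops are bounded by the variable `4`, with a total denotational
semantics, compiled to `RamProg` with a running time polynomial in the bound. -/

/-- Expressions with bounded sums and bounded iteration. -/
inductive BExpr : Type
  | const (c : ℕ)
  | var (x : ℕ)
  | get (k : ℕ) (i : BExpr)
  | add (e f : BExpr)
  | sub (e f : BExpr)
  | mul (e f : BExpr)
  | ite (c a b : BExpr)
  | sum (x : ℕ) (e : BExpr)
  | fold (x y : ℕ) (a b : BExpr)

namespace BExpr

/-- The value of an expression in the memory with variables `v` and arrays `m`. The first factor of
a product is cut off at the bound. -/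
def eval : BExpr → (ℕ → ℕ) → (ℕ → ℕ → ℕ) → ℕ
  | const c, _, _ => c
  | var x, v, _ => v x
  | get k i, v, m => m k (i.eval v m)
  | add e f, v, m => e.eval v m + f.eval v m
  | sub e f, v, m => e.eval v m - f.eval v m
  | mul e f, v, m => min (e.eval v m) (v 4) * f.eval v m
  | ite c a b, v, m => if c.eval v m ≠ 0 then a.eval v m else b.eval v m
  | sum x e, v, m => ∑ i ∈ Finset.range (v 4), e.eval (Function.update v x i) m
  | fold x y a b, v, m => Nat.rec (a.eval v m)
      (fun i acc => b.eval (Function.update (Function.update v x i) y acc) m) (v 4)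

/-- The variables of an expression are below `100`, and `4` is not bound. -/
def wf : BExpr → Bool
  | const _ => true
  | var x => decide (x < 100)
  | get _ i => i.wf
  | add e f => e.wf && f.wf
  | sub e f => e.wf && f.wf
  | mul e f => e.wf && f.wf
  | ite c a b => c.wf && a.wf && b.wf
  | sum x e => decide (x < 100) && decide (x ≠ 4) && e.wf
  | fold x y a b => decide (x < 100) && decide (x ≠ 4) && decide (y < 100) && decide (y ≠ 4) &&
      a.wf && b.wf

/-- The arrays an expression reads. -/
def arrs : BExpr → List ℕ
  | const _ => []
  | var _ => []
  | get k i => k :: i.arrs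
  | add e f => e.arrs ++ f.arrs
  | sub e f => e.arrs ++ f.arrs
  | mul e f => e.arrs ++ f.arrs
  | ite c a b => c.arrs ++ a.arrs ++ b.arrs
  | sum _ e => e.arrs
  | fold _ _ a b => a.arrs ++ b.arrs

/-- The loop that runs `body` with the counter `c` until it reaches the bound. -/
def countLoop (c : ℕ) (body : RamProg) : RamProg :=
  .loop (.sub (.var 4) (.var c)) (.seq body (.setVar c (.add (.var c) (.const 1))))

/-- Compilation; the value ends up in the variable `d`, variables from `d` on are scratch. -/
def compile : BExpr → ℕ → RamProg
  | const c, d => .setVar d (.const c)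
  | var x, d => .setVar d (.var x)
  | get k i, d => .seq (i.compile d) (.setVar d (.get k (.var d)))
  | add e f, d => .seq (e.compile d) (.seq (f.compile (d + 1))
      (.setVar d (.add (.var d) (.var (d + 1)))))
  | sub e f, d => .seq (e.compile d) (.seq (f.compile (d + 1))
      (.setVar d (.sub (.var d) (.var (d + 1)))))
  | mul e f, d => .seq (e.compile d) (.seq (f.compile (d + 1)) (.seq (.setVar (d + 2) (.const 0))
      (.seq (.setVar (d + 3) (.const 0)) (.seq
        (countLoop (d + 3) (.ite (.sub (.var d) (.var (d + 3)))
          (.setVar (d + 2) (.add (.var (d + 2)) (.var (d + 1)))) .skip))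
        (.setVar d (.var (d + 2)))))))
  | ite c a b, d => .seq (c.compile d) (.ite (.var d) (a.compile d) (b.compile d))
  | sum x e, d => .seq (.setVar d (.const 0)) (.seq (.setVar (d + 1) (.const 0))
      (.seq (.setVar (d + 2) (.var x)) (.seq
        (countLoop (d + 1) (.seq (.setVar x (.var (d + 1))) (.seq (e.compile (d + 3))
          (.setVar d (.add (.var d) (.var (d + 3)))))))
        (.setVar x (.var (d + 2))))))
  | fold x y a b, d => .seq (a.compile d) (.seq (.setVar (d + 1) (.const 0))
      (.seq (.setVar (d + 2) (.var x)) (.seq (.setVar (d + 3) (.var y)) (.seq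
        (countLoop (d + 1) (.seq (.setVar x (.var (d + 1))) (.seq (.setVar y (.var d))
          (.seq (b.compile (d + 4)) (.setVar d (.var (d + 4)))))))
        (.seq (.setVar y (.var (d + 3))) (.setVar x (.var (d + 2))))))))

/-- A bound for the running time of the compiled expression, when the loop bound is `B`. -/
def cost : BExpr → ℕ → ℕ
  | const _, _ => 2
  | var _, _ => 2
  | get _ i, B => i.cost B + 3
  | add e f, B => e.cost B + f.cost B + 4
  | sub e f, B => e.cost B + f.cost B + 4
  | mul e f, B => e.cost B + f.cost B + ((B + 1) * 20 + 10)
  | ite c a b, B => c.cost B + a.cost B + b.cost B + 2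
  | sum _ e, B => (B + 1) * (e.cost B + 20) + 20
  | fold _ _ a b, B => a.cost B + (B + 1) * (b.cost B + 20) + 20

end BExpr

/-! ### Rules for time-bounded execution -/

/-- `P`, started in `s`, halts within `T` steps in a state satisfying `Q`. -/
def Runs (P : RamProg) (s : RamState) (T : ℕ) (Q : RamState → Prop) : Prop :=
  ∃ t s', Exec P s t s' ∧ t ≤ T ∧ Q s'

theorem Runs.mono {P : RamProg} {s : RamState} {T T' : ℕ} {Q Q' : RamState → Prop}
    (h : Runs P s T Q) (hT : T ≤ T') (hQ : ∀ s', Q s' → Q' s') : Runs P s T' Q' := by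
  obtain ⟨t, s', he, ht, hq⟩ := h
  exact ⟨t, s', he, ht.trans hT, hQ _ hq⟩

theorem Runs.seq {P P' : RamProg} {s : RamState} {T T' U : ℕ} {Q Q' : RamState → Prop}
    (h : Runs P s T Q) (h' : ∀ s', Q s' → Runs P' s' T' Q') (hU : T + T' ≤ U) :
    Runs (.seq P P') s U Q' := by
  obtain ⟨t, s', he, ht, hq⟩ := h
  obtain ⟨t', s'', he', ht', hq'⟩ := h' _ hq
  exact ⟨t + t', s'', .seq he he', by omega, hq'⟩

theorem Runs.setVar {x : ℕ} {e : RamExpr} {s : RamState} {T : ℕ} {Q : RamState → Prop}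
    (hT : e.cost + 1 ≤ T) (hQ : Q ⟨Function.update s.var x (e.eval s), s.arr⟩) :
    Runs (.setVar x e) s T Q :=
  ⟨_, _, .setVar x e s, hT, hQ⟩

theorem Runs.ite {P P' : RamProg} {e : RamExpr} {s : RamState} {T U : ℕ} {Q : RamState → Prop}
    (h : e.eval s ≠ 0 → Runs P s T Q) (h' : e.eval s = 0 → Runs P' s T Q)
    (hU : e.cost + 1 + T ≤ U) : Runs (.ite e P P') s U Q := by
  by_cases he : e.eval s = 0
  · obtain ⟨t, s', hx, ht, hq⟩ := h' he
    exact ⟨_, s', .ite_false he hx, by omega, hq⟩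
  · obtain ⟨t, s', hx, ht, hq⟩ := h he
    exact ⟨_, s', .ite_true he hx, by omega, hq⟩

/-- The overhead of `8` per pass is the test (`4` steps) and the increment (`4` steps); the final
`4` is the failing test. The invariant is evaluated after the counter has been advanced, which is
why it must not depend on the counter cell. -/
theorem Runs.countLoop {c B : ℕ} {body : RamProg} {T : ℕ} (hc : c ≠ 4)
    (I : ℕ → RamState → Prop)
    (hI : ∀ i s, I i s → I i ⟨Function.update s.var c (i), s.arr⟩)
    (hstep : ∀ i < B, ∀ s, s.var 4 = B → s.var c = i → I i s →
      Runs body s T (fun s' => s'.var 4 = B ∧ s'.var c = i ∧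
        I (i + 1) ⟨Function.update s'.var c (i + 1), s'.arr⟩))
    {s : RamState} (h4 : s.var 4 = B) (h0 : s.var c = 0) (hs : I 0 s) :
    Runs (BExpr.countLoop c body) s (B * (T + 8) + 4) (fun s' => s'.var 4 = B ∧ I B s') := by
  suffices h : ∀ k i s, i + k = B → s.var 4 = B → s.var c = i → I i s →
      Runs (BExpr.countLoop c body) s (k * (T + 8) + 4) (fun s' => s'.var 4 = B ∧ I B s') from
    h B 0 s (by omega) h4 h0 hs
  intro k
  induction k with
  | zero =>
    intro i s hi h4 hc' hs
    obtain rfl : i = B := by omega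
    refine ⟨_, s, .loop_done (by simp [RamExpr.eval, h4, hc']), by simp [RamExpr.cost], h4, hs⟩
  | succ k ih =>
    intro i s hi h4 hc' hs
    obtain ⟨t, s', he, ht, h4', hc'', hI'⟩ := hstep i (by omega) s h4 hc' hs
    obtain ⟨t', s'', he', ht', hq⟩ := ih (i + 1) ⟨Function.update s'.var c (i + 1), s'.arr⟩ (by omega)
      (by simp [Function.update_of_ne hc.symm, h4']) (by simp) hI'
    have hset := Exec.setVar c (.add (.var c) (.const 1)) s'
    rw [show RamExpr.eval s' (.add (.var c) (.const 1)) = i + 1 by simp [RamExpr.eval, hc'']] at hset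
    refine ⟨_, s'', .loop_step ?_ (.seq he hset) he', ?_, hq⟩
    · simp [RamExpr.eval, h4, hc']; omega
    · simp only [RamExpr.cost]
      have : (k + 1) * (T + 8) = k * (T + 8) + T + 8 := by ring
      omega

/-! ### Correctness of compiled expressions -/

namespace BExpr

/-- Scratch variables start at `100`, so a well-formed expression cannot see them. This is what
allows its value to be transported across the execution of other compiled code. -/
theorem eval_congr {e : BExpr} (he : e.wf = true) {v v' : ℕ → ℕ} {m m' : ℕ → ℕ → ℕ}
    (hv : ∀ x < 100, v x = v' x) (hm : ∀ k ∈ e.arrs, m k = m' k) : e.eval v m = e.eval v' m' := by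
  induction e generalizing v v' with
  | const c => rfl
  | var x => simp only [wf, decide_eq_true_eq] at he; exact hv x he
  | get k i ih =>
    simp only [arrs, List.mem_cons, forall_eq_or_imp] at hm
    simp only [eval]; rw [hm.1, ih he hv hm.2]
  | add e f ihe ihf | sub e f ihe ihf | mul e f ihe ihf =>
    simp only [wf, Bool.and_eq_true] at he
    simp only [arrs, List.mem_append] at hm
    simp only [eval]; rw [ihe he.1 hv fun k hk => hm k (.inl hk), ihf he.2 hv fun k hk => hm k (.inr hk)]
    try rw [hv 4 (by omega)]
  | ite c a b ihc iha ihb =>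
    simp only [wf, Bool.and_eq_true] at he
    simp only [arrs, List.mem_append] at hm
    simp only [eval]
    rw [ihc he.1.1 hv fun k hk => hm k (.inl (.inl hk)),
      iha he.1.2 hv fun k hk => hm k (.inl (.inr hk)), ihb he.2 hv fun k hk => hm k (.inr hk)]
  | sum x e ih =>
    simp only [wf, Bool.and_eq_true] at he
    simp only [eval]
    rw [hv 4 (by omega)]
    refine Finset.sum_congr rfl fun i _ => ih he.2 (fun y hy => ?_) hm
    simp only [Function.update_apply, hv y hy]
  | fold x y a b iha ihb =>
    simp only [wf, Bool.and_eq_true] at he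
    simp only [arrs, List.mem_append] at hm
    simp only [eval]
    rw [hv 4 (by omega), iha he.1.2 hv fun k hk => hm k (.inl hk)]
    congr 1
    funext i acc
    refine ihb he.2 (fun y hy => ?_) (fun k hk => hm k (.inr hk))
    simp only [Function.update_apply, hv y hy]

/-- What a compiled expression does: it leaves the memory below `d` unchanged. -/
def Post (e : BExpr) (d : ℕ) (s s' : RamState) : Prop :=
  s'.arr = s.arr ∧ s'.var d = e.eval s.var s.arr ∧ ∀ x < d, s'.var x = s.var x

/-- Each subexpression receives scratch space above the values that are still needed, so induction
on the expression suffices. The condition `100 ≤ d` separates the scratch space from the bound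
variables, which lie below `100` and are restored after each loop. -/
theorem runs_compile (e : BExpr) (he : e.wf = true) (d : ℕ) (hd : 100 ≤ d) (s : RamState) :
    Runs (e.compile d) s (e.cost (s.var 4)) (e.Post d s) := by
  induction e generalizing d s with
  | const c =>
    refine Runs.setVar (by simp [RamExpr.cost, cost]) ⟨rfl, by simp [RamExpr.eval, eval], fun x hx => ?_⟩
    simp [Function.update_of_ne hx.ne]
  | var c =>
    refine Runs.setVar (by simp [RamExpr.cost, cost]) ⟨rfl, by simp [RamExpr.eval, eval], fun x hx => ?_⟩
    simp [Function.update_of_ne hx.ne]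
  | get k i ih =>
    refine (ih he d hd s).seq (T' := 3) ?_ (by simp [cost])
    rintro s' ⟨h1, h2, h3⟩
    refine Runs.setVar (by simp [RamExpr.cost]) ⟨h1, by simp [RamExpr.eval, eval, h1, h2], fun x hx => ?_⟩
    simp [Function.update_of_ne hx.ne, h3 x hx]
  | add a b iha ihb | sub a b iha ihb =>
    simp only [wf, Bool.and_eq_true] at he
    refine (iha he.1 d hd s).seq (T' := b.cost (s.var 4) + 4) ?_ (by simp [cost]; omega)
    rintro s1 ⟨h1, h2, h3⟩
    rw [← h3 4 (by omega)]
    refine (ihb he.2 (d + 1) (by omega) s1).seq (T' := 4) ?_ (by simp)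
    rintro s2 ⟨g1, g2, g3⟩
    have hb : b.eval s1.var s1.arr = b.eval s.var s.arr :=
      eval_congr he.2 (fun x hx => h3 x (by omega)) (fun k _ => by rw [h1])
    refine Runs.setVar (by simp [RamExpr.cost]) ⟨by simp [g1, h1], ?_, fun x hx => ?_⟩
    · simp [RamExpr.eval, eval, g2, g3 d (by omega), h2, hb]
    · simp [Function.update_of_ne hx.ne, h3 x hx, g3 x (by omega)]
  | mul a b iha ihb =>
    simp only [wf, Bool.and_eq_true] at he
    refine (iha he.1 d hd s).seq
      (T' := b.cost (s.var 4) + ((s.var 4 + 1) * 20 + 10)) ?_ (by simp [cost]; omega)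
    rintro s1 ⟨h1, h2, h3⟩
    have h34 := h3 4 (by omega)
    rw [← h34]
    refine (ihb he.2 (d + 1) (by omega) s1).seq (T' := ((s1.var 4 + 1) * 20 + 10)) ?_ (by simp)
    rintro s2 ⟨g1, g2, g3⟩
    have hb : b.eval s1.var s1.arr = b.eval s.var s.arr :=
      eval_congr he.2 (fun x hx => h3 x (by omega)) (fun k _ => by rw [h1])
    rw [hb] at g2
    refine Runs.seq (T := 2) (T' := ((s1.var 4 + 1) * 20 + 8)) (Q := fun s' => s'.arr = s.arr ∧
      s'.var d = a.eval s.var s.arr ∧ s'.var (d + 1) = b.eval s.var s.arr ∧ s'.var (d + 2) = 0 ∧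
      ∀ x < d, s'.var x = s.var x) (.setVar (by simp [RamExpr.cost])
        ⟨by simp [g1, h1], ?_, ?_, ?_, ?_⟩) ?_ (by omega)
    · simp [Function.update_apply, g3, h2]
    · simp [Function.update_apply, g2]
    · simp [RamExpr.eval]
    · intro x hx
      simp [Function.update_apply, g3 x (by omega), h3 x hx, show x ≠ d + 2 by omega]
    rintro s3 ⟨k1, k2, k3, k4, k5⟩
    refine Runs.seq (T := 2) (T' := ((s1.var 4 + 1) * 20 + 6)) (Q := fun s' => s'.arr = s.arr ∧
      s'.var d = a.eval s.var s.arr ∧ s'.var (d + 1) = b.eval s.var s.arr ∧ s'.var (d + 2) = 0 ∧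
      s'.var (d + 3) = 0 ∧
      ∀ x < d, s'.var x = s.var x) (.setVar (by simp [RamExpr.cost])
        ⟨k1, by simp [Function.update_apply, k2], by simp [Function.update_apply, k3],
          by simp [Function.update_apply, k4], by simp [RamExpr.eval], ?_⟩) ?_ (by omega)
    · intro x hx
      simp [Function.update_apply, k5 x hx, show x ≠ d + 3 by omega]
    rintro s4 ⟨l1, l2, l3, l4, l5, l6⟩
    have hl4 : s4.var 4 = s.var 4 := l6 4 (by omega)
    -- After `i` passes the accumulator is `min a i * b`; at the bound this is the product cut off
    -- exactly as in `eval`.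
    refine Runs.seq (T := s4.var 4 * (8 + 8) + 4) (T' := 2) (Runs.countLoop (T := 8) (by omega)
      (fun i s' => s'.arr = s.arr ∧ s'.var d = a.eval s.var s.arr ∧
        s'.var (d + 1) = b.eval s.var s.arr ∧
        s'.var (d + 2) = min (a.eval s.var s.arr) i * b.eval s.var s.arr ∧
        ∀ x < d, s'.var x = s.var x) ?_ ?_ rfl l5 ⟨l1, l2, l3, by simp [l4], l6⟩) ?_
        (by rw [hl4, ← h34]; omega)
    · rintro i s' ⟨m1, m2, m3, m4, m5⟩
      refine ⟨m1, by simp [Function.update_apply, m2], by simp [Function.update_apply, m3],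
        by simp [Function.update_apply, m4], fun x hx => ?_⟩
      simp [Function.update_apply, m5 x hx, show x ≠ d + 3 by omega]
    · rintro i hi s' h4' hc ⟨m1, m2, m3, m4, m5⟩
      refine Runs.ite (T := 4) ?_ ?_ (by simp [RamExpr.cost])
      · intro hne
        simp only [RamExpr.eval, m2, hc] at hne
        refine Runs.setVar (by simp [RamExpr.cost]) ⟨?_, ?_, m1, ?_, ?_, ?_, ?_⟩
        · simp [Function.update_apply, h4', show 4 ≠ d + 2 by omega]
        · simp [Function.update_apply, hc]
        · simp [Function.update_apply, m2]
        · simp [Function.update_apply, m3]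
        · simp only [RamExpr.eval, Function.update_apply, m4, m3]
          simp [show min (a.eval s.var s.arr) i = i by omega,
            show min (a.eval s.var s.arr) (i + 1) = i + 1 by omega, Nat.succ_mul]
        · intro x hx
          simp [Function.update_apply, m5 x hx, show x ≠ d + 3 by omega, show x ≠ d + 2 by omega]
      · intro hne
        simp only [RamExpr.eval, m2, hc] at hne
        refine ⟨1, s', .skip s', by omega, h4', hc, m1, ?_, ?_, ?_, ?_⟩
        · simp [Function.update_apply, m2]
        · simp [Function.update_apply, m3]
        · simp only [Function.update_apply, m4]
          simp [show min (a.eval s.var s.arr) i = a.eval s.var s.arr by omega,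
            show min (a.eval s.var s.arr) (i + 1) = a.eval s.var s.arr by omega]
        · intro x hx
          simp [Function.update_apply, m5 x hx, show x ≠ d + 3 by omega]
    · rintro s5 ⟨m4, m1, m2, m3, m5, m6⟩
      refine Runs.setVar (by simp [RamExpr.cost]) ⟨m1, ?_, fun x hx => ?_⟩
      · simp [RamExpr.eval, m5, eval, hl4]
      · simp [Function.update_of_ne hx.ne, m6 x hx]
  | ite c a b ihc iha ihb =>
    simp only [wf, Bool.and_eq_true] at he
    refine (ihc he.1.1 d hd s).seq (T' := a.cost (s.var 4) + b.cost (s.var 4) + 2) ?_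
      (by simp [cost]; omega)
    rintro s1 ⟨h1, h2, h3⟩
    have ha : a.eval s1.var s1.arr = a.eval s.var s.arr :=
      eval_congr he.1.2 (fun x hx => h3 x (by omega)) (fun k _ => by rw [h1])
    have hb : b.eval s1.var s1.arr = b.eval s.var s.arr :=
      eval_congr he.2 (fun x hx => h3 x (by omega)) (fun k _ => by rw [h1])
    refine Runs.ite (T := a.cost (s.var 4) + b.cost (s.var 4)) (fun hne => ?_) (fun hne => ?_)
      (by simp [RamExpr.cost]; omega)
    · simp only [RamExpr.eval, h2] at hne
      refine (iha he.1.2 d hd s1).mono (by rw [h3 4 (by omega)]; omega) ?_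
      rintro s2 ⟨g1, g2, g3⟩
      exact ⟨g1.trans h1, by simp [g2, eval, hne, ha], fun x hx => (g3 x hx).trans (h3 x hx)⟩
    · simp only [RamExpr.eval, h2] at hne
      refine (ihb he.2 d hd s1).mono (by rw [h3 4 (by omega)]; omega) ?_
      rintro s2 ⟨g1, g2, g3⟩
      exact ⟨g1.trans h1, by simp [g2, eval, hne, hb], fun x hx => (g3 x hx).trans (h3 x hx)⟩
  | sum x e ih =>
    simp only [wf, Bool.and_eq_true, decide_eq_true_eq] at he
    obtain ⟨⟨hx, hx4⟩, he⟩ := he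
    refine Runs.seq (T := 2) (T' := (s.var 4 + 1) * (e.cost (s.var 4) + 20) + 18)
      (Q := fun s' => s'.arr = s.arr ∧ s'.var d = 0 ∧ ∀ x < d, s'.var x = s.var x)
      (.setVar (by simp [RamExpr.cost]) ⟨rfl, by simp [RamExpr.eval], fun x hx => ?_⟩) ?_
      (by simp [cost]; omega)
    · simp [Function.update_of_ne hx.ne]
    rintro s1 ⟨h1, h2, h3⟩
    refine Runs.seq (T := 2) (T' := (s.var 4 + 1) * (e.cost (s.var 4) + 20) + 16)
      (Q := fun s' => s'.arr = s.arr ∧ s'.var d = 0 ∧ s'.var (d + 1) = 0 ∧ ∀ x < d, s'.var x = s.var x)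
      (.setVar (by simp [RamExpr.cost]) ⟨h1, by simp [Function.update_apply, h2], by simp [RamExpr.eval],
        fun x hx => ?_⟩) ?_ (by omega)
    · simp [Function.update_apply, show x ≠ d + 1 by omega, h3 x hx]
    rintro s2 ⟨g1, g2, g3, g4⟩
    -- The loop overwrites the summation variable, so its old value is parked in `d + 2` and written
    -- back at the end; until then the invariant excludes that variable.
    refine Runs.seq (T := 2) (T' := (s.var 4 + 1) * (e.cost (s.var 4) + 20) + 14)
      (Q := fun s' => s'.arr = s.arr ∧ s'.var d = 0 ∧ s'.var (d + 1) = 0 ∧ s'.var (d + 2) = s.var x ∧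
        ∀ x < d, s'.var x = s.var x)
      (.setVar (by simp [RamExpr.cost]) ⟨g1, by simp [Function.update_apply, g2],
        by simp [Function.update_apply, g3], by simp [RamExpr.eval, g4 x (by omega)],
        fun x hx => ?_⟩) ?_ (by omega)
    · simp [Function.update_apply, show x ≠ d + 2 by omega, g4 x hx]
    rintro s3 ⟨k1, k2, k3, k4, k5⟩
    have hk4 : s3.var 4 = s.var 4 := k5 4 (by omega)
    refine Runs.seq (T := s3.var 4 * ((e.cost (s.var 4) + 6) + 8) + 4) (T' := 2)
      (Runs.countLoop (T := e.cost (s.var 4) + 6) (by omega)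
      (fun i s' => s'.arr = s.arr ∧
        s'.var d = ∑ j ∈ Finset.range i, e.eval (Function.update s.var x j) s.arr ∧
        s'.var (d + 2) = s.var x ∧ ∀ y < d, y ≠ x → s'.var y = s.var y) ?_ ?_ rfl k3
        ⟨k1, by simp [k2], k4, fun y hy _ => k5 y hy⟩) ?_ ?_
    · rintro i s' ⟨m1, m2, m3, m4⟩
      refine ⟨m1, by simp [Function.update_apply, m2], by simp [Function.update_apply, m3],
        fun y hy hyx => ?_⟩
      simp [Function.update_apply, m4 y hy hyx, show y ≠ d + 1 by omega]
    · rintro i hi s' h4' hc ⟨m1, m2, m3, m4⟩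
      refine Runs.seq (T := 2) (T' := e.cost (s.var 4) + 4) (Q := fun s'' => s''.arr = s.arr ∧
        s''.var d = ∑ j ∈ Finset.range i, e.eval (Function.update s.var x j) s.arr ∧
        s''.var (d + 1) = i ∧ s''.var (d + 2) = s.var x ∧
        ∀ y < d, s''.var y = Function.update s.var x i y)
        (.setVar (by simp [RamExpr.cost]) ⟨m1, ?_, ?_, ?_, ?_⟩) ?_ (by omega)
      · simp [Function.update_apply, m2, show d ≠ x by omega]
      · simp [Function.update_apply, hc, show d + 1 ≠ x by omega]
      · simp [Function.update_apply, m3, show d + 2 ≠ x by omega]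
      · intro y hy
        by_cases hyx : y = x
        · subst hyx; simp [RamExpr.eval, hc]
        · simp [Function.update_apply, hyx, m4 y hy hyx]
      rintro s5 ⟨n1, n2, n3, n4, n5⟩
      have hn4 : s5.var 4 = s.var 4 := by simp [n5 4 (by omega), Function.update_apply, hx4.symm]
      have hev : e.eval s5.var s5.arr = e.eval (Function.update s.var x i) s.arr :=
        eval_congr he (fun y hy => n5 y (by omega)) (fun k _ => by rw [n1])
      rw [← hn4]
      refine (ih he (d + 3) (by omega) s5).seq (T' := 4) ?_ (by omega)
      rintro s6 ⟨o1, o2, o3⟩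
      refine Runs.setVar (by simp [RamExpr.cost]) ⟨?_, ?_, ?_, ?_, ?_, ?_⟩
      · simp [Function.update_apply, show 4 ≠ d by omega, o3 4 (by omega), hn4, hk4]
      · simp [Function.update_apply, o3 (d + 1) (by omega), n3]
      · simp [o1, n1]
      · simp only [RamExpr.eval, Function.update_apply]
        simp [o3 d (by omega), n2, o2, hev, Finset.sum_range_succ]
      · simp [Function.update_apply, o3 (d + 2) (by omega), n4]
      · intro y hy hyx
        simp [Function.update_apply, o3 y (by omega), n5 y hy, hyx, show y ≠ d by omega,
          show y ≠ d + 1 by omega]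
    · rintro s4 ⟨m0, m1, m2, m3, m4⟩
      refine Runs.setVar (by simp [RamExpr.cost]) ⟨m1, ?_, fun y hy => ?_⟩
      · simp [Function.update_apply, show d ≠ x by omega, m2, eval, hk4]
      · by_cases hyx : y = x
        · subst hyx; simp [RamExpr.eval, m3]
        · simp [Function.update_apply, hyx, m4 y hy hyx]
    · rw [hk4]; nlinarith [Nat.zero_le (e.cost (s.var 4))]
  | fold x y a b iha ihb =>
    simp only [wf, Bool.and_eq_true, decide_eq_true_eq] at he
    obtain ⟨⟨⟨⟨⟨hx, hx4⟩, hy⟩, hy4⟩, ha⟩, hb⟩ := he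
    refine (iha ha d hd s).seq (T' := (s.var 4 + 1) * (b.cost (s.var 4) + 20) + 20) ?_
      (by simp [cost]; omega)
    rintro s1 ⟨h1, h2, h3⟩
    refine Runs.seq (T := 2) (T' := (s.var 4 + 1) * (b.cost (s.var 4) + 20) + 18)
      (Q := fun s' => s'.arr = s.arr ∧ s'.var d = a.eval s.var s.arr ∧ s'.var (d + 1) = 0 ∧
        ∀ x < d, s'.var x = s.var x)
      (.setVar (by simp [RamExpr.cost]) ⟨h1, by simp [Function.update_apply, h2], by simp [RamExpr.eval],
        fun x hx => ?_⟩) ?_ (by omega)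
    · simp [Function.update_apply, show x ≠ d + 1 by omega, h3 x hx]
    rintro s2 ⟨g1, g2, g3, g4⟩
    refine Runs.seq (T := 2) (T' := (s.var 4 + 1) * (b.cost (s.var 4) + 20) + 16)
      (Q := fun s' => s'.arr = s.arr ∧ s'.var d = a.eval s.var s.arr ∧ s'.var (d + 1) = 0 ∧
        s'.var (d + 2) = s.var x ∧ ∀ x < d, s'.var x = s.var x)
      (.setVar (by simp [RamExpr.cost]) ⟨g1, by simp [Function.update_apply, g2],
        by simp [Function.update_apply, g3], by simp [RamExpr.eval, g4 x (by omega)],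
        fun x hx => ?_⟩) ?_ (by omega)
    · simp [Function.update_apply, show x ≠ d + 2 by omega, g4 x hx]
    rintro s2' ⟨g1, g2, g3, g4', g4⟩
    refine Runs.seq (T := 2) (T' := (s.var 4 + 1) * (b.cost (s.var 4) + 20) + 14)
      (Q := fun s' => s'.arr = s.arr ∧ s'.var d = a.eval s.var s.arr ∧ s'.var (d + 1) = 0 ∧
        s'.var (d + 2) = s.var x ∧ s'.var (d + 3) = s.var y ∧ ∀ x < d, s'.var x = s.var x)
      (.setVar (by simp [RamExpr.cost]) ⟨g1, by simp [Function.update_apply, g2],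
        by simp [Function.update_apply, g3], by simp [Function.update_apply, g4'],
        by simp [RamExpr.eval, g4 y (by omega)],
        fun x hx => ?_⟩) ?_ (by omega)
    · simp [Function.update_apply, show x ≠ d + 3 by omega, g4 x hx]
    rintro s3 ⟨k1, k2, k3, k4, k4', k5⟩
    have hk4 : s3.var 4 = s.var 4 := k5 4 (by omega)
    set F : ℕ → ℕ := fun j => Nat.rec (a.eval s.var s.arr)
      (fun i acc => b.eval (Function.update (Function.update s.var x i) y acc) s.arr) j with hF
    refine Runs.seq (T := s3.var 4 * ((b.cost (s.var 4) + 8) + 8) + 4) (T' := 4)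
      (Runs.countLoop (T := b.cost (s.var 4) + 8) (by omega)
      (fun i s' => s'.arr = s.arr ∧ s'.var d = F i ∧
        s'.var (d + 2) = s.var x ∧ s'.var (d + 3) = s.var y ∧
        ∀ z < d, z ≠ x → z ≠ y → s'.var z = s.var z) ?_ ?_ rfl k3
        ⟨k1, by simp [k2, hF], k4, k4', fun y hy _ _ => k5 y hy⟩) ?_ ?_
    · rintro i s' ⟨m1, m2, m3, m3', m4⟩
      refine ⟨m1, by simp [Function.update_apply, m2], by simp [Function.update_apply, m3],
        by simp [Function.update_apply, m3'], fun z hz hzx hzy => ?_⟩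
      simp [Function.update_apply, m4 z hz hzx hzy, show z ≠ d + 1 by omega]
    · rintro i hi s' h4' hc ⟨m1, m2, m3, m3', m4⟩
      refine Runs.seq (T := 2) (T' := b.cost (s.var 4) + 6) (Q := fun s'' => s''.arr = s.arr ∧
        s''.var d = F i ∧ s''.var (d + 1) = i ∧ s''.var (d + 2) = s.var x ∧
        s''.var (d + 3) = s.var y ∧
        ∀ z < d, z ≠ y → s''.var z = Function.update s.var x i z)
        (.setVar (by simp [RamExpr.cost]) ⟨m1, ?_, ?_, ?_, ?_, ?_⟩) ?_ (by omega)
      · simp [Function.update_apply, m2, show d ≠ x by omega]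
      · simp [Function.update_apply, hc, show d + 1 ≠ x by omega]
      · simp [Function.update_apply, m3, show d + 2 ≠ x by omega]
      · simp [Function.update_apply, m3', show d + 3 ≠ x by omega]
      · intro z hz hzy
        by_cases hzx : z = x
        · subst hzx; simp [RamExpr.eval, hc]
        · simp [Function.update_apply, hzx, m4 z hz hzx hzy]
      rintro s4 ⟨p1, p2, p3, p4, p5, p6⟩
      refine Runs.seq (T := 2) (T' := b.cost (s.var 4) + 4) (Q := fun s'' => s''.arr = s.arr ∧
        s''.var d = F i ∧ s''.var (d + 1) = i ∧ s''.var (d + 2) = s.var x ∧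
        s''.var (d + 3) = s.var y ∧
        ∀ z < d, s''.var z = Function.update (Function.update s.var x i) y (F i) z)
        (.setVar (by simp [RamExpr.cost]) ⟨p1, ?_, ?_, ?_, ?_, ?_⟩) ?_ (by omega)
      · simp [Function.update_apply, p2, show d ≠ y by omega]
      · simp [Function.update_apply, p3, show d + 1 ≠ y by omega]
      · simp [Function.update_apply, p4, show d + 2 ≠ y by omega]
      · simp [Function.update_apply, p5, show d + 3 ≠ y by omega]
      · intro z hz
        by_cases hzy : z = y
        · subst hzy; simp [RamExpr.eval, p2]
        · have := p6 z hz hzy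
          simp only [Function.update_apply, hzy, if_false] at this ⊢
          exact this
      rintro s5 ⟨n1, n2, n3, n4, n4', n5⟩
      have hn4 : s5.var 4 = s.var 4 := by
        simp [n5 4 (by omega), Function.update_apply, hx4.symm, hy4.symm]
      have hev : b.eval s5.var s5.arr = F (i + 1) :=
        eval_congr hb (fun y hy => n5 y (by omega)) (fun k _ => by rw [n1])
      rw [← hn4]
      refine (ihb hb (d + 4) (by omega) s5).seq (T' := 4) ?_ (by omega)
      rintro s6 ⟨o1, o2, o3⟩
      refine Runs.setVar (by simp [RamExpr.cost]) ⟨?_, ?_, ?_, ?_, ?_, ?_, ?_⟩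
      · simp [Function.update_apply, show 4 ≠ d by omega, o3 4 (by omega), hn4, hk4]
      · simp [Function.update_apply, o3 (d + 1) (by omega), n3]
      · simp [o1, n1]
      · simp only [RamExpr.eval, Function.update_apply]
        simp [o2, hev]
      · simp [Function.update_apply, o3 (d + 2) (by omega), n4]
      · simp [Function.update_apply, o3 (d + 3) (by omega), n4']
      · intro z hz hzx hzy
        simp [Function.update_apply, o3 z (by omega), n5 z hz, hzx, hzy, show z ≠ d by omega,
          show z ≠ d + 1 by omega]
    · rintro s4 ⟨m0, m1, m2, m3, m3', m4⟩
      refine Runs.seq (T := 2) (T' := 2) (Q := fun s'' => s''.arr = s.arr ∧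
        s''.var d = F (s.var 4) ∧ s''.var (d + 2) = s.var x ∧
        ∀ z < d, z ≠ x → s''.var z = s.var z)
        (.setVar (by simp [RamExpr.cost]) ⟨m1, ?_, ?_, fun z hz hzx => ?_⟩) ?_ (by omega)
      · simp [Function.update_apply, show d ≠ y by omega, m2, hk4]
      · simp [Function.update_apply, show d + 2 ≠ y by omega, m3]
      · by_cases hzy : z = y
        · subst hzy; simp [RamExpr.eval, m3']
        · simp [Function.update_apply, hzy, m4 z hz hzx hzy]
      rintro s5 ⟨n1, n2, n3, n4⟩
      refine Runs.setVar (by simp [RamExpr.cost]) ⟨n1, ?_, fun z hz => ?_⟩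
      · simp [Function.update_apply, show d ≠ x by omega, n2, hF, eval]
      · by_cases hzx : z = x
        · subst hzx; simp [RamExpr.eval, n3]
        · simp [Function.update_apply, hzx, n4 z hz hzx]
    · rw [hk4]; nlinarith [Nat.zero_le (b.cost (s.var 4))]

end BExpr

/-! ### Bounded programs: effect, frame properties, compilation -/

/-- Programs whose loops are bounded by the variable `4`. -/
inductive BCmd : Type
  | skip
  | setVar (x : ℕ) (e : BExpr)
  | setArr (k : ℕ) (i e : BExpr)
  | seq (a b : BCmd)
  | ite (e : BExpr) (a b : BCmd)
  | loop (x : ℕ) (a : BCmd)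

namespace BCmd

/-- The effect of a program. -/
def den : BCmd → RamState → RamState
  | skip, s => s
  | setVar x e, s => ⟨Function.update s.var x (e.eval s.var s.arr), s.arr⟩
  | setArr k i e, s => ⟨s.var, Function.update s.arr k
      (Function.update (s.arr k) (i.eval s.var s.arr) (e.eval s.var s.arr))⟩
  | seq a b, s => b.den (a.den s)
  | ite e a b, s => if e.eval s.var s.arr ≠ 0 then a.den s else b.den s
  | loop x a, s => Nat.rec s (fun i s' => a.den ⟨Function.update s'.var x i, s'.arr⟩) (s.var 4)

/-- Well-formed programs use variables below `100` and do not change the variable `4`. -/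
def wf : BCmd → Bool
  | skip => true
  | setVar x e => decide (x < 100) && decide (x ≠ 4) && e.wf
  | setArr _ i e => i.wf && e.wf
  | seq a b => a.wf && b.wf
  | ite e a b => e.wf && a.wf && b.wf
  | loop x a => decide (x < 100) && decide (x ≠ 4) && a.wf

/-- The variables a program may change. -/
def modV : BCmd → List ℕ
  | skip => []
  | setVar x _ => [x]
  | setArr _ _ _ => []
  | seq a b => a.modV ++ b.modV
  | ite _ a b => a.modV ++ b.modV
  | loop x a => x :: a.modV

/-- The arrays a program may change. -/
def modA : BCmd → List ℕ
  | skip => []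
  | setVar _ _ => []
  | setArr k _ _ => [k]
  | seq a b => a.modA ++ b.modA
  | ite _ a b => a.modA ++ b.modA
  | loop _ a => a.modA

/-- Compilation; variables from `d` on are scratch. -/
def compile : BCmd → ℕ → RamProg
  | skip, _ => .skip
  | setVar x e, d => .seq (e.compile d) (.setVar x (.var d))
  | setArr k i e, d => .seq (i.compile d) (.seq (e.compile (d + 1))
      (.setArr k (.var d) (.var (d + 1))))
  | seq a b, d => .seq (a.compile d) (b.compile d)
  | ite e a b, d => .seq (e.compile d) (.ite (.var d) (a.compile d) (b.compile d))
  | loop x a, d => .seq (.setVar d (.const 0))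
      (BExpr.countLoop d (.seq (.setVar x (.var d)) (a.compile (d + 1))))

/-- A bound for the running time when the loop bound is `B`. -/
def cost : BCmd → ℕ → ℕ
  | skip, _ => 1
  | setVar _ e, B => e.cost B + 2
  | setArr _ i e, B => i.cost B + e.cost B + 3
  | seq a b, B => a.cost B + b.cost B
  | ite e a b, B => e.cost B + a.cost B + b.cost B + 2
  | loop _ a, B => (B + 1) * (a.cost B + 20)

/-- Agreement of two memories apart from scratch variables. -/
def Agree (s s' : RamState) : Prop := s.arr = s'.arr ∧ ∀ x < 100, s.var x = s'.var x

/-- Frame rule: membership in `modV` is decidable for a concrete program, so that later correctness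
proofs obtain unchanged variables by computation instead of carrying them through invariants.
`den_arr` does the same for arrays. -/
theorem den_var {c : BCmd} {s : RamState} {x : ℕ} (hx : x ∉ c.modV) :
    (c.den s).var x = s.var x := by
  induction c generalizing s with
  | skip => rfl
  | setVar y e => simp only [modV, List.mem_singleton] at hx; simp [den, Function.update_of_ne hx]
  | setArr k i e => rfl
  | seq a b iha ihb =>
    simp only [modV, List.mem_append, not_or] at hx
    simp only [den]; rw [ihb hx.2, iha hx.1]
  | ite e a b iha ihb =>
    simp only [modV, List.mem_append, not_or] at hx
    simp only [den]
    split_ifs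
    · exact iha hx.1
    · exact ihb hx.2
  | loop y a ih =>
    simp only [modV, List.mem_cons, not_or] at hx
    simp only [den]
    induction s.var 4 with
    | zero => rfl
    | succ k ihk => simp only; rw [ih hx.2]; simp [Function.update_of_ne hx.1, ihk]

theorem den_arr {c : BCmd} {s : RamState} {k : ℕ} (hk : k ∉ c.modA) :
    (c.den s).arr k = s.arr k := by
  induction c generalizing s with
  | skip => rfl
  | setVar y e => rfl
  | setArr l i e => simp only [modA, List.mem_singleton] at hk; simp [den, Function.update_of_ne hk]
  | seq a b iha ihb =>
    simp only [modA, List.mem_append, not_or] at hk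
    simp only [den]; rw [ihb hk.2, iha hk.1]
  | ite e a b iha ihb =>
    simp only [modA, List.mem_append, not_or] at hk
    simp only [den]
    split_ifs
    · exact iha hk.1
    · exact ihb hk.2
  | loop y a ih =>
    simp only [modA] at hk
    simp only [den]
    induction s.var 4 with
    | zero => rfl
    | succ j ihj => simp only; rw [ih hk]; exact ihj

theorem wf_bound {c : BCmd} (hc : c.wf = true) : 4 ∉ c.modV := by
  induction c with
  | skip => simp [modV]
  | setVar y e => simp [wf, modV] at *; omega
  | setArr l i e => simp [modV]
  | seq a b iha ihb => simp only [wf, Bool.and_eq_true] at hc; simp [modV, iha hc.1, ihb hc.2]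
  | ite e a b iha ihb => simp only [wf, Bool.and_eq_true] at hc; simp [modV, iha hc.1.2, ihb hc.2]
  | loop y a ih =>
    simp only [wf, Bool.and_eq_true, decide_eq_true_eq] at hc
    simp [modV, ih hc.2, hc.1.2.symm]

theorem den_bound {c : BCmd} (hc : c.wf = true) (s : RamState) : (c.den s).var 4 = s.var 4 :=
  den_var (wf_bound hc)

/-- The real memory `s` and the idealised memory `s₀` are kept apart because the scratch variables
differ after the first compiled statement. The preservation of scratch below `d` protects the
counters of enclosing loops. -/
theorem runs_compile (c : BCmd) (hc : c.wf = true) (d : ℕ) (hd : 100 ≤ d) (s s₀ : RamState)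
    (hs : Agree s s₀) :
    Runs (c.compile d) s (c.cost (s.var 4)) (fun s' => Agree s' (c.den s₀) ∧
      ∀ x, 100 ≤ x → x < d → s'.var x = s.var x) := by
  induction c generalizing d s s₀ with
  | skip => exact ⟨1, s, .skip s, le_rfl, hs, fun _ _ _ => rfl⟩
  | setVar x e =>
    simp only [wf, Bool.and_eq_true, decide_eq_true_eq] at hc
    refine (e.runs_compile hc.2 d hd s).seq (T' := 2) ?_ (by simp [cost])
    rintro s' ⟨h1, h2, h3⟩
    refine Runs.setVar (by simp [RamExpr.cost]) ⟨⟨by simp [h1, hs.1, den], fun y hy => ?_⟩,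
      fun y hy hy' => ?_⟩
    · rw [BExpr.eval_congr hc.2 hs.2 fun k _ => by rw [hs.1]] at h2
      by_cases hyx : y = x
      · subst hyx; simp [den, RamExpr.eval, h2]
      · simp [den, Function.update_apply, hyx, h3 y (by omega), hs.2 y hy]
    · simp [Function.update_apply, show y ≠ x by omega, h3 y hy']
  | setArr k i e =>
    simp only [wf, Bool.and_eq_true] at hc
    refine (i.runs_compile hc.1 d hd s).seq (T' := e.cost (s.var 4) + 3) ?_ (by simp [cost]; omega)
    rintro s1 ⟨h1, h2, h3⟩
    rw [← h3 4 (by omega)]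
    refine (e.runs_compile hc.2 (d + 1) (by omega) s1).seq (T' := 3) ?_ (by omega)
    rintro s2 ⟨g1, g2, g3⟩
    rw [BExpr.eval_congr hc.1 hs.2 fun k _ => by rw [hs.1]] at h2
    rw [BExpr.eval_congr hc.2 (v' := s₀.var) (m' := s₀.arr)
      (fun x hx => (h3 x (by omega)).trans (hs.2 x hx)) fun k _ => by rw [h1, hs.1]] at g2
    refine ⟨_, _, .setArr k _ _ s2, by simp [RamExpr.cost], ⟨?_, fun x hx => ?_⟩, fun x hx hx' => ?_⟩
    · simp [den, RamExpr.eval, g3 d (by omega), h2, g2, g1, h1, hs.1]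
    · simp [den, g3 x (by omega), h3 x (by omega), hs.2 x hx]
    · simp [g3 x (by omega), h3 x hx']
  | seq a b iha ihb =>
    simp only [wf, Bool.and_eq_true] at hc
    refine (iha hc.1 d hd s s₀ hs).seq (T' := b.cost (s.var 4)) ?_ (by simp [cost])
    rintro s1 ⟨h1, h2⟩
    have h4 : s1.var 4 = s.var 4 := by rw [h1.2 4 (by omega), den_bound hc.1, hs.2 4 (by omega)]
    rw [← h4]
    refine (ihb hc.2 d hd s1 _ h1).mono le_rfl ?_
    rintro s2 ⟨g1, g2⟩
    exact ⟨g1, fun x hx hx' => (g2 x hx hx').trans (h2 x hx hx')⟩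
  | ite e a b iha ihb =>
    simp only [wf, Bool.and_eq_true] at hc
    refine (e.runs_compile hc.1.1 d hd s).seq (T' := a.cost (s.var 4) + b.cost (s.var 4) + 2) ?_
      (by simp [cost]; omega)
    rintro s1 ⟨h1, h2, h3⟩
    have hs1 : Agree s1 s₀ := ⟨h1.trans hs.1, fun x hx => (h3 x (by omega)).trans (hs.2 x hx)⟩
    rw [BExpr.eval_congr hc.1.1 hs.2 fun k _ => by rw [hs.1]] at h2
    refine Runs.ite (T := a.cost (s.var 4) + b.cost (s.var 4)) (fun hne => ?_) (fun hne => ?_)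
      (by simp [RamExpr.cost]; omega)
    · simp only [RamExpr.eval, h2] at hne
      refine (iha hc.1.2 d hd s1 s₀ hs1).mono (by rw [h3 4 (by omega)]; omega) ?_
      rintro s2 ⟨g1, g2⟩
      exact ⟨by simpa [den, hne] using g1, fun x hx hx' => (g2 x hx hx').trans (h3 x hx')⟩
    · simp only [RamExpr.eval, h2] at hne
      refine (ihb hc.2 d hd s1 s₀ hs1).mono (by rw [h3 4 (by omega)]; omega) ?_
      rintro s2 ⟨g1, g2⟩
      exact ⟨by simpa [den, hne] using g1, fun x hx hx' => (g2 x hx hx').trans (h3 x hx')⟩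
  | loop x a ih =>
    simp only [wf, Bool.and_eq_true, decide_eq_true_eq] at hc
    have hwf := hc.2
    refine Runs.seq (T := 2) (T' := s.var 4 * (a.cost (s.var 4) + 2 + 8) + 4)
      (Q := fun s' => Agree s' s₀ ∧ s'.var d = 0 ∧ ∀ x, 100 ≤ x → x < d → s'.var x = s.var x)
      (.setVar (by simp [RamExpr.cost]) ⟨⟨hs.1, fun y hy => ?_⟩, by simp [RamExpr.eval],
        fun y hy hy' => ?_⟩) ?_ ?_
    · simp [Function.update_apply, show y ≠ d by omega, hs.2 y hy]
    · simp [Function.update_apply, show y ≠ d by omega]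
    · rintro s1 ⟨h1, h2, h3⟩
      have h4 : s1.var 4 = s.var 4 := (h1.2 4 (by omega)).trans (hs.2 4 (by omega)).symm
      rw [← h4]
      set F : ℕ → RamState := fun j =>
        Nat.rec s₀ (fun i s' => a.den ⟨Function.update s'.var x i, s'.arr⟩) j with hF
      refine (Runs.countLoop (T := a.cost (s1.var 4) + 2) (by omega)
        (fun i s' => Agree s' (F i) ∧ ∀ x, 100 ≤ x → x < d → s'.var x = s.var x)
        ?_ ?_ rfl h2 ⟨h1, h3⟩).mono le_rfl ?_
      · rintro i s' ⟨m1, m2⟩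
        refine ⟨⟨m1.1, fun y hy => ?_⟩, fun y hy hy' => ?_⟩
        · simp [Function.update_apply, show y ≠ d by omega, m1.2 y hy]
        · simp [Function.update_apply, show y ≠ d by omega, m2 y hy hy']
      · rintro i hi s' h4' hcd ⟨m1, m2⟩
        refine Runs.seq (T := 2) (T' := a.cost (s1.var 4))
          (Q := fun s'' => Agree s'' ⟨Function.update (F i).var x i, (F i).arr⟩ ∧ s''.var d = i ∧
            s''.var 4 = s1.var 4 ∧
            ∀ x, 100 ≤ x → x < d → s''.var x = s.var x)
          (.setVar (by simp [RamExpr.cost]) ⟨⟨m1.1, fun y hy => ?_⟩, ?_, ?_, fun y hy hy' => ?_⟩) ?_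
          (by omega)
        · by_cases hyx : y = x
          · subst hyx; simp [RamExpr.eval, hcd]
          · simp [Function.update_apply, hyx, m1.2 y hy]
        · simp [Function.update_apply, show d ≠ x by omega, hcd]
        · simp [Function.update_apply, hc.1.2.symm, h4']
        · simp [Function.update_apply, show y ≠ x by omega, m2 y hy hy']
        rintro s2 ⟨n1, n2, n3, n4⟩
        rw [← n3]
        refine (ih hwf (d + 1) (by omega) s2 _ n1).mono le_rfl ?_
        rintro s3 ⟨o1, o2⟩
        refine ⟨?_, by rw [o2 d hd (by omega), n2], ⟨o1.1, fun y hy => ?_⟩, fun y hy hy' => ?_⟩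
        · rw [o1.2 4 (by omega), den_bound hwf, ← n1.2 4 (by omega)]
        · simp [Function.update_apply, show y ≠ d by omega, o1.2 y hy, hF]
        · simp [Function.update_apply, show y ≠ d by omega, o2 y hy (by omega), n4 y hy hy']
      · rintro s' ⟨-, m1, m2⟩
        refine ⟨?_, m2⟩
        rw [h4, hs.2 4 (by omega)] at m1
        exact m1
    · simp only [cost]; nlinarith [Nat.zero_le (a.cost (s.var 4))]

end BCmd

/-! ### Polynomial running times -/

/-- Functions bounded by a polynomial. -/
def PolyBounded (f : ℕ → ℕ) : Prop := ∃ C D, ∀ B, f B ≤ C * (B + 1) ^ D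

namespace PolyBounded

theorem const (c : ℕ) : PolyBounded fun _ => c := ⟨c, 0, by simp⟩

theorem add {f g : ℕ → ℕ} (hf : PolyBounded f) (hg : PolyBounded g) :
    PolyBounded fun B => f B + g B := by
  obtain ⟨C, D, h⟩ := hf
  obtain ⟨C', D', h'⟩ := hg
  refine ⟨C + C', max D D', fun B => (Nat.add_le_add (h B) (h' B)).trans ?_⟩
  rw [add_mul]
  gcongr <;> first | omega | simp

theorem mul {f g : ℕ → ℕ} (hf : PolyBounded f) (hg : PolyBounded g) :
    PolyBounded fun B => f B * g B := by
  obtain ⟨C, D, h⟩ := hf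
  obtain ⟨C', D', h'⟩ := hg
  refine ⟨C * C', D + D', fun B => (Nat.mul_le_mul (h B) (h' B)).trans (le_of_eq ?_)⟩
  ring

theorem succ : PolyBounded fun B => B + 1 := ⟨1, 1, by simp⟩

theorem expr (e : BExpr) : PolyBounded e.cost := by
  induction e with
  | const c => exact const 2
  | var x => exact const 2
  | get k i ih => exact ih.add (const 3)
  | add e f ihe ihf | sub e f ihe ihf => exact (ihe.add ihf).add (const 4)
  | mul e f ihe ihf => exact (ihe.add ihf).add ((succ.mul (const 20)).add (const 10))
  | ite c a b ihc iha ihb => exact ((ihc.add iha).add ihb).add (const 2)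
  | sum x e ih => exact (succ.mul (ih.add (const 20))).add (const 20)
  | fold x y a b iha ihb => exact (iha.add (succ.mul (ihb.add (const 20)))).add (const 20)

theorem cmd (c : BCmd) : PolyBounded c.cost := by
  induction c with
  | skip => exact const 1
  | setVar x e => exact (expr e).add (const 2)
  | setArr k i e => exact ((expr i).add (expr e)).add (const 3)
  | seq a b iha ihb => exact iha.add ihb
  | ite e a b iha ihb => exact (((expr e).add iha).add ihb).add (const 2)
  | loop x a ih => exact succ.mul (ih.add (const 20))

end PolyBounded

/-! ### Conditions, quantifiers and bounded search as expressions -/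

namespace BExpr

/-- An expression regarded as a condition. -/
def holds (e : BExpr) (v : ℕ → ℕ) (m : ℕ → ℕ → ℕ) : Prop := e.eval v m ≠ 0

/-- The truth value of an expression. -/
def bool (a : BExpr) : BExpr := ite a (const 1) (const 0)
-- Truth means being non-zero. Truncated subtraction then is a strict comparison, addition is
-- disjunction and a sum is an existential quantifier.
def lt (a b : BExpr) : BExpr := sub b a
def le (a b : BExpr) : BExpr := sub (add b (const 1)) a
def not (a : BExpr) : BExpr := ite a (const 0) (const 1)
def and (a b : BExpr) : BExpr := ite a b (const 0)
def or (a b : BExpr) : BExpr := add a b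
def eq (a b : BExpr) : BExpr := not (add (sub a b) (sub b a))
/-- Some value of the variable `x` below the bound satisfies `e`. -/
def ex (x : ℕ) (e : BExpr) : BExpr := sum x e
/-- All values of the variable `x` below the bound satisfy `e`. -/
def all (x : ℕ) (e : BExpr) : BExpr := not (sum x (not e))
/-- The least value of the variable `z` that satisfies `e`; `x` is an auxiliary variable. -/
def least (x z : ℕ) (e : BExpr) : BExpr := sum x (all z (or (not (le (var z) (var x))) (not e)))
/-- The address of a tuple in an array with rows of the length of the bound. -/
def idx (l : List BExpr) : BExpr := l.foldl (fun p e => add (mul (var 4) p) e) (const 0)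

section
variable (v : ℕ → ℕ) (m : ℕ → ℕ → ℕ) (a b c e : BExpr) (x y k : ℕ)

@[simp] theorem eval_const : (const k).eval v m = k := rfl
@[simp] theorem eval_var : (var x).eval v m = v x := rfl
@[simp] theorem eval_get : (get k a).eval v m = m k (a.eval v m) := rfl
@[simp] theorem eval_add : (add a b).eval v m = a.eval v m + b.eval v m := rfl
@[simp] theorem eval_sub : (sub a b).eval v m = a.eval v m - b.eval v m := rfl
@[simp] theorem eval_mul : (mul a b).eval v m = min (a.eval v m) (v 4) * b.eval v m := rfl
open Classical in
@[simp] theorem eval_ite : (ite c a b).eval v m = if c.holds v m then a.eval v m else b.eval v m := by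
  by_cases h : c.eval v m = 0 <;> simp [eval, holds, h]
@[simp] theorem eval_sum : (sum x a).eval v m =
    ∑ i ∈ Finset.range (v 4), a.eval (Function.update v x i) m := rfl
open Classical in
@[simp] theorem eval_bool : (bool a).eval v m = if a.holds v m then 1 else 0 := by simp [bool]

@[simp] theorem holds_const : (const k).holds v m ↔ k ≠ 0 := Iff.rfl
@[simp] theorem holds_var : (var x).holds v m ↔ v x ≠ 0 := Iff.rfl
@[simp] theorem holds_get : (get k a).holds v m ↔ m k (a.eval v m) ≠ 0 := Iff.rfl
@[simp] theorem holds_bool : (bool a).holds v m ↔ a.holds v m := by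
  simp only [holds, bool, eval]; split_ifs <;> simp_all
@[simp] theorem holds_lt : (lt a b).holds v m ↔ a.eval v m < b.eval v m := by
  simp [holds, lt, Nat.sub_eq_zero_iff_le]
@[simp] theorem holds_le : (le a b).holds v m ↔ a.eval v m ≤ b.eval v m := by
  simp [holds, le, Nat.sub_eq_zero_iff_le, Nat.lt_succ_iff]
@[simp] theorem holds_not : (not a).holds v m ↔ ¬ a.holds v m := by
  simp only [holds, not, eval]; split_ifs <;> simp_all
@[simp] theorem holds_and : (and a b).holds v m ↔ a.holds v m ∧ b.holds v m := by
  simp only [holds, and, eval]; split_ifs <;> simp_all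
@[simp] theorem holds_or : (or a b).holds v m ↔ a.holds v m ∨ b.holds v m := by
  simp only [holds, or, eval]; omega
@[simp] theorem holds_ite : (ite c a b).holds v m ↔
    (c.holds v m ∧ a.holds v m) ∨ (¬ c.holds v m ∧ b.holds v m) := by
  simp only [holds, eval]; split_ifs <;> tauto
@[simp] theorem holds_eq : (eq a b).holds v m ↔ a.eval v m = b.eval v m := by
  rw [eq, holds_not, holds, eval_add, eval_sub, eval_sub]; omega
@[simp] theorem holds_ex : (ex x a).holds v m ↔ ∃ i < v 4, a.holds (Function.update v x i) m := by
  simp [holds, ex]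
@[simp] theorem holds_all : (all x a).holds v m ↔ ∀ i < v 4, a.holds (Function.update v x i) m := by
  rw [all, holds_not, holds, eval_sum]
  simp only [ne_eq, Finset.sum_eq_zero_iff, Finset.mem_range, not_not]
  refine forall₂_congr fun i _ => ?_
  have := holds_not (Function.update v x i) m a
  simp only [holds] at this ⊢
  tauto

/-- The sum counts the numbers `j` below the bound such that no `i ≤ j` satisfies the condition;
these are precisely the numbers below the least witness `r`, and there are `r` of them. Existence of
`r` below the bound is needed, otherwise the bound itself would be returned. -/
theorem eval_least (P : ℕ → Prop) (hxz : x ≠ y) (hx : x ≠ 4) (hy : y ≠ 4) (hw : e.wf = true)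
    (hP : ∀ i < v 4, ∀ j < v 4, e.holds (Function.update (Function.update v x j) y i) m ↔ P i)
    {r : ℕ} (hr : r < v 4) (hPr : P r) (hmin : ∀ i, P i → r ≤ i) :
    (least x y e).eval v m = r := by
  classical
  have key : ∀ j < v 4, (all y (or (not (le (var y) (var x))) (not e))).eval
      (Function.update v x j) m = if j < r then 1 else 0 := by
    intro j hj
    have h1 : (all y (or (not (le (var y) (var x))) (not e))).holds (Function.update v x j) m ↔
        j < r := by
      simp only [holds_all, Function.update_of_ne hx.symm, holds_or, holds_not, holds_le, eval_var,
        Function.update_self, Function.update_of_ne hxz]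
      constructor
      · intro h
        by_contra hlt
        rcases h r hr with h' | h'
        · omega
        · exact h' ((hP r hr j hj).2 hPr)
      · intro h i hi
        by_cases hij : i ≤ j
        · exact .inr fun h' => absurd (hmin i ((hP i hi j hj).1 h')) (by omega)
        · exact .inl hij
    have h2 : (all y (or (not (le (var y) (var x))) (not e))).eval (Function.update v x j) m =
        if (all y (or (not (le (var y) (var x))) (not e))).holds (Function.update v x j) m then 1
        else 0 := by
      simp only [all, not, eval_ite, holds_ite, eval_const, holds_const]
      split_ifs <;> simp_all
    rw [h2]; simp only [h1]
  rw [least, eval_sum, Finset.sum_congr rfl fun j hj => key j (Finset.mem_range.1 hj),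
    Finset.sum_ite, Finset.sum_const_zero, add_zero, Finset.sum_const, smul_eq_mul, mul_one]
  rw [show (Finset.range (v 4)).filter (fun j => j < r) = Finset.range r by ext j; simp; omega]
  simp

end

end BExpr

/-! ### Filling tables by nested loops -/

/-- Assign a value to a variable. -/
def RamState.setV (s : RamState) (x i : ℕ) : RamState := ⟨Function.update s.var x i, s.arr⟩

@[simp] theorem RamState.setV_var (s : RamState) (x i : ℕ) :
    (s.setV x i).var = Function.update s.var x i := rfl
@[simp] theorem RamState.setV_arr (s : RamState) (x i : ℕ) : (s.setV x i).arr = s.arr := rfl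

/-- The address of a tuple in an array with rows of length `B`. -/
def hor (B : ℕ) (l : List ℕ) : ℕ := l.foldl (fun p i => B * p + i) 0

theorem hor_snoc (B : ℕ) (l : List ℕ) (a : ℕ) : hor B (l ++ [a]) = B * hor B l + a := by
  simp [hor]

/-- The digits of the tails are read off from the end as remainders modulo `B`. The prefixes need
not consist of digits, hence only their own addresses can be compared. -/
theorem hor_inj {B : ℕ} {P P' : List ℕ} {t t' : List ℕ} (hl : t.length = t'.length)
    (ht : ∀ i ∈ t, i < B) (ht' : ∀ i ∈ t', i < B) (h : hor B (P ++ t) = hor B (P' ++ t')) :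
    hor B P = hor B P' ∧ t = t' := by
  induction t using List.reverseRecOn generalizing t' with
  | nil =>
    obtain rfl : t' = [] := List.length_eq_zero_iff.1 (by simpa using hl.symm)
    simpa using h
  | append_singleton t a ih =>
    rcases List.eq_nil_or_concat t' with rfl | ⟨t'', b, rfl⟩
    · simp at hl
    · rw [List.concat_eq_append] at *
      rw [← List.append_assoc, ← List.append_assoc, hor_snoc, hor_snoc] at h
      have ha : a < B := ht a (by simp)
      have hb : b < B := ht' b (by simp)
      have hab : a = b := by
        have := congrArg (· % B) h
        simpa [Nat.mul_add_mod, Nat.mod_eq_of_lt ha, Nat.mod_eq_of_lt hb] using this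
      subst hab
      have := ih (t' := t'') (by simpa using hl) (fun i hi => ht i (by simp [hi]))
        (fun i hi => ht' i (by simp [hi])) (by
          have : B * hor B (P ++ t) = B * hor B (P' ++ t'') := by omega
          exact Nat.eq_of_mul_eq_mul_left (by omega) this)
      exact ⟨this.1, by rw [this.2]⟩

theorem BExpr.eval_idx (l : List BExpr) (v : ℕ → ℕ) (m : ℕ → ℕ → ℕ) :
    (BExpr.idx l).eval v m = hor (v 4) (l.map fun e => e.eval v m) := by
  induction l using List.reverseRecOn with
  | nil => rfl
  | append_singleton l a ih =>
    rw [List.map_append, List.map_singleton, hor_snoc, ← ih]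
    simp [BExpr.idx]

/-- Assign values to several variables. -/
def upds (v : ℕ → ℕ) : List ℕ → List ℕ → ℕ → ℕ
  | x :: xs, i :: t => upds (Function.update v x i) xs t
  | _, _ => v

theorem upds_congr {v v' : ℕ → ℕ} {xs t : List ℕ} (hl : t.length = xs.length)
    (h : ∀ y ∉ xs, v y = v' y) : upds v xs t = upds v' xs t := by
  induction xs generalizing v v' t with
  | nil => obtain rfl : t = [] := by simpa using hl
           funext y; exact h y (by simp)
  | cons x xs ih =>
    cases t with
    | nil => simp at hl
    | cons i t =>
      refine ih (by simpa using hl) fun y hy => ?_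
      by_cases hyx : y = x
      · subst hyx; simp
      · simp [Function.update_of_ne hyx, h y (by simp [hy, hyx])]

namespace BCmd

/-- The iterations `i, …, i + m - 1` of the loop over `x` with the given body. -/
def iter (x : ℕ) (a : BCmd) : ℕ → ℕ → RamState → RamState
  | _, 0, s => s
  | i, m + 1, s => iter x a (i + 1) m (a.den (s.setV x i))

theorem iter_add (x : ℕ) (a : BCmd) (i m m' : ℕ) (s : RamState) :
    iter x a i (m + m') s = iter x a (i + m) m' (iter x a i m s) := by
  induction m generalizing i s with
  | zero => simp [iter]
  | succ m ih =>
    rw [Nat.succ_add, iter, ih, iter]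
    congr 1
    omega

theorem iter_succ (x : ℕ) (a : BCmd) (i m : ℕ) (s : RamState) :
    iter x a i (m + 1) s = a.den ((iter x a i m s).setV x (i + m)) := by
  rw [iter_add]; rfl

theorem den_loop (x : ℕ) (a : BCmd) (s : RamState) :
    (loop x a).den s = iter x a 0 (s.var 4) s := by
  have h : ∀ m, iter x a 0 m s =
      Nat.rec s (fun i s' => a.den ⟨Function.update s'.var x i, s'.arr⟩) m := by
    intro m
    induction m with
    | zero => rfl
    | succ m ih => rw [iter_succ, ih, Nat.zero_add]; rfl
  rw [h]; rfl

/-- `s'` agrees with `s` outside the variables and arrays that `c` may change. -/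
def Frame (c : BCmd) (s s' : RamState) : Prop :=
  (∀ y ∉ c.modV, s'.var y = s.var y) ∧ ∀ k ∉ c.modA, s'.arr k = s.arr k

theorem den_frame (c : BCmd) (s : RamState) : c.Frame s (c.den s) :=
  ⟨fun _ hy => den_var hy, fun _ hk => den_arr hk⟩

theorem iter_frame (x : ℕ) (a : BCmd) (i m : ℕ) (s : RamState) :
    (loop x a).Frame s (iter x a i m s) := by
  induction m with
  | zero => exact ⟨fun _ _ => rfl, fun _ _ => rfl⟩
  | succ m ih =>
    rw [iter_succ]
    refine ⟨fun y hy => ?_, fun k hk => ?_⟩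
    · rw [← ih.1 y hy]
      simp only [modV, List.mem_cons, not_or] at hy
      rw [den_var hy.2]; simp [Function.update_of_ne hy.1]
    · rw [← ih.2 k hk]
      exact den_arr (s := (iter x a i m s).setV x (i + m)) (c := a) hk

/-- Whatever the body does not modify is available through `Frame` relative to the initial state, so
the invariant only has to mention what changes. -/
theorem loop_inv {x : ℕ} {a : BCmd} {s : RamState} (I : ℕ → RamState → Prop) (h0 : I 0 s)
    (hstep : ∀ i < s.var 4, ∀ s', (loop x a).Frame s s' → I i s' → I (i + 1) (a.den (s'.setV x i))) :
    I (s.var 4) ((loop x a).den s) := by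
  rw [den_loop]
  suffices h : ∀ m ≤ s.var 4, I m (iter x a 0 m s) from h _ le_rfl
  intro m
  induction m with
  | zero => exact fun _ => h0
  | succ m ih =>
    intro hm
    rw [iter_succ, Nat.zero_add]
    exact hstep m (by omega) _ (iter_frame x a 0 m s) (ih (by omega))

/-- Fill the cells of the array `k` whose address is a tuple that extends `pre`. -/
def tabAux (k : ℕ) (pre : List ℕ) : List ℕ → BExpr → BCmd
  | [], e => setArr k (BExpr.idx (pre.map BExpr.var)) e
  | x :: xs, e => loop x (tabAux k (pre ++ [x]) xs e)

/-- Fill the cells of the array `k` by the values of `e`, as a function of the variables `xs`. -/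
def tab (k : ℕ) (xs : List ℕ) (e : BExpr) : BCmd := tabAux k [] xs e

theorem modV_tabAux (k : ℕ) (pre xs : List ℕ) (e : BExpr) : (tabAux k pre xs e).modV = xs := by
  induction xs generalizing pre with
  | nil => rfl
  | cons x xs ih => simp [tabAux, modV, ih]

theorem modA_tabAux (k : ℕ) (pre xs : List ℕ) (e : BExpr) : (tabAux k pre xs e).modA = [k] := by
  induction xs generalizing pre with
  | nil => rfl
  | cons x xs ih => simp [tabAux, modA, ih]

/-- As `e` does not read the array `k`, all entries are computed from the original memory; as
addresses determine tuples, no later pass overwrites an earlier entry. The statement about untouched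
cells is needed for the induction and for filling a single row. -/
theorem den_tabAux {k : ℕ} {e : BExpr} (he : e.wf = true) (hk : k ∉ e.arrs) {xs : List ℕ} :
    ∀ (pre : List ℕ) (s : RamState), xs.Nodup → 4 ∉ xs → (∀ x ∈ pre, x ∉ xs) →
    (∀ t : List ℕ, t.length = xs.length → (∀ i ∈ t, i < s.var 4) →
      ((tabAux k pre xs e).den s).arr k (hor (s.var 4) (pre.map s.var ++ t)) =
        e.eval (upds s.var xs t) s.arr) ∧
    ∀ a, (∀ t : List ℕ, t.length = xs.length → (∀ i ∈ t, i < s.var 4) →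
      a ≠ hor (s.var 4) (pre.map s.var ++ t)) →
      ((tabAux k pre xs e).den s).arr k a = s.arr k a := by
  induction xs with
  | nil =>
    intro pre s _ _ _
    have hidx : (BExpr.idx (pre.map BExpr.var)).eval s.var s.arr = hor (s.var 4) (pre.map s.var) := by
      rw [BExpr.eval_idx, List.map_map]; rfl
    constructor
    · intro t ht _
      obtain rfl : t = [] := by simpa using ht
      simp [tabAux, den, hidx, upds]
    · intro a ha
      have := ha [] rfl (by simp)
      simp only [List.append_nil] at this
      simp [tabAux, den, hidx, Function.update_of_ne this]
  | cons x xs ih =>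
    intro pre s hnd h4 hpre
    simp only [List.nodup_cons, List.mem_cons, not_or] at hnd h4 hpre
    let I : ℕ → RamState → Prop := fun n s' =>
      (∀ j < n, ∀ t : List ℕ, t.length = xs.length → (∀ i ∈ t, i < s.var 4) →
        s'.arr k (hor (s.var 4) (pre.map s.var ++ j :: t)) = e.eval (upds s.var (x :: xs) (j :: t)) s.arr) ∧
      ∀ a, (∀ j < n, ∀ t : List ℕ, t.length = xs.length → (∀ i ∈ t, i < s.var 4) →
        a ≠ hor (s.var 4) (pre.map s.var ++ j :: t)) → s'.arr k a = s.arr k a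
    have hI : I (s.var 4) ((tabAux k pre (x :: xs) e).den s) := by
      refine loop_inv (s := s) I ⟨by simp, fun a _ => rfl⟩ ?_
      rintro n hn s' ⟨hf1, hf2⟩ ⟨h1, h2⟩
      simp only [modV, modA, modV_tabAux, modA_tabAux, List.mem_cons, not_or, List.not_mem_nil,
        or_false] at hf1 hf2
      have hs4 : (s'.setV x n).var 4 = s.var 4 := by
        simp [Function.update_of_ne h4.1, hf1 4 h4]
      have hmap : (pre ++ [x]).map (s'.setV x n).var = pre.map s.var ++ [n] := by
        simp only [List.map_append, List.map_singleton, RamState.setV_var, Function.update_self]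
        congr 1
        refine List.map_congr_left fun y hy => ?_
        rw [Function.update_of_ne (hpre y hy).1, hf1 y (hpre y hy)]
      obtain ⟨g1, g2⟩ := ih (pre ++ [x]) (s'.setV x n) hnd.2 h4.2 (by
        intro y hy
        rcases List.mem_append.1 hy with hy | hy
        · exact (hpre y hy).2
        · simp only [List.mem_singleton] at hy; rw [hy]; exact hnd.1)
      rw [hs4, hmap] at g1 g2
      simp only [List.append_assoc, List.singleton_append] at g1 g2
      constructor
      · intro j hj t ht htb
        by_cases hjn : j = n
        · subst hjn
          rw [g1 t ht htb]
          simp only [upds]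
          rw [upds_congr (v' := Function.update s.var x j) ht]
          · exact BExpr.eval_congr he (fun _ _ => rfl) fun k' hk' => hf2 k' (by rintro rfl; exact hk hk')
          · intro y hy
            by_cases hyx : y = x
            · subst hyx; simp
            · simp [Function.update_of_ne hyx, hf1 y ⟨hyx, hy⟩]
        · rw [g2, RamState.setV_arr, h1 j (by omega) t ht htb]
          intro t' ht' htb' heq
          have := (hor_inj (t := j :: t) (t' := n :: t') (by simp [ht, ht'])
            (by simp only [List.mem_cons, forall_eq_or_imp]; exact ⟨by omega, htb⟩)
            (by simp only [List.mem_cons, forall_eq_or_imp]; exact ⟨by omega, htb'⟩) heq).2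
          simp only [List.cons.injEq] at this
          exact hjn this.1
      · intro a ha
        rw [g2 a fun t ht htb => ha n (by omega) t ht htb]
        exact h2 a fun j hj => ha j (by omega)
    constructor
    · rintro (_ | ⟨j, t⟩) ht htb
      · simp at ht
      · simp only [List.mem_cons, forall_eq_or_imp] at htb
        exact hI.1 j htb.1 t (by simpa using ht) htb.2
    · intro a ha
      refine hI.2 a fun j hj t ht htb => ha (j :: t) (by simp [ht]) ?_
      simp only [List.mem_cons, forall_eq_or_imp]
      exact ⟨hj, htb⟩

section
variable {k p x y B q : ℕ} {e : BExpr} {s : RamState}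

theorem tab1 (hB : s.var 4 = B) (he : e.wf = true) (hk : k ∉ e.arrs) (hx : x ≠ 4) {i : ℕ}
    (hi : i < B) :
    ((tab k [x] e).den s).arr k i = e.eval (Function.update s.var x i) s.arr := by
  subst hB
  have := (den_tabAux he hk (xs := [x]) [] s (by simp) (by simpa using hx.symm) (by simp)).1 [i] rfl
    (by simpa using hi)
  simpa [hor, upds, tab] using this

theorem tab2 (hB : s.var 4 = B) (he : e.wf = true) (hk : k ∉ e.arrs) (hx : x ≠ 4) (hy : y ≠ 4)
    (hxy : x ≠ y) {i j : ℕ} (hi : i < B) (hj : j < B) :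
    ((tab k [x, y] e).den s).arr k (B * i + j) =
      e.eval (Function.update (Function.update s.var x i) y j) s.arr := by
  subst hB
  have := (den_tabAux he hk (xs := [x, y]) [] s (by simpa using hxy)
    (by simp; exact ⟨hx.symm, hy.symm⟩) (by simp)).1 [i, j] rfl (by simpa using ⟨hi, hj⟩)
  simpa [hor, upds, tab] using this

theorem row (hB : s.var 4 = B) (hq : s.var p = q) (he : e.wf = true) (hk : k ∉ e.arrs) (hx : x ≠ 4)
    (hp : p ≠ x) {i : ℕ} (hi : i < B) :
    ((tabAux k [p] [x] e).den s).arr k (B * q + i) =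
      e.eval (Function.update s.var x i) s.arr := by
  subst hB hq
  have := (den_tabAux he hk (xs := [x]) [p] s (by simp) (by simpa using hx.symm)
    (by simpa using hp)).1 [i] rfl (by simpa using hi)
  simpa [hor, upds, tab] using this

theorem row_of_ne (hB : s.var 4 = B) (hq : s.var p = q) (he : e.wf = true) (hk : k ∉ e.arrs)
    (hx : x ≠ 4) (hp : p ≠ x) {l i : ℕ} (hi : i < B) (hl : l ≠ q) :
    ((tabAux k [p] [x] e).den s).arr k (B * l + i) = s.arr k (B * l + i) := by
  subst hB hq
  refine (den_tabAux he hk (xs := [x]) [p] s (by simp) (by simpa using hx.symm)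
    (by simpa using hp)).2 _ fun t ht htb heq => ?_
  match t, ht with
  | [j], _ =>
    simp only [List.mem_singleton, forall_eq] at htb
    have h : s.var 4 * l + i = s.var 4 * s.var p + j := by simpa [hor] using heq
    apply hl
    have := congrArg (· / s.var 4) h
    have h0 : 0 < s.var 4 := by omega
    simpa [Nat.mul_add_div h0, Nat.div_eq_of_lt hi, Nat.div_eq_of_lt htb] using this

theorem tab5 {x₁ x₂ x₃ x₄ x₅ : ℕ} (hB : s.var 4 = B) (he : e.wf = true) (hk : k ∉ e.arrs)
    (hx : [x₁, x₂, x₃, x₄, x₅].Nodup) (h4 : 4 ∉ [x₁, x₂, x₃, x₄, x₅]) {i₁ i₂ i₃ i₄ i₅ : ℕ}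
    (h₁ : i₁ < B) (h₂ : i₂ < B) (h₃ : i₃ < B) (h₄ : i₄ < B) (h₅ : i₅ < B) :
    ((tab k [x₁, x₂, x₃, x₄, x₅] e).den s).arr k (hor B [i₁, i₂, i₃, i₄, i₅]) =
      e.eval (Function.update (Function.update (Function.update (Function.update (Function.update
        s.var x₁ i₁) x₂ i₂) x₃ i₃) x₄ i₄) x₅ i₅) s.arr := by
  subst hB
  have := (den_tabAux he hk (xs := [x₁, x₂, x₃, x₄, x₅]) [] s hx h4 (by simp)).1
    [i₁, i₂, i₃, i₄, i₅] rfl (by simp; exact ⟨h₁, h₂, h₃, h₄, h₅⟩)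
  simpa [upds, tab] using this

/-- The conditions under which the table of `e` over the variables `xs` is filled correctly. -/
def tabOk (k : ℕ) (xs : List ℕ) (e : BExpr) : Bool :=
  e.wf && (decide (k ∉ e.arrs) && (decide xs.Nodup && decide (4 ∉ xs)))

theorem tabOk_iff {xs : List ℕ} :
    tabOk k xs e = true ↔ e.wf = true ∧ k ∉ e.arrs ∧ xs.Nodup ∧ 4 ∉ xs := by simp [tabOk]

theorem arr_tab1 (h : tabOk k [x] e = true) (hB : s.var 4 = B) {i : ℕ} (hi : i < B) :
    ((tab k [x] e).den s).arr k i = e.eval (Function.update s.var x i) s.arr := by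
  obtain ⟨h1, h2, -, h3⟩ := tabOk_iff.1 h
  exact tab1 hB h1 h2 (by simpa [eq_comm] using h3) hi

theorem arr_tab1_ne (h : tabOk k [x] e = true) (hB : s.var 4 = B) {i : ℕ} (hi : i < B) :
    ((tab k [x] e).den s).arr k i ≠ 0 ↔ e.holds (Function.update s.var x i) s.arr := by
  rw [arr_tab1 h hB hi]; rfl

theorem arr_tab2 (h : tabOk k [x, y] e = true) (hB : s.var 4 = B) {i j : ℕ} (hi : i < B)
    (hj : j < B) : ((tab k [x, y] e).den s).arr k (B * i + j) =
      e.eval (Function.update (Function.update s.var x i) y j) s.arr := by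
  obtain ⟨h1, h2, h3, h4⟩ := tabOk_iff.1 h
  simp only [List.mem_cons, List.not_mem_nil, or_false, not_or] at h4
  exact tab2 hB h1 h2 (Ne.symm h4.1) (Ne.symm h4.2) (by simpa using h3) hi hj

theorem arr_tab2_ne (h : tabOk k [x, y] e = true) (hB : s.var 4 = B) {i j : ℕ} (hi : i < B)
    (hj : j < B) : ((tab k [x, y] e).den s).arr k (B * i + j) ≠ 0 ↔
      e.holds (Function.update (Function.update s.var x i) y j) s.arr := by
  rw [arr_tab2 h hB hi hj]; rfl

theorem arr_row (h : tabOk k [x] e = true) (hp : p ≠ x) (hB : s.var 4 = B) (hq : s.var p = q)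
    {i : ℕ} (hi : i < B) : ((tabAux k [p] [x] e).den s).arr k (B * q + i) =
      e.eval (Function.update s.var x i) s.arr := by
  obtain ⟨h1, h2, -, h3⟩ := tabOk_iff.1 h
  exact row hB hq h1 h2 (by simpa [eq_comm] using h3) hp hi

theorem arr_row_ne (h : tabOk k [x] e = true) (hp : p ≠ x) (hB : s.var 4 = B) (hq : s.var p = q)
    {i : ℕ} (hi : i < B) : ((tabAux k [p] [x] e).den s).arr k (B * q + i) ≠ 0 ↔
      e.holds (Function.update s.var x i) s.arr := by
  rw [arr_row h hp hB hq hi]; rfl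

theorem arr_row_of_ne (h : tabOk k [x] e = true) (hp : p ≠ x) (hB : s.var 4 = B) {l i : ℕ}
    (hi : i < B) (hl : l ≠ s.var p) :
    ((tabAux k [p] [x] e).den s).arr k (B * l + i) = s.arr k (B * l + i) := by
  obtain ⟨h1, h2, -, h3⟩ := tabOk_iff.1 h
  exact row_of_ne hB rfl h1 h2 (by simpa [eq_comm] using h3) hp hi hl

theorem arr_tab1_lt_ne (h : tabOk k [x] e = true) {i : ℕ} (hi : i < s.var 4) :
    ((tab k [x] e).den s).arr k i ≠ 0 ↔ e.holds (Function.update s.var x i) s.arr :=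
  arr_tab1_ne h rfl hi

theorem seq_den (a b : BCmd) (s : RamState) : (seq a b).den s = b.den (a.den s) := rfl

end

end BCmd

/-! ### Connected components and tree-depth of vertex sets -/

section TreeDepth

variable (A : ℕ → ℕ → Prop)

/-- Within `D`, the vertex `v` can be reached from `u` by at most `i` steps. -/
def Reach (D : Finset ℕ) : ℕ → ℕ → ℕ → Prop
  | 0, u, v => u = v ∧ u ∈ D
  | i + 1, u, v => v ∈ D ∧ ∃ w, Reach D i u w ∧ (w = v ∨ A w v)

/-- Within `D`, the vertices `u` and `v` are connected. -/
def Conn (D : Finset ℕ) (u v : ℕ) : Prop := ∃ i, Reach A D i u v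

open Classical in
/-- The component of `v` in `D`. -/
noncomputable def comp (D : Finset ℕ) (v : ℕ) : Finset ℕ := {u ∈ D | Conn A D v u}

variable {A} {D D' : Finset ℕ} {i u v w : ℕ}

theorem Reach.mem (h : Reach A D i u v) : u ∈ D ∧ v ∈ D := by
  induction i generalizing v with
  | zero => exact ⟨h.2, h.1 ▸ h.2⟩
  | succ i ih => obtain ⟨h, w, hw, -⟩ := h; exact ⟨(ih hw).1, h⟩

theorem Reach.succ (h : Reach A D i u v) : Reach A D (i + 1) u v := ⟨h.mem.2, v, h, .inl rfl⟩

theorem Reach.mono {j : ℕ} (h : Reach A D i u v) (hij : i ≤ j) : Reach A D j u v := by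
  induction hij with
  | refl => exact h
  | step _ ih => exact ih.succ

theorem Conn.mem (h : Conn A D u v) : u ∈ D ∧ v ∈ D := h.elim fun _ h => h.mem

theorem Conn.refl (h : u ∈ D) : Conn A D u u := ⟨0, rfl, h⟩

theorem Conn.step (h : Conn A D u v) (hw : w ∈ D) (ha : A v w) : Conn A D u w :=
  h.elim fun i h => ⟨i + 1, hw, v, h, .inr ha⟩

theorem Conn.induct {P : ℕ → Prop} (h : Conn A D u v) (hu : P u)
    (hs : ∀ x y, Conn A D u x → y ∈ D → A x y → P x → P y) : P v := by
  obtain ⟨i, h⟩ := h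
  induction i generalizing v with
  | zero => exact h.1 ▸ hu
  | succ i ih =>
    obtain ⟨hv, w, hw, rfl | ha⟩ := h
    · exact ih hw
    · exact hs w v ⟨i, hw⟩ hv ha (ih hw)

theorem Conn.trans (h : Conn A D u v) (h' : Conn A D v w) : Conn A D u w :=
  h'.induct h fun _ _ _ hy ha hx => hx.step hy ha

theorem Conn.symm (hA : Symmetric A) (h : Conn A D u v) : Conn A D v u :=
  h.induct (.refl h.mem.1) fun _ _ hx hy ha h' =>
    ((Conn.refl hy).step hx.mem.2 (hA ha)).trans h'

theorem Conn.mono (h : Conn A D u v) (hD : D ⊆ D') : Conn A D' u v :=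
  h.induct (.refl (hD h.mem.1)) fun _ _ _ hy ha h' => h'.step (hD hy) ha

theorem mem_comp : u ∈ comp A D v ↔ Conn A D v u := by
  classical
  unfold comp
  rw [Finset.mem_filter, and_iff_right_iff_imp]
  exact fun h => h.mem.2

theorem self_mem_comp (h : v ∈ D) : v ∈ comp A D v := mem_comp.2 (.refl h)

theorem comp_subset : comp A D v ⊆ D := fun _ h => (mem_comp.1 h).mem.2

theorem comp_mono (hD : D ⊆ D') : comp A D v ⊆ comp A D' v :=
  fun _ h => mem_comp.2 ((mem_comp.1 h).mono hD)

theorem Conn.comp_eq (hA : Symmetric A) (h : Conn A D u v) : comp A D u = comp A D v := by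
  ext w
  simp only [mem_comp]
  exact ⟨fun h' => (h.symm hA).trans h', fun h' => h.trans h'⟩

theorem Conn.in_comp (h : Conn A D u v) : Conn A (comp A D u) u v :=
  h.induct (.refl (self_mem_comp h.mem.1)) fun _ _ hx hy ha h' => h'.step (mem_comp.2 (hx.step hy ha)) ha

/-- A vertex set that contains a component entirely has it as a component. -/
theorem comp_eq_of_subset (hD : D' ⊆ D) (h : comp A D v ⊆ D') (hv : v ∈ D) :
    comp A D' v = comp A D v := by
  refine (comp_mono hD).antisymm fun u hu => ?_
  exact mem_comp.2 ((mem_comp.1 hu).in_comp.mono h)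

theorem comp_comp (hA : Symmetric A) (h : Conn A D v u) : comp A (comp A D v) u = comp A D v := by
  rw [comp_eq_of_subset comp_subset (by rw [h.comp_eq hA]) h.mem.2, h.comp_eq hA]

variable (A) in
/-- The tree-depth of the graph induced on a vertex set is at most `h`. -/
def TdLe : ℕ → Finset ℕ → Prop
  | 0, W => W = ∅
  | h + 1, W => ∀ v ∈ W, ∃ r ∈ comp A W v, TdLe h ((comp A W v).erase r)

theorem tdLe_empty (h : ℕ) : TdLe A h ∅ := by cases h <;> simp [TdLe]

theorem TdLe.mono {h : ℕ} {W W' : Finset ℕ} (hW : TdLe A h W) (hs : W' ⊆ W) : TdLe A h W' := by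
  induction h generalizing W W' with
  | zero => simp only [TdLe] at *; subst hW; simpa using hs
  | succ h ih =>
    intro v hv
    obtain ⟨r, hr, htd⟩ := hW v (hs hv)
    by_cases hr' : r ∈ comp A W' v
    · exact ⟨r, hr', ih htd (Finset.erase_subset_erase _ (comp_mono hs))⟩
    -- The old root is not in the smaller component, so that component already avoids it and any of
    -- its vertices may serve as root.
    · refine ⟨v, self_mem_comp hv, ih htd fun x hx => ?_⟩
      have hx' := Finset.mem_of_mem_erase hx
      exact Finset.mem_erase.2 ⟨fun h => hr' (h ▸ hx'), comp_mono hs hx'⟩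

theorem TdLe.succ {h : ℕ} {W : Finset ℕ} (hW : TdLe A h W) : TdLe A (h + 1) W :=
  fun v hv => ⟨v, self_mem_comp hv, hW.mono ((Finset.erase_subset _ _).trans comp_subset)⟩

theorem tdLe_iff_comp (hA : Symmetric A) {h : ℕ} {W : Finset ℕ} :
    TdLe A h W ↔ ∀ v ∈ W, TdLe A h (comp A W v) := by
  refine ⟨fun hW v _ => hW.mono comp_subset, fun hW => ?_⟩
  cases h with
  | zero =>
    refine Finset.eq_empty_of_forall_notMem fun v hv => ?_
    have h1 : comp A W v = ∅ := hW v hv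
    have := self_mem_comp (A := A) hv
    simp [h1] at this
  | succ h =>
    intro v hv
    have := hW v hv v (self_mem_comp hv)
    rwa [comp_comp hA (.refl hv)] at this

/-- A connected set of tree-depth at most `h + 1` has a root. -/
theorem TdLe.exists_root (hA : Symmetric A) {h : ℕ} {W : Finset ℕ} (hv : v ∈ W)
    (hW : TdLe A (h + 1) (comp A W v)) : ∃ r ∈ comp A W v, TdLe A h ((comp A W v).erase r) := by
  have := hW v (self_mem_comp hv)
  rwa [comp_comp hA (.refl hv)] at this

/-- Conversely, a root of a component. -/
theorem tdLe_of_root (hA : Symmetric A) {h r : ℕ} {W : Finset ℕ} (hr : r ∈ comp A W v)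
    (hW : TdLe A h ((comp A W v).erase r)) : TdLe A (h + 1) (comp A W v) := by
  intro u hu
  rw [comp_comp hA (mem_comp.1 hu)]
  exact ⟨r, hr, hW⟩

/-- A path in a set of tree-depth at most `h` has fewer than `2 ^ h` vertices. -/
theorem TdLe.length_lt {h : ℕ} {W : Finset ℕ} (hA : Symmetric A) (hW : TdLe A h W) {l : List ℕ}
    (hc : l.IsChain A) (hn : l.Nodup) (hl : ∀ x ∈ l, x ∈ W) : l.length < 2 ^ h := by
  induction h generalizing W l with
  | zero =>
    cases l with
    | nil => simp
    | cons x l => have := hl x (by simp); rw [hW] at this; simp at this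
  | succ h ih =>
    cases l with
    | nil => simp
    | cons x l =>
      obtain ⟨r, hr, htd⟩ := hW x (hl x (by simp))
      have hconn : ∀ y ∈ x :: l, y ∈ comp A W x := by
        have key : ∀ (l : List ℕ) (x : ℕ), (x :: l).IsChain A → (∀ y ∈ x :: l, y ∈ W) →
            ∀ y ∈ x :: l, Conn A W x y := by
          intro l
          induction l with
          | nil => intro x _ hl y hy; simp at hy; subst hy; exact .refl (hl _ (by simp))
          | cons z l ihl =>
            intro x hc hl y hy
            rw [List.isChain_cons_cons] at hc
            rcases List.mem_cons.1 hy with rfl | hy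
            · exact .refl (hl _ (by simp))
            · exact ((Conn.refl (hl x (by simp))).step (hl z (by simp)) hc.1).trans
                (ihl z hc.2 (fun y hy => hl y (by simp only [List.mem_cons] at hy ⊢; tauto)) y hy)
        exact fun y hy => mem_comp.2 (key l x hc hl y hy)
      -- The root cuts the path into two paths with at most `2^h - 1` vertices each, which gives `2
      -- (2^h - 1) + 1 < 2^(h+1)`.
      by_cases hrl : r ∈ x :: l
      · obtain ⟨l₁, l₂, h12⟩ := List.append_of_mem hrl
        rw [h12] at hc hn hconn ⊢
        have hc' := List.isChain_append.1 hc
        have hn' := List.nodup_append.1 hn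
        have h1 := ih htd hc'.1 hn'.1 fun y hy => Finset.mem_erase.2
          ⟨hn'.2.2 y hy r (by simp), hconn y (by simp [hy])⟩
        have h2 := ih htd hc'.2.1.tail (List.Nodup.of_cons hn'.2.1) fun y hy => Finset.mem_erase.2
          ⟨fun h => (List.nodup_cons.1 hn'.2.1).1 (h ▸ hy), hconn y (by
            simp only [List.mem_append, List.mem_cons]; exact .inr (.inr hy))⟩
        simp only [List.length_append, List.length_cons, pow_succ, List.tail_cons] at *
        omega
      · refine (ih htd hc hn fun y hy => Finset.mem_erase.2 ⟨fun h => hrl (h ▸ hy), hconn y hy⟩).trans ?_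
        exact Nat.pow_lt_pow_right (by omega) (by omega)

/-- The distance of `v` from `u` within `D`. -/
noncomputable def distIn (A : ℕ → ℕ → Prop) (D : Finset ℕ) (u v : ℕ) : ℕ := sInf {i | Reach A D i u v}

/-- The least vertex of the component of `v` in `D`. -/
noncomputable def rootOf (A : ℕ → ℕ → Prop) (D : Finset ℕ) (v : ℕ) : ℕ := sInf {u | Conn A D v u}

/-- The distance of `v` from the least vertex of its component. -/
noncomputable def rootDist (A : ℕ → ℕ → Prop) (D : Finset ℕ) (v : ℕ) : ℕ := distIn A D (rootOf A D v) v

theorem reach_distIn (h : Conn A D u v) : Reach A D (distIn A D u v) u v := Nat.sInf_mem h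

theorem distIn_le (h : Reach A D i u v) : distIn A D u v ≤ i := Nat.sInf_le h

theorem reach_iff (h : Conn A D u v) : Reach A D i u v ↔ distIn A D u v ≤ i :=
  ⟨distIn_le, fun hi => (reach_distIn h).mono hi⟩

theorem conn_rootOf (h : v ∈ D) : Conn A D v (rootOf A D v) := Nat.sInf_mem (s := {u | Conn A D v u}) ⟨v, Conn.refl h⟩

theorem rootOf_le (h : Conn A D v u) : rootOf A D v ≤ u := Nat.sInf_le h

theorem rootOf_eq (hA : Symmetric A) (h : Conn A D u v) : rootOf A D u = rootOf A D v := by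
  unfold rootOf
  congr 1
  ext w
  exact ⟨fun h' => (h.symm hA).trans h', fun h' => h.trans h'⟩

theorem distIn_eq_zero (h : Conn A D u v) : distIn A D u v = 0 ↔ u = v := by
  constructor
  · intro h0
    have := reach_distIn h
    rw [h0] at this
    exact this.1
  · rintro rfl
    exact Nat.le_zero.1 (distIn_le ⟨rfl, h.mem.1⟩)

theorem distIn_step (h : Conn A D u v) (hw : w ∈ D) (ha : A v w) :
    distIn A D u w ≤ distIn A D u v + 1 :=
  distIn_le ⟨hw, v, reach_distIn h, .inr ha⟩

/-- A shortest walk has no idle last step, and the distance along it drops by exactly one. -/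
theorem exists_pred (h : Conn A D u v) (h0 : distIn A D u v = i + 1) :
    ∃ w, Conn A D u w ∧ A w v ∧ distIn A D u w = i := by
  have hr := reach_distIn h
  rw [h0] at hr
  obtain ⟨hv, w, hw, rfl | ha⟩ := hr
  · have := distIn_le hw; omega
  · have h1 := distIn_le hw
    have h2 := distIn_step ⟨i, hw⟩ hv ha
    exact ⟨w, ⟨i, hw⟩, ha, by omega⟩

theorem exists_distIn_eq (h : Conn A D u v) {j : ℕ} (hj : j ≤ distIn A D u v) :
    ∃ w, Conn A D u w ∧ distIn A D u w = j := by
  obtain ⟨k, hk⟩ : ∃ k, distIn A D u v = j + k := ⟨_, (Nat.add_sub_cancel' hj).symm⟩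
  induction k generalizing v with
  | zero => exact ⟨v, h, by omega⟩
  | succ k ih =>
    obtain ⟨w, hw, -, hd⟩ := exists_pred h (i := j + k) (by omega)
    exact ih hw (by omega) hd

/-- Every smaller distance is attained as well, so `D` has at least `distIn A D u v + 1` vertices.
-/
theorem distIn_lt_card (h : Conn A D u v) : distIn A D u v < D.card := by
  have h1 : Finset.range (distIn A D u v + 1) ⊆ D.image (distIn A D u) := by
    intro j hj
    obtain ⟨w, hw, hd⟩ := exists_distIn_eq h (j := j) (by simp at hj; omega)
    exact Finset.mem_image.2 ⟨w, hw.mem.2, hd⟩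
  have := (Finset.card_le_card h1).trans Finset.card_image_le
  simpa using this

theorem conn_iff_reach {m : ℕ} (hm : D.card ≤ m) : Conn A D u v ↔ Reach A D m u v :=
  ⟨fun h => (reach_iff h).2 ((distIn_lt_card h).le.trans hm), fun h => ⟨m, h⟩⟩

end TreeDepth

/-- An elimination forest of height at most `d` bounds the recursive tree-depth. -/
theorem EliminationForest.tdLe {n : ℕ} {G : SimpleGraph (Fin n)} (F : EliminationForest G) {d : ℕ}
    (hd : ∀ v, F.depth v ≤ d) {A : ℕ → ℕ → Prop}
    (hA : ∀ u v, A u v ↔ ∃ (hu : u < n) (hv : v < n), G.Adj ⟨u, hu⟩ ⟨v, hv⟩) :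
    TdLe A d (Finset.range n) := by
  have hanc : ∀ x y, Relation.ReflTransGen (fun x y => F.parent y = some x) x y →
      x = y ∨ F.depth x < F.depth y := by
    intro x y h
    induction h with
    | refl => exact .inl rfl
    | @tail b c hb hp ih =>
      have := F.depth_child _ _ hp
      rcases ih with rfl | ih
      · right; omega
      · right; omega
  -- Two ancestors of a common vertex are comparable, and the one of smaller depth lies above the
  -- other.
  have hchain : ∀ x y z, Relation.ReflTransGen (fun x y => F.parent y = some x) x z →
      Relation.ReflTransGen (fun x y => F.parent y = some x) y z → F.depth x ≤ F.depth y →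
      Relation.ReflTransGen (fun x y => F.parent y = some x) x y := by
    intro x y z hx hy hle
    induction hx with
    | refl =>
      rcases hanc _ _ hy with rfl | h
      · exact .refl
      · omega
    | @tail b c hb hp ih =>
      rcases Relation.ReflTransGen.cases_tail hy with rfl | ⟨b', hb', hp'⟩
      · exact hb.tail hp
      · have : b' = b := by rw [hp] at hp'; exact (Option.some.inj hp').symm
        subst this
        exact ih hb'
  -- Induction over the number of depths still allowed: all vertices of `W` lie deeper than `d - h`
  -- in the forest.
  have main : ∀ h (W : Finset ℕ), (∀ v ∈ W, ∃ hv : v < n, d < F.depth ⟨v, hv⟩ + h) → TdLe A h W := by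
    intro h
    induction h with
    | zero =>
      intro W hW
      refine Finset.eq_empty_of_forall_notMem fun v hv => ?_
      obtain ⟨hvn, h⟩ := hW v hv
      have := hd ⟨v, hvn⟩
      omega
    | succ h ih =>
      intro W hW v hv
      let dp : ℕ → ℕ := fun x => if hx : x < n then F.depth ⟨x, hx⟩ else 0
      -- A vertex of least depth in a component is an ancestor of the whole component: walking along
      -- an edge, one either descends or climbs to an ancestor that, by minimality, is still below
      -- `r`. It is taken as the root, and all other vertices are strictly deeper.
      obtain ⟨r, hr, hmin⟩ := (comp A W v).exists_min_image dp ⟨v, self_mem_comp hv⟩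
      refine ⟨r, hr, ih _ fun u hu => ?_⟩
      obtain ⟨hur, hu⟩ := Finset.mem_erase.1 hu
      obtain ⟨hrn, hrd⟩ := hW r (comp_subset hr)
      have hsym : Symmetric A := by
        intro x y h
        rw [hA] at h ⊢
        obtain ⟨hx, hy, h⟩ := h
        exact ⟨hy, hx, h.symm⟩
      have hconn : Conn A W r u := ((mem_comp.1 hr).symm hsym).trans (mem_comp.1 hu)
      have hdesc : ∃ hun : u < n,
          Relation.ReflTransGen (fun x y => F.parent y = some x) ⟨r, hrn⟩ ⟨u, hun⟩ := by
        refine hconn.induct (P := fun u => ∃ hun : u < n,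
          Relation.ReflTransGen (fun x y => F.parent y = some x) ⟨r, hrn⟩ ⟨u, hun⟩) ⟨hrn, .refl⟩ ?_
        rintro x y hx hy ha ⟨hxn, hxr⟩
        obtain ⟨_, hyn, ha⟩ := (hA x y).1 ha
        refine ⟨hyn, ?_⟩
        rcases F.adj_comparable _ _ ha with h | h
        · exact hxr.trans h
        · refine hchain _ _ _ hxr h ?_
          have := hmin y (mem_comp.2 ((mem_comp.1 hr).trans (hx.step hy ((hA x y).2 ⟨_, _, ha⟩))))
          simpa [dp, hrn, hyn] using this
      obtain ⟨hun, hdesc⟩ := hdesc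
      refine ⟨hun, ?_⟩
      rcases hanc _ _ hdesc with h | h
      · exact absurd (Fin.mk.inj_iff.1 h).symm hur
      · omega
  refine main d _ fun v hv => ⟨Finset.mem_range.1 hv, ?_⟩
  have : 1 ≤ F.depth ⟨v, Finset.mem_range.1 hv⟩ := by
    cases hp : F.parent ⟨v, Finset.mem_range.1 hv⟩ with
    | none => rw [F.depth_root _ hp]
    | some u => rw [F.depth_child _ _ hp]; omega
  omega

/-! ### Obstructions to small tree-depth -/

section Obstruction

/-- The predecessor of `v` on a shortest path from the least vertex of its component. -/
noncomputable def pred (A : ℕ → ℕ → Prop) (D : Finset ℕ) (v : ℕ) : ℕ :=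
  sInf {u | Conn A D v u ∧ A u v ∧ rootDist A D u + 1 = rootDist A D v}

open Classical in
/-- `m` rounds of closing `U` under predecessors. -/
noncomputable def clos (A : ℕ → ℕ → Prop) (D U : Finset ℕ) : ℕ → Finset ℕ
  | 0 => U
  | i + 1 => {x ∈ D | x ∈ clos A D U i ∨
      ∃ u ∈ clos A D U i, rootDist A D u ≠ 0 ∧ pred A D u = x}

open Classical in
/-- The vertices whose rank among the vertices of `X` in their component is `a`. -/
noncomputable def pick (A : ℕ → ℕ → Prop) (D X : Finset ℕ) (a : ℕ) : Finset ℕ :=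
  {v ∈ X | ({u ∈ X | u < v ∧ Conn A D v u} : Finset ℕ).card = a}

open Classical in
/-- For each component of `D`, the part of `Y` in one component of `D'`. -/
noncomputable def sel (A : ℕ → ℕ → Prop) (D D' Y : Finset ℕ) : Finset ℕ :=
  {v ∈ Y | ∃ w ∈ Y, Conn A D' v w ∧ ∀ u ∈ Y, Conn A D v u → w ≤ u}

open Classical in
/-- The generators of the obstruction: the given vertices close to the root, and in every component
one vertex on a shortest path with `2 ^ h` vertices from the root, if there is one. -/
noncomputable def gens (A : ℕ → ℕ → Prop) (h : ℕ) (D U : Finset ℕ) : Finset ℕ :=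
  {v ∈ D | (v ∈ U ∧ rootDist A D v < 2 ^ h) ∨ (rootDist A D v + 1 = 2 ^ h ∧
    ∀ u, Conn A D v u → rootDist A D u + 1 = 2 ^ h → v ≤ u)}

/-- A bound for the size of the obstructions. -/
def obstBound (h : ℕ) : ℕ := 2 ^ (4 * 2 ^ h - h - 4)

open Classical in
/-- A set that contains, for every component of `D` of tree-depth more than `h`, a small subset of
the same tree-depth, and nothing of the other components. -/
noncomputable def obst (A : ℕ → ℕ → Prop) (m : ℕ) : ℕ → Finset ℕ → Finset ℕ
  | 0, D => clos A D (gens A 0 D ∅) m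
  | h + 1, D => clos A D (gens A (h + 1) D {v ∈ D | (v ∈ obst A m h D ∨ ∃ a < obstBound h,
      v ∈ sel A D (D \ pick A D (obst A m h D) a) (obst A m h (D \ pick A D (obst A m h D) a))) ∧
      ∀ a < obstBound h, ∃ u, Conn A D v u ∧ u ∈ obst A m h (D \ pick A D (obst A m h D) a)}) m

variable {A : ℕ → ℕ → Prop} {D D' X U : Finset ℕ} {h i m u v w : ℕ}

theorem rootDist_reach (hA : Symmetric A) (hv : v ∈ D) : Conn A D (rootOf A D v) v :=
  (conn_rootOf hv).symm hA

/-- The set whose infimum defines `pred` is non-empty by `exists_pred`, applied to a shortest walk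
from the least vertex of the component; moving inside the component does not change that vertex. -/
theorem pred_spec (hA : Symmetric A) (hv : v ∈ D) (h0 : rootDist A D v = i + 1) :
    Conn A D v (pred A D v) ∧ A (pred A D v) v ∧ rootDist A D (pred A D v) = i := by
  obtain ⟨w, hw, ha, hd⟩ := exists_pred (rootDist_reach hA hv) h0
  have hvw : Conn A D v w := (conn_rootOf hv).trans hw
  have hne : {u | Conn A D v u ∧ A u v ∧ rootDist A D u + 1 = rootDist A D v}.Nonempty := by
    refine ⟨w, hvw, ha, ?_⟩
    rw [h0, rootDist, ← rootOf_eq hA hvw, hd]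
  have := Nat.sInf_mem hne
  exact ⟨this.1, this.2.1, by have := this.2.2; unfold pred; omega⟩

theorem pred_iterate (hA : Symmetric A) (hv : v ∈ D) (hi : i ≤ rootDist A D v) :
    Conn A D v ((pred A D)^[i] v) ∧ rootDist A D ((pred A D)^[i] v) + i = rootDist A D v := by
  induction i with
  | zero => exact ⟨.refl hv, rfl⟩
  | succ i ih =>
    obtain ⟨h1, h2⟩ := ih (by omega)
    rw [Function.iterate_succ_apply']
    obtain ⟨g1, -, g3⟩ := pred_spec hA h1.mem.2
      (i := rootDist A D v - (i + 1)) (by omega)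
    exact ⟨h1.trans g1, by omega⟩

theorem rootDist_lt_card (hA : Symmetric A) (hv : v ∈ D) : rootDist A D v < D.card :=
  distIn_lt_card (rootDist_reach hA hv)

/-- Unfolds the rounds of the closure into iterated predecessors. The bound by the root distance
matters, since `pred` is meaningless at the root. -/
theorem mem_clos (hA : Symmetric A) (hU : U ⊆ D) {x : ℕ} :
    x ∈ clos A D U m ↔ ∃ u ∈ U, ∃ i ≤ m, i ≤ rootDist A D u ∧ (pred A D)^[i] u = x := by
  classical
  induction m generalizing x with
  | zero =>
    simp only [clos, Nat.le_zero]
    exact ⟨fun hx => ⟨x, hx, 0, rfl, Nat.zero_le _, rfl⟩, by rintro ⟨u, hu, i, rfl, -, rfl⟩; exact hu⟩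
  | succ m ih =>
    simp only [clos, Finset.mem_filter]
    constructor
    · rintro ⟨-, hx | ⟨w, hw, h0, rfl⟩⟩
      · obtain ⟨u, hu, i, hi, hd, he⟩ := ih.1 hx
        exact ⟨u, hu, i, by omega, hd, he⟩
      · obtain ⟨u, hu, i, hi, hd, rfl⟩ := ih.1 hw
        refine ⟨u, hu, i + 1, by omega, ?_, Function.iterate_succ_apply' _ _ _⟩
        have := (pred_iterate hA (hU hu) hd).2
        omega
    · rintro ⟨u, hu, i, hi, hd, rfl⟩
      refine ⟨(pred_iterate hA (hU hu) hd).1.mem.2, ?_⟩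
      rcases i with _ | i
      · exact .inl (ih.2 ⟨u, hu, 0, by omega, by omega, rfl⟩)
      · refine .inr ⟨(pred A D)^[i] u, ih.2 ⟨u, hu, i, by omega, by omega, rfl⟩, ?_,
          (Function.iterate_succ_apply' _ _ _).symm⟩
        have := (pred_iterate hA (hU hu) (i := i) (by omega)).2
        omega

theorem clos_subset (hA : Symmetric A) (hU : U ⊆ D) : clos A D U m ⊆ D := by
  intro x hx
  obtain ⟨u, hu, i, hi, hd, rfl⟩ := (mem_clos hA hU).1 hx
  exact (pred_iterate hA (hU hu) hd).1.mem.2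

theorem subset_clos (hA : Symmetric A) (hU : U ⊆ D) : U ⊆ clos A D U m :=
  fun u hu => (mem_clos hA hU).2 ⟨u, hu, 0, by omega, by omega, rfl⟩

theorem pred_iterate_mem_clos (hA : Symmetric A) (hU : U ⊆ D) (hm : D.card ≤ m) {x : ℕ}
    (hx : x ∈ clos A D U m) (hi : i ≤ rootDist A D x) : (pred A D)^[i] x ∈ clos A D U m := by
  obtain ⟨u, hu, j, hj, hd, rfl⟩ := (mem_clos hA hU).1 hx
  have := (pred_iterate hA (hU hu) hd).2
  have := rootDist_lt_card hA (hU hu)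
  exact (mem_clos hA hU).2 ⟨u, hu, i + j, by omega, by omega, Function.iterate_add_apply _ _ _ _⟩

/-- The way to the root is a path: consecutive iterates are adjacent, and they are distinct because
their root distances differ. -/
theorem isChain_iterate (hA : Symmetric A) (hv : v ∈ D) (hi : i ≤ rootDist A D v + 1) :
    ((List.range i).map fun j => (pred A D)^[j] v).IsChain A ∧
    ((List.range i).map fun j => (pred A D)^[j] v).Nodup := by
  constructor
  · rw [List.isChain_map, List.isChain_range]
    intro j hj
    have h1 := pred_iterate hA hv (i := j) (by omega)
    have := pred_spec hA h1.1.mem.2 (i := rootDist A D v - j - 1) (by omega)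
    rw [Nat.succ_eq_add_one, Function.iterate_succ_apply']
    exact hA this.2.1
  · refine List.Nodup.map_on ?_ List.nodup_range
    intro j hj k hk hjk
    simp only [List.mem_range] at hj hk
    have h1 := pred_iterate hA hv (i := j) (by omega)
    have h2 := pred_iterate hA hv (i := k) (by omega)
    have hjk : (pred A D)^[j] v = (pred A D)^[k] v := hjk
    rw [hjk] at h1
    omega

/-- The closure is connected inside every component. -/
theorem conn_clos (hA : Symmetric A) (hU : U ⊆ D) (hm : D.card ≤ m) (hu : u ∈ clos A D U m)
    (hv : v ∈ clos A D U m) (huv : Conn A D u v) {K : Finset ℕ} (hK : K = clos A D U m ∩ comp A D u) :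
    Conn A K u v := by
  have hD := clos_subset (m := m) hA hU
  -- Every vertex of the closure is joined to the least vertex of its component by its predecessors,
  -- which stay in the closure.
  have key : ∀ x ∈ K, Conn A K x (rootOf A D u) := by
    intro x hx
    rw [hK, Finset.mem_inter, mem_comp] at hx
    have hroot : (pred A D)^[rootDist A D x] x = rootOf A D u := by
      have := pred_iterate hA hx.2.mem.2 (le_refl (rootDist A D x))
      have h0 : rootDist A D ((pred A D)^[rootDist A D x] x) = 0 := by omega
      have h1 := (distIn_eq_zero (rootDist_reach hA this.1.mem.2)).1 h0
      rw [← h1, ← rootOf_eq hA this.1, rootOf_eq hA hx.2]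
    rw [← hroot]
    have : ∀ i ≤ rootDist A D x, Conn A K x ((pred A D)^[i] x) := by
      intro i
      induction i with
      | zero => exact fun _ => .refl (by rw [hK, Finset.mem_inter, mem_comp]; exact hx)
      | succ i ih =>
        intro hi
        have h1 := pred_iterate hA hx.2.mem.2 (i := i) (by omega)
        have h2 := pred_spec hA h1.1.mem.2 (i := rootDist A D x - i - 1) (by omega)
        refine (ih (by omega)).step ?_ ?_ (v := (pred A D)^[i] x)
        · rw [hK, Finset.mem_inter, mem_comp]
          exact ⟨pred_iterate_mem_clos hA hU hm hx.1 hi,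
            hx.2.trans (pred_iterate hA hx.2.mem.2 hi).1⟩
        · rw [Function.iterate_succ_apply']
          exact hA h2.2.1
    exact this _ le_rfl
  have hu' : u ∈ K := by rw [hK, Finset.mem_inter, mem_comp]; exact ⟨hu, .refl (hD hu)⟩
  have hv' : v ∈ K := by rw [hK, Finset.mem_inter, mem_comp]; exact ⟨hv, huv⟩
  exact (key u hu').trans ((key v hv').symm hA)

theorem pick_subset {a : ℕ} : pick A D X a ⊆ X := fun _ h => by
  classical
  unfold pick at h
  exact (Finset.mem_filter.1 h).1

theorem mem_pick {a : ℕ} : v ∈ pick A D X a ↔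
    v ∈ X ∧ by classical exact ({u ∈ X | u < v ∧ Conn A D v u} : Finset ℕ).card = a := by
  classical
  unfold pick
  exact Finset.mem_filter

/-- Every vertex of `X` is the only vertex of its component of some rank. -/
theorem exists_pick (hA : Symmetric A) (hX : X ⊆ D) {r : ℕ} (hr : r ∈ X) :
    ∃ a < (X ∩ comp A D r).card, ∀ u, Conn A D r u → (u ∈ pick A D X a ↔ u = r) := by
  classical
  refine ⟨({u ∈ X | u < r ∧ Conn A D r u} : Finset ℕ).card, ?_, ?_⟩
  · refine Finset.card_lt_card ⟨fun u hu => ?_, fun hs => ?_⟩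
    · have := Finset.mem_filter.1 hu
      exact Finset.mem_inter.2 ⟨this.1, mem_comp.2 this.2.2⟩
    · have := hs (Finset.mem_inter.2 ⟨hr, self_mem_comp (hX hr)⟩)
      simp at this
  · intro u hu
    rw [mem_pick]
    constructor
    · rintro ⟨huX, hcard⟩
      -- Ranks within one component increase strictly, so the rank determines the vertex.
      have hlt : ∀ x y, x ∈ X → Conn A D r x → Conn A D r y → x < y →
          ({z ∈ X | z < x ∧ Conn A D x z} : Finset ℕ).card <
            ({z ∈ X | z < y ∧ Conn A D y z} : Finset ℕ).card := by
        intro x y hx hrx hry hxy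
        refine Finset.card_lt_card ⟨fun z hz => ?_, fun hs => ?_⟩
        · simp only [Finset.mem_filter] at hz ⊢
          exact ⟨hz.1, by omega, (hry.symm hA).trans (hrx.trans hz.2.2)⟩
        · have : x ∈ ({z ∈ X | z < x ∧ Conn A D x z} : Finset ℕ) :=
            hs (Finset.mem_filter.2 ⟨hx, hxy, (hry.symm hA).trans hrx⟩)
          simp at this
      rcases lt_trichotomy u r with h | h | h
      · have := hlt u r huX hu (.refl (hX hr)) h
        convert absurd hcard this.ne
      · exact h
      · have := hlt r u hr (.refl (hX hr)) hu h
        convert absurd hcard this.ne'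
    · rintro rfl
      exact ⟨hr, by convert rfl⟩

theorem mem_sel {Y : Finset ℕ} : v ∈ sel A D D' Y ↔
    v ∈ Y ∧ ∃ w ∈ Y, Conn A D' v w ∧ ∀ u ∈ Y, Conn A D v u → w ≤ u := by
  classical
  unfold sel
  exact Finset.mem_filter

theorem mem_gens : v ∈ gens A h D U ↔ v ∈ D ∧ ((v ∈ U ∧ rootDist A D v < 2 ^ h) ∨
    (rootDist A D v + 1 = 2 ^ h ∧ ∀ u, Conn A D v u → rootDist A D u + 1 = 2 ^ h → v ≤ u)) := by
  classical
  unfold gens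
  exact Finset.mem_filter

theorem gens_subset : gens A h D U ⊆ D := fun _ h => (mem_gens.1 h).1

/-- The two cases for the closure of the generators in a component. -/
theorem clos_gens_spec (hA : Symmetric A) (hm : D.card ≤ m) (hv : v ∈ D) {K C : Finset ℕ}
    (hK : K = comp A D v) (hC : C = clos A D (gens A h D U) m) :
    (TdLe A h K → U ∩ K = ∅ → C ∩ K = ∅) ∧
    ((U ∩ K ⊆ C ∧ ∀ u ∈ K, rootDist A D u + 1 < 2 ^ h) ∨ ¬ TdLe A h (C ∩ K)) ∧
    (C ∩ K).card ≤ ((U ∩ K).card + 1) * 2 ^ h := by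
  classical
  -- A vertex whose root distance is at least `2^h - 1` brings along a path with at least `2^h`
  -- vertices, which excludes tree-depth at most `h`.
  have hfar : ∀ u ∈ K, ∀ E : Finset ℕ, (∀ i ≤ rootDist A D u, (pred A D)^[i] u ∈ E) →
      2 ^ h ≤ rootDist A D u + 1 → ¬ TdLe A h E := by
    intro u hu E hE hle htd
    rw [hK, mem_comp] at hu
    have := isChain_iterate hA hu.mem.2 hle
    have h2 := htd.length_lt hA this.1 this.2 (by
      intro x hx
      obtain ⟨j, hj, rfl⟩ := List.mem_map.1 hx
      rw [List.mem_range] at hj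
      exact hE j (by omega))
    simp at h2
  have hsub : gens A h D U ⊆ D := gens_subset
  refine ⟨fun htd hUK => ?_, ?_, ?_⟩
  · refine Finset.eq_empty_of_forall_notMem fun x hx => ?_
    rw [Finset.mem_inter, hC, mem_clos hA hsub] at hx
    obtain ⟨⟨u, hu, i, -, hi, rfl⟩, hxK⟩ := hx
    have hcu := (pred_iterate hA (hsub hu) hi).1
    have huK : u ∈ K := by
      rw [hK, mem_comp] at hxK ⊢
      exact hxK.trans (hcu.symm hA)
    rcases (mem_gens.1 hu).2 with ⟨hU, -⟩ | ⟨hd, -⟩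
    · have : u ∈ U ∩ K := Finset.mem_inter.2 ⟨hU, huK⟩
      simp [hUK] at this
    · refine hfar u huK K (fun j hj => ?_) (by omega) htd
      rw [hK, mem_comp] at huK ⊢
      exact huK.trans (pred_iterate hA (hsub hu) hj).1
  -- If some vertex is that far, distances being attained continuously there is one at distance
  -- exactly `2^h - 1`; the least of these is a generator and its path to the root is the
  -- obstruction. Otherwise all given vertices are near and are kept.
  · by_cases hex : ∃ u ∈ K, 2 ^ h ≤ rootDist A D u + 1
    · right
      obtain ⟨u, hu, hle⟩ := hex
      rw [hK, mem_comp] at hu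
      have hex' : ∃ w, Conn A D v w ∧ rootDist A D w + 1 = 2 ^ h := by
        obtain ⟨w, hw, hd⟩ := exists_distIn_eq (rootDist_reach hA hu.mem.2) (j := 2 ^ h - 1)
          (by unfold rootDist at hle; omega)
        have hvw : Conn A D v w := (hu.trans (conn_rootOf hu.mem.2)).trans hw
        refine ⟨w, hvw, ?_⟩
        rw [rootDist, ← rootOf_eq hA hvw, rootOf_eq hA hu, hd]
        have := Nat.one_le_two_pow (n := h)
        omega
      have hmin := Nat.sInf_mem hex'
      set w := sInf {w | Conn A D v w ∧ rootDist A D w + 1 = 2 ^ h} with hw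
      have hwg : w ∈ gens A h D U := mem_gens.2 ⟨hmin.1.mem.2, .inr ⟨hmin.2, fun y hy hyd =>
        Nat.sInf_le ⟨hmin.1.trans hy, hyd⟩⟩⟩
      refine hfar w (by rw [hK, mem_comp]; exact hmin.1) _ (fun i hi => ?_) hmin.2.ge
      rw [Finset.mem_inter, hC, hK, mem_comp]
      exact ⟨pred_iterate_mem_clos hA hsub hm (subset_clos hA hsub hwg) hi,
        hmin.1.trans (pred_iterate hA hmin.1.mem.2 hi).1⟩
    · left
      push Not at hex
      refine ⟨fun u hu => ?_, hex⟩
      rw [Finset.mem_inter] at hu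
      have := hex u hu.2
      rw [hC]
      refine subset_clos hA hsub (mem_gens.2 ⟨?_, .inl ⟨hu.1, by omega⟩⟩)
      rw [hK] at hu
      exact comp_subset hu.2
  -- Every generator lies at distance less than `2^h`, so it adds at most `2^h` vertices; beyond `U`
  -- a component has at most one generator, as the far one is chosen least.
  · have h1 : C ∩ K ⊆ ((gens A h D U ∩ K) ×ˢ Finset.range (2 ^ h)).image
        (fun x => (pred A D)^[x.2] x.1) := by
      intro x hx
      rw [Finset.mem_inter, hC, mem_clos hA hsub] at hx
      obtain ⟨⟨u, hu, i, -, hi, rfl⟩, hxK⟩ := hx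
      refine Finset.mem_image.2 ⟨(u, i), ?_, rfl⟩
      have hcu := (pred_iterate hA (hsub hu) hi).1
      simp only [Finset.mem_product, Finset.mem_inter, Finset.mem_range]
      refine ⟨⟨hu, ?_⟩, ?_⟩
      · rw [hK, mem_comp] at hxK ⊢
        exact hxK.trans (hcu.symm hA)
      · rcases (mem_gens.1 hu).2 with ⟨-, hd⟩ | ⟨hd, -⟩ <;> omega
    have h2 : gens A h D U ∩ K ⊆ (U ∩ K) ∪ {w ∈ K | rootDist A D w + 1 = 2 ^ h ∧
        ∀ u, Conn A D w u → rootDist A D u + 1 = 2 ^ h → w ≤ u} := by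
      intro u hu
      rw [Finset.mem_inter] at hu
      rcases (mem_gens.1 hu.1).2 with ⟨hU, -⟩ | hd
      · exact Finset.mem_union_left _ (Finset.mem_inter.2 ⟨hU, hu.2⟩)
      · exact Finset.mem_union_right _ (Finset.mem_filter.2 ⟨hu.2, hd⟩)
    have h3 : ({w ∈ K | rootDist A D w + 1 = 2 ^ h ∧
        ∀ u, Conn A D w u → rootDist A D u + 1 = 2 ^ h → w ≤ u} : Finset ℕ).card ≤ 1 := by
      rw [Finset.card_le_one]
      intro a ha b hb
      simp only [Finset.mem_filter, hK, mem_comp] at ha hb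
      have hab : Conn A D a b := (ha.1.symm hA).trans hb.1
      exact le_antisymm (ha.2.2 b hab hb.2.1) (hb.2.2 a (hab.symm hA) ha.2.1)
    calc (C ∩ K).card ≤ (gens A h D U ∩ K).card * 2 ^ h := by
          refine (Finset.card_le_card h1).trans (Finset.card_image_le.trans ?_)
          simp
      _ ≤ _ := by
          gcongr
          exact (Finset.card_le_card h2).trans ((Finset.card_union_le _ _).trans (by omega))

end Obstruction

/-! ### Correctness and size of the obstructions -/

section Obstruction

variable {A : ℕ → ℕ → Prop} {D D' X U : Finset ℕ} {h i m u v w : ℕ}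

theorem obstBound_pos : 1 ≤ obstBound h := Nat.one_le_two_pow

/-- With `b` the bound at level `h`, the obstruction is generated by at most `b` old vertices, `b`
vertices for each of `b` candidate roots, and one far vertex, each contributing up to `2^(h+1)`
vertices. The exponent `4 * 2^h - h - 4` is chosen so that the bound at level `h + 1` equals `4 b²
2^(h+1)`; the subtraction is not truncated as `h + 1 ≤ 2^h`. -/
theorem obstBound_succ (h : ℕ) :
    (obstBound h + obstBound h * obstBound h + 1) * 2 ^ (h + 1) ≤ obstBound (h + 1) := by
  have h1 : h + 1 ≤ 2 ^ h := Nat.lt_two_pow_self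
  have h2 : obstBound (h + 1) = 4 * (obstBound h * obstBound h) * 2 ^ (h + 1) := by
    have h3 : (4 : ℕ) * (2 ^ (4 * 2 ^ h - h - 4) * 2 ^ (4 * 2 ^ h - h - 4)) * 2 ^ (h + 1) =
        2 ^ (2 + ((4 * 2 ^ h - h - 4) + (4 * 2 ^ h - h - 4)) + (h + 1)) := by
      generalize 4 * 2 ^ h - h - 4 = e
      ring
    unfold obstBound
    rw [h3]
    congr 1
    rw [pow_succ 2 h]
    omega
  rw [h2]
  have := obstBound_pos (h := h)
  gcongr
  nlinarith

theorem obst_subset (hA : Symmetric A) : obst A m h D ⊆ D := by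
  cases h <;> exact clos_subset hA gens_subset

open Classical in
/-- The generators of the obstruction one level up. -/
noncomputable def cand (A : ℕ → ℕ → Prop) (m h : ℕ) (D : Finset ℕ) : Finset ℕ :=
  {v ∈ D | (v ∈ obst A m h D ∨ ∃ a < obstBound h,
      v ∈ sel A D (D \ pick A D (obst A m h D) a) (obst A m h (D \ pick A D (obst A m h D) a))) ∧
      ∀ a < obstBound h, ∃ u, Conn A D v u ∧ u ∈ obst A m h (D \ pick A D (obst A m h D) a)}

theorem obst_succ : obst A m (h + 1) D = clos A D (gens A (h + 1) D (cand A m h D)) m := rfl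

theorem mem_cand : v ∈ cand A m h D ↔ v ∈ D ∧ (v ∈ obst A m h D ∨ ∃ a < obstBound h,
      v ∈ sel A D (D \ pick A D (obst A m h D) a) (obst A m h (D \ pick A D (obst A m h D) a))) ∧
      ∀ a < obstBound h, ∃ u, Conn A D v u ∧ u ∈ obst A m h (D \ pick A D (obst A m h D) a) := by
  classical
  unfold cand
  exact Finset.mem_filter

/-- `obst` consists of small obstructions to tree-depth at most `h` in the components that have
larger tree-depth. -/
theorem obst_spec (hA : Symmetric A) (h : ℕ) : ∀ D : Finset ℕ, D.card ≤ m → ∀ v ∈ D,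
    (TdLe A h (comp A D v) → obst A m h D ∩ comp A D v = ∅) ∧
    (¬ TdLe A h (comp A D v) → ¬ TdLe A h (obst A m h D ∩ comp A D v)) ∧
    (obst A m h D ∩ comp A D v).card ≤ obstBound h := by
  induction h with
  | zero =>
    intro D hm v hv
    obtain ⟨-, h2, h3⟩ := clos_gens_spec (h := 0) (U := ∅) hA hm hv rfl rfl
    refine ⟨fun h0 => ?_, fun _ => ?_, by simpa [obstBound, obst] using h3⟩
    · have : comp A D v = ∅ := h0
      rw [this]; simp
    · rcases h2 with h2 | h2
      · have := h2.2 v (self_mem_comp hv)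
        simp at this
      · exact h2
  | succ h ih =>
    intro D hm v hv
    set K := comp A D v with hK
    set X := obst A m h D with hX
    set Da : ℕ → Finset ℕ := fun a => D \ pick A D X a with hDa
    set Y : ℕ → Finset ℕ := fun a => obst A m h (Da a) with hY
    have hXD : X ⊆ D := obst_subset hA
    have hYD : ∀ a, Y a ⊆ Da a := fun a => obst_subset hA
    have hDaD : ∀ a, Da a ⊆ D := fun a => Finset.sdiff_subset
    have hcard : ∀ a, (Da a).card ≤ m := fun a => (Finset.card_le_card (hDaD a)).trans hm
    obtain ⟨hX1, hX2, hX3⟩ := ih D hm v hv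
    have hKD : ∀ {u}, u ∈ K → comp A D u = K := fun hu => ((mem_comp.1 hu).comp_eq hA).symm
    have hKc : ∀ {u w}, u ∈ K → Conn A D u w → w ∈ K :=
      fun hu hw => mem_comp.2 ((mem_comp.1 hu).trans hw)
    -- For every candidate root there is a rank `a` such that passing from `D` to `Da a` deletes
    -- precisely this candidate from `K`. Ranks let all components try their candidates in the same
    -- recursive calls.
    have hpick : ∀ r ∈ X ∩ K, ∃ a < obstBound h, ∀ u ∈ K, u ∈ pick A D X a ↔ u = r := by
      intro r hr
      rw [Finset.mem_inter] at hr
      obtain ⟨a, ha, hu⟩ := exists_pick hA hXD hr.1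
      rw [hKD hr.2] at ha
      exact ⟨a, ha.trans_le hX3, fun u huK => hu u (((mem_comp.1 hr.2).symm hA).trans (mem_comp.1 huK))⟩
    have hDaK : ∀ a, ∀ u ∈ Da a, u ∈ K → comp A (Da a) u ⊆ K := by
      intro a u hu huK x hx
      exact hKc huK ((mem_comp.1 hx).mono (hDaD a))
    obtain ⟨s1, s2, s3⟩ := clos_gens_spec (h := h + 1) (U := cand A m h D) hA hm hv hK obst_succ
    rw [obst_succ]
    rw [obst_succ] at s1 s2 s3
    -- A root outside `X` would leave the obstruction `X ∩ K` intact, hence roots are found in `X`.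
    have hroot : ∀ r ∈ K, TdLe A h (K.erase r) → ¬ TdLe A h K → r ∈ X ∩ K := by
      intro r hr htd hn
      by_contra hrX
      refine hX2 hn (htd.mono fun x hx => Finset.mem_erase.2 ⟨?_, (Finset.mem_inter.1 hx).2⟩)
      rintro rfl
      exact hrX hx
    refine ⟨fun htd => s1 htd ?_, fun htd => ?_, ?_⟩
    · refine Finset.eq_empty_of_forall_notMem fun u hu => ?_
      rw [Finset.mem_inter, mem_cand] at hu
      obtain ⟨⟨huD, -, hbad⟩, huK⟩ := hu
      -- It must be shown that some rank finds no obstruction in `K`. If `K` already has tree-depth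
      -- at most `h`, nothing is picked from it and rank `0` works; otherwise the rank of a root
      -- works.
      by_cases htdK : TdLe A h K
      · obtain ⟨w, hw, hwY⟩ := hbad 0 obstBound_pos
        have hsub : K ⊆ Da 0 := by
          intro x hx
          refine Finset.mem_sdiff.2 ⟨comp_subset hx, fun hx' => ?_⟩
          have : x ∈ X ∩ K := Finset.mem_inter.2 ⟨pick_subset hx', hx⟩
          rw [hX1 htdK] at this
          simp at this
        have hwK := hKc huK hw
        have hcomp : comp A (Da 0) w = K := by
          rw [comp_eq_of_subset (hDaD 0) (by rw [hKD hwK]; exact hsub) (comp_subset hwK), hKD hwK]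
        have := (ih (Da 0) (hcard 0) w (hsub hwK)).1 (by rw [hcomp]; exact htdK)
        have hw' : w ∈ obst A m h (Da 0) ∩ comp A (Da 0) w :=
          Finset.mem_inter.2 ⟨hwY, self_mem_comp (hsub hwK)⟩
        rw [this] at hw'
        simp at hw'
      · obtain ⟨r, hr, hrtd⟩ := TdLe.exists_root hA hv htd
        obtain ⟨a, ha, hpa⟩ := hpick r (hroot r hr hrtd htdK)
        obtain ⟨w, hw, hwY⟩ := hbad a ha
        have hwK := hKc huK hw
        have hwD : w ∈ Da a := hYD a hwY
        have := (ih (Da a) (hcard a) w hwD).1 (hrtd.mono fun x hx => by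
          have hxK := hDaK a w hwD hwK hx
          refine Finset.mem_erase.2 ⟨fun hxr => ?_, hxK⟩
          exact (Finset.mem_sdiff.1 (comp_subset hx)).2 ((hpa x hxK).2 hxr))
        have hw' : w ∈ obst A m h (Da a) ∩ comp A (Da a) w :=
          Finset.mem_inter.2 ⟨hwY, self_mem_comp hwD⟩
        rw [this] at hw'
        simp at hw'
    · have htdK : ¬ TdLe A h K := fun h' => htd h'.succ
      have hexY : ∀ a, ∀ u ∈ Da a, u ∈ K → ¬ TdLe A h (comp A (Da a) u) → ∃ w ∈ K, w ∈ Y a := by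
        intro a u hu huK hn
        have := (ih (Da a) (hcard a) u hu).2.1 hn
        by_contra! hcon
        refine this ?_
        rw [Finset.eq_empty_of_forall_notMem (s := obst A m h (Da a) ∩ comp A (Da a) u)]
        · exact tdLe_empty h
        · intro x hx
          rw [Finset.mem_inter] at hx
          exact hcon x (hDaK a u hu huK hx.2) hx.1
      -- Each rank removes at most one vertex from `K`; since no vertex is a root, what remains has
      -- tree-depth more than `h` and the recursive call finds an obstruction in it.
      have hbad : ∀ a, ∃ w ∈ K, w ∈ Y a := by
        intro a
        by_cases hp : ∃ r ∈ K, r ∈ pick A D X a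
        · obtain ⟨r, hrK, hrp⟩ := hp
          obtain ⟨a', -, ha'⟩ := hpick r (Finset.mem_inter.2 ⟨pick_subset hrp, hrK⟩)
          have haa : a = a' := by
            have h1 := (mem_pick.1 hrp).2
            have h2 := (mem_pick.1 ((ha' r hrK).2 rfl)).2
            exact h1.symm.trans h2
          subst haa
          have hsub : K.erase r ⊆ Da a := by
            intro x hx
            rw [Finset.mem_erase] at hx
            exact Finset.mem_sdiff.2 ⟨comp_subset hx.2, fun hx' => hx.1 ((ha' x hx.2).1 hx')⟩
          have hn : ¬ TdLe A h (K.erase r) := fun h' => htd (tdLe_of_root hA hrK h')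
          rw [tdLe_iff_comp hA] at hn
          push Not at hn
          obtain ⟨u, hu, hun⟩ := hn
          exact hexY a u (hsub hu) (Finset.mem_of_mem_erase hu) fun h' => hun (h'.mono (comp_mono hsub))
        · push Not at hp
          have hsub : K ⊆ Da a := fun x hx =>
            Finset.mem_sdiff.2 ⟨comp_subset hx, hp x hx⟩
          have hvK : v ∈ K := self_mem_comp hv
          refine hexY a v (hsub hvK) hvK ?_
          rw [comp_eq_of_subset (hDaD a) hsub hv]
          exact htdK
      rcases s2 with ⟨s2, -⟩ | s2
      · intro hcon
        set C := clos A D (gens A (h + 1) D (cand A m h D)) m with hC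
        have hcandK : ∀ x ∈ K, (x ∈ X ∨ ∃ a < obstBound h, x ∈ sel A D (Da a) (Y a)) → x ∈ C := by
          intro x hx hx'
          refine s2 (Finset.mem_inter.2 ⟨mem_cand.2 ⟨comp_subset hx, hx', fun a _ => ?_⟩, hx⟩)
          obtain ⟨w, hw, hwY⟩ := hbad a
          exact ⟨w, ((mem_comp.1 hx).symm hA).trans (mem_comp.1 hw), hwY⟩
        have hXC : X ∩ K ⊆ C ∩ K := fun x hx => by
          rw [Finset.mem_inter] at hx ⊢
          exact ⟨hcandK x hx.2 (.inl hx.1), hx.2⟩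
        have hXn := hX2 htdK
        obtain ⟨x, hx⟩ : (X ∩ K).Nonempty := by
          rw [Finset.nonempty_iff_ne_empty]
          intro h0
          rw [h0] at hXn
          exact hXn (tdLe_empty h)
        have hxC := hXC hx
        obtain ⟨r, hr, hrtd⟩ := hcon x hxC
        -- The closure made the obstruction connected. A bound `h + 1` for its tree-depth would
        -- therefore provide one root for all of it.
        have hcc : comp A (C ∩ K) x = C ∩ K := by
          refine comp_subset.antisymm fun y hy => mem_comp.2 ?_
          have hx' := Finset.mem_inter.1 hxC
          have hy' := Finset.mem_inter.1 hy
          exact conn_clos hA gens_subset hm hx'.1 hy'.1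
            (((mem_comp.1 hx'.2).symm hA).trans (mem_comp.1 hy'.2)) (by rw [hKD hx'.2])
        rw [hcc] at hr hrtd
        -- A root in `X` has a rank, and the piece selected from the result for that rank avoids it
        -- and has tree-depth more than `h`. A root outside `X` is refuted by `X` itself.
        by_cases hrX : r ∈ X
        · have hrK := (Finset.mem_inter.1 hr).2
          obtain ⟨a, ha, hpa⟩ := hpick r (Finset.mem_inter.2 ⟨hrX, hrK⟩)
          obtain ⟨w₀, hw₀, hmin⟩ := (Y a ∩ K).exists_min_image id (by
            obtain ⟨w, hw, hwY⟩ := hbad a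
            exact ⟨w, Finset.mem_inter.2 ⟨hwY, hw⟩⟩)
          rw [Finset.mem_inter] at hw₀
          obtain ⟨g1, g2, -⟩ := ih (Da a) (hcard a) w₀ (hYD a hw₀.1)
          have hne : ¬ TdLe A h (comp A (Da a) w₀) := by
            intro h'
            have h3 : w₀ ∈ obst A m h (Da a) ∩ comp A (Da a) w₀ :=
              Finset.mem_inter.2 ⟨hw₀.1, self_mem_comp (hYD a hw₀.1)⟩
            rw [g1 h'] at h3
            simp at h3
          refine g2 hne (hrtd.mono fun y hy => ?_)
          rw [Finset.mem_inter] at hy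
          have hyK : y ∈ K := hDaK a w₀ (hYD a hw₀.1) hw₀.2 hy.2
          have hyD : y ∈ Da a := comp_subset hy.2
          refine Finset.mem_erase.2 ⟨?_, Finset.mem_inter.2 ⟨hcandK y hyK (.inr ⟨a, ha, ?_⟩), hyK⟩⟩
          · rintro rfl
            exact (Finset.mem_sdiff.1 hyD).2 ((hpa y hyK).2 rfl)
          · refine mem_sel.2 ⟨hy.1, w₀, hw₀.1, (mem_comp.1 hy.2).symm hA, fun u hu hyu => ?_⟩
            exact hmin u (Finset.mem_inter.2 ⟨hu, hKc hyK hyu⟩)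
        · refine hXn (hrtd.mono fun y hy => Finset.mem_erase.2 ⟨?_, hXC hy⟩)
          rintro rfl
          exact hrX (Finset.mem_inter.1 hy).1
      · exact s2
    · refine (s3.trans ?_).trans (obstBound_succ h)
      -- After the deletion `K` may fall apart into many pieces with an obstruction each. Only the
      -- piece containing the least vertex of `Y a` in `K` is kept, so the bound of a single
      -- component applies.
      have hsel : ∀ a, (sel A D (Da a) (Y a) ∩ K).card ≤ obstBound h := by
        intro a
        by_cases hne : (Y a ∩ K).Nonempty
        · obtain ⟨w₀, hw₀, hmin⟩ := (Y a ∩ K).exists_min_image id hne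
          rw [Finset.mem_inter] at hw₀
          refine (Finset.card_le_card ?_).trans (ih (Da a) (hcard a) w₀ (hYD a hw₀.1)).2.2
          intro x hx
          rw [Finset.mem_inter, mem_sel] at hx
          obtain ⟨⟨hxY, w, hwY, hxw, hw⟩, hxK⟩ := hx
          have h1 : w ≤ w₀ := hw w₀ hw₀.1 (((mem_comp.1 hxK).symm hA).trans (mem_comp.1 hw₀.2))
          have h2 : w₀ ≤ w := hmin w (Finset.mem_inter.2 ⟨hwY, hKc hxK (hxw.mono (hDaD a))⟩)
          obtain rfl : w = w₀ := le_antisymm h1 h2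
          exact Finset.mem_inter.2 ⟨hxY, mem_comp.2 (hxw.symm hA)⟩
        · rw [Finset.not_nonempty_iff_eq_empty] at hne
          have : sel A D (Da a) (Y a) ∩ K ⊆ Y a ∩ K := fun x hx => by
            rw [Finset.mem_inter, mem_sel] at hx
            exact Finset.mem_inter.2 ⟨hx.1.1, hx.2⟩
          rw [hne] at this
          rw [Finset.subset_empty.1 this]
          simp
      have hsub : cand A m h D ∩ K ⊆ (X ∩ K) ∪
          (Finset.range (obstBound h)).biUnion fun a => sel A D (Da a) (Y a) ∩ K := by
        intro x hx
        rw [Finset.mem_inter, mem_cand] at hx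
        obtain ⟨⟨-, hx' | ⟨a, ha, hx'⟩, -⟩, hxK⟩ := hx
        · exact Finset.mem_union_left _ (Finset.mem_inter.2 ⟨hx', hxK⟩)
        · exact Finset.mem_union_right _ (Finset.mem_biUnion.2
            ⟨a, Finset.mem_range.2 ha, Finset.mem_inter.2 ⟨hx', hxK⟩⟩)
      gcongr
      refine (Finset.card_le_card hsub).trans ((Finset.card_union_le _ _).trans ?_)
      refine Nat.add_le_add hX3 (Finset.card_biUnion_le.trans ?_)
      refine (Finset.sum_le_card_nsmul _ _ _ fun a _ => hsel a).trans ?_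
      simp

/-- `obst` is empty exactly for sets of tree-depth at most `h`. -/
theorem obst_eq_empty (hA : Symmetric A) (hm : D.card ≤ m) : obst A m h D = ∅ ↔ TdLe A h D := by
  rw [tdLe_iff_comp hA]
  constructor
  · intro h0 v hv
    by_contra hn
    have := (obst_spec hA h D hm v hv).2.1 hn
    rw [h0, Finset.empty_inter] at this
    exact this (tdLe_empty h)
  · intro hall
    refine Finset.eq_empty_of_forall_notMem fun v hv => ?_
    have hvD := obst_subset hA hv
    have := (obst_spec hA h D hm v hvD).1 (hall v hvD)
    have h1 : v ∈ obst A m h D ∩ comp A D v := Finset.mem_inter.2 ⟨hv, self_mem_comp hvD⟩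
    rw [this] at h1
    simp at h1

end Obstruction

/-! ### Partial Vandermonde determinants -/

section Vandermonde

/-- The sign of the column `a` in the set of columns `S`. -/
def colSign (S : Finset ℕ) (a : ℕ) : ℤ := (-1) ^ (S.filter (a < ·)).card

/-- The minor of a Vandermonde matrix with columns `S` and rows given by a list of numbers, by
expansion along the first row. -/
def vand : List ℕ → Finset ℕ → ℤ
  | [], S => if S = ∅ then 1 else 0
  | y :: w, S => ∑ a ∈ S, colSign S a * (y : ℤ) ^ a * vand w (S.erase a)

theorem colSign_erase_lt {S : Finset ℕ} {a b : ℕ} (hab : a < b) :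
    colSign (S.erase a) b = colSign S b := by
  unfold colSign
  congr 2
  ext x
  simp only [Finset.mem_filter, Finset.mem_erase]
  constructor
  · rintro ⟨⟨_, h⟩, h'⟩; exact ⟨h, h'⟩
  · rintro ⟨h, h'⟩; exact ⟨⟨by omega, h⟩, h'⟩

theorem colSign_erase_gt {S : Finset ℕ} {a b : ℕ} (hab : a < b) (hb : b ∈ S) :
    colSign (S.erase b) a = - colSign S a := by
  unfold colSign
  have h1 : S.filter (a < ·) = insert b ((S.erase b).filter (a < ·)) := by
    ext x
    simp only [Finset.mem_filter, Finset.mem_erase, Finset.mem_insert]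
    constructor
    · rintro ⟨h, h'⟩
      by_cases hx : x = b
      · exact .inl hx
      · exact .inr ⟨⟨hx, h⟩, h'⟩
    · rintro (rfl | ⟨⟨_, h⟩, h'⟩)
      · exact ⟨hb, hab⟩
      · exact ⟨h, h'⟩
  rw [h1, Finset.card_insert_of_notMem (by simp), pow_succ]
  simp

/-- Expand along both rows and exchange the two columns chosen. Removing a smaller column does not
affect the sign of the other one while removing a larger column flips it, so exactly one of the two
orders gains a sign. -/
theorem vand_swap (y z : ℕ) (w : List ℕ) (S : Finset ℕ) :
    vand (y :: z :: w) S = - vand (z :: y :: w) S := by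
  have h : ∀ y z : ℕ, vand (y :: z :: w) S = ∑ p ∈ (S ×ˢ S).filter (fun p => p.1 ≠ p.2),
      colSign S p.1 * colSign (S.erase p.1) p.2 * (y : ℤ) ^ p.1 * (z : ℤ) ^ p.2 *
        vand w ((S.erase p.1).erase p.2) := by
    intro y z
    rw [Finset.sum_filter, Finset.sum_product]
    simp only [vand]
    refine Finset.sum_congr rfl fun a ha => ?_
    rw [← Finset.sum_filter, Finset.mul_sum]
    refine Finset.sum_congr ?_ fun b _ => by ring
    ext b
    simp only [Finset.mem_erase, Finset.mem_filter]
    tauto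
  rw [h, h, ← Finset.sum_neg_distrib]
  refine Finset.sum_nbij' Prod.swap Prod.swap ?_ ?_ (fun _ _ => rfl) (fun _ _ => rfl) ?_
  · simp only [Finset.mem_filter, Finset.mem_product, Prod.fst_swap, Prod.snd_swap]
    exact fun p hp => ⟨⟨hp.1.2, hp.1.1⟩, hp.2.symm⟩
  · simp only [Finset.mem_filter, Finset.mem_product, Prod.fst_swap, Prod.snd_swap]
    exact fun p hp => ⟨⟨hp.1.2, hp.1.1⟩, hp.2.symm⟩
  · rintro ⟨a, b⟩ hp
    simp only [Finset.mem_filter, Finset.mem_product] at hp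
    simp only [Prod.fst_swap, Prod.snd_swap, Finset.erase_right_comm (s := S) (a := a) (b := b)]
    rcases lt_or_gt_of_ne hp.2 with h | h
    · rw [colSign_erase_lt h, colSign_erase_gt h hp.1.2]; ring
    · rw [colSign_erase_lt h, colSign_erase_gt h hp.1.1]; ring

theorem vand_perm {w w' : List ℕ} (h : w.Perm w') :
    ∃ e : ℤ, e ≠ 0 ∧ ∀ S, vand w' S = e * vand w S := by
  induction h with
  | nil => exact ⟨1, one_ne_zero, by simp⟩
  | cons x _ ih =>
    obtain ⟨e, he, h⟩ := ih
    refine ⟨e, he, fun S => ?_⟩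
    simp only [vand, h, Finset.mul_sum]
    exact Finset.sum_congr rfl fun a _ => by ring
  | swap x y l => exact ⟨-1, by simp, fun S => by rw [vand_swap]; ring⟩
  | trans _ _ ih ih' =>
    obtain ⟨e, he, h⟩ := ih
    obtain ⟨e', he', h'⟩ := ih'
    exact ⟨e' * e, mul_ne_zero he' he, fun S => by rw [h', h]; ring⟩

/-- Move the repeated entry to the front; exchanging the two equal rows changes the sign, hence the
value is zero. -/
theorem vand_cons_of_mem {y : ℕ} {w : List ℕ} (h : y ∈ w) (S : Finset ℕ) : vand (y :: w) S = 0 := by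
  obtain ⟨e, he, hp⟩ := vand_perm ((List.perm_cons_erase h).symm.cons y)
  have h0 := vand_swap y y (w.erase y) S
  rw [hp, show vand (y :: y :: w.erase y) S = 0 by omega, mul_zero]

theorem vand_of_not_nodup {w : List ℕ} (h : ¬ w.Nodup) (S : Finset ℕ) : vand w S = 0 := by
  induction w generalizing S with
  | nil => simp at h
  | cons y w ih =>
    by_cases hy : y ∈ w
    · exact vand_cons_of_mem hy S
    · have hw : ¬ w.Nodup := fun hw => h (List.nodup_cons.2 ⟨hy, hw⟩)
      simp [vand, ih hw]

/-- As a function of its first row the minor is a polynomial of degree at most `i`, the length of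
`w`, vanishing at the `i` entries of `w`. If it vanished at `y` as well it would be zero,
contradicting that its leading coefficient is non-zero by induction. -/
theorem vand_ne_zero {w : List ℕ} (h : w.Nodup) : vand w (Finset.range w.length) ≠ 0 := by
  induction w with
  | nil => simp [vand]
  | cons y w ih =>
    rw [List.nodup_cons] at h
    intro h0
    set i := w.length with hi
    let P : Polynomial ℤ := ∑ a ∈ Finset.range (i + 1),
      Polynomial.C (colSign (Finset.range (i + 1)) a * vand w ((Finset.range (i + 1)).erase a)) *
        Polynomial.X ^ a
    have heval : ∀ z : ℕ, P.eval (z : ℤ) = vand (z :: w) (Finset.range (i + 1)) := by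
      intro z
      simp only [P, Polynomial.eval_finsetSum, vand]
      exact Finset.sum_congr rfl fun a _ => by simp; ring
    -- The last column has no larger ones to its right, so it carries the sign `+1`.
    have hcoeff : P.coeff i = vand w (Finset.range i) := by
      simp only [P, Polynomial.finsetSum_coeff, Polynomial.coeff_C_mul, Polynomial.coeff_X_pow]
      rw [Finset.sum_eq_single i]
      · have h1 : (Finset.range (i + 1)).filter (i < ·) = ∅ := by
          ext x; simp
        have h2 : (Finset.range (i + 1)).erase i = Finset.range i := by
          ext x; simp; omega
        simp [colSign, h1, h2]
      · intro b _ hb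
        simp [hb.symm]
      · intro h; simp at h
    have hdeg : P.natDegree < i + 1 := by
      refine Nat.lt_succ_of_le (Polynomial.natDegree_sum_le_of_forall_le _ _ fun a ha => ?_)
      exact (Polynomial.natDegree_C_mul_X_pow_le _ _).trans (by simp at ha; omega)
    have hP : P = 0 := by
      refine Polynomial.eq_zero_of_natDegree_lt_card_of_eval_eq_zero' P
        ((y :: w).toFinset.image ((↑) : ℕ → ℤ)) ?_ ?_
      · intro r hr
        obtain ⟨z, hz, rfl⟩ := Finset.mem_image.1 hr
        rw [heval]
        simp only [List.toFinset_cons, Finset.mem_insert, List.mem_toFinset] at hz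
        rcases hz with rfl | hz
        · exact h0
        · exact vand_cons_of_mem hz _
      · rw [Finset.card_image_of_injective _ Nat.cast_injective,
          List.toFinset_card_of_nodup (List.nodup_cons.2 h)]
        simpa using hdeg
    rw [hP] at hcoeff
    exact ih h.2 (by rw [← hcoeff]; simp)

end Vandermonde

/-! ### Words that describe packings -/

/-- The data for the search of packings: the number `n` of vertices, adjacency, pairs of ends at which
a path may stop (or `n, n` before the first path), admissible vertices, and restrictions on the letter
at each position. -/
structure WordSpec where
  n : ℕ
  bd : ℕ
  adj : ℕ → ℕ → Prop
  acc : ℕ → ℕ → Prop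
  act : ℕ → Prop
  pref : ℕ → Bool → ℕ → Prop

namespace WordSpec

variable (W : WordSpec)

open Classical in
/-- All words (last letter first) of length `i` that describe `k` paths, the last of which starts in
`s` and currently ends in `x`. The letter `(true, y)` starts a new path in `y`, the letter `(false, y)`
continues the current path to `y`. -/
noncomputable def words : ℕ → ℕ → ℕ → ℕ → List (List (Bool × ℕ))
  | 0, k, s, x => if k = 0 ∧ s = W.n ∧ x = W.n then [[]] else []
  | i + 1, k, s, y => if y < W.n ∧ W.act y then
      (if W.pref i false y then (List.range W.bd).flatMap fun x =>
        if W.adj x y then (words i k s x).map ((false, y) :: ·) else [] else []) ++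
      (if s = y ∧ 1 ≤ k ∧ W.pref i true y then (List.range W.bd).flatMap fun s' =>
        (List.range W.bd).flatMap fun x =>
          if W.acc s' x then (words i (k - 1) s' x).map ((true, y) :: ·) else [] else [])
    else []

/-- The weight of a list of words. -/
def weight (S S' : Finset ℕ) (L : List (List (Bool × ℕ))) : ℤ :=
  (L.map fun w => vand (w.map Prod.snd) S * vand (w.map Prod.snd) S').sum

variable {S S' : Finset ℕ}

@[simp] theorem weight_nil : weight S S' [] = 0 := rfl

theorem weight_append (L L' : List (List (Bool × ℕ))) :
    weight S S' (L ++ L') = weight S S' L + weight S S' L' := by simp [weight]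

theorem weight_flatMap (m : ℕ) (f : ℕ → List (List (Bool × ℕ))) :
    weight S S' ((List.range m).flatMap f) = ∑ x ∈ Finset.range m, weight S S' (f x) := by
  induction m with
  | zero => rfl
  | succ m ih =>
    rw [List.range_succ, List.flatMap_append, weight_append, ih, Finset.sum_range_succ]
    simp

/-- Both determinants are expanded along the row of the new letter; the double sum over the removed
columns is bilinear, so the words behind it only enter through their weight. -/
theorem weight_cons (f : Bool) (y : ℕ) (L : List (List (Bool × ℕ))) :
    weight S S' (L.map ((f, y) :: ·)) = ∑ a ∈ S, ∑ b ∈ S',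
      colSign S a * colSign S' b * (y : ℤ) ^ (a + b) * weight (S.erase a) (S'.erase b) L := by
  induction L with
  | nil => simp
  | cons w L ih =>
    have h : ∀ (T T' : Finset ℕ) w L, weight T T' (w :: L) =
        vand (w.map Prod.snd) T * vand (w.map Prod.snd) T' + weight T T' L := fun _ _ _ _ => rfl
    rw [List.map_cons, h, ih]
    simp only [h, mul_add, Finset.sum_add_distrib, List.map_cons, vand]
    congr 1
    rw [Finset.sum_mul_sum]
    refine Finset.sum_congr rfl fun a _ => Finset.sum_congr rfl fun b _ => ?_
    rw [pow_add]; ring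

-- This recursion no longer mentions individual words: exponentially many of them are summarised by
-- numbers indexed by two column sets and the state of the last path.
open Classical in
theorem weight_words_succ (i k s y : ℕ) :
    weight S S' (W.words (i + 1) k s y) = if y < W.n ∧ W.act y then
      ∑ a ∈ S, ∑ b ∈ S', colSign S a * colSign S' b * (y : ℤ) ^ (a + b) *
        ((if W.pref i false y then ∑ x ∈ Finset.range W.bd,
          if W.adj x y then weight (S.erase a) (S'.erase b) (W.words i k s x) else 0 else 0) +
        (if s = y ∧ 1 ≤ k ∧ W.pref i true y then ∑ s' ∈ Finset.range W.bd, ∑ x ∈ Finset.range W.bd,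
          if W.acc s' x then weight (S.erase a) (S'.erase b) (W.words i (k - 1) s' x) else 0 else 0))
      else 0 := by
  have hmap : ∀ (f : Bool) (L : List (List (Bool × ℕ))) (p : Prop), weight S S'
      (if p then L.map ((f, y) :: ·) else []) = ∑ a ∈ S, ∑ b ∈ S',
      colSign S a * colSign S' b * (y : ℤ) ^ (a + b) *
        if p then weight (S.erase a) (S'.erase b) L else 0 := by
    intro f L p
    split_ifs
    · exact weight_cons f y L
    · simp
  rw [words]
  split_ifs with h1 h2 h3 h3 <;>
    simp only [weight_append, weight_flatMap, hmap, weight_nil, add_zero, zero_add, mul_add,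
      Finset.sum_add_distrib, Finset.mul_sum]
  · congr 1
    · rw [Finset.sum_comm]
      refine Finset.sum_congr rfl fun a _ => Finset.sum_comm
    · have : ∀ s' ∈ Finset.range W.bd, (∑ x ∈ Finset.range W.bd, ∑ a ∈ S, ∑ b ∈ S',
          colSign S a * colSign S' b * (y : ℤ) ^ (a + b) *
            if W.acc s' x then weight (S.erase a) (S'.erase b) (W.words i (k - 1) s' x) else 0) =
          ∑ a ∈ S, ∑ b ∈ S', ∑ x ∈ Finset.range W.bd,
          colSign S a * colSign S' b * (y : ℤ) ^ (a + b) *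
            if W.acc s' x then weight (S.erase a) (S'.erase b) (W.words i (k - 1) s' x) else 0 := by
        intro s' _
        rw [Finset.sum_comm]
        refine Finset.sum_congr rfl fun a _ => Finset.sum_comm
      rw [Finset.sum_congr rfl this, Finset.sum_comm]
      refine Finset.sum_congr rfl fun a _ => Finset.sum_comm
  · rw [Finset.sum_comm]
    refine Finset.sum_congr rfl fun a _ => Finset.sum_comm
  · have : ∀ s' ∈ Finset.range W.bd, (∑ x ∈ Finset.range W.bd, ∑ a ∈ S, ∑ b ∈ S',
        colSign S a * colSign S' b * (y : ℤ) ^ (a + b) *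
          if W.acc s' x then weight (S.erase a) (S'.erase b) (W.words i (k - 1) s' x) else 0) =
        ∑ a ∈ S, ∑ b ∈ S', ∑ x ∈ Finset.range W.bd,
        colSign S a * colSign S' b * (y : ℤ) ^ (a + b) *
          if W.acc s' x then weight (S.erase a) (S'.erase b) (W.words i (k - 1) s' x) else 0 := by
      intro s' _
      rw [Finset.sum_comm]
      refine Finset.sum_congr rfl fun a _ => Finset.sum_comm
    rw [Finset.sum_congr rfl this, Finset.sum_comm]
    refine Finset.sum_congr rfl fun a _ => Finset.sum_comm
  · simp

variable {W} in
theorem mem_words_zero {k s x : ℕ} {w : List (Bool × ℕ)} :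
    w ∈ W.words 0 k s x ↔ w = [] ∧ k = 0 ∧ s = W.n ∧ x = W.n := by
  rw [words]
  split_ifs with h
  · simp [h]
  · simp [h]

variable {W} in
theorem mem_words_succ {i k s y : ℕ} {w : List (Bool × ℕ)} :
    w ∈ W.words (i + 1) k s y ↔ (y < W.n ∧ W.act y) ∧
      ((W.pref i false y ∧ ∃ x < W.bd, W.adj x y ∧ ∃ w' ∈ W.words i k s x, w = (false, y) :: w') ∨
        ((s = y ∧ 1 ≤ k ∧ W.pref i true y) ∧ ∃ s' < W.bd, ∃ x < W.bd, W.acc s' x ∧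
          ∃ w' ∈ W.words i (k - 1) s' x, w = (true, y) :: w')) := by
  have hif : ∀ (f : Bool) (L : List (List (Bool × ℕ))) (p : Prop) [Decidable p],
      w ∈ (if p then L.map ((f, y) :: ·) else []) ↔ p ∧ ∃ w' ∈ L, w = (f, y) :: w' := by
    intro f L p _
    split_ifs with h
    · simp [h, eq_comm]
    · simp [h]
  have hif' : ∀ (L : List (List (Bool × ℕ))) (p : Prop) [Decidable p],
      w ∈ (if p then L else []) ↔ p ∧ w ∈ L := by
    intro L p _
    split_ifs with h <;> simp [h]
  rw [words]
  simp only [hif, hif', List.mem_append, List.mem_flatMap, List.mem_range]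

theorem length_of_mem_words {i k s x : ℕ} {w : List (Bool × ℕ)} (h : w ∈ W.words i k s x) :
    w.length = i := by
  induction i generalizing k s x w with
  | zero => simp [(mem_words_zero.1 h).1]
  | succ i ih =>
    rcases (mem_words_succ.1 h).2 with ⟨-, x, -, -, w', hw', rfl⟩ | ⟨-, s', -, x, -, -, w', hw', rfl⟩ <;>
      simp [ih hw']

/-- The weight of the words for the full set of columns tells whether one of them has distinct
vertices. -/
theorem weight_ne_zero_iff {i k s x : ℕ} :
    weight (Finset.range i) (Finset.range i) (W.words i k s x) ≠ 0 ↔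
      ∃ w ∈ W.words i k s x, (w.map Prod.snd).Nodup := by
  -- Every summand is a square, so the sum vanishes only if each term does.
  have key : ∀ L : List (List (Bool × ℕ)), (∀ w ∈ L, w.length = i) →
      0 ≤ weight (Finset.range i) (Finset.range i) L ∧
      (weight (Finset.range i) (Finset.range i) L ≠ 0 ↔ ∃ w ∈ L, (w.map Prod.snd).Nodup) := by
    intro L
    induction L with
    | nil => simp
    | cons w L ih =>
      intro hL
      obtain ⟨h0, h1⟩ := ih fun w hw => hL w (by simp [hw])
      have h : weight (Finset.range i) (Finset.range i) (w :: L) =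
        vand (w.map Prod.snd) (Finset.range i) * vand (w.map Prod.snd) (Finset.range i) +
          weight (Finset.range i) (Finset.range i) L := rfl
      rw [h]
      have hsq := mul_self_nonneg (vand (w.map Prod.snd) (Finset.range i))
      refine ⟨by omega, ?_⟩
      simp only [List.mem_cons, exists_eq_or_imp]
      by_cases hw : (w.map Prod.snd).Nodup
      · have := vand_ne_zero hw
        rw [List.length_map, hL w (by simp)] at this
        have := mul_self_pos.2 this
        simp only [hw, true_or, iff_true]
        omega
      · rw [vand_of_not_nodup hw]
        simp only [mul_zero, zero_add, hw, false_or]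
        exact h1
  exact (key _ fun w hw => W.length_of_mem_words hw).2

end WordSpec

/-! ### Packings of paths -/

/-- `P` is a list of disjoint paths in `D` of the graph `A` whose ends are related by `dem`. -/
structure IsPacking (A dem : ℕ → ℕ → Prop) (D : Finset ℕ) (P : List (List ℕ)) : Prop where
  chain : ∀ l ∈ P, l.IsChain A
  ends : ∀ l ∈ P, ∃ s x, l.getLast? = some s ∧ l.head? = some x ∧ dem s x
  nodup : P.flatten.Nodup
  mem : ∀ x ∈ P.flatten, x ∈ D

/-- The maximum number of paths of a packing in `D`. -/
noncomputable def maxPacking (A dem : ℕ → ℕ → Prop) (D : Finset ℕ) : ℕ :=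
  sSup {k | ∃ P, IsPacking A dem D P ∧ P.length = k}

section Packing

variable {A dem : ℕ → ℕ → Prop} {D D' K : Finset ℕ} {P P' : List (List ℕ)}

namespace IsPacking

theorem ne_nil (h : IsPacking A dem D P) {l : List ℕ} (hl : l ∈ P) : l ≠ [] := by
  obtain ⟨s, x, -, hx, -⟩ := h.ends l hl
  rintro rfl
  simp at hx

theorem nil : IsPacking A dem D [] := ⟨by simp, by simp, by simp, by simp⟩

theorem flatten_length_le (h : IsPacking A dem D P) : P.flatten.length ≤ D.card := by
  rw [← List.toFinset_card_of_nodup h.nodup]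
  exact Finset.card_le_card fun x hx => h.mem x (by simpa using hx)

theorem length_le_flatten (h : IsPacking A dem D P) : P.length ≤ P.flatten.length := by
  rw [List.length_flatten]
  have hpos : ∀ x ∈ P.map List.length, 1 ≤ x := by
    intro x hx
    obtain ⟨l, hl, rfl⟩ := List.mem_map.1 hx
    exact List.length_pos_iff.2 (h.ne_nil hl)
  simpa using List.card_nsmul_le_sum (P.map List.length) 1 hpos

theorem mono (h : IsPacking A dem D P) (hD : D ⊆ D') : IsPacking A dem D' P :=
  ⟨h.chain, h.ends, h.nodup, fun x hx => hD (h.mem x hx)⟩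

theorem sublist (h : IsPacking A dem D P) (hP : P'.Sublist P) : IsPacking A dem D P' :=
  ⟨fun l hl => h.chain l (hP.subset hl), fun l hl => h.ends l (hP.subset hl),
    h.nodup.sublist hP.flatten, fun x hx => h.mem x (hP.flatten.subset hx)⟩

theorem perm (h : IsPacking A dem D P) (hP : P'.Perm P) : IsPacking A dem D P' :=
  ⟨fun l hl => h.chain l (hP.subset hl), fun l hl => h.ends l (hP.subset hl),
    hP.flatten.nodup_iff.2 h.nodup, fun x hx => h.mem x (hP.flatten.subset hx)⟩

theorem append (h : IsPacking A dem D P) (h' : IsPacking A dem D' P') (hD : Disjoint D D') :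
    IsPacking A dem (D ∪ D') (P ++ P') where
  chain l hl := by
    rcases List.mem_append.1 hl with hl | hl
    · exact h.chain l hl
    · exact h'.chain l hl
  ends l hl := by
    rcases List.mem_append.1 hl with hl | hl
    · exact h.ends l hl
    · exact h'.ends l hl
  nodup := by
    rw [List.flatten_append]
    exact h.nodup.append h'.nodup fun x hx hx' =>
      Finset.disjoint_left.1 hD (h.mem x hx) (h'.mem x hx')
  mem x hx := by
    rw [List.flatten_append, List.mem_append] at hx
    exact Finset.mem_union.2 (hx.imp (h.mem x) (h'.mem x))

theorem mem_le (h : IsPacking A dem D P) : P.length ≤ maxPacking A dem D :=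
  le_csSup ⟨D.card, by
    rintro k ⟨P, hP, rfl⟩
    exact hP.length_le_flatten.trans hP.flatten_length_le⟩ ⟨P, h, rfl⟩

theorem map_reverse (hA : Symmetric A) (hd : Symmetric dem) (h : IsPacking A dem D P) :
    IsPacking A dem D (P.map List.reverse).reverse := by
  have hp : (P.map List.reverse).reverse.flatten.Perm P.flatten := by
    refine (List.reverse_perm _).flatten.trans ?_
    clear h
    induction P with
    | nil => simp
    | cons l P ih => simpa using (List.reverse_perm l).append ih
  refine ⟨?_, ?_, hp.nodup_iff.2 h.nodup, fun x hx => h.mem x (hp.subset hx)⟩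
  · intro l hl
    obtain ⟨l', hl', rfl⟩ := List.mem_map.1 (List.mem_reverse.1 hl)
    rw [List.isChain_reverse]
    exact (h.chain l' hl').imp fun a b hab => hA hab
  · intro l hl
    obtain ⟨l', hl', rfl⟩ := List.mem_map.1 (List.mem_reverse.1 hl)
    obtain ⟨s, x, hs, hx, hsx⟩ := h.ends l' hl'
    exact ⟨x, s, by simpa using hx, by simpa using hs, hd hsx⟩

end IsPacking

theorem exists_maxPacking (A dem : ℕ → ℕ → Prop) (D : Finset ℕ) :
    ∃ P, IsPacking A dem D P ∧ P.length = maxPacking A dem D :=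
  Nat.sSup_mem (s := {k | ∃ P, IsPacking A dem D P ∧ P.length = k}) ⟨0, [], .nil, rfl⟩
    ⟨D.card, by
      rintro k ⟨P, hP, rfl⟩
      exact hP.length_le_flatten.trans hP.flatten_length_le⟩

theorem exists_packing_of_le {k : ℕ} (hk : k ≤ maxPacking A dem D) :
    ∃ P, IsPacking A dem D P ∧ P.length = k := by
  obtain ⟨P, hP, hl⟩ := exists_maxPacking A dem D
  exact ⟨P.take k, hP.sublist (List.take_sublist _ _), by simp [hl, hk]⟩

theorem maxPacking_mono (hD : D ⊆ D') : maxPacking A dem D ≤ maxPacking A dem D' := by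
  obtain ⟨P, hP, hl⟩ := exists_maxPacking A dem D
  exact hl ▸ (hP.mono hD).mem_le

theorem maxPacking_empty : maxPacking A dem ∅ = 0 := by
  obtain ⟨P, hP, hl⟩ := exists_maxPacking A dem ∅
  have := hP.length_le_flatten.trans hP.flatten_length_le
  simp at this
  simp [← hl, this]

/-- At most one path of a packing passes through `r`, and dropping it leaves a packing in the rest.
-/
theorem maxPacking_le_erase (r : ℕ) : maxPacking A dem D ≤ maxPacking A dem (D.erase r) + 1 := by
  obtain ⟨P, hP, hl⟩ := exists_maxPacking A dem D
  rw [← hl]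
  by_cases hr : r ∈ P.flatten
  · obtain ⟨l, hlP, hrl⟩ := List.mem_flatten.1 hr
    have hp : IsPacking A dem D (l :: P.erase l) := hP.perm (List.perm_cons_erase hlP).symm
    have h1 : IsPacking A dem (D.erase r) (P.erase l) := by
      have h2 := hp.sublist (List.sublist_cons_self l (P.erase l))
      refine ⟨h2.chain, h2.ends, h2.nodup, fun x hx => Finset.mem_erase.2 ⟨?_, h2.mem x hx⟩⟩
      rintro rfl
      have := hp.nodup
      rw [List.flatten_cons, List.nodup_append] at this
      exact this.2.2 x hrl x hx rfl
    have := h1.mem_le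
    rw [(List.perm_cons_erase hlP).length_eq]
    simp only [List.length_cons]
    omega
  · have h1 : IsPacking A dem (D.erase r) P := ⟨hP.chain, hP.ends, hP.nodup, fun x hx =>
      Finset.mem_erase.2 ⟨by rintro rfl; exact hr hx, hP.mem x hx⟩⟩
    exact h1.mem_le.trans (Nat.le_succ _)

theorem maxPacking_add_le (hD : Disjoint D D') :
    maxPacking A dem D + maxPacking A dem D' ≤ maxPacking A dem (D ∪ D') := by
  obtain ⟨P, hP, hl⟩ := exists_maxPacking A dem D
  obtain ⟨P', hP', hl'⟩ := exists_maxPacking A dem D'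
  simpa [hl, hl'] using (hP.append hP' hD).mem_le

/-- A path that starts in a closed part of the graph stays there. -/
theorem chain_mem_of_closed (hK : ∀ x ∈ K, ∀ y ∈ D, A x y → y ∈ K) {l : List ℕ} (hl : l.IsChain A)
    (hD : ∀ x ∈ l, x ∈ D) {z : ℕ} (hz : l.head? = some z) (hzK : z ∈ K) : ∀ x ∈ l, x ∈ K := by
  induction l generalizing z with
  | nil => simp
  | cons a l ih =>
    simp only [List.head?_cons, Option.some.injEq] at hz
    subst hz
    cases l with
    | nil => simpa using hzK
    | cons b l =>
      rw [List.isChain_cons_cons] at hl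
      have := ih hl.2 (fun x hx => hD x (by simp [hx])) rfl (hK a hzK b (hD b (by simp)) hl.1)
      intro x hx
      rcases List.mem_cons.1 hx with rfl | hx
      · exact hzK
      · exact this x hx

/-- No edge of `D` leaves `K`, so every path lies entirely inside or outside, depending on where its
first list entry lies. -/
theorem maxPacking_le_add (hA : Symmetric A) (hKD : K ⊆ D)
    (hK : ∀ x ∈ K, ∀ y ∈ D, A x y → y ∈ K) :
    maxPacking A dem D ≤ maxPacking A dem K + maxPacking A dem (D \ K) := by
  classical
  obtain ⟨P, hP, hl⟩ := exists_maxPacking A dem D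
  let p : List ℕ → Bool := fun l => decide (∃ z ∈ K, l.head? = some z)
  have h1 : IsPacking A dem K (P.filter p) := by
    have h := hP.sublist (List.filter_sublist (p := p))
    refine ⟨h.chain, h.ends, h.nodup, fun x hx => ?_⟩
    obtain ⟨l, hlP, hxl⟩ := List.mem_flatten.1 hx
    have hp := (List.mem_filter.1 hlP).2
    simp only [p, decide_eq_true_eq] at hp
    obtain ⟨z, hz, hlz⟩ := hp
    exact chain_mem_of_closed hK (h.chain l hlP)
      (fun x hx => h.mem x (List.mem_flatten.2 ⟨l, hlP, hx⟩)) hlz hz x hxl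
  have h2 : IsPacking A dem (D \ K) (P.filter (fun l => !p l)) := by
    have h := hP.sublist (List.filter_sublist (p := fun l => !p l))
    refine ⟨h.chain, h.ends, h.nodup, fun x hx => ?_⟩
    obtain ⟨l, hlP, hxl⟩ := List.mem_flatten.1 hx
    have hp := (List.mem_filter.1 hlP).2
    simp only [p, Bool.not_eq_true', decide_eq_false_iff_not] at hp
    obtain ⟨s, z, -, hz, -⟩ := h.ends l hlP
    have hmem : ∀ x ∈ l, x ∈ D := fun x hx => h.mem x (List.mem_flatten.2 ⟨l, hlP, hx⟩)
    have hzl : z ∈ l := by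
      cases l with
      | nil => simp at hz
      | cons a l => simp at hz; simp [hz]
    refine chain_mem_of_closed (K := D \ K) (D := D) ?_ (h.chain l hlP) hmem hz ?_ x hxl
    · intro x hx y hy hxy
      rw [Finset.mem_sdiff] at hx ⊢
      exact ⟨hy, fun hyK => hx.2 (hK y hyK x hx.1 (hA hxy))⟩
    · exact Finset.mem_sdiff.2 ⟨hmem z hzl, fun hzK => hp ⟨z, hzK, hz⟩⟩
  have h3 := (List.filter_append_perm p P).length_eq
  rw [List.length_append] at h3
  have := h1.mem_le
  have := h2.mem_le
  omega

/-- In a component of small tree-depth, packings have few vertices. -/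
theorem IsPacking.flatten_le (hA : Symmetric A) (hP : IsPacking A dem D P) {h : ℕ}
    (hD : TdLe A h D) : P.flatten.length ≤ P.length * 2 ^ h := by
  rw [List.length_flatten]
  have hb : ∀ x ∈ P.map List.length, x ≤ 2 ^ h := by
    intro x hx
    obtain ⟨l, hl, rfl⟩ := List.mem_map.1 hx
    have hs : l.Sublist P.flatten := List.sublist_flatten_of_mem hl
    exact (TdLe.length_lt hA hD (hP.chain l hl) (hP.nodup.sublist hs)
      (fun x hx => hP.mem x (hs.subset hx))).le
  simpa using List.sum_le_card_nsmul _ _ hb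

end Packing

/-! ### Words and packings -/

/-- The paths that a word describes. -/
def decode : List (Bool × ℕ) → List (List ℕ)
  | [] => []
  | (true, y) :: w => [y] :: decode w
  | (false, y) :: w => match decode w with
    | [] => [[y]]
    | l :: P => (y :: l) :: P

theorem flatten_decode (w : List (Bool × ℕ)) : (decode w).flatten = w.map Prod.snd := by
  induction w with
  | nil => rfl
  | cons a w ih =>
    obtain ⟨f, y⟩ := a
    cases f
    · simp only [decode, List.map_cons]
      rw [← ih]
      cases decode w <;> simp
    · simp [decode, ih]

namespace WordSpec

variable {W : WordSpec} {dem : ℕ → ℕ → Prop}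

/-- The demand of the last path is not yet checked while it can still grow, but all earlier ones
were checked when the next path was started. The state `n, n` occurs only for the empty word: it has
no neighbours, so the first letter must start a path. -/
theorem decode_of_mem_words (hA : Symmetric W.adj)
    (hacc : ∀ s x, W.acc s x ↔ (s = W.n ∧ x = W.n) ∨ dem s x)
    (hdem : ∀ s x, dem s x → s < W.n ∧ x < W.n) (hadj : ∀ x y, W.adj x y → x < W.n)
    {i k s x : ℕ} {w : List (Bool × ℕ)} (hw : w ∈ W.words i k s x) :
    (∀ y ∈ w.map Prod.snd, y < W.n ∧ W.act y) ∧
    ((w = [] ∧ k = 0 ∧ s = W.n ∧ x = W.n) ∨ (x < W.n ∧ ∃ l P, decode w = l :: P ∧ l.head? = some x ∧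
      l.getLast? = some s ∧ l.IsChain W.adj ∧ (∀ l' ∈ P, l'.IsChain W.adj ∧
        ∃ s x, l'.getLast? = some s ∧ l'.head? = some x ∧ dem s x) ∧ P.length + 1 = k)) := by
  induction i generalizing k s x w with
  | zero =>
    have h := mem_words_zero.1 hw
    exact ⟨by simp [h.1], .inl h⟩
  | succ i ih =>
    obtain ⟨hy, h⟩ := mem_words_succ.1 hw
    rcases h with ⟨-, z, -, hzx, w', hw', rfl⟩ | ⟨⟨rfl, hk, -⟩, s', -, z, -, hacc', w', hw', rfl⟩
    · obtain ⟨h1, h2⟩ := ih hw'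
      refine ⟨by simpa [hy] using h1, .inr ⟨hy.1, ?_⟩⟩
      rcases h2 with ⟨-, -, -, rfl⟩ | ⟨-, l, P, hd, hh, hl, hc, hP, hk⟩
      · exact absurd (hadj _ _ hzx) (lt_irrefl _)
      · refine ⟨x :: l, P, by simp [decode, hd], rfl, ?_, ?_, hP, hk⟩
        · rw [List.getLast?_cons, hl]; rfl
        · cases l with
          | nil => simp
          | cons a l =>
            simp only [List.head?_cons, Option.some.injEq] at hh
            subst hh
            exact List.isChain_cons_cons.2 ⟨hA hzx, hc⟩
    · obtain ⟨h1, h2⟩ := ih hw'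
      refine ⟨by simpa [hy] using h1, .inr ⟨hy.1, [s], decode w', rfl, rfl, rfl, by simp, ?_⟩⟩
      rcases h2 with ⟨rfl, hk0, -, -⟩ | ⟨hz, l, P, hd, hh, hl, hc, hP, hk'⟩
      · simp [decode]; omega
      · rw [hd]
        have hds : dem s' z := by
          rcases (hacc _ _).1 hacc' with ⟨-, rfl⟩ | h
          · exact absurd hz (lt_irrefl _)
          · exact h
        refine ⟨?_, by simp; omega⟩
        intro l' hl'
        rcases List.mem_cons.1 hl' with rfl | hl'
        · exact ⟨hc, s', z, hl, hh, hds⟩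
        · exact hP l' hl'

/-- Accepted words with distinct vertices describe packings. -/
theorem isPacking_decode (hA : Symmetric W.adj)
    (hacc : ∀ s x, W.acc s x ↔ (s = W.n ∧ x = W.n) ∨ dem s x)
    (hdem : ∀ s x, dem s x → s < W.n ∧ x < W.n) (hadj : ∀ x y, W.adj x y → x < W.n)
    {i k s x : ℕ} {w : List (Bool × ℕ)} (hw : w ∈ W.words i k s x) (hsx : W.acc s x)
    (hnd : (w.map Prod.snd).Nodup) {D : Finset ℕ} (hD : ∀ y, y < W.n → W.act y → y ∈ D) :
    IsPacking W.adj dem D (decode w) ∧ (decode w).length = k := by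
  obtain ⟨h1, h2⟩ := decode_of_mem_words hA hacc hdem hadj hw
  have hn : (decode w).flatten.Nodup := by rwa [flatten_decode]
  have hm : ∀ x ∈ (decode w).flatten, x ∈ D := by
    rw [flatten_decode]
    exact fun x hx => hD x (h1 x hx).1 (h1 x hx).2
  rcases h2 with ⟨rfl, rfl, -, -⟩ | ⟨hx, l, P, hd, hh, hl, hc, hP, hk'⟩
  · exact ⟨.nil, rfl⟩
  · have hds : dem s x := by
      rcases (hacc _ _).1 hsx with ⟨-, rfl⟩ | h
      · exact absurd hx (lt_irrefl _)
      · exact h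
    refine ⟨⟨?_, ?_, hn, hm⟩, by rw [hd]; simpa using hk'⟩ <;> rw [hd] <;> intro l' hl' <;>
      rcases List.mem_cons.1 hl' with rfl | hl'
    · exact hc
    · exact (hP l' hl').1
    · exact ⟨s, x, hl, hh, hds⟩
    · exact (hP l' hl').2

/-- Packings are described by accepted words. -/
theorem exists_word_of_isPacking (hA : Symmetric W.adj)
    (hacc : ∀ s x, W.acc s x ↔ (s = W.n ∧ x = W.n) ∨ dem s x) (hbd : W.n < W.bd)
    (hpref : ∀ i f y, W.pref i f y)
    {D : Finset ℕ} (hD : ∀ y ∈ D, y < W.n ∧ W.act y) {P : List (List ℕ)}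
    (hP : IsPacking W.adj dem D P) :
    ∃ s < W.bd, ∃ x < W.bd, W.acc s x ∧ ∃ w ∈ W.words P.flatten.length P.length s x,
      (w.map Prod.snd).Nodup := by
  suffices h : ∃ s < W.bd, ∃ x < W.bd, W.acc s x ∧ ∃ w ∈ W.words P.flatten.length P.length s x,
      w.map Prod.snd = P.flatten by
    obtain ⟨s, hs, x, hx, ha, w, hw, h⟩ := h
    exact ⟨s, hs, x, hx, ha, w, hw, h ▸ hP.nodup⟩
  induction P with
  | nil => exact ⟨W.n, hbd, W.n, hbd, (hacc _ _).2 (.inl ⟨rfl, rfl⟩), [], mem_words_zero.2 (by simp), rfl⟩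
  | cons l P ih =>
    obtain ⟨s', hs', x', hx', ha', w', hw', h'⟩ := ih (hP.sublist (List.sublist_cons_self _ _))
    obtain ⟨s, x, hs, hx, hsx⟩ := hP.ends l (by simp)
    have hc := hP.chain l (by simp)
    have hm : ∀ y ∈ l, y < W.n ∧ W.act y := fun y hy => hD y (hP.mem y (by simp [hy]))
    -- The lists are stored from the end of a path backwards, so induction on `l` strips the newest
    -- letter; the last one left starts the path.
    have key : ∃ w ∈ W.words (l.length + P.flatten.length) (P.length + 1) s x,
        w.map Prod.snd = l ++ P.flatten := by
      clear hP hsx ih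
      induction l generalizing x with
      | nil => simp at hx
      | cons y l ih =>
        simp only [List.head?_cons, Option.some.injEq] at hx
        subst hx
        cases l with
        | nil =>
          simp only [List.getLast?_singleton, Option.some.injEq] at hs
          subst hs
          refine ⟨(true, y) :: w', ?_, by simp [h']⟩
          rw [List.length_singleton, add_comm 1]
          exact mem_words_succ.2 ⟨hm y (by simp), .inr ⟨⟨rfl, by omega, hpref _ _ _⟩, s', hs', x', hx',
            ha', w', hw', rfl⟩⟩
        | cons z l =>
          rw [List.isChain_cons_cons] at hc
          obtain ⟨w, hw, h⟩ := ih z (by rw [List.getLast?_cons_cons] at hs; exact hs) rfl hc.2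
            (fun y hy => hm y (by simp [hy]))
          refine ⟨(false, y) :: w, ?_, by simp [h]⟩
          rw [show (y :: z :: l).length + P.flatten.length =
            ((z :: l).length + P.flatten.length) + 1 by simp; omega]
          exact mem_words_succ.2 ⟨hm y (by simp), .inl ⟨hpref _ _ _, z, (hm z (by simp)).1.trans hbd,
            hA hc.1, w, hw, rfl⟩⟩
    obtain ⟨w, hw, h⟩ := key
    have hxl : x ∈ l := List.mem_of_mem_head? hx
    have hsl : s ∈ l := List.mem_of_getLast? hs
    exact ⟨s, (hm s hsl).1.trans hbd, x, (hm x hxl).1.trans hbd, (hacc _ _).2 (.inr hsx), w,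
      by simpa using hw, by simpa using h⟩

/-- The word `w` (last letter first) satisfies the restrictions `p`. -/
def Fits (p : ℕ → Bool → ℕ → Prop) (w : List (Bool × ℕ)) : Prop :=
  ∀ i f y, w.reverse[i]? = some (f, y) → p i f y

theorem fits_cons {p : ℕ → Bool → ℕ → Prop} {f : Bool} {y : ℕ} {w : List (Bool × ℕ)} :
    Fits p ((f, y) :: w) ↔ p w.length f y ∧ Fits p w := by
  constructor
  · intro h
    refine ⟨h _ _ _ (by simp), fun i g z hi => h i g z ?_⟩
    have hlt := (List.getElem?_eq_some_iff.1 hi).1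
    rw [List.reverse_cons, List.getElem?_append_left hlt, hi]
  · rintro ⟨h, h'⟩ i g z hi
    rw [List.reverse_cons] at hi
    rcases lt_trichotomy i w.length with hlt | rfl | hgt
    · rw [List.getElem?_append_left (by simpa using hlt)] at hi
      exact h' i g z hi
    · simp at hi
      rw [← hi.1, ← hi.2]; exact h
    · rw [List.getElem?_eq_none (by simp; omega)] at hi
      simp at hi

/-- The restrictions on letters can be separated. -/
theorem mem_words_iff_fits (W : WordSpec) {i k s x : ℕ} {w : List (Bool × ℕ)} :
    w ∈ W.words i k s x ↔
      w ∈ WordSpec.words { W with pref := fun _ _ _ => True } i k s x ∧ Fits W.pref w := by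
  induction i generalizing k s x w with
  | zero =>
    rw [mem_words_zero, mem_words_zero]
    refine ⟨fun h => ⟨h, ?_⟩, fun h => h.1⟩
    rw [h.1]; intro i f y hi; simp at hi
  | succ i ih =>
    rw [mem_words_succ, mem_words_succ]
    constructor
    · rintro ⟨hy, ⟨hp, z, hz, hzx, w', hw', rfl⟩ | ⟨⟨rfl, hk, hp⟩, s', hs', z, hz, ha, w', hw', rfl⟩⟩
      · have := ih.1 hw'
        refine ⟨⟨hy, .inl ⟨trivial, z, hz, hzx, w', this.1, rfl⟩⟩, fits_cons.2 ⟨?_, this.2⟩⟩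
        rwa [W.length_of_mem_words hw']
      · have := ih.1 hw'
        refine ⟨⟨hy, .inr ⟨⟨rfl, hk, trivial⟩, s', hs', z, hz, ha, w', this.1, rfl⟩⟩,
          fits_cons.2 ⟨?_, this.2⟩⟩
        rwa [W.length_of_mem_words hw']
    · rintro ⟨⟨hy, ⟨-, z, hz, hzx, w', hw', rfl⟩ | ⟨⟨rfl, hk, -⟩, s', hs', z, hz, ha, w', hw', rfl⟩⟩,
        hf⟩
      · have hf' := fits_cons.1 hf
        rw [length_of_mem_words _ hw'] at hf'
        exact ⟨hy, .inl ⟨hf'.1, z, hz, hzx, w', ih.2 ⟨hw', hf'.2⟩, rfl⟩⟩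
      · have hf' := fits_cons.1 hf
        rw [length_of_mem_words _ hw'] at hf'
        exact ⟨hy, .inr ⟨⟨rfl, hk, hf'.1⟩, s', hs', z, hz, ha, w', ih.2 ⟨hw', hf'.2⟩, rfl⟩⟩

end WordSpec

/-! ### Connectivity, distances and predecessors on the machine -/

/-- The adjacency relation on `0, …, n - 1` with matrix `a`. -/
def adjRel (n : ℕ) (a : ℕ → ℕ) (u v : ℕ) : Prop := u < n ∧ v < n ∧ a (u * n + v) ≠ 0

/-- The array represents the set, as far as numbers below `B` are concerned. -/
def Represents (B : ℕ) (a : ℕ → ℕ) (D : Finset ℕ) : Prop := ∀ v < B, a v ≠ 0 ↔ v ∈ D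

namespace BExpr

/-- Adjacency of two vertices, for the matrix in the array `k`. -/
def adjE (k : ℕ) (u v : BExpr) : BExpr :=
  and (and (lt u (var 0)) (lt v (var 0))) (get k (add (mul u (var 0)) v))

/-- An entry of a table with rows of the length of the bound. -/
def at2 (k : ℕ) (u v : BExpr) : BExpr := get k (add (mul (var 4) u) v)

variable {v : ℕ → ℕ} {m : ℕ → ℕ → ℕ}

theorem holds_adjE (k : ℕ) (a b : BExpr) (h : v 0 ≤ v 4) :
    (adjE k a b).holds v m ↔ adjRel (v 0) (m k) (a.eval v m) (b.eval v m) := by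
  simp only [adjE, holds_and, holds_lt, eval_var, holds_get, eval_add, eval_mul, adjRel, and_assoc]
  refine and_congr_right fun h1 => ?_
  rw [min_eq_left (h1.le.trans h)]

@[simp] theorem eval_at2 (k : ℕ) (a b : BExpr) :
    (at2 k a b).eval v m = m k (v 4 * a.eval v m + b.eval v m) := by simp [at2]

@[simp] theorem holds_at2 (k : ℕ) (a b : BExpr) :
    (at2 k a b).holds v m ↔ m k (v 4 * a.eval v m + b.eval v m) ≠ 0 := by simp [at2]

end BExpr

namespace BCmd

open BExpr

/-- One round of the computation of reachability and distances in the set in array `4`. -/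
def connStep : BCmd :=
  .seq (tab 12 [20, 21] (add (at2 7 (var 20) (var 21)) (bool (not (at2 5 (var 20) (var 21))))))
  (.seq (tab 7 [20, 21] (at2 12 (var 20) (var 21)))
  (.seq (tab 6 [20, 21] (bool (or (at2 5 (var 20) (var 21)) (and (get 4 (var 21))
      (ex 22 (and (at2 5 (var 20) (var 22)) (adjE 0 (var 22) (var 21))))))))
  (tab 5 [20, 21] (at2 6 (var 20) (var 21)))))

/-- Connectivity in the set in array `4`, with roots, distances and predecessors. -/
def conn : BCmd :=
  .seq (tab 5 [20, 21] (bool (and (eq (var 20) (var 21)) (get 4 (var 20)))))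
  (.seq (tab 7 [20, 21] (const 0))
  (.seq (.loop 13 connStep)
  (.seq (tab 8 [20] (least 23 22 (at2 5 (var 20) (var 22))))
  (.seq (tab 9 [20] (at2 7 (get 8 (var 20)) (var 20)))
  (tab 10 [20] (least 23 22 (and (at2 5 (var 20) (var 22)) (and (adjE 0 (var 22) (var 20))
    (eq (add (get 9 (var 22)) (const 1)) (get 9 (var 20)))))))))))

open Classical in
/-- The tables after `i` rounds of `connStep`. -/
def ConnInv (B : ℕ) (A : ℕ → ℕ → Prop) (D : Finset ℕ) (i : ℕ) (s : RamState) : Prop :=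
  ∀ u < B, ∀ v < B, (s.arr 5 (B * u + v) ≠ 0 ↔ Reach A D i u v) ∧
    s.arr 7 (B * u + v) = ((Finset.range i).filter fun j => ¬ Reach A D j u v).card

/-- Array `7` counts the rounds in which a vertex was not yet reached; once it is reached, this
number is its distance. Arrays `12` and `6` are buffers, since a table must not be read while it is
filled. -/
theorem connStep_spec {s : RamState} {A : ℕ → ℕ → Prop} {D : Finset ℕ} {i B : ℕ}
    (hB : s.var 4 = B) (hDB : D ⊆ Finset.range B)
    (hn : s.var 0 ≤ B) (hA : A = adjRel (s.var 0) (s.arr 0)) (hD : Represents B (s.arr 4) D)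
    (hI : ConnInv B A D i s) : ConnInv B A D (i + 1) (connStep.den s) := by
  classical
  intro u hu v hv
  obtain ⟨h1, h2⟩ := hI u hu v hv
  have hn' := hB ▸ hn
  simp only [connStep, seq_den]
  constructor
  · simp
      (disch := first | assumption | decide | (simp (disch := decide) only [Function.update_of_ne, den_var]; assumption))
      only [arr_tab2_ne, den_var, den_arr, holds_at2, eval_var,
      Function.update_self, Function.update_of_ne, hB, holds_bool, holds_or, holds_and, holds_get,
      holds_ex, holds_adjE, ← hA]
    rw [h1, hD v hv]
    constructor
    · rintro (h | ⟨hvD, w, hw, h, ha⟩)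
      · exact h.succ
      · exact ⟨hvD, w, ((hI u hu w hw).1.1 h), .inr ha⟩
    · rintro ⟨hvD, w, hw, rfl | ha⟩
      · exact .inl hw
      · have hwB := Finset.mem_range.1 (hDB hw.mem.2)
        exact .inr ⟨hvD, w, hwB, (hI u hu w hwB).1.2 hw, ha⟩
  · simp
      (disch := first | assumption | decide | (simp (disch := decide) only [Function.update_of_ne, den_var]; assumption))
      only [arr_tab2, arr_tab2_ne, den_var, den_arr, eval_at2, eval_add,
      eval_bool, holds_not, holds_at2, eval_var, Function.update_self, Function.update_of_ne, hB,
      holds_bool]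
    rw [h2, Finset.range_add_one, Finset.filter_insert]
    by_cases h : Reach A D i u v
    · rw [if_neg (not_not.2 (h1.2 h)), if_neg (not_not.2 h), add_zero]
    · rw [if_pos fun h' => h (h1.1 h'), if_pos h, Finset.card_insert_of_notMem (by simp)]

/-- What the tables of `conn` contain. -/
structure ConnTables (B : ℕ) (A : ℕ → ℕ → Prop) (D : Finset ℕ) (s : RamState) : Prop where
  conn : ∀ u < B, ∀ v < B, s.arr 5 (B * u + v) ≠ 0 ↔ Conn A D u v
  root : ∀ v ∈ D, s.arr 8 v = rootOf A D v
  dist : ∀ v ∈ D, s.arr 9 v = rootDist A D v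
  pred : ∀ v ∈ D, rootDist A D v ≠ 0 → s.arr 10 v = pred A D v

/-- After `B` rounds reachability has stabilised because distances are less than the number of
vertices of `D ⊆ range B`. Least vertices and predecessors are then found by bounded search,
matching the infima in `rootOf` and `pred`. -/
theorem conn_spec {s : RamState} {A : ℕ → ℕ → Prop} {D : Finset ℕ} {B : ℕ} (hAs : Symmetric A)
    (hB : s.var 4 = B) (hDB : D ⊆ Finset.range B)
    (hn : s.var 0 ≤ B) (hA : A = adjRel (s.var 0) (s.arr 0)) (hD : Represents B (s.arr 4) D) :
    ConnTables B A D (conn.den s) := by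
  classical
  have hn' := hB ▸ hn
  have hcard : D.card ≤ B := by simpa using Finset.card_le_card hDB
  simp only [BCmd.conn, seq_den]
  set s0 := (tab 7 [20, 21] (const 0)).den
    ((tab 5 [20, 21] (bool (and (eq (var 20) (var 21)) (get 4 (var 20))))).den s) with hs0
  have h0 : ConnInv B A D 0 s0 := by
    intro u hu v hv
    simp
      (disch := first | assumption | decide | (simp (disch := decide) only [Function.update_of_ne, den_var]; assumption))
      only [hs0, arr_tab2, arr_tab2_ne, den_var, den_arr, holds_and, holds_eq,
      holds_get, eval_var, Function.update_self, Function.update_of_ne, hB, holds_bool, eval_const]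
    simp [hD u hu, Reach]
  have hv4 : s0.var 4 = B := by simp (disch := decide) only [hs0, den_var, hB]
  have hv0 : s0.var 0 = s.var 0 := by simp (disch := decide) only [hs0, den_var]
  have ha0 : s0.arr 0 = s.arr 0 := by simp (disch := decide) only [hs0, den_arr]
  have ha4 : s0.arr 4 = s.arr 4 := by simp (disch := decide) only [hs0, den_arr]
  have hloop : ConnInv B A D B ((loop 13 connStep).den s0) := by
    have := loop_inv (x := 13) (a := connStep) (s := s0) (fun i s => ConnInv B A D i s) h0 (by
      intro i hi s' hf hI
      refine connStep_spec ?_ hDB ?_ ?_ ?_ hI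
      · simp (disch := decide) only [RamState.setV_var, Function.update_of_ne, hf.1, hv4]
      · simp (disch := decide) only [RamState.setV_var, Function.update_of_ne, hf.1, hv0, hn]
      · simp (disch := decide) only [RamState.setV_var, RamState.setV_arr, Function.update_of_ne,
          hf.1, hf.2, hv0, ha0, hA]
      · simp (disch := decide) only [RamState.setV_arr, hf.2, ha4]
        exact hD)
    rwa [hv4] at this
  set s1 := (loop 13 connStep).den s0 with hs1
  have hf := den_frame (loop 13 connStep) s0
  have hB1 : s1.var 4 = B := by simp (disch := decide) only [hs1, hf.1, hv4]
  have hn1 : s1.var 0 ≤ s1.var 4 := by simp (disch := decide) only [hs1, hf.1, hv4, hv0, hn]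
  have hA1 : A = adjRel (s1.var 0) (s1.arr 0) := by
    simp (disch := decide) only [hs1, hf.1, hf.2, hv0, ha0, hA]
  have hc1 : ∀ u < B, ∀ v < B, s1.arr 5 (B * u + v) ≠ 0 ↔ Conn A D u v := fun u hu v hv => by
    rw [(hloop u hu v hv).1, conn_iff_reach hcard]
  have hd1 : ∀ u v, Conn A D u v → s1.arr 7 (B * u + v) = distIn A D u v := by
    intro u v h
    have hu := Finset.mem_range.1 (hDB h.mem.1)
    have hv := Finset.mem_range.1 (hDB h.mem.2)
    rw [(hloop u hu v hv).2]
    have hlt := distIn_lt_card h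
    rw [show (Finset.range B).filter (fun j => ¬ Reach A D j u v) = Finset.range (distIn A D u v) by
      ext j
      simp only [Finset.mem_filter, Finset.mem_range, reach_iff h]
      omega]
    simp
  clear_value s1
  have hDv : ∀ v ∈ D, v < B := fun v hv => Finset.mem_range.1 (hDB hv)
  have e8 : ∀ v ∈ D, ((tab 8 [20] (least 23 22 (at2 5 (var 20) (var 22)))).den s1).arr 8 v =
      rootOf A D v := by
    intro v hv
    have hvB := hDv v hv
    rw [arr_tab1 rfl hB1 hvB]
    refine eval_least _ _ _ _ _ (fun u => Conn A D v u) (by decide) (by decide) (by decide) rfl ?_ ?_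
      (conn_rootOf hv) (fun u hu => rootOf_le hu)
    · simp (disch := decide) only [Function.update_of_ne, hB1]
      intro i hi j hj
      simp (disch := decide) only [Function.update_of_ne, hB1, holds_at2, eval_var,
        Function.update_self]
      exact hc1 v hvB i hi
    · simp (disch := decide) only [Function.update_of_ne, hB1]
      exact hDv _ (conn_rootOf hv).mem.2
  set s2 := (tab 8 [20] (least 23 22 (at2 5 (var 20) (var 22)))).den s1 with hs2
  have e9 : ∀ v ∈ D, ((tab 9 [20] (at2 7 (get 8 (var 20)) (var 20))).den s2).arr 9 v =
      rootDist A D v := by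
    intro v hv
    rw [arr_tab1 rfl (B := B) (by simp (disch := decide) only [hs2, den_var, hB1]) (hDv v hv)]
    simp (disch := decide) only [eval_at2, Function.update_of_ne, eval_get, eval_var,
      Function.update_self, e8 v hv]
    simp (disch := decide) only [hs2, den_var, den_arr, hB1]
    exact hd1 _ _ ((conn_rootOf hv).symm hAs)
  set s3 := (tab 9 [20] (at2 7 (get 8 (var 20)) (var 20))).den s2 with hs3
  have hB3 : s3.var 4 = B := by simp (disch := decide) only [hs3, hs2, den_var, hB1]
  have hn3 : s3.var 0 ≤ s3.var 4 := by simp (disch := decide) only [hs3, hs2, den_var]; exact hn1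
  have hA3 : A = adjRel (s3.var 0) (s3.arr 0) := by
    simp (disch := decide) only [hs3, hs2, den_var, den_arr]; exact hA1
  have hc3 : ∀ u < B, ∀ v < B, s3.arr 5 (B * u + v) ≠ 0 ↔ Conn A D u v := fun u hu v hv => by
    simp (disch := decide) only [hs3, hs2, den_arr]; exact hc1 u hu v hv
  have e83 : ∀ v ∈ D, s3.arr 8 v = rootOf A D v := fun v hv => by
    simp (disch := decide) only [hs3, den_arr]; exact e8 v hv
  clear_value s3
  refine ⟨?_, ?_, ?_, ?_⟩
  · simp (disch := decide) only [den_arr]; exact hc3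
  · simp (disch := decide) only [den_arr]; exact e83
  · simp (disch := decide) only [den_arr]; exact e9
  · intro v hv h0
    have hvB := hDv v hv
    have hp := pred_spec hAs hv (Nat.succ_pred_eq_of_ne_zero h0).symm
    rw [arr_tab1 rfl hB3 hvB]
    refine eval_least _ _ _ _ _ (fun u => Conn A D v u ∧ A u v ∧ rootDist A D u + 1 = rootDist A D v)
      (by decide) (by decide) (by decide) rfl ?_ ?_ ?_ (fun u hu => Nat.sInf_le hu)
    · simp (disch := decide) only [Function.update_of_ne, hB3]
      intro i hi j hj
      simp
      (disch := first | assumption | decide | (simp (disch := decide) only [Function.update_of_ne, den_var]; assumption))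
      only [Function.update_of_ne, hB3, holds_at2,
        eval_var, Function.update_self, holds_and, holds_adjE, holds_eq, eval_add, eval_get,
        eval_const, ← hA3]
      rw [hc3 v hvB i hi]
      refine and_congr_right fun hc => ?_
      rw [e9 v hv, e9 i hc.mem.2]
    · simp (disch := decide) only [Function.update_of_ne, hB3]
      exact hDv _ hp.1.mem.2
    · refine ⟨hp.1, hp.2.1, ?_⟩
      rw [hp.2.2]
      exact Nat.succ_pred_eq_of_ne_zero h0

end BCmd

/-! ### Closure under predecessors on the machine -/

namespace BCmd

open BExpr

/-- One round of the closure of the set in array `11` under predecessors. -/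
def closStep : BCmd :=
  .seq (tab 12 [20] (bool (and (get 4 (var 20)) (or (get 11 (var 20)) (ex 21 (and (get 11 (var 21))
    (and (get 9 (var 21)) (eq (get 10 (var 21)) (var 20)))))))))
  (tab 11 [20] (get 12 (var 20)))

/-- The obstruction generated by the set in array `14`, as a subset of the set in array `4`; the
variable `11` contains a bound for the distance from the roots. -/
def finish : BCmd :=
  .seq conn (.seq (tab 11 [20] (bool (and (get 4 (var 20)) (or
    (and (get 14 (var 20)) (lt (get 9 (var 20)) (var 11)))
    (and (eq (add (get 9 (var 20)) (const 1)) (var 11)) (all 21 (or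
      (not (and (at2 5 (var 20) (var 21)) (eq (add (get 9 (var 21)) (const 1)) (var 11))))
      (le (var 20) (var 21)))))))))
  (.loop 14 closStep))

theorem finish_spec {s : RamState} {A : ℕ → ℕ → Prop} {D U : Finset ℕ} {B h : ℕ} (hAs : Symmetric A)
    (hB : s.var 4 = B) (hDB : D ⊆ Finset.range B)
    (hn : s.var 0 ≤ B) (hA : A = adjRel (s.var 0) (s.arr 0)) (hD : Represents B (s.arr 4) D)
    (hU : Represents B (s.arr 14) U) (hh : s.var 11 = 2 ^ h) :
    Represents B ((finish.den s).arr 11) (clos A D (gens A h D U) B) := by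
  classical
  have hT := conn_spec hAs hB hDB hn hA hD
  have hDv : ∀ v ∈ D, v < B := fun v hv => Finset.mem_range.1 (hDB hv)
  simp only [finish, seq_den]
  have hB1 : (conn.den s).var 4 = B := by simp (disch := decide) only [den_var, hB]
  have hh1 : (conn.den s).var 11 = 2 ^ h := by simp (disch := decide) only [den_var, hh]
  have hD1 : Represents B ((conn.den s).arr 4) D := by simp (disch := decide) only [den_arr]; exact hD
  have hU1 : Represents B ((conn.den s).arr 14) U := by simp (disch := decide) only [den_arr]; exact hU
  set s1 := conn.den s
  clear_value s1
  set e : BExpr := (bool (and (get 4 (var 20)) (or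
    (and (get 14 (var 20)) (lt (get 9 (var 20)) (var 11)))
    (and (eq (add (get 9 (var 20)) (const 1)) (var 11)) (all 21 (or
      (not (and (at2 5 (var 20) (var 21)) (eq (add (get 9 (var 21)) (const 1)) (var 11))))
      (le (var 20) (var 21)))))))) with he
  have hg : Represents B (((tab 11 [20] e).den s1).arr 11) (gens A h D U) := by
    intro v hv
    rw [arr_tab1_ne rfl hB1 hv]
    simp
      (disch := decide)
      only [he, Function.update_of_ne, hB1, holds_bool, holds_at2, eval_var, Function.update_self,
      holds_and, holds_or, holds_eq, eval_add, eval_get, eval_const, holds_not, holds_all, holds_le,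
      holds_lt, holds_get, hh1]
    rw [mem_gens, hD1 v hv, hU1 v hv]
    refine and_congr_right fun hvD => ?_
    rw [hT.dist v hvD]
    refine or_congr_right (and_congr_right fun _ => ⟨fun hl u hu hu' => ?_, fun hl u hu => ?_⟩)
    · rcases hl u (hDv u hu.mem.2) with h' | h'
      · exact absurd ⟨(hT.conn v hv u (hDv u hu.mem.2)).2 hu, by rw [hT.dist u hu.mem.2, hu']⟩ h'
      · exact h'
    · by_cases hc : Conn A D v u
      · by_cases hd : rootDist A D u + 1 = 2 ^ h
        · exact .inr (hl u hc hd)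
        · exact .inl fun h' => hd (by rw [← hT.dist u hc.mem.2, h'.2])
      · exact .inl fun h' => hc ((hT.conn v hv u hu).1 h'.1)
  set s2 := (tab 11 [20] e).den s1 with hs2
  have hB2 : s2.var 4 = B := by simp (disch := decide) only [hs2, den_var, hB1]
  have key := loop_inv (x := 14) (a := closStep) (s := s2)
    (fun i s => Represents B (s.arr 11) (clos A D (gens A h D U) i)) hg (by
      intro i hi s' hf hI
      have hB' : (s'.setV 14 i).var 4 = B := by
        simp (disch := decide) only [RamState.setV_var, Function.update_of_ne, hf.1, hB2]
      have e4 : s'.arr 4 = s1.arr 4 := by simp (disch := decide) only [hf.2, hs2, den_arr]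
      have e9 : s'.arr 9 = s1.arr 9 := by simp (disch := decide) only [hf.2, hs2, den_arr]
      have e10 : s'.arr 10 = s1.arr 10 := by simp (disch := decide) only [hf.2, hs2, den_arr]
      intro v hv
      simp only [closStep, seq_den]
      simp
        (disch := first | assumption | decide | (simp (disch := decide) only [den_var]; assumption))
        only [arr_tab1_ne, holds_get, eval_var, Function.update_self, holds_bool]
      simp (disch := first | assumption | decide) only [arr_tab1_ne, holds_get, eval_var,
        Function.update_self, holds_bool, holds_and, holds_or, holds_ex, holds_eq, eval_get,
        Function.update_of_ne, hB', RamState.setV_arr, e4, e9, e10]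
      rw [hD1 v hv, hI v hv]
      simp only [clos, Finset.mem_filter]
      refine and_congr_right fun hvD => or_congr_right ⟨?_, ?_⟩
      · rintro ⟨u, hu, h1, h2, h3⟩
        have huc := (hI u hu).1 h1
        have huD := clos_subset hAs gens_subset huc
        rw [hT.dist u huD] at h2
        exact ⟨u, huc, h2, by rw [← h3, hT.pred u huD h2]⟩
      · rintro ⟨u, huc, h2, h3⟩
        have huD := clos_subset hAs gens_subset huc
        exact ⟨u, hDv u huD, (hI u (hDv u huD)).2 huc, by rw [hT.dist u huD]; exact h2,
          by rw [hT.pred u huD h2, h3]⟩)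
  rwa [hB2] at key

end BCmd

namespace BCmd

open BExpr

/-! ### The recursive computation of obstructions, with explicit stack -/

theorem var_setVar (x : ℕ) (e : BExpr) (s : RamState) :
    ((setVar x e).den s).var x = e.eval s.var s.arr := by simp [den]

theorem arr_setArr (k : ℕ) (i e : BExpr) (s : RamState) (j : ℕ) :
    ((setArr k i e).den s).arr k j =
      if j = i.eval s.var s.arr then e.eval s.var s.arr else s.arr k j := by
  simp [den, Function.update_apply]

theorem ite_den_of_ne {e : BExpr} {a b : BCmd} {s : RamState} (h : e.holds s.var s.arr) :
    (ite e a b).den s = a.den s := if_pos h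

theorem ite_den_of_not {e : BExpr} {a b : BCmd} {s : RamState} (h : ¬ e.holds s.var s.arr) :
    (ite e a b).den s = b.den s := if_neg h

/-- Row `r` of the array represents the set. -/
def RowRep (B : ℕ) (a : ℕ → ℕ) (r : ℕ) (p : ℕ → Prop) : Prop := ∀ v < B, a (B * r + v) ≠ 0 ↔ p v

/-- Load the current set, whose level is in variable `5`, and its subset one level below. -/
def loadRows : BCmd :=
  .seq (.setVar 9 (sub (var 5) (const 1)))
  (.seq (.setVar 10 (get 22 (var 5)))
  (.seq (tab 4 [20] (at2 13 (var 9) (var 20)))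
  (.seq conn
  (.seq (tab 19 [20, 21] (at2 5 (var 20) (var 21)))
  (.seq (tab 4 [20] (at2 13 (var 5) (var 20)))
  conn)))))

/-- Record the result for the first subset. -/
def recordFirst : BCmd :=
  .seq (tabAux 15 [5] [20] (get 11 (var 20)))
  (.seq (tabAux 16 [5] [20] (get 11 (var 20)))
  (tabAux 17 [5] [20] (const 0)))

/-- Record the result for a later subset. -/
def recordNext : BCmd :=
  .seq (tab 20 [20] (bool (and (get 11 (var 20)) (ex 21 (and (get 11 (var 21))
      (and (at2 19 (var 20) (var 21)) (all 22 (or (not (and (get 11 (var 22))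
        (at2 5 (var 20) (var 22)))) (le (var 21) (var 22))))))))))
  (.seq (tab 12 [20] (bool (or (at2 16 (var 5) (var 20)) (get 20 (var 20)))))
  (.seq (tabAux 16 [5] [20] (get 12 (var 20)))
  (.seq (tab 12 [20] (bool (or (at2 17 (var 5) (var 20)) (and (get 4 (var 20))
      (not (ex 21 (and (at2 5 (var 20) (var 21)) (get 11 (var 21)))))))))
  (tabAux 17 [5] [20] (get 12 (var 20))))))

/-- Connectivity in the subset `D'` is computed first and saved in array `19`, because the same
routine is then run for `D`; both relations enter `sel`. -/
theorem loadRows_spec {s : RamState} {A : ℕ → ℕ → Prop} {D D' : Finset ℕ} {B l a : ℕ}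
    (hAs : Symmetric A) (hB : s.var 4 = B) (hDB : D ⊆ Finset.range B) (hDB' : D' ⊆ Finset.range B)
    (hn : s.var 0 ≤ B) (hA : A = adjRel (s.var 0) (s.arr 0)) (h5 : s.var 5 = l + 1)
    (ha : s.arr 22 (l + 1) = a) (hD : RowRep B (s.arr 13) (l + 1) (· ∈ D))
    (hD' : RowRep B (s.arr 13) l (· ∈ D')) :
    (loadRows.den s).var 9 = l ∧ (loadRows.den s).var 10 = a ∧
    Represents B ((loadRows.den s).arr 4) D ∧ ConnTables B A D (loadRows.den s) ∧
    ∀ u < B, ∀ v < B, (loadRows.den s).arr 19 (B * u + v) ≠ 0 ↔ Conn A D' u v := by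
  simp only [loadRows, seq_den]
  set s1 := (setVar 10 (get 22 (var 5))).den ((setVar 9 (sub (var 5) (const 1))).den s) with hs1
  have v9 : s1.var 9 = l := by
    simp (disch := decide) only [hs1, den_var, var_setVar, eval_sub, eval_var, eval_const, h5]; rfl
  have v10 : s1.var 10 = a := by
    simp (disch := decide) only [hs1, den_var, den_arr, var_setVar, eval_get, eval_var, h5, ha]
  have v4 : s1.var 4 = B := by simp (disch := decide) only [hs1, den_var, hB]
  have v5 : s1.var 5 = l + 1 := by simp (disch := decide) only [hs1, den_var, h5]
  have v0 : s1.var 0 = s.var 0 := by simp (disch := decide) only [hs1, den_var]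
  have ar : s1.arr = s.arr := rfl
  clear_value s1
  set s2 := (tab 4 [20] (at2 13 (var 9) (var 20))).den s1 with hs2
  have h2 : Represents B (s2.arr 4) D' := by
    intro v hv
    rw [arr_tab1_ne rfl v4 hv]
    simp (disch := decide) only [holds_at2, eval_var, Function.update_of_ne, Function.update_self,
      v4, v9, ar]
    exact hD' v hv
  have t2 := conn_spec (s := s2) (D := D') hAs (by simp (disch := decide) only [hs2, den_var, v4])
    hDB' (by simp (disch := decide) only [hs2, den_var, v0, hn])
    (by simp (disch := decide) only [hs2, den_var, den_arr, hA, v0, ar]) h2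
  set s3 := (tab 19 [20, 21] (at2 5 (var 20) (var 21))).den (conn.den s2) with hs3
  have h3 : ∀ u < B, ∀ v < B, s3.arr 19 (B * u + v) ≠ 0 ↔ Conn A D' u v := by
    intro u hu v hv
    have h4 : (conn.den s2).var 4 = B := by simp (disch := decide) only [hs2, den_var, v4]
    rw [arr_tab2_ne rfl h4 hu hv]
    simp (disch := decide) only [holds_at2, eval_var, Function.update_of_ne, Function.update_self, h4]
    exact t2.conn u hu v hv
  set s4 := (tab 4 [20] (at2 13 (var 5) (var 20))).den s3 with hs4
  have h4 : Represents B (s4.arr 4) D := by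
    intro v hv
    have h4 : s3.var 4 = B := by simp (disch := decide) only [hs3, hs2, den_var, v4]
    rw [arr_tab1_ne rfl h4 hv]
    simp (disch := decide) only [holds_at2, eval_var, Function.update_of_ne, Function.update_self,
      hs3, hs2, den_var, den_arr, v4, v5, ar]
    exact hD v hv
  have t4 := conn_spec (s := s4) (D := D) hAs
    (by simp (disch := decide) only [hs4, hs3, hs2, den_var, v4])
    hDB (by simp (disch := decide) only [hs4, hs3, hs2, den_var, hn, v0])
    (by simp (disch := decide) only [hs4, hs3, hs2, den_var, den_arr, hA, v0, ar]) h4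
  refine ⟨?_, ?_, ?_, t4, ?_⟩
  · simp (disch := decide) only [hs4, hs3, hs2, den_var, v9]
  · simp (disch := decide) only [hs4, hs3, hs2, den_var, v10]
  · simp (disch := decide) only [den_arr]; exact h4
  · simp (disch := decide) only [hs4, den_arr]; exact h3

theorem recordFirst_spec {s : RamState} {Z : Finset ℕ} {B r : ℕ}
    (hB : s.var 4 = B) (h5 : s.var 5 = r) (hZ : Represents B (s.arr 11) Z) :
    RowRep B ((recordFirst.den s).arr 15) r (· ∈ Z) ∧
    RowRep B ((recordFirst.den s).arr 16) r (· ∈ Z) ∧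
    RowRep B ((recordFirst.den s).arr 17) r (fun _ => False) ∧
    (∀ l v, v < B → l ≠ r → (recordFirst.den s).arr 15 (B * l + v) = s.arr 15 (B * l + v)) ∧
    (∀ l v, v < B → l ≠ r → (recordFirst.den s).arr 16 (B * l + v) = s.arr 16 (B * l + v)) ∧
    (∀ l v, v < B → l ≠ r → (recordFirst.den s).arr 17 (B * l + v) = s.arr 17 (B * l + v)) := by
  simp only [recordFirst, seq_den]
  refine ⟨fun v hv => ?_, fun v hv => ?_, fun v hv => ?_, fun l v hv hl => ?_, fun l v hv hl => ?_,
    fun l v hv hl => ?_⟩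
  all_goals
    simp
      (disch := first | assumption | decide | (simp (disch := decide) only [Function.update_of_ne, den_var, hB, h5]; first | done | assumption))
      only [arr_row_ne, arr_row_of_ne, den_var, den_arr, holds_get, eval_var, Function.update_self,
      holds_const, hZ v hv, ne_eq, not_true]

/-- Array `16` accumulates the selected vertices, array `17` the vertices whose component was free
of obstructions for some rank. A vertex of `16` missing from `17` at the end is a candidate in the
sense of `cand`. -/
theorem recordNext_spec {s : RamState} {A : ℕ → ℕ → Prop} {D D' Z : Finset ℕ} {B r : ℕ}
    {U G : ℕ → Prop} (hB : s.var 4 = B) (h5 : s.var 5 = r)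
    (hD : Represents B (s.arr 4) D) (hT : ConnTables B A D s)
    (hT' : ∀ u < B, ∀ v < B, s.arr 19 (B * u + v) ≠ 0 ↔ Conn A D' u v)
    (hZ : Represents B (s.arr 11) Z) (hZB : Z ⊆ Finset.range B)
    (hU : RowRep B (s.arr 16) r U) (hG : RowRep B (s.arr 17) r G) :
    RowRep B ((recordNext.den s).arr 16) r (fun v => U v ∨ v ∈ sel A D D' Z) ∧
    RowRep B ((recordNext.den s).arr 17) r (fun v => G v ∨ v ∈ D ∧ ¬ ∃ u, Conn A D v u ∧ u ∈ Z) ∧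
    (∀ l v, v < B → l ≠ r → (recordNext.den s).arr 16 (B * l + v) = s.arr 16 (B * l + v)) ∧
    (∀ l v, v < B → l ≠ r → (recordNext.den s).arr 17 (B * l + v) = s.arr 17 (B * l + v)) := by
  have hZv : ∀ v ∈ Z, v < B := fun v hv => Finset.mem_range.1 (hZB hv)
  simp only [recordNext, seq_den]
  refine ⟨fun v hv => ?_, fun v hv => ?_, fun l v hv hl => ?_, fun l v hv hl => ?_⟩
  · simp
      (disch := first | assumption | decide | (simp (disch := decide) only [Function.update_of_ne, den_var, hB, h5]; first | done | assumption))
      only [arr_row_ne, den_var, den_arr, arr_tab1_lt_ne, holds_get, holds_or, holds_at2, holds_and, holds_bool, eval_var,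
      Function.update_self, Function.update_of_ne, holds_ex, holds_all, holds_not, holds_le, h5, hB]
    refine or_congr (hU v hv) ?_
    rw [mem_sel, hZ v hv]
    refine and_congr_right fun hvZ => ⟨?_, ?_⟩
    · rintro ⟨w, hw, h1, h2, h3⟩
      refine ⟨w, (hZ w hw).1 h1, (hT' v hv w hw).1 h2, fun u hu hc => ?_⟩
      rcases h3 u (hZv u hu) with h' | h'
      · exact absurd ⟨(hZ u (hZv u hu)).2 hu, (hT.conn v hv u (hZv u hu)).2 hc⟩ h'
      · exact h'
    · rintro ⟨w, hw, h2, h3⟩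
      refine ⟨w, hZv w hw, (hZ w (hZv w hw)).2 hw, (hT' v hv w (hZv w hw)).2 h2, fun u hu => ?_⟩
      by_cases h : u ∈ Z ∧ Conn A D v u
      · exact .inr (h3 u h.1 h.2)
      · exact .inl fun h' => h ⟨(hZ u hu).1 h'.1, (hT.conn v hv u hu).1 h'.2⟩
  · simp
      (disch := first | assumption | decide | (simp (disch := decide) only [Function.update_of_ne, den_var, hB, h5]; first | done | assumption))
      only [arr_row_ne, den_var, den_arr, arr_tab1_lt_ne, holds_get, holds_or, holds_at2, holds_and, holds_bool, eval_var,
      Function.update_self, Function.update_of_ne, holds_ex, holds_not, h5, hB]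
    refine or_congr (hG v hv) (and_congr (hD v hv) (not_congr ⟨?_, ?_⟩))
    · rintro ⟨u, hu, h1, h2⟩
      exact ⟨u, (hT.conn v hv u hu).1 h1, (hZ u hu).1 h2⟩
    · rintro ⟨u, h1, h2⟩
      exact ⟨u, hZv u h2, (hT.conn v hv u (hZv u h2)).2 h1, (hZ u (hZv u h2)).2 h2⟩
  all_goals
    simp
      (disch := first | assumption | decide | (simp (disch := decide) only [Function.update_of_ne, den_var, hB, h5]; first | done | assumption))
      only [arr_row_of_ne, den_var, den_arr]

end BCmd

/-! ### Transitions of the stack computation -/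

namespace BCmd

open BExpr

/-- Proceed to the next subset. -/
def nextSub : BCmd :=
  .seq (tab 12 [20] (bool (and (get 4 (var 20)) (not (and (at2 15 (var 5) (var 20))
    (eq (sum 21 (bool (and (at2 15 (var 5) (var 21)) (and (lt (var 21) (var 20))
      (at2 5 (var 20) (var 21)))))) (var 10)))))))
  (.seq (tabAux 13 [9] [20] (get 12 (var 20)))
  (.seq (.setArr 22 (var 5) (add (var 10) (const 1)))
  (.seq (.setVar 5 (var 9))
  (.setVar 6 (const 0)))))

/-- Combine the results for the subsets. -/
def combine : BCmd :=
  .seq (tab 14 [20] (bool (and (at2 16 (var 5) (var 20)) (not (at2 17 (var 5) (var 20))))))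
  (.seq (.setVar 11 (get 18 (var 5)))
  (.seq finish
  (.setVar 5 (add (var 5) (const 1)))))

/-- Start the computation for the current set. -/
def callSub : BCmd :=
  .seq (.setArr 22 (var 5) (const 0))
  (.seq (.setVar 9 (sub (var 5) (const 1)))
  (.seq (tab 12 [20] (at2 13 (var 5) (var 20)))
  (.seq (tabAux 13 [9] [20] (get 12 (var 20)))
  (.setVar 5 (var 9)))))

/-- The computation for the current set at the lowest level. -/
def callLeaf : BCmd :=
  .seq (tab 4 [20] (at2 13 (var 5) (var 20)))
  (.seq (tab 14 [20] (const 0))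
  (.seq (.setVar 11 (const 1))
  (.seq finish
  (.seq (.setVar 5 (const 1)) (.setVar 6 (const 1))))))

/-- Process the result for a subset. -/
def returned : BCmd :=
  .seq loadRows
  (.seq (.ite (var 10) recordNext recordFirst)
  (.seq (.setVar 12 (get 18 (sub (sub (get 18 (add (var 5) (const 1))) (var 5)) (const 3))))
  (.ite (lt (var 10) (var 12)) nextSub combine)))

/-- One step of the computation. -/
def tick : BCmd :=
  .ite (lt (var 7) (var 5)) .skip (.ite (var 6) returned (.ite (var 5) callSub callLeaf))

theorem sum_bool_eq_card {S : Finset ℕ} {B x : ℕ} {e : BExpr} {v : ℕ → ℕ} {m : ℕ → ℕ → ℕ}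
    (hS : S ⊆ Finset.range B) (h : ∀ i < B, e.holds (Function.update v x i) m ↔ i ∈ S) :
    ∑ i ∈ Finset.range B, (bool e).eval (Function.update v x i) m = S.card := by
  classical
  rw [Finset.card_eq_sum_ones, ← Finset.sum_subset hS (f := fun i =>
    (bool e).eval (Function.update v x i) m)]
  · refine Finset.sum_congr rfl fun i hi => ?_
    rw [eval_bool, if_pos ((h i (Finset.mem_range.1 (hS hi))).2 hi)]
  · intro i hi hiS
    rw [eval_bool, if_neg fun h' => hiS ((h i (Finset.mem_range.1 hi)).1 h')]

/-- The rank of a vertex is obtained by summing the truth values of the conditions that define the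
set counted in `pick`. -/
theorem nextSub_spec {s : RamState} {A : ℕ → ℕ → Prop} {D X : Finset ℕ} {B l a : ℕ}
    (hB : s.var 4 = B) (h5 : s.var 5 = l + 1) (h9 : s.var 9 = l) (h10 : s.var 10 = a)
    (hD : Represents B (s.arr 4) D) (hT : ConnTables B A D s) (hX : RowRep B (s.arr 15) (l + 1) (· ∈ X))
    (hXB : X ⊆ Finset.range B) :
    (nextSub.den s).var 5 = l ∧ (nextSub.den s).var 6 = 0 ∧
    (∀ r, (nextSub.den s).arr 22 r = if r = l + 1 then a + 1 else s.arr 22 r) ∧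
    RowRep B ((nextSub.den s).arr 13) l (· ∈ D \ pick A D X a) ∧
    ∀ r v, v < B → r ≠ l → (nextSub.den s).arr 13 (B * r + v) = s.arr 13 (B * r + v) := by
  classical
  simp only [nextSub, seq_den]
  refine ⟨?_, ?_, ?_, ?_, ?_⟩
  · simp (disch := decide) only [den_var, var_setVar, eval_var, h9]
  · simp (disch := decide) only [den_var, var_setVar, eval_const]
  · intro r
    simp (disch := decide) only [den_var, den_arr, arr_setArr, eval_var, eval_add, eval_const, h5, h10]
  · intro v hv
    simp
      (disch := first | assumption | decide | (simp (disch := decide) only [Function.update_of_ne, den_var, hB, h9]; first | done | assumption))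
      only [arr_row_ne, den_var, den_arr, arr_tab1_lt_ne, holds_get, holds_or, holds_at2, holds_and, holds_bool, eval_var,
      Function.update_self, Function.update_of_ne, holds_not, h5, hB, holds_eq, eval_sum, h10]
    rw [Finset.mem_sdiff, mem_pick, hD v hv, hX v hv]
    refine and_congr_right fun hvD => not_congr (and_congr_right fun hvX => ?_)
    have hsum := sum_bool_eq_card (S := X.filter fun u => u < v ∧ Conn A D v u) (B := B)
      (e := (at2 15 (var 5) (var 21)).and (((var 21).lt (var 20)).and (at2 5 (var 20) (var 21))))
      (v := Function.update s.var 20 v) (x := 21) (m := s.arr)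
      (fun u hu => hXB (Finset.mem_filter.1 hu).1) (by
        intro i hi
        simp (disch := decide) only [holds_and, holds_lt, holds_at2, eval_var, Function.update_self,
          Function.update_of_ne, hB, h5]
        rw [hT.conn v hv i hi, hX i hi, Finset.mem_filter])
    rw [hsum]
  · intro r v hv hr
    simp
      (disch := first | assumption | decide | (simp (disch := decide) only [Function.update_of_ne, den_var, hB, h9]; first | done | assumption))
      only [arr_row_of_ne, den_var, den_arr]

theorem combine_spec {s : RamState} {A : ℕ → ℕ → Prop} {D U : Finset ℕ} {B l : ℕ}
    (hAs : Symmetric A) (hB : s.var 4 = B) (hDB : D ⊆ Finset.range B) (hn : s.var 0 ≤ B)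
    (hA : A = adjRel (s.var 0) (s.arr 0)) (hD : Represents B (s.arr 4) D)
    (h5 : s.var 5 = l + 1) (h18 : s.arr 18 (l + 1) = 2 ^ (l + 1))
    (hU : ∀ v < B, s.arr 16 (B * (l + 1) + v) ≠ 0 ∧ ¬ s.arr 17 (B * (l + 1) + v) ≠ 0 ↔ v ∈ U) :
    (combine.den s).var 5 = l + 2 ∧
    Represents B ((combine.den s).arr 11) (clos A D (gens A (l + 1) D U) B) := by
  simp only [combine, seq_den]
  refine ⟨by simp (disch := decide) only [den_var, var_setVar, eval_add, eval_var, eval_const, h5], ?_⟩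
  simp (disch := decide) only [den_arr]
  refine finish_spec hAs ?_ hDB ?_ ?_ ?_ ?_ ?_
  · simp (disch := decide) only [den_var, hB]
  · simp (disch := decide) only [den_var, hn]
  · simp (disch := decide) only [den_var, den_arr, hA]
  · simp (disch := decide) only [den_arr]; exact hD
  · intro v hv
    simp
      (disch := first | assumption | decide | (simp (disch := decide) only [Function.update_of_ne, den_var, hB]; first | done | assumption))
      only [den_var, den_arr, arr_tab1_lt_ne, holds_at2, holds_and, holds_bool, eval_var,
      Function.update_self, Function.update_of_ne, holds_not, h5, hB]
    exact hU v hv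
  · simp (disch := decide) only [den_var, den_arr, var_setVar, eval_get, eval_var, h5, h18]

theorem callSub_spec {s : RamState} {B l : ℕ} {D : Finset ℕ} (hB : s.var 4 = B)
    (h5 : s.var 5 = l + 1) (hD : RowRep B (s.arr 13) (l + 1) (· ∈ D)) :
    (callSub.den s).var 5 = l ∧
    (∀ r, (callSub.den s).arr 22 r = if r = l + 1 then 0 else s.arr 22 r) ∧
    RowRep B ((callSub.den s).arr 13) l (· ∈ D) ∧
    ∀ r v, v < B → r ≠ l → (callSub.den s).arr 13 (B * r + v) = s.arr 13 (B * r + v) := by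
  simp only [callSub, seq_den]
  refine ⟨?_, ?_, ?_, ?_⟩
  · simp (disch := decide) only [den_var, var_setVar, eval_var, eval_sub, eval_const, h5]; rfl
  · intro r
    simp (disch := decide) only [den_var, den_arr, arr_setArr, eval_var, eval_add, eval_const, h5]
  · intro v hv
    simp
      (disch := first | assumption | decide | (simp (disch := decide) only [Function.update_of_ne, den_var, var_setVar, eval_sub, eval_var, eval_const, hB, h5, Nat.add_sub_cancel]; first | done | assumption))
      only [arr_row_ne, den_var, den_arr, arr_tab1_lt_ne, holds_get, holds_at2, eval_var,
      Function.update_self, Function.update_of_ne, h5, hB]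
    exact hD v hv
  · intro r v hv hr
    simp
      (disch := first | assumption | decide | (simp (disch := decide) only [Function.update_of_ne, den_var, var_setVar, eval_sub, eval_var, eval_const, hB, h5, Nat.add_sub_cancel]; first | done | assumption))
      only [arr_row_of_ne, den_var, den_arr]

theorem callLeaf_spec {s : RamState} {A : ℕ → ℕ → Prop} {D : Finset ℕ} {B : ℕ} (hAs : Symmetric A)
    (hB : s.var 4 = B) (hDB : D ⊆ Finset.range B) (hn : s.var 0 ≤ B)
    (hA : A = adjRel (s.var 0) (s.arr 0)) (h5 : s.var 5 = 0) (hD : RowRep B (s.arr 13) 0 (· ∈ D)) :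
    (callLeaf.den s).var 5 = 1 ∧ (callLeaf.den s).var 6 = 1 ∧
    Represents B ((callLeaf.den s).arr 11) (obst A B 0 D) := by
  simp only [callLeaf, seq_den]
  refine ⟨by simp (disch := decide) only [den_var, var_setVar, eval_const],
    by simp (disch := decide) only [den_var, var_setVar, eval_const], ?_⟩
  simp (disch := decide) only [den_arr]
  refine finish_spec (U := ∅) (h := 0) hAs ?_ hDB ?_ ?_ ?_ ?_ ?_
  · simp (disch := decide) only [den_var, hB]
  · simp (disch := decide) only [den_var, hn]
  · simp (disch := decide) only [den_var, den_arr, hA]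
  · intro v hv
    simp
      (disch := first | assumption | decide | (simp (disch := decide) only [Function.update_of_ne, den_var, hB]; first | done | assumption))
      only [den_var, den_arr, arr_tab1_lt_ne, holds_at2, eval_var,
      Function.update_self, Function.update_of_ne, h5, hB]
    exact hD v hv
  · intro v hv
    simp
      (disch := first | assumption | decide | (simp (disch := decide) only [Function.update_of_ne, den_var, hB]; first | done | assumption))
      only [den_var, den_arr, arr_tab1_lt_ne, holds_const]
    simp
  · simp (disch := decide) only [den_var, var_setVar, eval_const, pow_zero]

/-! ### The stack invariants -/

/-- The memory during the computation of obstructions at levels up to `lev`. -/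
structure TickEnv (B : ℕ) (A : ℕ → ℕ → Prop) (lev : ℕ) (s : RamState) : Prop where
  bound : s.var 4 = B
  size : s.var 0 ≤ B
  adj : A = adjRel (s.var 0) (s.arr 0)
  level : s.var 7 = lev
  pow : ∀ i ≤ B, s.arr 18 i = 2 ^ i

/-- `s'` agrees with `s` in the stack above level `l`. -/
structure Keep (B l : ℕ) (s s' : RamState) : Prop where
  sets : ∀ r v, v < B → l ≤ r → s'.arr 13 (B * r + v) = s.arr 13 (B * r + v)
  row15 : ∀ r v, v < B → l < r → s'.arr 15 (B * r + v) = s.arr 15 (B * r + v)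
  row16 : ∀ r v, v < B → l < r → s'.arr 16 (B * r + v) = s.arr 16 (B * r + v)
  row17 : ∀ r v, v < B → l < r → s'.arr 17 (B * r + v) = s.arr 17 (B * r + v)
  count : ∀ r, l < r → s'.arr 22 r = s.arr 22 r

theorem Keep.trans {B l : ℕ} {s s' s'' : RamState} (h : Keep B l s s') (h' : Keep B l s' s'') :
    Keep B l s s'' where
  sets r v hv hr := (h'.sets r v hv hr).trans (h.sets r v hv hr)
  row15 r v hv hr := (h'.row15 r v hv hr).trans (h.row15 r v hv hr)
  row16 r v hv hr := (h'.row16 r v hv hr).trans (h.row16 r v hv hr)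
  row17 r v hv hr := (h'.row17 r v hv hr).trans (h.row17 r v hv hr)
  count r hr := (h'.count r hr).trans (h.count r hr)

theorem Keep.mono {B l l' : ℕ} {s s' : RamState} (h : Keep B l s s') (hl : l ≤ l') :
    Keep B l' s s' where
  sets r v hv hr := h.sets r v hv (by omega)
  row15 r v hv hr := h.row15 r v hv (by omega)
  row16 r v hv hr := h.row16 r v hv (by omega)
  row17 r v hv hr := h.row17 r v hv (by omega)
  count r hr := h.count r (by omega)

/-- The `a`-th subset of `D` for which the obstruction is computed. -/
noncomputable def subProblem (A : ℕ → ℕ → Prop) (B l : ℕ) (D : Finset ℕ) : ℕ → Finset ℕ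
  | 0 => D
  | a + 1 => D \ pick A D (obst A B l D) a

/-- The state in which the result for the `a`-th subset has been computed. -/
structure Returned (B : ℕ) (A : ℕ → ℕ → Prop) (l : ℕ) (D : Finset ℕ) (a : ℕ) (s : RamState) :
    Prop where
  level : s.var 5 = l + 1
  mode : s.var 6 ≠ 0
  count : s.arr 22 (l + 1) = a
  set : RowRep B (s.arr 13) (l + 1) (· ∈ D)
  sub : RowRep B (s.arr 13) l (· ∈ subProblem A B l D a)
  result : Represents B (s.arr 11) (obst A B l (subProblem A B l D a))
  row15 : a ≠ 0 → RowRep B (s.arr 15) (l + 1) (· ∈ obst A B l D)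
  row16 : a ≠ 0 → RowRep B (s.arr 16) (l + 1) fun v => v ∈ obst A B l D ∨ ∃ b < a - 1,
    v ∈ sel A D (subProblem A B l D (b + 1)) (obst A B l (subProblem A B l D (b + 1)))
  row17 : a ≠ 0 → RowRep B (s.arr 17) (l + 1) fun v => ∃ b < a - 1, v ∈ D ∧
    ¬ ∃ u, Conn A D v u ∧ u ∈ obst A B l (subProblem A B l D (b + 1))

end BCmd

/-! ### Correctness of the stack computation -/

namespace BCmd

open BExpr

variable {B l a lev : ℕ} {A : ℕ → ℕ → Prop} {D : Finset ℕ} {s s' : RamState}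

theorem ConnTables.congr (h : ConnTables B A D s) (h5 : s'.arr 5 = s.arr 5)
    (h8 : s'.arr 8 = s.arr 8) (h9 : s'.arr 9 = s.arr 9) (h10 : s'.arr 10 = s.arr 10) :
    ConnTables B A D s' :=
  ⟨by rw [h5]; exact h.conn, by rw [h8]; exact h.root, by rw [h9]; exact h.dist,
    by rw [h10]; exact h.pred⟩

theorem subProblem_subset : subProblem A B l D a ⊆ D := by
  cases a
  · exact Finset.Subset.refl _
  · exact Finset.sdiff_subset

/-- The state in which the results for the subsets up to the `a`-th one have been recorded. -/
structure Recorded (B : ℕ) (A : ℕ → ℕ → Prop) (l : ℕ) (D : Finset ℕ) (a : ℕ) (s : RamState) :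
    Prop where
  level : s.var 5 = l + 1
  below : s.var 9 = l
  index : s.var 10 = a
  set : Represents B (s.arr 4) D
  tables : ConnTables B A D s
  row15 : RowRep B (s.arr 15) (l + 1) (· ∈ obst A B l D)
  row16 : RowRep B (s.arr 16) (l + 1) fun v => v ∈ obst A B l D ∨ ∃ b < a,
    v ∈ sel A D (subProblem A B l D (b + 1)) (obst A B l (subProblem A B l D (b + 1)))
  row17 : RowRep B (s.arr 17) (l + 1) fun v => ∃ b < a, v ∈ D ∧
    ¬ ∃ u, Conn A D v u ∧ u ∈ obst A B l (subProblem A B l D (b + 1))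

theorem exists_lt_succ_or {p : ℕ → Prop} {a : ℕ} (ha : a ≠ 0) :
    (∃ b < a, p b) ↔ (∃ b < a - 1, p b) ∨ p (a - 1) := by
  constructor
  · rintro ⟨b, hb, h⟩
    rcases Nat.lt_or_ge b (a - 1) with h' | h'
    · exact .inl ⟨b, h', h⟩
    · obtain rfl : b = a - 1 := by omega
      exact .inr h
  · rintro (⟨b, hb, h⟩ | h)
    · exact ⟨b, by omega, h⟩
    · exact ⟨a - 1, by omega, h⟩

/-- The part of `returned` that records the result. -/
def record : BCmd := .seq loadRows (.ite (var 10) recordNext recordFirst)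

/-- Index `0` belongs to `D` itself, whose result is the set `X` from which ranks are taken; index
`a + 1` belongs to `D` without the vertices of rank `a`. Recording index `a` therefore completes the
ranks below `a`. -/
theorem record_spec (hAs : Symmetric A) (hE : TickEnv B A lev s) (hDB : D ⊆ Finset.range B)
    (h : Returned B A l D a s) : Recorded B A l D a (record.den s) ∧ Keep B (l + 1) s (record.den s) := by
  have hs := loadRows_spec (D' := subProblem A B l D a) hAs hE.bound hDB
    (subProblem_subset.trans hDB) (hE.bound ▸ hE.bound.symm ▸ hE.size) hE.adj h.level h.count h.set h.sub
  simp only [record, seq_den]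
  have f1 := den_frame loadRows s
  set s1 := loadRows.den s
  obtain ⟨h9, h10, h4, hT, h19⟩ := hs
  have b1 : s1.var 4 = B := by simp (disch := decide) only [f1.1, hE.bound]
  have l1 : s1.var 5 = l + 1 := by simp (disch := decide) only [f1.1, h.level]
  have z1 : Represents B (s1.arr 11) (obst A B l (subProblem A B l D a)) := by
    simp (disch := decide) only [f1.2]; exact h.result
  have c13 : s1.arr 13 = s.arr 13 := by simp (disch := decide) only [f1.2]
  have c15 : s1.arr 15 = s.arr 15 := by simp (disch := decide) only [f1.2]
  have c16 : s1.arr 16 = s.arr 16 := by simp (disch := decide) only [f1.2]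
  have c17 : s1.arr 17 = s.arr 17 := by simp (disch := decide) only [f1.2]
  have c22 : s1.arr 22 = s.arr 22 := by simp (disch := decide) only [f1.2]
  clear_value s1
  by_cases ha : a = 0
  · subst ha
    rw [ite_den_of_not (by simp [h10])]
    obtain ⟨g1, g2, g3, g4, g5, g6⟩ := recordFirst_spec b1 l1 z1
    refine ⟨⟨?_, ?_, ?_, ?_, ?_, g1, ?_, ?_⟩, ⟨?_, ?_, ?_, ?_, ?_⟩⟩
    · simp (disch := decide) only [den_var, l1]
    · simp (disch := decide) only [den_var, h9]
    · simp (disch := decide) only [den_var, h10]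
    · simp (disch := decide) only [den_arr]; exact h4
    · exact hT.congr (den_arr (by decide)) (den_arr (by decide)) (den_arr (by decide))
        (den_arr (by decide))
    · intro v hv
      rw [g2 v hv]
      simp [subProblem]
    · intro v hv
      rw [g3 v hv]
      simp
    · intro r v hv hr; simp (disch := decide) only [den_arr, c13]
    · intro r v hv hr; rw [g4 r v hv (by omega), c15]
    · intro r v hv hr; rw [g5 r v hv (by omega), c16]
    · intro r v hv hr; rw [g6 r v hv (by omega), c17]
    · intro r hr; simp (disch := decide) only [den_arr, c22]
  · rw [ite_den_of_ne (by simp [h10, ha])]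
    obtain ⟨g2, g3, g5, g6⟩ := recordNext_spec b1 l1 h4 hT h19 z1
      ((obst_subset hAs).trans (subProblem_subset.trans hDB)) (c16 ▸ h.row16 ha) (c17 ▸ h.row17 ha)
    refine ⟨⟨?_, ?_, ?_, ?_, ?_, ?_, ?_, ?_⟩, ⟨?_, ?_, ?_, ?_, ?_⟩⟩
    · simp (disch := decide) only [den_var, l1]
    · simp (disch := decide) only [den_var, h9]
    · simp (disch := decide) only [den_var, h10]
    · simp (disch := decide) only [den_arr]; exact h4
    · exact hT.congr (den_arr (by decide)) (den_arr (by decide)) (den_arr (by decide))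
        (den_arr (by decide))
    · simp (disch := decide) only [den_arr, c15]; exact h.row15 ha
    · intro v hv
      rw [g2 v hv]
      beta_reduce
      rw [exists_lt_succ_or ha, or_assoc, Nat.sub_add_cancel (by omega)]
    · intro v hv
      rw [g3 v hv]
      beta_reduce
      rw [exists_lt_succ_or ha, Nat.sub_add_cancel (by omega)]
    · intro r v hv hr; simp (disch := decide) only [den_arr, c13]
    · intro r v hv hr; simp (disch := decide) only [den_arr, c15]
    · intro r v hv hr; rw [g5 r v hv (by omega), c16]
    · intro r v hv hr; rw [g6 r v hv (by omega), c17]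
    · intro r hr; simp (disch := decide) only [den_arr, c22]

theorem TickEnv.frame (hE : TickEnv B A lev s) (h4 : s'.var 4 = s.var 4) (h0 : s'.var 0 = s.var 0)
    (h7 : s'.var 7 = s.var 7) (a0 : s'.arr 0 = s.arr 0) (a18 : s'.arr 18 = s.arr 18) :
    TickEnv B A lev s' :=
  ⟨h4.trans hE.bound, h0 ▸ hE.size, by rw [h0, a0]; exact hE.adj, h7.trans hE.level,
    by rw [a18]; exact hE.pow⟩

/-- The state in which a set is to be processed at level `l`. -/
structure Called (B l : ℕ) (D : Finset ℕ) (s : RamState) : Prop where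
  level : s.var 5 = l
  mode : s.var 6 = 0
  set : RowRep B (s.arr 13) l (· ∈ D)

theorem returned_eq (s : RamState) : returned.den s =
    ((ite (lt (var 10) (var 12)) nextSub combine).den ((setVar 12
      (get 18 (sub (sub (get 18 (add (var 5) (const 1))) (var 5)) (const 3)))).den (record.den s))) :=
  rfl

/-- While ranks remain, the next subset is prepared one level below; after the last one the results
are combined and the computation moves one level up. In both cases the stack above the current level
is untouched. -/
theorem returned_spec (hAs : Symmetric A) (hE : TickEnv B A lev s) (hDB : D ⊆ Finset.range B)
    (hl : l + 2 ≤ B) (hp : 2 ^ (l + 2) ≤ B) (h : Returned B A l D a s) :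
    Keep B (l + 1) s (returned.den s) ∧
    (a < obstBound l → Called B l (subProblem A B l D (a + 1)) (returned.den s) ∧
      (returned.den s).arr 22 (l + 1) = a + 1 ∧
      RowRep B ((returned.den s).arr 15) (l + 1) (· ∈ obst A B l D) ∧
      RowRep B ((returned.den s).arr 16) (l + 1) (fun v => v ∈ obst A B l D ∨ ∃ b < a,
        v ∈ sel A D (subProblem A B l D (b + 1)) (obst A B l (subProblem A B l D (b + 1)))) ∧
      RowRep B ((returned.den s).arr 17) (l + 1) (fun v => ∃ b < a, v ∈ D ∧
        ¬ ∃ u, Conn A D v u ∧ u ∈ obst A B l (subProblem A B l D (b + 1)))) ∧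
    (a = obstBound l → (returned.den s).var 5 = l + 2 ∧ (returned.den s).var 6 ≠ 0 ∧
      Represents B ((returned.den s).arr 11) (obst A B (l + 1) D)) := by
  obtain ⟨hR, hK⟩ := record_spec hAs hE hDB h
  have hE1 : TickEnv B A lev (record.den s) := hE.frame (den_var (by decide)) (den_var (by decide))
    (den_var (by decide)) (den_arr (by decide)) (den_arr (by decide))
  have m1 : (record.den s).var 6 ≠ 0 := by simp (disch := decide) only [den_var]; exact h.mode
  rw [returned_eq]
  set s1 := record.den s
  clear_value s1
  set s2 := (setVar 12 (get 18 (sub (sub (get 18 (add (var 5) (const 1))) (var 5)) (const 3)))).den s1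
    with hs2
  -- Variable `5` holds `l + 1`, so the index read is `2^(l+2) - (l+1) - 3 = 4 * 2^l - l - 4`, the
  -- exponent in `obstBound l`.
  have v12 : s2.var 12 = obstBound l := by
    rw [hs2, var_setVar]
    simp only [eval_get, eval_sub, eval_add, eval_var, eval_const, hR.level]
    have hp' : 2 ^ (l + 1 + 1) ≤ B := hp
    rw [hE1.pow (l + 1 + 1) hl, hE1.pow _ (by omega)]
    unfold obstBound
    congr 1
    rw [pow_succ, pow_succ]; omega
  have e2 : s2.arr = s1.arr := rfl
  have v2 : ∀ x, x ≠ 12 → s2.var x = s1.var x := fun x hx => den_var (by simpa [modV] using hx)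
  clear_value s2
  have hT2 : ConnTables B A D s2 := hR.tables.congr (by rw [e2]) (by rw [e2]) (by rw [e2]) (by rw [e2])
  have hX : obst A B l D ⊆ Finset.range B := (obst_subset hAs).trans hDB
  have hK2 : Keep B (l + 1) s s2 := ⟨by rw [e2]; exact hK.sets, by rw [e2]; exact hK.row15,
    by rw [e2]; exact hK.row16, by rw [e2]; exact hK.row17, by rw [e2]; exact hK.count⟩
  have w4 : s2.var 4 = B := (v2 4 (by decide)).trans hE1.bound
  have w5 : s2.var 5 = l + 1 := (v2 5 (by decide)).trans hR.level
  have w9 : s2.var 9 = l := (v2 9 (by decide)).trans hR.below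
  have w10 : s2.var 10 = a := (v2 10 (by decide)).trans hR.index
  by_cases ha : a < obstBound l
  · rw [ite_den_of_ne (by simp only [holds_lt, eval_var, v12, w10]; exact ha)]
    obtain ⟨g1, g2, g3, g4, g5⟩ := nextSub_spec (D := D) (X := obst A B l D) w4 w5 w9 w10
      (by rw [e2]; exact hR.set) hT2 (by rw [e2]; exact hR.row15) hX
    refine ⟨hK2.trans ⟨?_, ?_, ?_, ?_, ?_⟩, fun _ => ⟨⟨g1, g2, g4⟩, ?_, ?_, ?_, ?_⟩, fun h => by omega⟩
    · intro r v hv hr; exact g5 r v hv (by omega)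
    · intro r v hv hr; rw [den_arr (by decide)]
    · intro r v hv hr; rw [den_arr (by decide)]
    · intro r v hv hr; rw [den_arr (by decide)]
    · intro r hr; rw [g3, if_neg (by omega)]
    · rw [g3, if_pos rfl]
    · rw [den_arr (by decide), e2]; exact hR.row15
    · rw [den_arr (by decide), e2]; exact hR.row16
    · rw [den_arr (by decide), e2]; exact hR.row17
  · rw [ite_den_of_not (by simp only [holds_lt, eval_var, v12, w10]; exact ha)]
    refine ⟨hK2.trans ⟨?_, ?_, ?_, ?_, ?_⟩, fun h => absurd h ha, fun ha => ?_⟩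
    · intro r v hv hr; rw [den_arr (by decide)]
    · intro r v hv hr; rw [den_arr (by decide)]
    · intro r v hv hr; rw [den_arr (by decide)]
    · intro r v hv hr; rw [den_arr (by decide)]
    · intro r hr; rw [den_arr (by decide)]
    -- The universal condition in `cand` is the complement of array `17`, which records the ranks
    -- for which it fails.
    · obtain ⟨g1, g2⟩ := combine_spec (U := cand A B l D) hAs w4 hDB
        ((v2 0 (by decide)).symm ▸ hE1.size) (by rw [v2 0 (by decide), e2]; exact hE1.adj)
        (by rw [e2]; exact hR.set) w5 (by rw [e2]; exact hE1.pow _ (by omega)) (by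
          intro v hv
          rw [e2, hR.row16 v hv, hR.row17 v hv, mem_cand, ha]
          simp only [subProblem]
          constructor
          · rintro ⟨h1, h2⟩
            have hvD : v ∈ D := by
              rcases h1 with h1 | ⟨b, -, h1⟩
              · exact obst_subset hAs h1
              · exact Finset.sdiff_subset (obst_subset hAs (mem_sel.1 h1).1)
            refine ⟨hvD, h1, fun b hb => ?_⟩
            by_contra hc
            exact h2 ⟨b, hb, hvD, hc⟩
          · rintro ⟨hvD, h1, h2⟩
            refine ⟨h1, ?_⟩
            rintro ⟨b, hb, -, h3⟩
            exact h3 (h2 b hb))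
      refine ⟨g1, ?_, g2⟩
      rw [den_var (by decide), v2 6 (by decide)]
      exact m1

/-- The number of steps for the computation at level `l`. -/
def tickCount : ℕ → ℕ
  | 0 => 1
  | l + 1 => 1 + (obstBound l + 1) * (tickCount l + 1)

theorem TickEnv.iter {i m : ℕ} (hE : TickEnv B A lev s) : TickEnv B A lev (iter 8 tick i m s) :=
  have f := iter_frame 8 tick i m s
  hE.frame (f.1 _ (by decide)) (f.1 _ (by decide)) (f.1 _ (by decide)) (f.2 _ (by decide))
    (f.2 _ (by decide))

theorem TickEnv.setV {i : ℕ} (hE : TickEnv B A lev s) : TickEnv B A lev (s.setV 8 i) :=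
  ⟨hE.bound, hE.size, hE.adj, hE.level, hE.pow⟩

theorem tick_returned (hE : TickEnv B A lev s) (h5 : s.var 5 = l) (hl : l ≤ lev) (h6 : s.var 6 ≠ 0) :
    tick.den s = returned.den s := by
  rw [tick, ite_den_of_not (by simp only [holds_lt, eval_var, hE.level, h5]; omega),
    ite_den_of_ne (by simpa using h6)]

/-- The computation at level `l` returns the obstruction of the current set. -/
theorem iter_tick (hAs : Symmetric A) (hp : 2 ^ (lev + 1) ≤ B) (hl : l ≤ lev) :
    ∀ (i : ℕ) (s : RamState) (D : Finset ℕ), TickEnv B A lev s → D ⊆ Finset.range B →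
      Called B l D s →
      (iter 8 tick i (tickCount l) s).var 5 = l + 1 ∧ (iter 8 tick i (tickCount l) s).var 6 ≠ 0 ∧
      Represents B ((iter 8 tick i (tickCount l) s).arr 11) (obst A B l D) ∧
      Keep B l s (iter 8 tick i (tickCount l) s) := by
  induction l with
  | zero =>
    intro i s D hE hDB hC
    have h1 : iter 8 tick i (tickCount 0) s = callLeaf.den (s.setV 8 i) := by
      simp only [tickCount, iter, tick]
      rw [ite_den_of_not (by simp [hE.level, hC.level]), ite_den_of_not (by simp [hC.mode]),
        ite_den_of_not (by simp [hC.level])]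
    rw [h1]
    obtain ⟨g1, g2, g3⟩ := callLeaf_spec (s := s.setV 8 i) hAs hE.setV.bound hDB hE.setV.size
      hE.setV.adj hC.level hC.set
    refine ⟨g1, by simp [g2], g3, ?_, ?_, ?_, ?_, ?_⟩
    · intro r v hv hr; rw [den_arr (by decide)]; rfl
    · intro r v hv hr; rw [den_arr (by decide)]; rfl
    · intro r v hv hr; rw [den_arr (by decide)]; rfl
    · intro r v hv hr; rw [den_arr (by decide)]; rfl
    · intro r hr; rw [den_arr (by decide)]; rfl
  | succ l ih =>
    intro i s D hE hDB hC
    have hlB : l + 2 ≤ B ∧ 2 ^ (l + 2) ≤ B := by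
      have h1 : 2 ^ (l + 2) ≤ 2 ^ (lev + 1) := Nat.pow_le_pow_right (by norm_num) (by omega)
      have h2 : l + 2 < 2 ^ (l + 2) := Nat.lt_two_pow_self
      omega
    -- after the results for the first `a + 1` subsets have been computed
    have key : ∀ a ≤ obstBound l, Returned B A l D a
        (iter 8 tick i (1 + tickCount l + a * (1 + tickCount l)) s) ∧
        Keep B (l + 1) s (iter 8 tick i (1 + tickCount l + a * (1 + tickCount l)) s) := by
      intro a
      induction a with
      | zero =>
        intro _
        rw [Nat.zero_mul, Nat.add_zero, iter_add]
        have h1 : iter 8 tick i 1 s = callSub.den (s.setV 8 i) := by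
          simp only [iter, tick]
          rw [ite_den_of_not (by simp [hE.level, hC.level]; omega), ite_den_of_not (by simp [hC.mode]),
            ite_den_of_ne (by simp [hC.level])]
        obtain ⟨g1, g2, g3, g4⟩ := callSub_spec (s := s.setV 8 i) hE.setV.bound hC.level hC.set
        have hE1 := hE.iter (i := i) (m := 1)
        rw [h1] at hE1 ⊢
        have k1 : Keep B (l + 1) s (callSub.den (s.setV 8 i)) := by
          refine ⟨?_, ?_, ?_, ?_, ?_⟩
          · intro r v hv hr; rw [g4 r v hv (by omega)]; rfl
          · intro r v hv hr; rw [den_arr (by decide)]; rfl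
          · intro r v hv hr; rw [den_arr (by decide)]; rfl
          · intro r v hv hr; rw [den_arr (by decide)]; rfl
          · intro r hr; rw [g2, if_neg (by omega)]; rfl
        have m1 : (callSub.den (s.setV 8 i)).var 6 = 0 := by
          rw [den_var (by decide)]; simpa using hC.mode
        have c1 := g2 (l + 1)
        rw [if_pos rfl] at c1
        set s1 := callSub.den (s.setV 8 i)
        clear_value s1
        obtain ⟨r1, r2, r3, r4⟩ := ih (by omega) (i + 1) s1 D hE1 hDB ⟨g1, m1, g3⟩
        refine ⟨⟨r1, r2, ?_, ?_, ?_, r3, by simp, by simp, by simp⟩, k1.trans (r4.mono (by omega))⟩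
        · rw [r4.count _ (by omega), c1]
        · intro v hv
          rw [r4.sets _ v hv (by omega), k1.sets _ v hv le_rfl]
          exact hC.set v hv
        · intro v hv
          rw [r4.sets _ v hv le_rfl]
          exact g3 v hv
      | succ a iha =>
        intro ha
        obtain ⟨hR, hK⟩ := iha (by omega)
        rw [Nat.succ_mul, ← Nat.add_assoc, iter_add]
        have hE0 := hE.iter (i := i) (m := 1 + tickCount l + a * (1 + tickCount l))
        set i0 := i + (1 + tickCount l + a * (1 + tickCount l))
        set s0 := iter 8 tick i (1 + tickCount l + a * (1 + tickCount l)) s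
        clear_value s0 i0
        have hR' : Returned B A l D a (s0.setV 8 i0) := ⟨hR.level, hR.mode, hR.count, hR.set, hR.sub,
          hR.result, hR.row15, hR.row16, hR.row17⟩
        rw [iter_add]
        have h1 : iter 8 tick i0 1 s0 = returned.den (s0.setV 8 i0) :=
          tick_returned hE0.setV hR'.level hl hR'.mode
        have hE1 := hE0.iter (i := i0) (m := 1)
        obtain ⟨k1, n1, -⟩ := returned_spec hAs hE0.setV hDB hlB.1 hlB.2 hR'
        obtain ⟨n2, n3, n4, n5, n6⟩ := n1 (by omega)
        have k1' : Keep B (l + 1) s0 (returned.den (s0.setV 8 i0)) :=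
          ⟨k1.sets, k1.row15, k1.row16, k1.row17, k1.count⟩
        rw [h1] at hE1 ⊢
        set s1 := returned.den (s0.setV 8 i0)
        clear_value s1
        obtain ⟨r1, r2, r3, r4⟩ := ih (by omega) (i0 + 1) s1 _ hE1
          (subProblem_subset.trans hDB) n2
        refine ⟨⟨r1, r2, ?_, ?_, ?_, r3, ?_, ?_, ?_⟩, (hK.trans k1').trans (r4.mono (by omega))⟩
        · rw [r4.count _ (by omega), n3]
        · intro v hv
          rw [r4.sets _ v hv (by omega), k1'.sets _ v hv le_rfl]
          exact hR.set v hv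
        · intro v hv
          rw [r4.sets _ v hv le_rfl]
          exact n2.set v hv
        · intro _ v hv
          rw [r4.row15 _ v hv (by omega)]; exact n4 v hv
        · intro _ v hv
          rw [r4.row16 _ v hv (by omega)]; exact n5 v hv
        · intro _ v hv
          rw [r4.row17 _ v hv (by omega)]; exact n6 v hv
    obtain ⟨hR, hK⟩ := key (obstBound l) le_rfl
    -- One tick to call the first subset, one to pass to each further subset, and one final tick to
    -- combine.
    have hcount : tickCount (l + 1) = 1 + tickCount l + obstBound l * (1 + tickCount l) + 1 := by
      simp only [tickCount]; ring
    rw [hcount, iter_add]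
    have hE0 := hE.iter (i := i) (m := 1 + tickCount l + obstBound l * (1 + tickCount l))
    set i0 := i + (1 + tickCount l + obstBound l * (1 + tickCount l))
    set s0 := iter 8 tick i (1 + tickCount l + obstBound l * (1 + tickCount l)) s
    clear_value s0 i0
    have hR' : Returned B A l D (obstBound l) (s0.setV 8 i0) := ⟨hR.level, hR.mode, hR.count, hR.set,
      hR.sub, hR.result, hR.row15, hR.row16, hR.row17⟩
    have h1 : iter 8 tick i0 1 s0 = returned.den (s0.setV 8 i0) :=
      tick_returned hE0.setV hR'.level hl hR'.mode
    obtain ⟨k1, -, n1⟩ := returned_spec hAs hE0.setV hDB hlB.1 hlB.2 hR'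
    obtain ⟨n2, n3, n4⟩ := n1 rfl
    rw [h1]
    exact ⟨n2, n3, n4, hK.trans ⟨k1.sets, k1.row15, k1.row16, k1.row17, k1.count⟩⟩

end BCmd

/-! ### The test for small tree-depth -/

namespace BCmd

open BExpr

/-- The factors at one level are at most `2^(4 * 2^l)` and, inductively, `2^(6 * 2^l)`; this leaves
`2^(2 * 2^l) ≥ 4` of room for the additive terms. -/
theorem tickCount_le (l : ℕ) : tickCount l + 1 ≤ 2 ^ (6 * 2 ^ l) := by
  induction l with
  | zero => norm_num [tickCount]
  | succ l ih =>
    have h1 : obstBound l + 1 ≤ 2 ^ (4 * 2 ^ l) := by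
      have h2 : obstBound l < 2 ^ (4 * 2 ^ l) := by
        have := Nat.one_le_two_pow (n := l)
        exact Nat.pow_lt_pow_right (by norm_num) (by omega)
      omega
    have h3 : 2 ^ (6 * 2 ^ (l + 1)) = 2 ^ (2 * 2 ^ l) * (2 ^ (4 * 2 ^ l) * 2 ^ (6 * 2 ^ l)) := by
      rw [← pow_add, ← pow_add]; congr 1; ring
    have h4 : 4 ≤ 2 ^ (2 * 2 ^ l) := by
      calc 4 = 2 ^ 2 := rfl
        _ ≤ _ := Nat.pow_le_pow_right (by norm_num) (by have := Nat.one_le_two_pow (n := l); omega)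
    have h5 := Nat.mul_le_mul h1 ih
    have h6 : 1 ≤ 2 ^ (4 * 2 ^ l) * 2 ^ (6 * 2 ^ l) := Nat.mul_pos (by positivity) (by positivity)
    rw [h3, tickCount]
    nlinarith

/-- Compute the obstruction of the set in array `21` at the level in variable `7`. -/
def find : BCmd :=
  .seq (tabAux 13 [7] [20] (get 21 (var 20)))
  (.seq (.setVar 5 (var 7))
  (.seq (.setVar 6 (const 0))
  (.loop 8 tick)))

/-- The result of `find` is not empty. -/
def found : BExpr := ex 20 (get 11 (var 20))

theorem tick_done {B lev : ℕ} {A : ℕ → ℕ → Prop} {s : RamState} (hE : TickEnv B A lev s)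
    (h : lev < s.var 5) : tick.den s = s := by
  rw [tick, ite_den_of_ne (by simpa only [holds_lt, eval_var, hE.level] using h)]
  rfl

/-- The loop performs `B` ticks, at least as many as needed; once the level in variable `5` exceeds
the requested one, further ticks do nothing. The answer is read off by `obst_eq_empty`. -/
theorem find_spec {B lev : ℕ} {A : ℕ → ℕ → Prop} {D : Finset ℕ} {s : RamState} (hAs : Symmetric A)
    (hE : TickEnv B A lev s) (hB : 2 ^ (6 * 2 ^ lev) ≤ B) (hDB : D ⊆ Finset.range B)
    (hD : Represents B (s.arr 21) D) :
    found.holds (find.den s).var (find.den s).arr ↔ ¬ TdLe A lev D := by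
  have hp : 2 ^ (lev + 1) ≤ B := by
    refine le_trans (Nat.pow_le_pow_right (by norm_num) ?_) hB
    have : lev < 2 ^ lev := Nat.lt_two_pow_self
    omega
  have ht : tickCount lev ≤ B := by have := tickCount_le lev; omega
  simp only [find, seq_den]
  set s1 := (setVar 6 (const 0)).den ((setVar 5 (var 7)).den
    ((tabAux 13 [7] [20] (get 21 (var 20))).den s)) with hs1
  have hE1 : TickEnv B A lev s1 := hE.frame (by simp (disch := decide) only [hs1, den_var])
    (by simp (disch := decide) only [hs1, den_var]) (by simp (disch := decide) only [hs1, den_var])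
    (by simp (disch := decide) only [hs1, den_arr]) (by simp (disch := decide) only [hs1, den_arr])
  have hC : Called B lev D s1 := by
    refine ⟨?_, ?_, ?_⟩
    · simp (disch := decide) only [hs1, den_var, var_setVar, eval_var, hE.level]
    · simp (disch := decide) only [hs1, var_setVar, eval_const]
    · intro v hv
      have hB := hE.bound
      have h7 := hE.level
      simp
        (disch := first | assumption | decide)
        only [hs1, arr_row_ne, den_arr, holds_get, eval_var, Function.update_self]
      exact hD v hv
  clear_value s1
  have hf := den_frame (loop 8 tick) s1
  have hB2 : ((loop 8 tick).den s1).var 4 = B := by rw [hf.1 4 (by decide), hE1.bound]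
  have key : ∀ m, (iter 8 tick 0 (tickCount lev + m) s1).var 5 = lev + 1 ∧
      Represents B ((iter 8 tick 0 (tickCount lev + m) s1).arr 11) (obst A B lev D) := by
    intro m
    induction m with
    | zero =>
      obtain ⟨h1, -, h2, -⟩ := iter_tick hAs hp le_rfl 0 s1 D hE1 hDB hC
      exact ⟨h1, h2⟩
    | succ m ih =>
      rw [← Nat.add_assoc, iter_succ]
      have hE2 := (hE1.iter (i := 0) (m := tickCount lev + m)).setV (i := 0 + (tickCount lev + m))
      have h5 : ((iter 8 tick 0 (tickCount lev + m) s1).setV 8 (0 + (tickCount lev + m))).var 5 =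
        lev + 1 := ih.1
      rw [tick_done hE2 (by rw [h5]; omega)]
      exact ⟨h5, ih.2⟩
  have h11 := (key (B - tickCount lev)).2
  rw [Nat.add_sub_cancel' ht, ← hE1.bound, ← den_loop, hE1.bound] at h11
  have hcard : D.card ≤ B := by simpa using Finset.card_le_card hDB
  rw [← obst_eq_empty hAs hcard, ← ne_eq, ← Finset.nonempty_iff_ne_empty]
  simp (disch := decide) only [found, holds_ex, holds_get, eval_var, Function.update_self, hB2]
  constructor
  · rintro ⟨i, hi, h⟩
    exact ⟨i, (h11 i hi).1 h⟩
  · rintro ⟨i, hi⟩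
    have hiB := Finset.mem_range.1 (hDB (obst_subset hAs hi))
    exact ⟨i, hiB, (h11 i hiB).2 hi⟩

end BCmd

/-! ### The search for packings: sets of columns -/

/-- The set of columns that a number stands for. -/
def bitSet (A : ℕ) : Finset ℕ := A.bitIndices.toFinset

theorem mem_bitSet {A a : ℕ} : a ∈ bitSet A ↔ A.testBit a := by simp [bitSet]

theorem bitSet_sub {A a : ℕ} (h : a ∈ bitSet A) : bitSet (A - 2 ^ a) = (bitSet A).erase a := by
  have h1 : A - 2 ^ a = ∑ i ∈ (bitSet A).erase a, 2 ^ i := by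
    have h2 : ∑ i ∈ bitSet A, 2 ^ i = A := Finset.sum_toFinset_bitIndices_two_pow A
    rw [← Finset.add_sum_erase _ _ h] at h2
    omega
  rw [h1]
  exact Finset.toFinset_bitIndices_sum_two_pow _

theorem bitSet_subset {A B : ℕ} (h : A < B) : bitSet A ⊆ Finset.range B := by
  intro a ha
  have := Nat.two_pow_le_of_mem_bitIndices (List.mem_toFinset.1 ha)
  have h2 : a < 2 ^ a := Nat.lt_two_pow_self
  exact Finset.mem_range.2 (by omega)

/-- Since `2 a ≤ 2^a + 1`, two columns occurring in numbers below `B` have `a + b ≤ B`, so a loop up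
to the bound can compute the power with exponent `a + b`. -/
theorem bitSet_two_mul_le {A B a : ℕ} (h : A < B) (ha : a ∈ bitSet A) : 2 * a ≤ B := by
  have h1 := Nat.two_pow_le_of_mem_bitIndices (List.mem_toFinset.1 ha)
  suffices h2 : 2 * a ≤ 2 ^ a + 1 by omega
  clear h1 ha h
  induction a with
  | zero => simp
  | succ a ih =>
    rw [pow_succ]
    rcases a with _ | a
    · norm_num
    · have : 2 ≤ 2 ^ (a + 1) := by rw [pow_succ]; have := Nat.one_le_two_pow (n := a); omega
      omega

theorem bitSet_two_pow_sub_one (i : ℕ) : bitSet (2 ^ i - 1) = Finset.range i := by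
  ext a
  rw [mem_bitSet, Nat.testBit_two_pow_sub_one, Finset.mem_range, decide_eq_true_eq]

theorem bitSet_eq_empty {A : ℕ} : bitSet A = ∅ ↔ A = 0 := by
  constructor
  · intro h
    rw [← Finset.sum_toFinset_bitIndices_two_pow A]
    unfold bitSet at h
    rw [h]; simp
  · rintro rfl; simp [bitSet]

/-- The machine has no division, so a bit is tested by searching for the higher and lower parts of
the number. -/
theorem mem_bitSet_iff_exists {A a : ℕ} :
    a ∈ bitSet A ↔ ∃ hi ≤ A, ∃ lo < 2 ^ a, A = hi * (2 ^ a + 2 ^ a) + (2 ^ a + lo) := by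
  rw [mem_bitSet, Nat.testBit_eq_decide_div_mod_eq, decide_eq_true_eq]
  have hp : 0 < 2 ^ a := by positivity
  constructor
  · intro h
    refine ⟨A / 2 ^ a / 2, (Nat.div_le_self _ _).trans (Nat.div_le_self _ _), A % 2 ^ a,
      Nat.mod_lt _ hp, ?_⟩
    have h1 := Nat.div_add_mod A (2 ^ a)
    have h2 := Nat.div_add_mod (A / 2 ^ a) 2
    rw [h] at h2
    generalize A / 2 ^ a / 2 = x at *
    generalize A % 2 ^ a = y at *
    rw [← h2] at h1
    linarith
  · rintro ⟨hi, -, lo, hlo, h⟩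
    have h1 : A / 2 ^ a = 2 * hi + 1 := by
      rw [Nat.div_eq_of_lt_le]
      · rw [h]; nlinarith
      · rw [h]; nlinarith
    rw [h1]; omega

-- Parity, too, is expressed as the existence of a half, for the lack of division.
open Classical in
theorem colSign_eq (S : Finset ℕ) (a : ℕ) :
    colSign S a = if ∃ h, (S.filter (a < ·)).card = h + h + 1 then -1 else 1 := by
  unfold colSign
  rcases Nat.even_or_odd' (S.filter (a < ·)).card with ⟨c, hc | hc⟩
  · rw [if_neg (by rintro ⟨h, h'⟩; omega), hc]; simp
  · rw [if_pos ⟨c, by omega⟩, hc, pow_succ]; simp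

namespace BCmd

open BExpr

/-- Tables of the powers of `2`, of the bits of the numbers below the bound, and of signs. -/
def tables : BCmd :=
  .seq (.setArr 18 (const 0) (const 1))
  (.seq (.loop 15 (.setArr 18 (add (var 15) (const 1)) (add (get 18 (var 15)) (get 18 (var 15)))))
  (.seq (tab 30 [41, 45] (bool (ex 47 (ex 48 (and (lt (var 48) (get 18 (var 45)))
    (eq (var 41) (add (mul (var 47) (add (get 18 (var 45)) (get 18 (var 45))))
      (add (get 18 (var 45)) (var 48)))))))))
  (tab 31 [41, 45] (bool (ex 47 (eq (sum 46 (bool (and (lt (var 45) (var 46))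
    (at2 30 (var 41) (var 46))))) (add (add (var 47) (var 47)) (const 1))))))))

/-- What `tables` computes. -/
structure BitTables (B : ℕ) (s : RamState) : Prop where
  pow : ∀ i ≤ B, s.arr 18 i = 2 ^ i
  bit : ∀ A < B, ∀ a < B, s.arr 30 (B * A + a) ≠ 0 ↔ a ∈ bitSet A
  sign : ∀ A < B, ∀ a < B, s.arr 31 (B * A + a) ≠ 0 ↔
    ∃ h, ((bitSet A).filter (a < ·)).card = h + h + 1

/-- All witnesses of the existential searches are below `B`: the high and low parts of a number are
smaller than the number, and half the count of columns is smaller than `B`. -/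
theorem tables_spec {s : RamState} {B : ℕ} (hB : s.var 4 = B) : BitTables B (tables.den s) := by
  simp only [tables, seq_den]
  set s0 := (setArr 18 (const 0) (const 1)).den s with hs0
  have h0 : s0.var 4 = B := by simp (disch := decide) only [hs0, den_var, hB]
  have hp := loop_inv (x := 15) (a := .setArr 18 (add (var 15) (const 1))
    (add (get 18 (var 15)) (get 18 (var 15)))) (s := s0) (fun i s => ∀ j ≤ i, s.arr 18 j = 2 ^ j) (by
      intro j hj
      obtain rfl : j = 0 := by omega
      simp [hs0, arr_setArr]) (by
      intro i hi s' hf hI j hj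
      rw [arr_setArr]
      simp only [eval_add, eval_var, eval_const, RamState.setV_var, Function.update_self, eval_get,
        RamState.setV_arr]
      split_ifs with h
      · rw [hI i le_rfl, h, pow_succ]; ring
      · exact hI j (by omega))
  have hf := den_frame (loop 15 (.setArr 18 (add (var 15) (const 1))
    (add (get 18 (var 15)) (get 18 (var 15))))) s0
  rw [h0] at hp
  set s1 := (loop 15 (.setArr 18 (add (var 15) (const 1))
    (add (get 18 (var 15)) (get 18 (var 15))))).den s0 with hs1
  have h1 : s1.var 4 = B := by rw [hf.1 4 (by decide), h0]
  clear_value s1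
  set e := (bool (ex 47 (ex 48 (and (lt (var 48) (get 18 (var 45)))
    (eq (var 41) (add (mul (var 47) (add (get 18 (var 45)) (get 18 (var 45))))
      (add (get 18 (var 45)) (var 48)))))))) with he
  have hb : ∀ A < B, ∀ a < B, ((tab 30 [41, 45] e).den s1).arr 30 (B * A + a) ≠ 0 ↔ a ∈ bitSet A := by
    intro A hA a ha
    rw [arr_tab2_ne rfl h1 hA ha]
    simp (disch := decide) only [he, holds_bool, holds_ex, holds_and, holds_lt, holds_eq, eval_var,
      Function.update_self, Function.update_of_ne, eval_add, eval_mul, eval_get, h1, hp a ha.le]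
    rw [mem_bitSet_iff_exists]
    constructor
    · rintro ⟨hi, hhi, lo, -, hlo, h⟩
      rw [min_eq_left hhi.le] at h
      refine ⟨hi, ?_, lo, hlo, h⟩
      have : 1 ≤ 2 ^ a := Nat.one_le_two_pow
      nlinarith
    · rintro ⟨hi, hhi, lo, hlo, h⟩
      exact ⟨hi, by omega, lo, by omega, hlo, by rw [min_eq_left (by omega)]; exact h⟩
  set s2 := (tab 30 [41, 45] e).den s1 with hs2
  have h2 : s2.var 4 = B := by simp (disch := decide) only [hs2, den_var, h1]
  have hp2 : ∀ i ≤ B, s2.arr 18 i = 2 ^ i := by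
    simp (disch := decide) only [hs2, den_arr]; exact hp
  clear_value s2
  refine ⟨?_, ?_, ?_⟩
  · simp (disch := decide) only [den_arr]; exact hp2
  · simp (disch := decide) only [den_arr]; exact hb
  · intro A hA a ha
    rw [arr_tab2_ne rfl h2 hA ha]
    have hsub : (bitSet A).filter (a < ·) ⊆ Finset.range B :=
      (Finset.filter_subset _ _).trans (bitSet_subset hA)
    have hs : ∀ i, ∑ j ∈ Finset.range B, ((bool (and (lt (var 45) (var 46))
        (at2 30 (var 41) (var 46))))).eval (Function.update (Function.update (Function.update
          (Function.update s2.var 41 A) 45 a) 47 i) 46 j) s2.arr = ((bitSet A).filter (a < ·)).card := by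
      intro i
      refine sum_bool_eq_card hsub fun j hj => ?_
      simp (disch := decide) only [holds_and, holds_lt, holds_at2, eval_var, Function.update_self,
        Function.update_of_ne, h2]
      rw [hb A hA j hj, Finset.mem_filter, and_comm]
    simp (disch := decide) only [holds_bool, holds_ex, holds_eq, eval_add, eval_var, eval_const,
      eval_sum, Function.update_self, Function.update_of_ne, h2, hs]
    constructor
    · rintro ⟨i, -, h⟩; exact ⟨i, h⟩
    · rintro ⟨i, h⟩
      refine ⟨i, ?_, h⟩
      have := Finset.card_le_card hsub
      rw [Finset.card_range] at this
      omega

end BCmd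

/-! ### Expressions for the dynamic program over words -/

namespace BCmd

open BExpr

/-- The code of a letter. -/
def letterCode (n : ℕ) (f : Bool) (y : ℕ) : ℕ := if f then n + y else y

/-- The words that the memory describes: paths in the set in array `24`, whose first letters (as many
as variable `30` says) are those in array `25`. -/
def wordSpec (s : RamState) : WordSpec where
  n := s.var 0
  bd := s.var 4
  adj := adjRel (s.var 0) (s.arr 0)
  acc u x := (u = s.var 0 ∧ x = s.var 0) ∨ adjRel (s.var 0) (s.arr 1) u x
  act v := s.arr 24 v ≠ 0
  pref i f y := i < s.var 30 → s.arr 25 i = letterCode (s.var 0) f y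

/-- The number of vertices, the state of the last path, and the sets of columns of a table entry. -/
def entry (t : ℕ) (k A C u y : BExpr) : BExpr := get t (idx [k, A, C, u, y])

/-- Acceptance of the ends of a path. -/
def accE (u x : BExpr) : BExpr := or (and (eq u (var 0)) (eq x (var 0))) (adjE 1 u x)

/-- The sum over the predecessors of the current table entry. -/
def inner (t : ℕ) : BExpr :=
  add
    (BExpr.ite (or (not (lt (var 31) (var 30))) (eq (get 25 (var 31)) (var 44)))
      (sum 47 (BExpr.ite (adjE 0 (var 47) (var 44)) (entry t (var 40) (sub (var 41) (get 18 (var 45)))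
        (sub (var 42) (get 18 (var 46))) (var 43) (var 47)) (const 0))) (const 0))
    (BExpr.ite (and (eq (var 43) (var 44)) (and (le (const 1) (var 40))
        (or (not (lt (var 31) (var 30))) (eq (get 25 (var 31)) (add (var 0) (var 44))))))
      (sum 48 (sum 47 (BExpr.ite (accE (var 48) (var 47)) (entry t (sub (var 40) (const 1))
        (sub (var 41) (get 18 (var 45))) (sub (var 42) (get 18 (var 46))) (var 48) (var 47))
        (const 0)))) (const 0))

/-- The contribution of a pair of columns, for the tables `t`, `t'` of positive and negative parts. -/
def colTerm (t t' : ℕ) : BExpr :=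
  fold 49 50 (BExpr.ite (eq (bool (at2 31 (var 41) (var 45))) (bool (at2 31 (var 42) (var 46))))
    (inner t) (inner t'))
    (BExpr.ite (lt (var 49) (add (var 45) (var 46))) (mul (var 44) (var 50)) (var 50))

/-- An entry of the next table. -/
def nextEntry (t t' : ℕ) : BExpr :=
  BExpr.ite (and (lt (var 44) (var 0)) (get 24 (var 44)))
    (sum 45 (BExpr.ite (at2 30 (var 41) (var 45)) (sum 46 (BExpr.ite (at2 30 (var 42) (var 46)) (colTerm t t')
      (const 0))) (const 0))) (const 0)

theorem eval_entry (t : ℕ) (k A C u y : BExpr) (v : ℕ → ℕ) (m : ℕ → ℕ → ℕ) :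
    (entry t k A C u y).eval v m = m t (hor (v 4)
      [k.eval v m, A.eval v m, C.eval v m, u.eval v m, y.eval v m]) := by
  rw [entry, eval_get, eval_idx]; rfl

theorem holds_accE (a b : BExpr) {v : ℕ → ℕ} {m : ℕ → ℕ → ℕ} (h : v 0 ≤ v 4) :
    (accE a b).holds v m ↔ (a.eval v m = v 0 ∧ b.eval v m = v 0) ∨
      adjRel (v 0) (m 1) (a.eval v m) (b.eval v m) := by
  rw [accE, holds_or, holds_and, holds_eq, holds_eq, holds_adjE _ _ _ h]; rfl

/-- The values of the variables when a table entry is computed. -/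
def cell (v : ℕ → ℕ) (k A C u y : ℕ) : ℕ → ℕ :=
  Function.update (Function.update (Function.update (Function.update (Function.update
    v 40 k) 41 A) 42 C) 43 u) 44 y

section
variable {s : RamState} {k A C u y a b t t' i B : ℕ}

-- Subtracting `2^a` from the number of a column set is intended for a column `a` that belongs to
-- it; the two summands correspond to a letter continuing the path and a letter starting a new one.
open Classical in
theorem eval_inner (hB : s.var 4 = B) (hn : s.var 0 ≤ B) (hp : ∀ i ≤ B, s.arr 18 i = 2 ^ i)
    (ha : a < B) (hb : b < B) (hi : s.var 31 = i) :
    (inner t).eval (Function.update (Function.update (cell s.var k A C u y) 45 a) 46 b) s.arr =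
      (if (wordSpec s).pref i false y then ∑ x ∈ Finset.range B, if (wordSpec s).adj x y then
        s.arr t (hor B [k, A - 2 ^ a, C - 2 ^ b, u, x]) else 0 else 0) +
      (if u = y ∧ 1 ≤ k ∧ (wordSpec s).pref i true y then ∑ u' ∈ Finset.range B,
        ∑ x ∈ Finset.range B, if (wordSpec s).acc u' x then
          s.arr t (hor B [k - 1, A - 2 ^ a, C - 2 ^ b, u', x]) else 0 else 0) := by
  have hn' : s.var 0 ≤ s.var 4 := hB ▸ hn
  simp
    (disch := first | assumption | decide | (simp (disch := decide) only [Function.update_of_ne]; assumption))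
    only [inner, cell, eval_add, eval_ite, eval_sum, eval_const, eval_entry, eval_var, eval_sub,
    eval_get, holds_or, holds_not, holds_lt, holds_eq, holds_and, holds_le, holds_adjE, holds_accE,
    Function.update_self, Function.update_of_ne, hB, hi, hp a ha.le, hp b hb.le]
  simp only [wordSpec, letterCode, hB, imp_iff_not_or]
  simp

/-- The fold multiplies by `y` in its first `a + b` rounds and idles afterwards, which computes a
power although the only loops run up to the bound. -/
theorem eval_colTerm {v : ℕ → ℕ} {m : ℕ → ℕ → ℕ} (hv : v 4 = B) (ha : v 45 = a) (hb : v 46 = b)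
    (hy : v 44 = y) (hyB : y ≤ B) (hab : a + b ≤ B) :
    (colTerm t t').eval v m = y ^ (a + b) * (BExpr.ite (eq (bool (at2 31 (var 41) (var 45)))
      (bool (at2 31 (var 42) (var 46)))) (inner t) (inner t')).eval v m := by
  classical
  rw [colTerm]
  generalize (BExpr.ite (eq (bool (at2 31 (var 41) (var 45)))
      (bool (at2 31 (var 42) (var 46)))) (inner t) (inner t')) = e
  have key : ∀ j, Nat.rec (e.eval v m) (fun i acc => (BExpr.ite (lt (var 49) (add (var 45) (var 46)))
      (mul (var 44) (var 50)) (var 50)).eval (Function.update (Function.update v 49 i) 50 acc) m) j =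
      y ^ (min j (a + b)) * e.eval v m := by
    intro j
    induction j with
    | zero => simp
    | succ j ih =>
      simp only [ih]
      simp (disch := decide) only [eval_ite, holds_lt, eval_var, eval_add, eval_mul,
        Function.update_self, Function.update_of_ne, ha, hb, hy, hv]
      rw [min_eq_left hyB]
      split_ifs with h
      · rw [min_eq_left (by omega), min_eq_left (by omega), pow_succ]; ring
      · rw [min_eq_right (by omega), min_eq_right (by omega)]
  refine (key (v 4)).trans ?_
  rw [hv, min_eq_right hab]

end

end BCmd

/-! ### The tables of the dynamic program -/

namespace BCmd

open BExpr

/-- The tables of positive and negative parts for the words of length `i`. -/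
def PackInv (B i : ℕ) (s : RamState) (W : WordSpec) : Prop :=
  ∀ k < B, ∀ A < B, ∀ C < B, ∀ u < B, ∀ y < B,
    (s.arr 26 (hor B [k, A, C, u, y]) : ℤ) - s.arr 27 (hor B [k, A, C, u, y]) =
      WordSpec.weight (bitSet A) (bitSet C) (W.words i k u y)

section
variable {s : RamState} {k A C u y a b t t' i B : ℕ}

-- Sums over all numbers below the bound collapse to sums over the column sets, as the bit table
-- suppresses the other terms. A negative sign exchanges the roles of the two tables.
open Classical in
theorem eval_nextEntry (hB : s.var 4 = B) (hn : s.var 0 ≤ B) (hT : BitTables B s)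
    (hi : s.var 31 = i) (hA : A < B) (hC : C < B) (hy : y < B) :
    (nextEntry t t').eval (cell s.var k A C u y) s.arr =
      if y < (wordSpec s).n ∧ (wordSpec s).act y then
        ∑ a ∈ bitSet A, ∑ b ∈ bitSet C, y ^ (a + b) *
          if colSign (bitSet A) a * colSign (bitSet C) b = 1 then
            (inner t).eval (Function.update (Function.update (cell s.var k A C u y) 45 a) 46 b) s.arr
          else
            (inner t').eval (Function.update (Function.update (cell s.var k A C u y) 45 a) 46 b) s.arr
      else 0 := by
  set v := cell s.var k A C u y with hv
  have v4 : v 4 = B := by rw [hv]; simp (disch := decide) only [cell, Function.update_of_ne, hB]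
  have v0 : v 0 = s.var 0 := by rw [hv]; simp (disch := decide) only [cell, Function.update_of_ne]
  have v41 : v 41 = A := by
    rw [hv]; simp (disch := decide) only [cell, Function.update_of_ne, Function.update_self]
  have v42 : v 42 = C := by
    rw [hv]; simp (disch := decide) only [cell, Function.update_of_ne, Function.update_self]
  have v44 : v 44 = y := by
    rw [hv]; simp (disch := decide) only [cell, Function.update_of_ne, Function.update_self]
  clear_value v
  rw [nextEntry, eval_ite]
  simp only [holds_and, holds_lt, holds_get, eval_var, v44, v0]
  refine if_congr Iff.rfl ?_ rfl
  rw [eval_sum, v4, ← Finset.sum_subset (bitSet_subset hA)]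
  · refine Finset.sum_congr rfl fun a ha => ?_
    have haB := Finset.mem_range.1 (bitSet_subset hA ha)
    rw [eval_ite, if_pos, eval_sum]
    · rw [Function.update_of_ne (by decide), v4, ← Finset.sum_subset (bitSet_subset hC)]
      · refine Finset.sum_congr rfl fun b hb => ?_
        have hbB := Finset.mem_range.1 (bitSet_subset hC hb)
        rw [eval_ite, if_pos, eval_colTerm (B := B) (a := a) (b := b) (y := y), eval_ite]
        · congr 1
          refine if_congr ?_ rfl rfl
          simp (disch := decide) only [holds_eq, eval_bool, holds_at2, eval_var, Function.update_self,
            Function.update_of_ne, v4, v41, v42]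
          rw [colSign_eq, colSign_eq]
          have h1 := hT.sign A hA a haB
          have h2 := hT.sign C hC b hbB
          simp only [← h1, ← h2, ne_eq, ite_not]
          split_ifs <;> simp
        · simp (disch := decide) only [Function.update_of_ne, v4]
        · simp (disch := decide) only [Function.update_of_ne, Function.update_self]
        · simp (disch := decide) only [Function.update_of_ne, Function.update_self]
        · simp (disch := decide) only [Function.update_of_ne, v44]
        · exact hy.le
        · have := bitSet_two_mul_le hA ha
          have := bitSet_two_mul_le hC hb
          omega
        · simp (disch := decide) only [holds_at2, eval_var, Function.update_self,
            Function.update_of_ne, v4, v42]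
          exact (hT.bit C hC b hbB).2 hb
      · intro b hb hbC
        rw [eval_ite, if_neg, eval_const]
        simp (disch := decide) only [holds_at2, eval_var, Function.update_self,
            Function.update_of_ne, v4, v42]
        exact fun h => hbC ((hT.bit C hC b (Finset.mem_range.1 hb)).1 h)
    · simp (disch := decide) only [holds_at2, eval_var, Function.update_self,
        Function.update_of_ne, v4, v41]
      exact (hT.bit A hA a haB).2 ha
  · intro a ha haA
    rw [eval_ite, if_neg, eval_const]
    simp (disch := decide) only [holds_at2, eval_var, Function.update_self,
        Function.update_of_ne, v4, v41]
    exact fun h => haA ((hT.bit A hA a (Finset.mem_range.1 ha)).1 h)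

theorem colSign_mul_cases (S S' : Finset ℕ) (a b : ℕ) :
    colSign S a * colSign S' b = 1 ∨ colSign S a * colSign S' b = -1 := by
  unfold colSign
  rcases neg_one_pow_eq_or ℤ (S.filter (a < ·)).card with h | h <;>
    rcases neg_one_pow_eq_or ℤ (S'.filter (b < ·)).card with h' | h' <;> simp [h, h']

/-- Memory holds natural numbers, so the integer weight is kept as a difference of two tables.
Exchanging them for negative signs makes the difference satisfy the recursion
`WordSpec.weight_words_succ`. -/
theorem nextEntry_spec (hB : s.var 4 = B) (hn : s.var 0 ≤ B) (hT : BitTables B s)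
    (hi : s.var 31 = i) (hI : PackInv B i s (wordSpec s)) (hk : k < B) (hA : A < B) (hC : C < B)
    (hu : u < B) (hy : y < B) :
    ((nextEntry 26 27).eval (cell s.var k A C u y) s.arr : ℤ) -
      (nextEntry 27 26).eval (cell s.var k A C u y) s.arr =
        WordSpec.weight (bitSet A) (bitSet C) ((wordSpec s).words (i + 1) k u y) := by
  classical
  rw [eval_nextEntry hB hn hT hi hA hC hy, eval_nextEntry hB hn hT hi hA hC hy,
    WordSpec.weight_words_succ]
  by_cases hact : y < (wordSpec s).n ∧ (wordSpec s).act y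
  swap
  · simp only [if_neg hact]; simp
  simp only [if_pos hact]
  push_cast
  rw [← Finset.sum_sub_distrib]
  refine Finset.sum_congr rfl fun a ha => ?_
  rw [← Finset.sum_sub_distrib]
  refine Finset.sum_congr rfl fun b hb => ?_
  have haB := Finset.mem_range.1 (bitSet_subset hA ha)
  have hbB := Finset.mem_range.1 (bitSet_subset hC hb)
  have hA' : A - 2 ^ a < B := (Nat.sub_le _ _).trans_lt hA
  have hC' : C - 2 ^ b < B := (Nat.sub_le _ _).trans_lt hC
  have hin : ((inner 26).eval (Function.update (Function.update (cell s.var k A C u y) 45 a) 46 b)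
      s.arr : ℤ) - (inner 27).eval (Function.update (Function.update (cell s.var k A C u y) 45 a) 46 b)
      s.arr = (if (wordSpec s).pref i false y then ∑ x ∈ Finset.range B, if (wordSpec s).adj x y then
        WordSpec.weight ((bitSet A).erase a) ((bitSet C).erase b) ((wordSpec s).words i k u x)
          else 0 else 0) +
      (if u = y ∧ 1 ≤ k ∧ (wordSpec s).pref i true y then ∑ u' ∈ Finset.range B,
        ∑ x ∈ Finset.range B, if (wordSpec s).acc u' x then
          WordSpec.weight ((bitSet A).erase a) ((bitSet C).erase b) ((wordSpec s).words i (k - 1) u' x)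
            else 0 else 0) := by
    rw [eval_inner hB hn hT.pow haB hbB hi, eval_inner hB hn hT.pow haB hbB hi, ← bitSet_sub ha,
      ← bitSet_sub hb]
    push_cast
    rw [add_sub_add_comm]
    congr 1
    · split_ifs
      · rw [← Finset.sum_sub_distrib]
        refine Finset.sum_congr rfl fun x hx => ?_
        split_ifs
        · exact hI k hk _ hA' _ hC' u hu x (Finset.mem_range.1 hx)
        · simp
      · simp
    · split_ifs
      · rw [← Finset.sum_sub_distrib]
        refine Finset.sum_congr rfl fun u' hu' => ?_
        rw [← Finset.sum_sub_distrib]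
        refine Finset.sum_congr rfl fun x hx => ?_
        split_ifs
        · exact hI (k - 1) (by omega) _ hA' _ hC' u' (Finset.mem_range.1 hu') x
            (Finset.mem_range.1 hx)
        · simp
      · simp
  have hbd : (wordSpec s).bd = B := hB
  rw [hbd, ← hin]
  rcases colSign_mul_cases (bitSet A) (bitSet C) a b with h | h
  · rw [h, if_pos rfl, if_pos rfl]; ring
  · rw [h, if_neg (by norm_num), if_neg (by norm_num)]; ring

end

/-- The tables for the empty word. -/
def packInit : BCmd :=
  .seq (tab 26 [40, 41, 42, 43, 44] (bool (and (and (eq (var 40) (const 0)) (and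
    (eq (var 43) (var 0)) (eq (var 44) (var 0)))) (and (eq (var 41) (const 0))
      (eq (var 42) (const 0))))))
  (tab 27 [40, 41, 42, 43, 44] (const 0))

/-- Record which words are accepted, and compute the next tables. -/
def packStep : BCmd :=
  .seq (tabAux 32 [31] [40] (bool (ex 43 (ex 44 (and (accE (var 43) (var 44)) (not (eq
    (entry 26 (var 40) (sub (get 18 (var 31)) (const 1)) (sub (get 18 (var 31)) (const 1)) (var 43)
      (var 44))
    (entry 27 (var 40) (sub (get 18 (var 31)) (const 1)) (sub (get 18 (var 31)) (const 1)) (var 43)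
      (var 44)))))))))
  (.seq (tab 28 [40, 41, 42, 43, 44] (nextEntry 26 27))
  (.seq (tab 29 [40, 41, 42, 43, 44] (nextEntry 27 26))
  (.seq (tab 26 [40, 41, 42, 43, 44] (entry 28 (var 40) (var 41) (var 42) (var 43) (var 44)))
  (tab 27 [40, 41, 42, 43, 44] (entry 29 (var 40) (var 41) (var 42) (var 43) (var 44))))))

/-- Row `m`, column `k` of the array `32` tells whether there is a packing with `k` paths and `m`
vertices that starts in the prescribed way. -/
def pack : BCmd := .seq packInit (.loop 31 packStep)

end BCmd

/-- There is an accepted word with `m` distinct vertices that describes `k` paths. -/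
def WordSpec.Feasible (W : WordSpec) (m k : ℕ) : Prop :=
  ∃ u < W.bd, ∃ x < W.bd, W.acc u x ∧ ∃ w ∈ W.words m k u x, (w.map Prod.snd).Nodup

theorem RamState.setV_of_ne {s : RamState} {x y i : ℕ} (h : y ≠ x) : (s.setV x i).var y = s.var y :=
  Function.update_of_ne h _ _

theorem RamState.setV_self (s : RamState) (x i : ℕ) : (s.setV x i).var x = i :=
  Function.update_self _ _ _

namespace BCmd

open BExpr

variable {s s' : RamState} {k A C u y i B : ℕ}

theorem arr_tab5 {t : ℕ} {e : BExpr} (h : tabOk t [40, 41, 42, 43, 44] e = true) (hB : s.var 4 = B)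
    (hk : k < B) (hA : A < B) (hC : C < B) (hu : u < B) (hy : y < B) :
    ((tab t [40, 41, 42, 43, 44] e).den s).arr t (hor B [k, A, C, u, y]) =
      e.eval (cell s.var k A C u y) s.arr := by
  obtain ⟨h1, h2, h3, h4⟩ := tabOk_iff.1 h
  exact tab5 hB h1 h2 h3 h4 hk hA hC hu hy

theorem wordSpec_congr (h0 : s'.var 0 = s.var 0) (h4 : s'.var 4 = s.var 4)
    (h30 : s'.var 30 = s.var 30) (a0 : s'.arr 0 = s.arr 0) (a1 : s'.arr 1 = s.arr 1)
    (a24 : s'.arr 24 = s.arr 24) (a25 : s'.arr 25 = s.arr 25) : wordSpec s' = wordSpec s := by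
  simp only [wordSpec, h0, h4, h30, a0, a1, a24, a25]

theorem BitTables.congr (h : BitTables B s) (a18 : s'.arr 18 = s.arr 18) (a30 : s'.arr 30 = s.arr 30)
    (a31 : s'.arr 31 = s.arr 31) : BitTables B s' :=
  ⟨by rw [a18]; exact h.pow, by rw [a30]; exact h.bit, by rw [a31]; exact h.sign⟩

theorem packInit_spec (hB : s.var 4 = B) : PackInv B 0 (packInit.den s) (wordSpec s) := by
  intro k hk A hA C hC u hu y hy
  simp only [packInit, seq_den]
  rw [arr_tab5 rfl (by simp (disch := decide) only [den_var, hB]) hk hA hC hu hy,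
    den_arr (by decide), arr_tab5 rfl hB hk hA hC hu hy]
  simp (disch := decide) only [eval_const, eval_bool, holds_and, holds_eq, eval_var, cell,
    Function.update_self, Function.update_of_ne]
  rw [WordSpec.words]
  have hn : (wordSpec s).n = s.var 0 := rfl
  rw [hn]
  by_cases h : k = 0 ∧ u = s.var 0 ∧ y = s.var 0
  · rw [if_pos h]
    simp only [h, true_and, WordSpec.weight, vand, List.map_nil, List.map_cons, List.sum_cons,
      List.sum_nil, bitSet_eq_empty]
    by_cases hA0 : A = 0 <;> by_cases hC0 : C = 0 <;> simp [hA0, hC0]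
  · rw [if_neg h, if_neg fun h' => h h'.1]
    simp

/-- The row for length `i` is recorded before the tables are advanced to length `i + 1`. The new
values go through arrays `28` and `29`, since both old tables are needed for both new ones. -/
theorem packStep_spec (hB : s.var 4 = B) (hn : s.var 0 ≤ B) (hT : BitTables B s)
    (hi : s.var 31 = i) (hiB : i < B) (hI : PackInv B i s (wordSpec s)) :
    PackInv B (i + 1) (packStep.den s) (wordSpec s) ∧
    (2 ^ i ≤ B → ∀ k < B, (packStep.den s).arr 32 (B * i + k) ≠ 0 ↔ (wordSpec s).Feasible i k) ∧
    ∀ j k, k < B → j ≠ i → (packStep.den s).arr 32 (B * j + k) = s.arr 32 (B * j + k) := by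
  simp only [packStep, seq_den]
  refine ⟨?_, ?_, ?_⟩
  · intro k hk A hA C hC u hu y hy
    set e := (bool (ex 43 (ex 44 (and (accE (var 43) (var 44)) (not (eq
    (entry 26 (var 40) (sub (get 18 (var 31)) (const 1)) (sub (get 18 (var 31)) (const 1)) (var 43)
      (var 44))
    (entry 27 (var 40) (sub (get 18 (var 31)) (const 1)) (sub (get 18 (var 31)) (const 1)) (var 43)
      (var 44)))))))) with he
    set s1 := (tabAux 32 [31] [40] e).den s with hs1
    have f1 : wordSpec s1 = wordSpec s := wordSpec_congr (den_var (by decide)) (den_var (by decide))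
      (den_var (by decide)) (den_arr (by decide)) (den_arr (by decide)) (den_arr (by decide))
      (den_arr (by decide))
    have b1 : s1.var 4 = B := by simp (disch := decide) only [hs1, den_var, hB]
    have n1 : s1.var 0 ≤ B := by simp (disch := decide) only [hs1, den_var, hn]
    have i1 : s1.var 31 = i := by simp (disch := decide) only [hs1, den_var, hi]
    have t1 : BitTables B s1 := hT.congr (den_arr (by decide)) (den_arr (by decide))
      (den_arr (by decide))
    have h1 : PackInv B i s1 (wordSpec s1) := by
      intro k hk A hA C hC u hu y hy
      rw [f1, hs1]
      simp (disch := decide) only [den_arr]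
      exact hI k hk A hA C hC u hu y hy
    rw [← f1]
    clear_value s1
    set s2 := (tab 28 [40, 41, 42, 43, 44] (nextEntry 26 27)).den s1 with hs2
    have b2 : s2.var 4 = B := by simp (disch := decide) only [hs2, den_var, b1]
    set s3 := (tab 29 [40, 41, 42, 43, 44] (nextEntry 27 26)).den s2 with hs3
    have b3 : s3.var 4 = B := by simp (disch := decide) only [hs3, den_var, b2]
    have h28 : s3.arr 28 (hor B [k, A, C, u, y]) =
        (nextEntry 26 27).eval (cell s1.var k A C u y) s1.arr := by
      rw [hs3, den_arr (by decide), hs2, arr_tab5 rfl b1 hk hA hC hu hy]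
    have h29 : s3.arr 29 (hor B [k, A, C, u, y]) =
        (nextEntry 27 26).eval (cell s1.var k A C u y) s1.arr := by
      rw [hs3, arr_tab5 rfl b2 hk hA hC hu hy]
      refine BExpr.eval_congr rfl (fun x _ => ?_) (fun j hj => ?_)
      · have hx : ∀ z, z ∉ [40, 41, 42, 43, 44] → s2.var z = s1.var z := fun z hz =>
          den_var (by rw [show (tab 28 [40, 41, 42, 43, 44] (nextEntry 26 27)).modV =
            [40, 41, 42, 43, 44] from rfl]; exact hz)
        simp only [cell, Function.update_apply]
        split_ifs with h1 h2 h3 h4 h5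
        all_goals first | rfl | exact hx x (by simp [h1, h2, h3, h4, h5])
      · refine den_arr ?_
        rw [show (tab 28 [40, 41, 42, 43, 44] (nextEntry 26 27)).modA = [28] from rfl]
        rintro hj'
        rw [List.mem_singleton] at hj'
        subst hj'
        exact absurd hj (by decide)
    clear_value s3
    rw [arr_tab5 rfl (by simp (disch := decide) only [den_var, b3]) hk hA hC hu hy,
      den_arr (by decide), arr_tab5 rfl b3 hk hA hC hu hy]
    have h4 : ∀ v : ℕ → ℕ, cell v k A C u y 4 = v 4 := fun v => by
      simp (disch := decide) only [cell, Function.update_of_ne]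
    simp (disch := decide) only [eval_entry, eval_var, h4, b3, den_var, den_arr]
    simp (disch := decide) only [cell, Function.update_of_ne, Function.update_self]
    rw [h28, h29]
    exact nextEntry_spec b1 n1 t1 i1 h1 hk hA hC hu hy
  · intro hpB k hk
    have hn' : s.var 0 ≤ s.var 4 := hB ▸ hn
    simp
      (disch := first | assumption | decide | (simp (disch := decide) only [Function.update_of_ne, hn']; done) | (simp (disch := decide) only [Function.update_of_ne]; assumption))
      only [den_arr, arr_row_ne, holds_bool, holds_ex, holds_and, holds_accE, holds_not, holds_eq,
      eval_entry, eval_sub, eval_get, eval_const, eval_var, Function.update_self,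
      Function.update_of_ne, hB, hi, hT.pow i hiB.le]
    have hbd : (wordSpec s).bd = B := hB
    rw [WordSpec.Feasible, hbd]
    refine exists_congr fun u => and_congr_right fun hu => exists_congr fun x =>
      and_congr_right fun hx => and_congr Iff.rfl ?_
    -- The full column set `range i` has the number `2^i - 1`, which must be a valid table index;
    -- this is the only place where `2^i ≤ B` is required.
    have hp : 2 ^ i - 1 < B := by have := Nat.one_le_two_pow (n := i); omega
    have := hI k hk _ hp _ hp u hu x hx
    rw [bitSet_two_pow_sub_one] at this
    rw [← WordSpec.weight_ne_zero_iff, ← this]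
    omega
  · intro j k hk hj
    simp
      (disch := first | assumption | decide | (simp only [hi]; assumption))
      only [den_arr, arr_row_of_ne]

theorem pack_spec (hB : s.var 4 = B) (hn : s.var 0 ≤ B) (hT : BitTables B s) {m : ℕ} (hm : m < B)
    (hm2 : 2 ^ m ≤ B) (hk : k < B) :
    (pack.den s).arr 32 (B * m + k) ≠ 0 ↔ (wordSpec s).Feasible m k := by
  simp only [pack, seq_den]
  have h0 := packInit_spec hB
  set s0 := packInit.den s with hs0
  have f0 : wordSpec s0 = wordSpec s := wordSpec_congr (den_var (by decide)) (den_var (by decide))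
      (den_var (by decide)) (den_arr (by decide)) (den_arr (by decide)) (den_arr (by decide))
      (den_arr (by decide))
  have b0 : s0.var 4 = B := by simp (disch := decide) only [hs0, den_var, hB]
  have n0 : s0.var 0 ≤ B := by simp (disch := decide) only [hs0, den_var, hn]
  have t0 : BitTables B s0 := hT.congr (den_arr (by decide)) (den_arr (by decide))
      (den_arr (by decide))
  rw [← f0] at h0 ⊢
  clear_value s0
  have key := loop_inv (x := 31) (a := packStep) (s := s0) (fun i s' => PackInv B i s' (wordSpec s0) ∧
    ∀ j < i, 2 ^ j ≤ B → ∀ k < B, s'.arr 32 (B * j + k) ≠ 0 ↔ (wordSpec s0).Feasible j k)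
    ⟨h0, by omega⟩ (by
      rintro i hi s' hf ⟨h1, h2⟩
      have hw : wordSpec (s'.setV 31 i) = wordSpec s0 := wordSpec_congr
        ((RamState.setV_of_ne (by decide)).trans (hf.1 _ (by decide)))
        ((RamState.setV_of_ne (by decide)).trans (hf.1 _ (by decide)))
        ((RamState.setV_of_ne (by decide)).trans (hf.1 _ (by decide)))
        (hf.2 _ (by decide)) (hf.2 _ (by decide)) (hf.2 _ (by decide)) (hf.2 _ (by decide))
      have e4 : (s'.setV 31 i).var 4 = B :=
        ((RamState.setV_of_ne (by decide)).trans (hf.1 _ (by decide))).trans b0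
      have e0 : (s'.setV 31 i).var 0 ≤ B :=
        ((RamState.setV_of_ne (by decide)).trans (hf.1 _ (by decide))).trans_le n0
      obtain ⟨g1, g2, g3⟩ := packStep_spec (s := s'.setV 31 i) (i := i) e4 e0
        (t0.congr (hf.2 _ (by decide)) (hf.2 _ (by decide)) (hf.2 _ (by decide)))
        (RamState.setV_self _ _ _) (b0 ▸ hi) (by rw [hw]; exact h1)
      rw [hw] at g1 g2
      refine ⟨g1, fun j hj hjB k hk => ?_⟩
      by_cases hji : j = i
      · subst hji; exact g2 hjB k hk
      · rw [g3 j k hk hji]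
        exact h2 j (by omega) hjB k hk)
  rw [b0] at key
  exact key.2 m hm hm2 k hk

end BCmd

/-! ### Maximum packings and the extraction of a word -/

namespace WordSpec

/-- Drop the restrictions on the letters. -/
def free (W : WordSpec) : WordSpec := { W with pref := fun _ _ _ => True }

/-- Separating the prescribed beginning from the remaining conditions allows one witness to be
reused while the prescription grows. -/
theorem feasible_iff {W : WordSpec} {m k : ℕ} : W.Feasible m k ↔ ∃ u < W.bd, ∃ x < W.bd, W.acc u x ∧
    ∃ w ∈ W.free.words m k u x, (w.map Prod.snd).Nodup ∧ Fits W.pref w := by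
  unfold Feasible
  simp only [W.mem_words_iff_fits, free, and_assoc, and_comm, and_left_comm]

theorem lt_of_mem_words {W : WordSpec} {i k s x : ℕ} {w : List (Bool × ℕ)} (h : w ∈ W.words i k s x) :
    ∀ a ∈ w, a.2 < W.n := by
  induction i generalizing k s x w with
  | zero => simp [(mem_words_zero.1 h).1]
  | succ i ih =>
    obtain ⟨hy, h⟩ := mem_words_succ.1 h
    rcases h with ⟨-, x, -, -, w', hw', rfl⟩ | ⟨-, s', -, x, -, -, w', hw', rfl⟩ <;>
      simpa [hy.1] using ih hw'

end WordSpec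

namespace BCmd

open BExpr

variable {s s' : RamState} {B : ℕ}

/-- `k` paths can be packed with at most as many vertices as the variable `51` says. -/
def feasE (k : BExpr) : BExpr := ex 34 (and (le (var 34) (var 51)) (at2 32 (var 34) k))

/-- The maximum number of paths of a packing with at most as many vertices as the variable `51` says,
into the variable `32`, and the number of vertices of such a packing, into the variable `33`. -/
def searchMax : BCmd :=
  .seq (.setVar 30 (const 0))
  (.seq pack
  (.seq (.setVar 32 (least 35 36 (and (feasE (var 36)) (all 31 (or (not (lt (var 36) (var 31)))
    (not (feasE (var 31))))))))
  (.setVar 33 (least 35 36 (and (le (var 36) (var 51)) (at2 32 (var 36) (var 32)))))))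

/-- Try a letter at the position in the variable `37`. -/
def tryLetter : BCmd :=
  .seq (.setArr 25 (var 37) (var 39))
  (.seq (.setVar 30 (add (var 37) (const 1)))
  (.seq pack
  (.setVar 38 (at2 32 (var 33) (var 32)))))

/-- Find the letter at the position in the variable `37`. -/
def findLetter : BCmd :=
  .seq (.setVar 38 (const 0)) (.loop 39 (.ite (var 38) .skip tryLetter))

/-- Find the letters of a word for the maximum number of paths. -/
def extract : BCmd := .loop 37 (.ite (lt (var 37) (var 33)) findLetter .skip)

theorem wordSpec_free_congr (h0 : s'.var 0 = s.var 0) (h4 : s'.var 4 = s.var 4)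
    (a0 : s'.arr 0 = s.arr 0) (a1 : s'.arr 1 = s.arr 1)
    (a24 : s'.arr 24 = s.arr 24) : (wordSpec s').free = (wordSpec s).free := by
  simp only [wordSpec, WordSpec.free, h0, h4, a0, a1, a24]

/-- The memory is ready for the search of packings. -/
structure PackEnv (B : ℕ) (s : RamState) : Prop where
  bound : s.var 4 = B
  size : 2 * s.var 0 ≤ B
  pos : 0 < B
  tables : BitTables B s
  count : 2 ^ s.var 51 ≤ B

theorem PackEnv.congr (h : PackEnv B s) (h0 : s'.var 0 = s.var 0) (h4 : s'.var 4 = s.var 4)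
    (h51 : s'.var 51 = s.var 51) (a18 : s'.arr 18 = s.arr 18) (a30 : s'.arr 30 = s.arr 30)
    (a31 : s'.arr 31 = s.arr 31) : PackEnv B s' :=
  ⟨h4.trans h.bound, h0 ▸ h.size, h.pos, h.tables.congr a18 a30 a31, h51 ▸ h.count⟩

theorem PackEnv.lt (h : PackEnv B s) {m : ℕ} (hm : m ≤ s.var 51) : m < B ∧ 2 ^ m ≤ B :=
  have h2 : 2 ^ m ≤ B := (Nat.pow_le_pow_right (by norm_num) hm).trans h.count
  ⟨Nat.lt_two_pow_self.trans_le h2, h2⟩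

theorem PackEnv.size_lt (h : PackEnv B s) : s.var 0 < B := by
  have := h.size; have := h.pos; omega

theorem PackEnv.pack_spec (h : PackEnv B s) {m k : ℕ} (hm : m ≤ s.var 51) (hk : k < B) :
    (pack.den s).arr 32 (B * m + k) ≠ 0 ↔ (wordSpec s).Feasible m k :=
  BCmd.pack_spec h.bound (by have := h.size; omega) h.tables (h.lt hm).1 (h.lt hm).2 hk

/-- No beginning is prescribed here. The maximum is the only element of the feasible counts that
bounds all of them, so the search for a least number with this property returns it. -/
theorem searchMax_spec (h : PackEnv B s) :
    (searchMax.den s).var 30 = 0 ∧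
    (searchMax.den s).var 33 ≤ s.var 51 ∧
    (searchMax.den s).var 32 < B ∧
    (wordSpec (searchMax.den s)).Feasible ((searchMax.den s).var 33) ((searchMax.den s).var 32) ∧
    ∀ m ≤ s.var 51, ∀ k < B, (wordSpec (searchMax.den s)).Feasible m k →
      k ≤ (searchMax.den s).var 32 := by
  classical
  have hf := den_frame searchMax s
  have hspec : wordSpec (searchMax.den s) = wordSpec ((setVar 30 (const 0)).den s) := by
    refine wordSpec_congr ?_ ?_ ?_ ?_ ?_ ?_ ?_ <;>
      simp (disch := decide) only [searchMax, seq_den, den_var, den_arr]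
  rw [hspec]
  simp only [searchMax, seq_den]
  set s0 := (setVar 30 (const 0)).den s with hs0
  have h0 : PackEnv B s0 := h.congr (den_var (by decide)) (den_var (by decide)) (den_var (by decide))
    rfl rfl rfl
  have h51 : s0.var 51 = s.var 51 := den_var (by decide)
  have h30 : s0.var 30 = 0 := var_setVar _ _ _
  rw [← h51]
  clear_value s0
  have hp := fun m hm k hk => h0.pack_spec (m := m) (k := k) hm hk
  set s1 := pack.den s0 with hs1
  have b1 : s1.var 4 = B := (den_var (by decide)).trans h0.bound
  have n1 : s1.var 51 = s0.var 51 := den_var (by decide)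
  have z1 : s1.var 30 = 0 := (den_var (by decide)).trans h30
  clear_value s1
  set W := wordSpec s0 with hW
  let F : ℕ → Prop := fun k => ∃ m ≤ s0.var 51, W.Feasible m k
  -- The empty word describes the empty packing; its state `n, n` is accepted.
  have hF0 : F 0 := by
    refine ⟨0, Nat.zero_le _, s0.var 0, ?_, s0.var 0, ?_, .inl ⟨rfl, rfl⟩, [],
      WordSpec.mem_words_zero.2 ⟨rfl, rfl, rfl, rfl⟩, by simp⟩ <;>
    · change s0.var 0 < s0.var 4
      rw [h0.bound]; exact h0.size_lt
  set S := (Finset.range B).filter F with hS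
  have hSne : S.Nonempty := ⟨0, by simp [hS, hF0, h0.pos]⟩
  have hfeas : ∀ v : ℕ → ℕ, ∀ e : BExpr, v 4 = B → v 51 = s0.var 51 →
      (∀ i, e.eval (Function.update v 34 i) s1.arr = e.eval v s1.arr) → e.eval v s1.arr < B →
      ((feasE e).holds v s1.arr ↔ F (e.eval v s1.arr)) := by
    intro v e h4 h5 he heB
    simp (disch := decide) only [feasE, holds_ex, holds_and, holds_le, eval_var, holds_at2,
      Function.update_self, Function.update_of_ne, h4, h5, he]
    constructor
    · rintro ⟨m, -, hm, h⟩
      exact ⟨m, hm, (hp m hm _ heB).1 h⟩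
    · rintro ⟨m, hm, h⟩
      exact ⟨m, (h0.lt hm).1, hm, (hp m hm _ heB).2 h⟩
  have hmax := Finset.mem_filter.1 (S.max'_mem hSne)
  have hk : S.max' hSne < B := Finset.mem_range.1 hmax.1
  have e32 : (least 35 36 (and (feasE (var 36)) (all 31 (or (not (lt (var 36) (var 31)))
      (not (feasE (var 31))))))).eval s1.var s1.arr = S.max' hSne := by
    refine eval_least _ _ _ _ _ (fun k => k ∈ S ∧ ∀ j ∈ S, j ≤ k) (by decide) (by decide) (by decide)
      rfl ?_ (by rw [b1]; exact hk) ⟨S.max'_mem _, fun j hj => S.le_max' j hj⟩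
      (fun k hk => hk.2 _ (S.max'_mem _))
    rw [b1]
    intro i hi j hj
    rw [holds_and, hfeas]
    · simp (disch := decide) only [holds_all, holds_or, holds_not, holds_lt, eval_var,
        Function.update_self, Function.update_of_ne, b1]
      refine and_congr (by simp [hS, hi]) ⟨fun h k hk => ?_, fun h k hk => ?_⟩
      · have hk' := Finset.mem_filter.1 hk
        have hkB := Finset.mem_range.1 hk'.1
        rcases h k hkB with h | h
        · omega
        · rw [hfeas] at h
          · exact absurd hk'.2 h
          all_goals simp (disch := decide) only [eval_var, Function.update_self, Function.update_of_ne, b1, n1, hkB]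
          all_goals simp
      · by_cases hik : i < k
        · right
          rw [hfeas]
          · intro hF
            exact absurd (h k (Finset.mem_filter.2 ⟨Finset.mem_range.2 hk, hF⟩)) (by omega)
          all_goals simp (disch := decide) only [eval_var, Function.update_self, Function.update_of_ne, b1, n1, hk]
          all_goals simp
        · exact .inl hik
    all_goals simp (disch := decide) only [eval_var, Function.update_self, Function.update_of_ne, b1, n1, hi]
    all_goals simp
  set s2 := (setVar 32 (least 35 36 (and (feasE (var 36)) (all 31 (or (not (lt (var 36) (var 31)))
      (not (feasE (var 31)))))))).den s1 with hs2
  have v2 : s2.var 32 = S.max' hSne := (var_setVar _ _ _).trans e32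
  have a2 : s2.arr = s1.arr := rfl
  have b2 : s2.var 4 = B := (den_var (by decide)).trans b1
  have n2 : s2.var 51 = s0.var 51 := (den_var (by decide)).trans n1
  have z2 : s2.var 30 = 0 := (den_var (by decide)).trans z1
  clear_value s2
  obtain ⟨m, hm, hmF⟩ := hmax.2
  have hex : ∃ m, m ≤ s0.var 51 ∧ W.Feasible m (S.max' hSne) := ⟨m, hm, hmF⟩
  have hfind := Nat.find_spec hex
  have e33 : (least 35 36 (and (le (var 36) (var 51)) (at2 32 (var 36) (var 32)))).eval
      s2.var s2.arr = Nat.find hex := by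
    refine eval_least _ _ _ _ _ (fun m => m ≤ s0.var 51 ∧ W.Feasible m (S.max' hSne)) (by decide)
      (by decide) (by decide) rfl ?_ (by rw [b2]; exact (h0.lt hfind.1).1) hfind
      (fun m hm => Nat.find_min' hex hm)
    intro i hi j hj
    simp (disch := decide) only [holds_and, holds_le, eval_var, holds_at2,
      Function.update_self, Function.update_of_ne, b2, n2, v2, a2]
    exact and_congr_right fun hi => hp i hi _ hk
  simp (disch := decide) only [den_var, var_setVar, e33, v2, z2]
  refine ⟨trivial, hfind.1, hk, hfind.2, fun m hm k hk hF => ?_⟩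
  exact S.le_max' k (Finset.mem_filter.2 ⟨Finset.mem_range.2 hk, m, hm, hF⟩)

/-- A feasible word supplies a letter at position `j`. Trying codes in increasing order, either an
earlier one already succeeds or this one does, so the search cannot end in failure. Codes are below
`2 n ≤ B`, which the loop covers. -/
theorem findLetter_spec (h : PackEnv B s) {j m k : ℕ} (hj : s.var 37 = j) (hjm : j < m)
    (h30 : s.var 30 = j) (h33 : s.var 33 = m) (h32 : s.var 32 = k) (hm : m ≤ s.var 51) (hk : k < B)
    (hF : (wordSpec s).Feasible m k) :
    (findLetter.den s).var 30 = j + 1 ∧ (wordSpec (findLetter.den s)).Feasible m k := by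
  obtain ⟨u, hu, x, hx, hux, w, hw, hnd, hfit⟩ := WordSpec.feasible_iff.1 hF
  have hlen : w.length = m := WordSpec.length_of_mem_words _ hw
  obtain ⟨f, y, hy⟩ : ∃ f y, w.reverse[j]? = some (f, y) := by
    have : j < w.reverse.length := by simpa [hlen] using hjm
    exact ⟨_, _, List.getElem?_eq_getElem this⟩
  have hyn : y < s.var 0 := WordSpec.lt_of_mem_words hw (f, y)
    (by simpa using List.mem_of_getElem? hy)
  have hcB : letterCode (s.var 0) f y < B := by
    have := h.size
    unfold letterCode
    split_ifs <;> omega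
  simp only [findLetter, seq_den]
  set s0 := (setVar 38 (const 0)).den s with hs0
  have h0 : PackEnv B s0 := h.congr (den_var (by decide)) (den_var (by decide)) (den_var (by decide))
    rfl rfl rfl
  have key := loop_inv (x := 39) (a := .ite (var 38) .skip tryLetter) (s := s0) (fun c s' =>
    (∀ i < j, s'.arr 25 i = s.arr 25 i) ∧
    (s'.var 38 ≠ 0 → s'.var 30 = j + 1 ∧ (wordSpec s').Feasible m k) ∧
    (s'.var 38 = 0 → c ≤ letterCode (s.var 0) f y)) ⟨fun _ _ => rfl,
      fun h => absurd (var_setVar _ _ _) h, fun _ => Nat.zero_le _⟩ (by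
    rintro c hc s' hfr ⟨h1, h2, h3⟩
    by_cases h38 : s'.var 38 = 0
    · rw [ite_den_of_not (by simpa (disch := decide) only [holds_var, RamState.setV_of_ne, not_not] using h38)]
      simp only [tryLetter, seq_den]
      set t := (setVar 30 (add (var 37) (const 1))).den ((setArr 25 (var 37) (var 39)).den
        (s'.setV 39 c)) with ht
      have v37 : s'.var 37 = j := by rw [hfr.1 37 (by decide), hs0, den_var (by decide), hj]
      have t30 : t.var 30 = j + 1 := by
        simp (disch := decide) only [ht, var_setVar, den_var, eval_add, eval_var, eval_const,
          RamState.setV_of_ne, v37]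
      have t25 : ∀ i, t.arr 25 i = if i = j then c else s'.arr 25 i := by
        intro i
        simp (disch := decide) only [ht, den_arr, arr_setArr, eval_var, RamState.setV_of_ne,
          RamState.setV_self, RamState.setV_arr, v37]
      have tv : ∀ z ∉ [30, 38, 31, 39, 40, 41, 42, 43, 44], t.var z = s.var z := by
        intro z hz
        simp only [List.mem_cons, not_or, List.not_mem_nil, not_false_eq_true, and_true] at hz
        have hz' : z ∉ (loop 39 (.ite (var 38) .skip tryLetter)).modV := by
          rw [show (loop 39 (.ite (var 38) .skip tryLetter)).modV = [39, 30, 40, 41, 42, 43, 44, 40, 41,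
            42, 43, 44, 31, 40, 40, 41, 42, 43, 44, 40, 41, 42, 43, 44, 40, 41, 42, 43, 44, 40, 41, 42,
            43, 44, 38] from rfl]
          simp; omega
        rw [ht, den_var (by simpa [modV] using hz.1), den_var (by simp [modV]),
          RamState.setV_of_ne (by omega), hfr.1 z hz', hs0, den_var (by simpa [modV] using hz.2.1)]
      have ta : ∀ z ∉ [25, 26, 27, 28, 29, 32], t.arr z = s.arr z := by
        intro z hz
        have hz' : z ∉ (loop 39 (.ite (var 38) .skip tryLetter)).modA := by
          rw [show (loop 39 (.ite (var 38) .skip tryLetter)).modA = [25, 26, 27, 32, 28, 29, 26, 27]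
            from rfl]
          simp at hz ⊢; omega
        simp only [List.mem_cons, not_or] at hz
        rw [ht, den_arr (by simp [modA]), den_arr (by simpa [modA] using hz.1), RamState.setV_arr,
          hfr.2 z hz']
        rfl
      have tE : PackEnv B t := h.congr (tv _ (by decide)) (tv _ (by decide)) (tv _ (by decide))
        (ta _ (by decide)) (ta _ (by decide)) (ta _ (by decide))
      have tp := tE.pack_spec (m := m) (k := k) (by rw [tv _ (by decide)]; exact hm) hk
      have t32 := tv 32 (by decide)
      have t33 := tv 33 (by decide)
      have tf : (wordSpec t).free = (wordSpec s).free := wordSpec_free_congr (tv _ (by decide))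
        (tv _ (by decide)) (ta _ (by decide)) (ta _ (by decide)) (ta _ (by decide))
      have t0 := tv 0 (by decide)
      have tb := tE.bound
      clear_value t
      have e38 : ((setVar 38 (at2 32 (var 33) (var 32))).den (pack.den t)).var 38 =
          (pack.den t).arr 32 (B * m + k) := by
        simp (disch := decide) only [var_setVar, eval_at2, eval_var, den_var, t32, t33, h32, h33, tb]
      have ew : wordSpec ((setVar 38 (at2 32 (var 33) (var 32))).den (pack.den t)) = wordSpec t := by
        refine wordSpec_congr ?_ ?_ ?_ ?_ ?_ ?_ ?_ <;>
          simp (disch := decide) only [den_var, den_arr]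
      refine ⟨fun i hi => ?_, fun h => ⟨?_, ?_⟩, fun h => ?_⟩
      · simp (disch := decide) only [den_arr, t25]
        rw [if_neg hi.ne, h1 i hi]
      · simp (disch := decide) only [den_var, t30]
      · rw [ew, ← tp, ← e38]; exact h
      -- If the code of the witness itself had been rejected, the witness would still fit the
      -- extended beginning, contradicting the answer of `pack`.
      · by_contra hlt
        have hc' : c = letterCode (s.var 0) f y := by have := h3 h38; omega
        refine absurd h ?_
        rw [e38]
        refine tp.2 (WordSpec.feasible_iff.2 ⟨u, ?_, x, ?_, ?_, w, by rw [tf]; exact hw, hnd, ?_⟩)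
        · change u < (wordSpec t).free.bd
          rw [tf]; exact hu
        · change x < (wordSpec t).free.bd
          rw [tf]; exact hx
        · change (wordSpec t).free.acc u x
          rw [tf]; exact hux
        · intro i g z hi hip
          change i < t.var 30 at hip
          rw [t30] at hip
          rw [t25, t0]
          by_cases hij : i = j
          · subst hij
            rw [hi] at hy
            cases hy
            rw [if_pos rfl, hc']
          · rw [if_neg hij, h1 i (by omega)]
            exact hfit i g z hi (by rw [h30]; omega)
    · rw [ite_den_of_ne (by simpa (disch := decide) only [holds_var, RamState.setV_of_ne] using h38)]
      have ew : wordSpec (s'.setV 39 c) = wordSpec s' := by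
        refine wordSpec_congr ?_ ?_ ?_ ?_ ?_ ?_ ?_ <;> first | rfl | exact RamState.setV_of_ne (by decide)
      refine ⟨h1, fun _ => ?_, fun h => ?_⟩
      · change (s'.setV 39 c).var 30 = _ ∧ (wordSpec (s'.setV 39 c)).Feasible m k
        rw [ew, RamState.setV_of_ne (by decide)]
        exact h2 h38
      · exact absurd (by simpa (disch := decide) only [den, RamState.setV_of_ne] using h) h38)
  rw [h0.bound] at key
  refine key.2.1 fun h => ?_
  have := key.2.2 h
  omega

end BCmd

namespace BCmd

open BExpr

variable {s s' : RamState} {B : ℕ}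

/-- Feasibility is preserved while the prescribed beginning grows by one letter per round. Once it
has full length, the word that witnesses feasibility is the word stored in array `25`. -/
theorem extract_spec (h : PackEnv B s) (h30 : s.var 30 = 0) (hm : s.var 33 ≤ s.var 51)
    (hk : s.var 32 < B) (hF : (wordSpec s).Feasible (s.var 33) (s.var 32)) :
    ∃ u < B, ∃ x < B, (wordSpec s).acc u x ∧
      ∃ w ∈ (wordSpec s).free.words (s.var 33) (s.var 32) u x, (w.map Prod.snd).Nodup ∧
        ∀ i f y, w.reverse[i]? = some (f, y) →
          (extract.den s).arr 25 i = letterCode (s.var 0) f y := by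
  have hv : ∀ t : RamState, (loop 37 (.ite (lt (var 37) (var 33)) findLetter .skip)).Frame s t →
      ∀ z ∈ [0, 4, 51, 32, 33], t.var z = s.var z := fun t ht z hz => ht.1 z (by
    rw [show (loop 37 (.ite (lt (var 37) (var 33)) findLetter .skip)).modV = [37, 38, 39, 30, 40, 41, 42,
      43, 44, 40, 41, 42, 43, 44, 31, 40, 40, 41, 42, 43, 44, 40, 41, 42, 43, 44, 40, 41, 42, 43, 44, 40,
      41, 42, 43, 44, 38] from rfl]
    simp at hz ⊢; omega)
  have ha : ∀ t : RamState, (loop 37 (.ite (lt (var 37) (var 33)) findLetter .skip)).Frame s t →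
      ∀ z ∈ [0, 1, 24, 18, 30, 31], t.arr z = s.arr z := fun t ht z hz => ht.2 z (by
    rw [show (loop 37 (.ite (lt (var 37) (var 33)) findLetter .skip)).modA =
      [25, 26, 27, 32, 28, 29, 26, 27] from rfl]
    simp at hz ⊢; omega)
  have key := loop_inv (x := 37) (a := .ite (lt (var 37) (var 33)) findLetter .skip) (s := s)
    (fun j s' => s'.var 30 = min j (s.var 33) ∧ (wordSpec s').Feasible (s.var 33) (s.var 32))
    ⟨by simp [h30], hF⟩ (by
    rintro j hj s' hfr ⟨h1, h2⟩
    have v := hv s' hfr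
    have a := ha s' hfr
    have ew : wordSpec (s'.setV 37 j) = wordSpec s' := by
      refine wordSpec_congr ?_ ?_ ?_ ?_ ?_ ?_ ?_ <;> first | rfl | exact RamState.setV_of_ne (by decide)
    by_cases hjm : j < s.var 33
    · rw [ite_den_of_ne (by
        simp (disch := decide) only [holds_lt, eval_var, RamState.setV_of_ne, RamState.setV_self,
          v 33 (by decide), hjm])]
      rw [min_eq_left (by omega)]
      have hE : PackEnv B (s'.setV 37 j) := h.congr (v 0 (by decide)) (v 4 (by decide))
        (v 51 (by decide)) (a 18 (by decide)) (a 30 (by decide)) (a 31 (by decide))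
      refine findLetter_spec hE (RamState.setV_self _ _ _) hjm ?_ (v 33 (by decide))
        (v 32 (by decide)) ?_ hk (by rw [ew]; exact h2)
      · rw [RamState.setV_of_ne (by decide), h1, min_eq_left hjm.le]
      · rw [RamState.setV_of_ne (by decide), v 51 (by decide)]; exact hm
    · rw [ite_den_of_not (by
        simp (disch := decide) only [holds_lt, eval_var, RamState.setV_of_ne, RamState.setV_self,
          v 33 (by decide), hjm, not_false_eq_true])]
      refine ⟨?_, by rw [← ew] at h2; exact h2⟩
      change (s'.setV 37 j).var 30 = _
      rw [RamState.setV_of_ne (by decide), h1]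
      omega)
  have hfr := den_frame extract s
  have v := hv _ hfr
  have a := ha _ hfr
  change (extract.den s).var 30 = _ ∧ (wordSpec (extract.den s)).Feasible _ _ at key
  have hmB := (h.lt hm).1
  rw [h.bound, min_eq_right hmB.le] at key
  have hfree : (wordSpec (extract.den s)).free = (wordSpec s).free := wordSpec_free_congr
    (v _ (by decide)) (v _ (by decide)) (a _ (by decide)) (a _ (by decide)) (a _ (by decide))
  obtain ⟨u, hu, x, hx, hux, w, hw, hnd, hfit⟩ := WordSpec.feasible_iff.1 key.2
  rw [hfree] at hw
  refine ⟨u, ?_, x, ?_, ?_, w, hw, hnd, fun i f y hi => ?_⟩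
  · have hu' : u < (extract.den s).var 4 := hu
    rwa [v 4 (by decide), h.bound] at hu'
  · have hu' : x < (extract.den s).var 4 := hx
    rwa [v 4 (by decide), h.bound] at hu'
  · change (wordSpec s).free.acc u x
    rw [← hfree]; exact hux
  · have hlt := (List.getElem?_eq_some_iff.1 hi).1
    rw [List.length_reverse, WordSpec.length_of_mem_words _ hw] at hlt
    rw [hfit i f y hi (by change i < (extract.den s).var 30; rw [key.1]; exact hlt)]
    rw [v 0 (by decide)]

end BCmd

/-! ### Writing the paths to the output -/

/-- The memory holds the list of lists `L` as output. -/
def OutRep (n : ℕ) (s : RamState) (L : List (List ℕ)) : Prop :=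
  s.var 3 = L.length ∧ ∀ (i : ℕ) (hi : i < L.length), s.arr 2 i = L[i].length ∧
    ∀ (j : ℕ) (hj : j < L[i].length), s.arr 3 (i * n + j) = L[i][j]

namespace OutRep

variable {n y : ℕ} {s s' : RamState} {L : List (List ℕ)} {l : List ℕ}

theorem congr (h : OutRep n s L) (h3 : s'.var 3 = s.var 3) (a2 : s'.arr 2 = s.arr 2)
    (a3 : s'.arr 3 = s.arr 3) : OutRep n s' L := by
  unfold OutRep
  rw [h3, a2, a3]
  exact h

theorem address_lt {i j k : ℕ} (hi : i < k) (hj : j < n) : i * n + j < k * n := by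
  have : (i + 1) * n ≤ k * n := Nat.mul_le_mul_right _ hi
  rw [Nat.succ_mul] at this
  omega

theorem snoc (h : OutRep n s L) (hL : ∀ l ∈ L, l.length ≤ n) (h3 : s'.var 3 = L.length + 1)
    (a2 : ∀ i, s'.arr 2 i = if i = L.length then 1 else s.arr 2 i)
    (a3 : ∀ i, s'.arr 3 i = if i = L.length * n then y else s.arr 3 i) :
    OutRep n s' (L ++ [[y]]) := by
  refine ⟨by simp [h3], fun i hi => ?_⟩
  rw [List.length_append, List.length_singleton] at hi
  by_cases hiL : i < L.length
  · simp only [List.getElem_append_left hiL]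
    refine ⟨by rw [a2, if_neg hiL.ne, (h.2 i hiL).1], fun j hj => ?_⟩
    rw [a3, if_neg, (h.2 i hiL).2 j hj]
    have := hL L[i] (List.getElem_mem hiL)
    exact (address_lt hiL (by omega)).ne
  · obtain rfl : i = L.length := by omega
    refine ⟨by simp [a2], fun j hj => ?_⟩
    have : j = 0 := by simpa using hj
    subst this
    simp [a3]

theorem extend (h : OutRep n s (L ++ [l])) (hL : ∀ l ∈ L, l.length ≤ n)
    (h3 : s'.var 3 = L.length + 1)
    (a2 : ∀ i, s'.arr 2 i = if i = L.length then l.length + 1 else s.arr 2 i)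
    (a3 : ∀ i, s'.arr 3 i = if i = L.length * n + l.length then y else s.arr 3 i) :
    OutRep n s' (L ++ [l ++ [y]]) := by
  refine ⟨by simp [h3], fun i hi => ?_⟩
  rw [List.length_append, List.length_singleton] at hi
  have hi' : i < (L ++ [l]).length := by simpa using hi
  have h2 := h.2 i hi'
  by_cases hiL : i < L.length
  · simp only [List.getElem_append_left hiL] at h2 ⊢
    refine ⟨by rw [a2, if_neg hiL.ne, h2.1], fun j hj => ?_⟩
    rw [a3, if_neg, h2.2 j hj]
    have := hL L[i] (List.getElem_mem hiL)
    have := address_lt (n := n) hiL (show j < n by omega)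
    omega
  · obtain rfl : i = L.length := by omega
    simp only [List.getElem_concat_length] at h2 ⊢
    refine ⟨by simp [a2], fun j hj => ?_⟩
    rw [List.length_append, List.length_singleton] at hj
    rw [a3]
    by_cases hjl : j = l.length
    · subst hjl; simp
    · rw [if_neg (by omega), h2.2 j (by omega)]
      exact (List.getElem_append_left (by omega)).symm

end OutRep

/-- The paths that a word describes, in the order in which they are output. -/
def outPaths (w : List (Bool × ℕ)) : List (List ℕ) := ((decode w).map List.reverse).reverse

theorem outPaths_cons_true (y : ℕ) (w : List (Bool × ℕ)) :
    outPaths ((true, y) :: w) = outPaths w ++ [[y]] := by simp [outPaths, decode]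

theorem flatten_reverse_perm {α : Type*} (P : List (List α)) :
    (P.map List.reverse).reverse.flatten.Perm P.flatten := by
  refine (List.reverse_perm _).flatten.trans ?_
  induction P with
  | nil => simp
  | cons l P ih => simpa using (List.reverse_perm l).append ih

namespace BCmd

open BExpr

variable {s s' : RamState} {B n : ℕ}

/-- Append the letter at the position in the variable `37` to the output. -/
def emitLetter : BCmd :=
  .ite (lt (get 25 (var 37)) (var 0))
    (.seq (.setArr 3 (add (mul (sub (var 3) (const 1)) (var 0)) (get 2 (sub (var 3) (const 1))))
      (get 25 (var 37)))
    (.setArr 2 (sub (var 3) (const 1)) (add (get 2 (sub (var 3) (const 1))) (const 1))))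
    (.seq (.setArr 3 (mul (var 3) (var 0)) (sub (get 25 (var 37)) (var 0)))
    (.seq (.setArr 2 (var 3) (const 1))
    (.setVar 3 (add (var 3) (const 1)))))

/-- Append the paths of a word to the output. -/
def emit : BCmd := .loop 37 (.ite (lt (var 37) (var 33)) emitLetter .skip)

theorem emitLetter_true {L : List (List ℕ)} {y j : ℕ} (hn : s.var 0 = n) (hLB : L.length ≤ s.var 4)
    (hj : s.var 37 = j) (hc : s.arr 25 j = letterCode n true y)
    (h : OutRep n s L) (hL : ∀ l ∈ L, l.length ≤ n) :
    OutRep n (emitLetter.den s) (L ++ [[y]]) := by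
  have hc' : s.arr 25 j = n + y := hc
  rw [emitLetter, ite_den_of_not (by simp only [holds_lt, eval_get, eval_var, hj, hc', hn]; omega)]
  simp only [seq_den]
  refine h.snoc hL ?_ (fun i => ?_) (fun i => ?_)
  · simp (disch := decide) only [var_setVar, eval_add, eval_var, eval_const, den_var, h.1]
  · simp (disch := decide) only [den_arr, arr_setArr, eval_var, eval_const, den_var, h.1]
  · simp (disch := decide) only [den_arr, arr_setArr, eval_var, eval_mul, eval_sub, eval_get, hj, hc', h.1,
      hn, min_eq_left hLB, Nat.add_sub_cancel_left]

theorem emitLetter_false {L : List (List ℕ)} {l : List ℕ} {y j : ℕ} (hn : s.var 0 = n)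
    (hLB : L.length ≤ s.var 4) (hj : s.var 37 = j) (hc : s.arr 25 j = letterCode n false y) (hy : y < n)
    (h : OutRep n s (L ++ [l])) (hL : ∀ l ∈ L, l.length ≤ n) :
    OutRep n (emitLetter.den s) (L ++ [l ++ [y]]) := by
  have hc' : s.arr 25 j = y := hc
  have h3 : s.var 3 = L.length + 1 := by simpa using h.1
  have h2 : s.arr 2 L.length = l.length := by
    have := (h.2 L.length (by simp)).1
    simpa using this
  rw [emitLetter, ite_den_of_ne (by simp only [holds_lt, eval_get, eval_var, hj, hc', hn]; omega)]
  simp only [seq_den]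
  refine h.extend hL ?_ (fun i => ?_) (fun i => ?_)
  · simp (disch := decide) only [den_var, h3]
  · simp (disch := decide) only [den_arr, den_var, arr_setArr, eval_var, eval_const, eval_add, eval_sub, eval_get, h3,
      Nat.add_sub_cancel, h2]
  · simp (disch := decide) only [den_arr, arr_setArr, eval_var, eval_mul, eval_sub, eval_get, eval_add,
      eval_const, hj, hc', h3, hn, Nat.add_sub_cancel, h2, min_eq_left hLB]

/-- Reading the letters in chronological order writes the decoded paths in reverse order, each of
them reversed, which is `outPaths`. That the decoding is non-empty once the state is a vertex
guarantees an open path for every continuing letter. -/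
theorem emit_iter {W : WordSpec} {L : List (List ℕ)} (hn : s.var 0 = n) (hW : W.n = n)
    (hadj : ∀ x y, W.adj x y → x < W.n) (hLB : L.length + n ≤ s.var 4)
    (h : OutRep n s L) (hL : ∀ l ∈ L, l.length ≤ n) {i : ℕ} :
    ∀ {k u x : ℕ} {w : List (Bool × ℕ)}, w ∈ W.words i k u x → i ≤ s.var 33 →
    (w.map Prod.snd).Nodup →
    (∀ j f y, w.reverse[j]? = some (f, y) → s.arr 25 j = letterCode n f y) →
    (x < n → decode w ≠ []) ∧
    OutRep n (iter 37 (.ite (lt (var 37) (var 33)) emitLetter .skip) 0 i s) (L ++ outPaths w) := by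
  induction i with
  | zero =>
    intro k u x w hw _ _ _
    obtain ⟨rfl, rfl, rfl, rfl⟩ := WordSpec.mem_words_zero.1 hw
    exact ⟨fun hx => absurd hx (by omega), by simpa [outPaths, decode, iter] using h⟩
  | succ i ih =>
    intro k u y w hw hi hnd hc
    obtain ⟨⟨hy, -⟩, hw'⟩ := WordSpec.mem_words_succ.1 hw
    rw [hW] at hy
    obtain ⟨f, k', u', x', w', hww, rfl, hfx⟩ : ∃ f k' u' x' w', w' ∈ W.words i k' u' x' ∧
        w = (f, y) :: w' ∧ (f = false → x' < n) := by
      rcases hw' with ⟨-, x, -, hxy, w', hw', rfl⟩ | ⟨-, s', -, x, -, -, w', hw', rfl⟩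
      · exact ⟨false, _, _, _, w', hw', rfl, fun _ => hW ▸ hadj _ _ hxy⟩
      · exact ⟨true, _, _, _, w', hw', rfl, by simp⟩
    have hlen := W.length_of_mem_words hww
    have hnd' : (w'.map Prod.snd).Nodup := by
      rw [List.map_cons, List.nodup_cons] at hnd
      exact hnd.2
    have hc' : ∀ j f y, w'.reverse[j]? = some (f, y) → s.arr 25 j = letterCode n f y := by
      intro j g z hj
      refine hc j g z ?_
      rw [List.reverse_cons, List.getElem?_append_left (List.getElem?_eq_some_iff.1 hj).1, hj]
    obtain ⟨hd, ho⟩ := ih hww (by omega) hnd' hc'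
    have hci : s.arr 25 i = letterCode n f y := hc i f y (by simp [hlen])
    have hlt := WordSpec.lt_of_mem_words hww
    have hoN : (outPaths w').flatten.Nodup := by
      rw [outPaths, (flatten_reverse_perm _).nodup_iff, flatten_decode]
      exact hnd'
    have hon : ∀ l ∈ outPaths w', l.length ≤ n := by
      intro l hl
      have hs := List.sublist_flatten_of_mem hl
      have hlN := hoN.sublist hs
      have : l.toFinset ⊆ Finset.range n := by
        intro z hz
        have hz' := hs.subset (List.mem_toFinset.1 hz)
        rw [outPaths, (flatten_reverse_perm _).mem_iff, flatten_decode] at hz'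
        obtain ⟨a, ha, rfl⟩ := List.mem_map.1 hz'
        exact Finset.mem_range.2 (hW ▸ hlt a ha)
      have := Finset.card_le_card this
      rwa [List.toFinset_card_of_nodup hlN, Finset.card_range] at this
    -- The path index must not exceed the bound, where multiplication is cut off in the computation
    -- of the address.
    have hcnt : (outPaths w').length ≤ n := by
      have h1 : (outPaths w').length ≤ w'.length := by
        simp only [outPaths, List.length_reverse, List.length_map]
        clear * -
        induction w' with
        | nil => rfl
        | cons a w ih =>
          obtain ⟨f, y⟩ := a
          cases f
          · simp only [decode]
            cases hd : decode w <;> simp_all <;> omega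
          · simpa [decode] using ih
      have h2 : (w'.map Prod.snd).toFinset ⊆ Finset.range n := by
        intro z hz
        obtain ⟨a, ha, rfl⟩ := List.mem_map.1 (List.mem_toFinset.1 hz)
        exact Finset.mem_range.2 (hW ▸ hlt a ha)
      have := Finset.card_le_card h2
      rw [List.toFinset_card_of_nodup hnd', Finset.card_range, List.length_map] at this
      omega
    have hfr := iter_frame 37 (.ite (lt (var 37) (var 33)) emitLetter .skip) 0 i s
    have hb : ∀ l ∈ L ++ outPaths w', l.length ≤ n := fun l hl =>
      (List.mem_append.1 hl).elim (hL l) (hon l)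
    rw [iter_succ, Nat.zero_add]
    set t := iter 37 (.ite (lt (var 37) (var 33)) emitLetter .skip) 0 i s with ht
    have ho' : OutRep n (t.setV 37 i) (L ++ outPaths w') :=
      ho.congr (RamState.setV_of_ne (by decide)) rfl rfl
    rw [ite_den_of_ne (by
      simp (disch := decide) only [holds_lt, eval_var, RamState.setV_self, RamState.setV_of_ne,
        hfr.1 33 (by decide)]
      omega)]
    have t0 : (t.setV 37 i).var 0 = n := by
      rw [RamState.setV_of_ne (by decide), hfr.1 0 (by decide), hn]
    have t4 : (t.setV 37 i).var 4 = s.var 4 := by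
      rw [RamState.setV_of_ne (by decide), hfr.1 4 (by decide)]
    have t25 : ∀ j, (t.setV 37 i).arr 25 j = s.arr 25 j := by
      intro j
      rw [RamState.setV_arr, hfr.2 25 (by decide)]
    cases f
    · have hne := hd (hfx rfl)
      obtain ⟨l, P, hlP⟩ := List.exists_cons_of_ne_nil hne
      have e1 : outPaths w' = (P.map List.reverse).reverse ++ [l.reverse] := by simp [outPaths, hlP]
      have e2 : outPaths ((false, y) :: w') = (P.map List.reverse).reverse ++ [l.reverse ++ [y]] := by
        simp [outPaths, decode, hlP]
      refine ⟨fun _ => by simp [decode, hlP], ?_⟩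
      rw [e1, ← List.append_assoc] at ho' hb
      rw [e2, ← List.append_assoc]
      rw [e1, List.length_append] at hcnt
      refine emitLetter_false t0 ?_ (RamState.setV_self _ _ _) ((t25 i).trans hci) hy ho'
        fun l hl => hb l (List.mem_append_left _ hl)
      rw [t4, List.length_append]
      omega
    · refine ⟨fun _ => by simp [decode], ?_⟩
      rw [outPaths_cons_true, ← List.append_assoc]
      refine emitLetter_true t0 ?_ (RamState.setV_self _ _ _) ((t25 i).trans hci) ho' hb
      rw [t4, List.length_append]
      omega

end BCmd

/-! ### Search for packings in a vertex set -/

namespace BCmd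

open BExpr

variable {s s' : RamState} {B n : ℕ} {A dem : ℕ → ℕ → Prop} {K : Finset ℕ}

/-- The memory holds the graph `A`, the demands `dem` and the tables for the search of packings. -/
structure StageEnv (B : ℕ) (A dem : ℕ → ℕ → Prop) (s : RamState) : Prop extends PackEnv B s where
  adj : A = adjRel (s.var 0) (s.arr 0)
  dem_eq : dem = adjRel (s.var 0) (s.arr 1)
  symm : Symmetric A
  dem_symm : Symmetric dem

theorem StageEnv.frame (h : StageEnv B A dem s) (hv : ∀ z ∈ [0, 4, 51], s'.var z = s.var z)
    (ha : ∀ z ∈ [0, 1, 18, 30, 31], s'.arr z = s.arr z) : StageEnv B A dem s' where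
  toPackEnv := h.toPackEnv.congr (hv 0 (by decide)) (hv 4 (by decide)) (hv 51 (by decide))
    (ha 18 (by decide)) (ha 30 (by decide)) (ha 31 (by decide))
  adj := by rw [hv 0 (by decide), ha 0 (by decide)]; exact h.adj
  dem_eq := by rw [hv 0 (by decide), ha 1 (by decide)]; exact h.dem_eq
  symm := h.symm
  dem_symm := h.dem_symm

theorem emit_spec {W : WordSpec} {L : List (List ℕ)} {m k u x : ℕ} {w : List (Bool × ℕ)}
    (hn : s.var 0 = n) (hW : W.n = n) (hadj : ∀ x y, W.adj x y → x < W.n)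
    (hLB : L.length + n ≤ s.var 4) (h : OutRep n s L) (hL : ∀ l ∈ L, l.length ≤ n)
    (hw : w ∈ W.words m k u x) (hm : s.var 33 = m) (hmB : m ≤ s.var 4)
    (hnd : (w.map Prod.snd).Nodup)
    (hc : ∀ j f y, w.reverse[j]? = some (f, y) → s.arr 25 j = letterCode n f y) :
    OutRep n (emit.den s) (L ++ outPaths w) := by
  rw [emit, den_loop, show s.var 4 = m + (s.var 4 - m) by omega]
  generalize s.var 4 - m = l
  induction l with
  | zero => exact (emit_iter hn hW hadj hLB h hL hw hm.ge hnd hc).2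
  | succ l ih =>
    rw [← Nat.add_assoc, iter_succ, ite_den_of_not]
    · exact ih.congr (RamState.setV_of_ne (by decide)) rfl rfl
    · simp (disch := decide) only [holds_lt, eval_var, RamState.setV_self, RamState.setV_of_ne,
        (iter_frame 37 _ 0 (m + l) s).1 33, hm]
      omega

/-- Translates between words and packings: the number found is attained by a packing, dominates
every packing with few enough vertices, and extraction followed by output appends a packing of that
size. Reversal of the stored lists is harmless because adjacency and demands are symmetric. -/
theorem search_spec (hE : StageEnv B A dem s) (hn : s.var 0 = n) (hK : Represents B (s.arr 24) K)
    (hKn : K ⊆ Finset.range n) :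
    (searchMax.den s).var 32 ≤ maxPacking A dem K ∧ (searchMax.den s).var 32 < B ∧
    (∀ P, IsPacking A dem K P → P.flatten.length ≤ s.var 51 →
      P.length ≤ (searchMax.den s).var 32) ∧
    ∀ L, OutRep n s L → (∀ l ∈ L, l.length ≤ n) → L.length + n ≤ B →
      ∃ P, IsPacking A dem K P ∧ P.length = (searchMax.den s).var 32 ∧
        OutRep n (emit.den (extract.den (searchMax.den s))) (L ++ P) := by
  obtain ⟨h30, h33, h32, hF, hmax⟩ := searchMax_spec hE.toPackEnv
  have hf := den_frame searchMax s
  have e51 : (searchMax.den s).var 51 = s.var 51 := hf.1 51 (by decide)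
  have hout : ∀ L, OutRep n s L → OutRep n (searchMax.den s) L := fun L h =>
    h.congr (hf.1 3 (by decide)) (hf.2 2 (by decide)) (hf.2 3 (by decide))
  have hE1 : StageEnv B A dem (searchMax.den s) :=
    hE.frame (fun z hz => hf.1 z (by revert z; decide)) (fun z hz => hf.2 z (by revert z; decide))
  have hn1 : (searchMax.den s).var 0 = n := (hf.1 0 (by decide)).trans hn
  have hK1 : Represents B ((searchMax.den s).arr 24) K := by rw [hf.2 24 (by decide)]; exact hK
  rw [← e51] at h33 hmax ⊢
  set t := searchMax.den s with ht
  clear_value t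
  have hnB : n < B := hn1 ▸ hE1.size_lt
  set W := (wordSpec t).free with hW
  have Wn : W.n = n := hn1
  have Wbd : W.bd = B := hE1.bound
  have Wadj : W.adj = A := hE1.adj.symm
  have Wacc : ∀ u x, W.acc u x ↔ (u = W.n ∧ x = W.n) ∨ dem u x := fun u x => by
    rw [hE1.dem_eq]; rfl
  have Wdem : ∀ u x, dem u x → u < W.n ∧ x < W.n := fun u x h => by
    rw [hE1.dem_eq] at h; exact ⟨h.1, h.2.1⟩
  have hadj : ∀ x y, W.adj x y → x < W.n := fun x y h => by
    rw [Wadj, hE1.adj] at h; exact h.1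
  have Wact : ∀ y, y < W.n → (W.act y ↔ y ∈ K) := fun y hy => hK1 y (by omega)
  have Wsymm : Symmetric W.adj := Wadj ▸ hE1.symm
  have hpack : ∀ {m k u x w}, w ∈ W.words m k u x → W.acc u x → (w.map Prod.snd).Nodup →
      IsPacking A dem K (decode w) ∧ (decode w).length = k := fun hw hux hnd => by
    have := WordSpec.isPacking_decode Wsymm Wacc Wdem hadj hw hux hnd (D := K)
      (fun y hy h => (Wact y hy).1 h)
    rwa [Wadj] at this
  refine ⟨?_, h32, fun P hP hl => ?_, fun L hL hLn hLB => ?_⟩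
  · obtain ⟨u, hu, x, hx, hux, w, hw, hnd, -⟩ := WordSpec.feasible_iff.1 hF
    obtain ⟨h1, h2⟩ := hpack hw hux hnd
    rw [← h2]
    exact h1.mem_le
  · have hlt := (hE1.lt hl).1
    refine hmax _ hl _ (hP.length_le_flatten.trans_lt hlt) (WordSpec.feasible_iff.2 ?_)
    obtain ⟨u, hu, x, hx, hux, w, hw, hnd⟩ := WordSpec.exists_word_of_isPacking (W := W) (D := K)
      Wsymm Wacc (by rw [Wn, Wbd]; exact hnB) (fun _ _ _ => trivial) (fun y hy => by
        have hyn : y < W.n := by rw [Wn]; exact Finset.mem_range.1 (hKn hy)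
        exact ⟨hyn, (Wact y hyn).2 hy⟩) (by rw [Wadj]; exact hP)
    exact ⟨u, hu, x, hx, hux, w, hw, hnd, fun i f y _ hi => by
      change i < t.var 30 at hi
      rw [h30] at hi
      omega⟩
  · obtain ⟨u, hu, x, hx, hux, w, hw, hnd, hc⟩ := extract_spec hE1.toPackEnv h30 h33 h32 hF
    obtain ⟨h1, h2⟩ := hpack hw hux hnd
    have hfe := den_frame extract t
    refine ⟨outPaths w, h1.map_reverse hE1.symm hE1.dem_symm, by simpa [outPaths] using h2, ?_⟩
    refine emit_spec (W := W) ((hfe.1 0 (by decide)).trans hn1) Wn hadj ?_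
      ((hout L hL).congr (hfe.1 3 (by decide)) (hfe.2 2 (by decide)) (hfe.2 3 (by decide))) hLn hw
      (hfe.1 33 (by decide)) ?_ hnd fun j f y h => by rw [hc j f y h, hn1]
    · rw [hfe.1 4 (by decide), hE1.bound]; exact hLB
    · rw [hfe.1 4 (by decide), hE1.bound]; exact (hE1.lt h33).1.le

end BCmd

/-! ### Treating one component -/

namespace BCmd

open BExpr

variable {s s' : RamState} {B n h : ℕ} {A dem : ℕ → ℕ → Prop} {K W : Finset ℕ} {L : List (List ℕ)}

/-- Delete the vertex in the variable `60` if this decreases the tree-depth of the set in array `24`. -/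
def tryRoot : BCmd :=
  .ite (and (not (var 61)) (get 24 (var 60)))
    (.seq (tab 21 [20] (and (get 24 (var 20)) (not (eq (var 20) (var 60)))))
    (.seq find
    (.ite found .skip (.seq (.setVar 61 (const 1)) (.setArr 23 (var 60) (const 0))))))
    .skip

/-- Delete a vertex from the set in array `23` such that the tree-depth of the set in array `24`
decreases. -/
def findRoot : BCmd :=
  .seq (.setVar 61 (const 0)) (.seq (.setVar 7 (sub (var 56) (const 1))) (.loop 60 tryRoot))

theorem StageEnv.tickEnv (hE : StageEnv B A dem s) (h7 : s.var 7 = h) : TickEnv B A h s :=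
  ⟨hE.bound, hE.size_lt.le, hE.adj, h7, hE.tables.pow⟩

/-- Each vertex of `K` is tried in turn with the tree-depth test at level `h`, and only the first
success is acted upon; the hypothesis provides a success. -/
theorem findRoot_spec (hE : StageEnv B A dem s) (hn : s.var 0 = n) (h56 : s.var 56 = h + 1)
    (hB : 2 ^ (6 * 2 ^ h) ≤ B) (hK : Represents B (s.arr 24) K) (hKn : K ⊆ Finset.range n)
    (hW : Represents B (s.arr 23) W) (hr : ∃ r ∈ K, TdLe A h (K.erase r)) :
    ∃ r ∈ K, TdLe A h (K.erase r) ∧ Represents B ((findRoot.den s).arr 23) (W.erase r) := by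
  have hnB : n < B := hn ▸ hE.size_lt
  have hKB : K ⊆ Finset.range B := hKn.trans (Finset.range_subset_range.2 hnB.le)
  simp only [findRoot, seq_den]
  set s0 := (setVar 7 (sub (var 56) (const 1))).den ((setVar 61 (const 0)).den s) with hs0
  have hE0 : StageEnv B A dem s0 := hE.frame (fun z hz => by
    rw [hs0, den_var, den_var] <;> revert z <;> decide) (fun z hz => rfl)
  have v7 : s0.var 7 = h := by
    simp (disch := decide) only [hs0, var_setVar, eval_sub, eval_var, eval_const, den_var, h56,
      Nat.add_sub_cancel]
  have v61 : s0.var 61 = 0 := by simp (disch := decide) only [hs0, den_var, var_setVar, eval_const]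
  have hK0 : Represents B (s0.arr 24) K := hK
  have hW0 : Represents B (s0.arr 23) W := hW
  clear_value s0
  have key := loop_inv (x := 60) (a := tryRoot) (s := s0) (fun j s' =>
    (s'.var 61 ≠ 0 → ∃ r ∈ K, TdLe A h (K.erase r) ∧ Represents B (s'.arr 23) (W.erase r)) ∧
    (s'.var 61 = 0 → Represents B (s'.arr 23) W ∧ ∀ r < j, r ∈ K → ¬ TdLe A h (K.erase r)))
    ⟨fun h => absurd v61 h, fun _ => ⟨hW0, by omega⟩⟩ (by
    rintro j hj s' hf ⟨h1, h2⟩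
    rw [hE0.bound] at hj
    have hEj : StageEnv B A dem (s'.setV 60 j) := hE0.frame
      (fun z hz => (RamState.setV_of_ne (by revert z; decide)).trans (hf.1 z (by revert z; decide)))
      (fun z hz => hf.2 z (by revert z; decide))
    have w7 : (s'.setV 60 j).var 7 = h := (RamState.setV_of_ne (by decide)).trans
      ((hf.1 7 (by decide)).trans v7)
    have w60 : (s'.setV 60 j).var 60 = j := RamState.setV_self _ _ _
    have w24 : Represents B ((s'.setV 60 j).arr 24) K := by
      rw [RamState.setV_arr, hf.2 24 (by decide)]; exact hK0
    have e61 : (s'.setV 60 j).var 61 = s'.var 61 := RamState.setV_of_ne (by decide)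
    rw [← e61] at h1 h2
    rw [← s'.setV_arr 60 j] at h1 h2
    set t := s'.setV 60 j with ht
    clear_value t
    by_cases h61 : t.var 61 = 0
    swap
    · rw [tryRoot, ite_den_of_not (by simp only [holds_and, holds_not, holds_var]; tauto)]
      exact ⟨fun _ => h1 h61, fun h => absurd h h61⟩
    obtain ⟨hWt, hno⟩ := h2 h61
    by_cases hjK : j ∈ K
    swap
    · rw [tryRoot, ite_den_of_not (by
        simp only [holds_and, holds_get, eval_var, w60, w24 j hj]; tauto)]
      refine ⟨fun h => absurd h61 h, fun _ => ⟨hWt, fun r hr hrK => ?_⟩⟩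
      rcases Nat.lt_succ_iff_lt_or_eq.1 hr with h | rfl
      · exact hno r h hrK
      · exact absurd hrK hjK
    rw [tryRoot, ite_den_of_ne (by
        simp only [holds_and, holds_not, holds_var, holds_get, eval_var, w60, w24 j hj]; tauto)]
    simp only [seq_den]
    set t1 := (tab 21 [20] (and (get 24 (var 20)) (not (eq (var 20) (var 60))))).den t with ht1
    have r21 : Represents B (t1.arr 21) (K.erase j) := by
      intro v hv
      have hb := hEj.bound
      simp
        (disch := first | assumption | decide)
        only [ht1, arr_tab1_ne, holds_and, holds_get, holds_not, holds_eq, eval_var,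
          Function.update_self, Function.update_of_ne, w24 v hv, w60]
      rw [Finset.mem_erase]
      tauto
    have hE1 : StageEnv B A dem t1 := hEj.frame
      (fun z hz => den_var (by revert z; decide)) (fun z hz => den_arr (by revert z; decide))
    have x7 : t1.var 7 = h := (den_var (by decide)).trans w7
    have hfs := find_spec hE1.symm (hE1.tickEnv x7) hB ((Finset.erase_subset _ _).trans hKB) r21
    have hf1 := den_frame find t1
    have y60 : (find.den t1).var 60 = j := (hf1.1 60 (by decide)).trans ((den_var (by decide)).trans w60)
    have y61 : (find.den t1).var 61 = 0 := (hf1.1 61 (by decide)).trans ((den_var (by decide)).trans h61)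
    have y23 : (find.den t1).arr 23 = t.arr 23 := (hf1.2 23 (by decide)).trans (den_arr (by decide))
    generalize find.den t1 = t2 at hfs y60 y61 y23 ⊢
    by_cases hg : TdLe A h (K.erase j)
    · rw [ite_den_of_not (fun hh => hfs.1 hh hg)]
      refine ⟨fun _ => ⟨j, hjK, hg, fun v hv => ?_⟩, fun h => ?_⟩
      · simp (disch := decide) only [seq_den, arr_setArr, eval_var, eval_const, den_var, y60, den_arr,
          y23]
        rw [Finset.mem_erase]
        by_cases hvj : v = j
        · simp [hvj]
        · rw [if_neg hvj]
          exact (hWt v hv).trans (by simp [hvj])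
      · simp (disch := decide) only [seq_den, den_var, var_setVar, eval_const] at h
        omega
    · rw [ite_den_of_ne (hfs.2 hg)]
      refine ⟨fun h => absurd y61 h, fun _ => ⟨fun v hv => ?_, fun r hr hrK => ?_⟩⟩
      · change t2.arr 23 v ≠ 0 ↔ _
        rw [y23]; exact hWt v hv
      · rcases Nat.lt_succ_iff_lt_or_eq.1 hr with h | rfl
        · exact hno r h hrK
        · exact hg)
  obtain ⟨r, hrK, hrt⟩ := hr
  refine key.1 fun h61 => (key.2 h61).2 r ?_ hrK hrt
  rw [hE0.bound]
  exact Finset.mem_range.1 (hKB hrK)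

/-- Pack paths in the component with root in the variable `57`, or delete a vertex. -/
def handle : BCmd :=
  .seq (tab 24 [20] (and (lt (var 20) (var 0)) (eq (get 34 (var 20)) (var 57))))
  (.seq searchMax
  (.ite (le (mul (add (var 32) (const 1)) (get 18 (var 56))) (var 51))
    (.seq extract (.seq emit
    (.seq (tab 35 [20] (and (get 23 (var 20)) (not (get 24 (var 20)))))
    (tab 23 [20] (get 35 (var 20))))))
    findRoot))

theorem _root_.IsPacking.length_le_of_mem {P : List (List ℕ)} (hP : IsPacking A dem (Finset.range n) P)
    {l : List ℕ} (hl : l ∈ P) : l.length ≤ n := by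
  have hs := List.sublist_flatten_of_mem hl
  have h1 := hs.length_le
  have h2 := hP.flatten_length_le
  rw [Finset.card_range] at h2
  exact h1.trans h2

/-- The set of vertices and the paths that have been output. -/
structure Partial (B n : ℕ) (A dem : ℕ → ℕ → Prop) (W : Finset ℕ) (L : List (List ℕ)) (s : RamState) :
    Prop where
  rep : Represents B (s.arr 23) W
  sub : W ⊆ Finset.range n
  out : OutRep n s L
  packing : IsPacking A dem (Finset.range n \ W) L

/-- Either the size limit was generous enough to certify the packing found as optimal for `K`, or
the failed comparison bounds the limit by the optimum of `K`. This lower bound on the optimum pays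
for the deleted root. -/
theorem handle_spec (hE : StageEnv B A dem s) (hn : s.var 0 = n) (h56 : s.var 56 = h + 1)
    (hB : 2 ^ (6 * 2 ^ (h + 1)) ≤ B)
    (hK : ∀ v < n, s.arr 34 v = s.var 57 ↔ v ∈ K) (hKW : K ⊆ W) (hI : Partial B n A dem W L s)
    (htd : TdLe A (h + 1) K) (hr : ∃ r ∈ K, TdLe A h (K.erase r)) :
    ∃ W' L', Partial B n A dem W' L' (handle.den s) ∧
      ((W' = W \ K ∧ L'.length = L.length + maxPacking A dem K) ∨
      (∃ r ∈ K, W' = W.erase r ∧ TdLe A h (K.erase r) ∧ L' = L ∧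
        s.var 51 < (maxPacking A dem K + 1) * 2 ^ (h + 1))) := by
  have hnB : n < B := hn ▸ hE.size_lt
  have hKn := hKW.trans hI.sub
  have hB' : 2 ^ (6 * 2 ^ h) ≤ B := (Nat.pow_le_pow_right (by norm_num) (by
    rw [pow_succ]; omega)).trans hB
  have hhB : h + 1 ≤ B := by
    refine le_trans ?_ hB
    have h1 : h + 1 < 2 ^ (h + 1) := Nat.lt_two_pow_self
    have h2 : 6 * 2 ^ (h + 1) < 2 ^ (6 * 2 ^ (h + 1)) := Nat.lt_two_pow_self
    omega
  simp only [handle, seq_den]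
  set s0 := (tab 24 [20] (and (lt (var 20) (var 0)) (eq (get 34 (var 20)) (var 57)))).den s with hs0
  have r24 : Represents B (s0.arr 24) K := by
    intro v hv
    have hb := hE.bound
    simp
      (disch := first | assumption | decide)
      only [hs0, arr_tab1_ne, holds_and, holds_lt, holds_get, eval_get, holds_eq, eval_var,
        Function.update_self, Function.update_of_ne, hn]
    constructor
    · rintro ⟨h1, h2⟩; exact (hK v h1).1 h2
    · intro h; have := Finset.mem_range.1 (hKn h); exact ⟨this, (hK v this).2 h⟩
  have hE0 : StageEnv B A dem s0 := hE.frame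
    (fun z hz => den_var (by revert z; decide)) (fun z hz => den_arr (by revert z; decide))
  have hn0 : s0.var 0 = n := (den_var (by decide)).trans hn
  have v56 : s0.var 56 = h + 1 := (den_var (by decide)).trans h56
  have v51 : s0.var 51 = s.var 51 := den_var (by decide)
  have hI0 : Partial B n A dem W L s0 := by
    refine ⟨?_, hI.sub, hI.out.congr (den_var (by decide)) (den_arr (by decide)) (den_arr (by decide)),
      hI.packing⟩
    rw [hs0, den_arr (by decide)]; exact hI.rep
  rw [← v51]
  clear_value s0
  obtain ⟨g1, g2, g3, g4⟩ := search_spec hE0 hn0 r24 hKn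
  have hf1 := den_frame searchMax s0
  set s1 := searchMax.den s0 with hs1
  have hn1 : s1.var 0 = n := (hf1.1 0 (by decide)).trans hn0
  have b1 : s1.var 4 = B := (hf1.1 4 (by decide)).trans hE0.bound
  have p1 : s1.arr 18 (h + 1) = 2 ^ (h + 1) := by
    rw [hf1.2 18 (by decide)]; exact hE0.tables.pow _ hhB
  have w56 : s1.var 56 = h + 1 := (hf1.1 56 (by decide)).trans v56
  have w51 : s1.var 51 = s0.var 51 := hf1.1 51 (by decide)
  have hcond : (le (mul (add (var 32) (const 1)) (get 18 (var 56))) (var 51)).holds s1.var s1.arr ↔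
      (s1.var 32 + 1) * 2 ^ (h + 1) ≤ s0.var 51 := by
    simp only [holds_le, eval_mul, eval_add, eval_var, eval_const, eval_get, w56, p1, b1, w51]
    rw [min_eq_left (by omega)]
  by_cases hc : (s1.var 32 + 1) * 2 ^ (h + 1) ≤ s0.var 51
  · rw [ite_den_of_ne (hcond.2 hc)]
    simp only [seq_den]
    have hLn : IsPacking A dem (Finset.range n) L := hI.packing.mono Finset.sdiff_subset
    obtain ⟨P, hP, hPl, hPo⟩ := g4 L hI0.out (fun l hl => hLn.length_le_of_mem hl) (by
      have h1 := hLn.length_le_flatten.trans hLn.flatten_length_le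
      rw [Finset.card_range] at h1
      have := hE0.size
      omega)
    -- A packing with one more path could be cut down to exactly `k + 1` paths, which occupy at most
    -- `(k + 1) 2^(h+1)` vertices and so would have been within the limit.
    have hmax : maxPacking A dem K = s1.var 32 := by
      refine le_antisymm ?_ g1
      by_contra hlt
      obtain ⟨P', hP', hl'⟩ := exists_packing_of_le (A := A) (dem := dem) (D := K)
        (k := s1.var 32 + 1) (by omega)
      have h1 := hP'.flatten_le hE.symm htd
      rw [hl'] at h1
      have := g3 P' hP' (h1.trans hc)
      omega
    have hf2 := den_frame extract s1
    set s2 := extract.den s1 with hs2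
    have hf3 := den_frame emit s2
    set s3 := emit.den s2 with hs3
    have b3 : s3.var 4 = B := (hf3.1 4 (by decide)).trans ((hf2.1 4 (by decide)).trans b1)
    have a23 : s3.arr 23 = s0.arr 23 := (hf3.2 23 (by decide)).trans
      ((hf2.2 23 (by decide)).trans (hf1.2 23 (by decide)))
    have a24 : s3.arr 24 = s0.arr 24 := (hf3.2 24 (by decide)).trans
      ((hf2.2 24 (by decide)).trans (hf1.2 24 (by decide)))
    clear_value s3
    refine ⟨W \ K, L ++ P, ⟨fun v hv => ?_, Finset.sdiff_subset.trans hI.sub,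
      hPo.congr (by simp (disch := decide) only [den_var]) (by simp (disch := decide) only [den_arr])
        (by simp (disch := decide) only [den_arr]), ?_⟩, .inl ⟨rfl, by simp [hPl, hmax]⟩⟩
    · simp
        (disch := first | assumption | decide | (simp (disch := decide) only [den_var]; assumption))
        only [arr_tab1_ne, den_arr, holds_and, holds_not, holds_get, eval_var,
          Function.update_self, a23, a24, hI0.rep v hv, r24 v hv]
      rw [Finset.mem_sdiff]
    · refine (hI.packing.append hP ?_).mono fun x hx => ?_
      · exact Finset.disjoint_left.2 fun x hx hxK => (Finset.mem_sdiff.1 hx).2 (hKW hxK)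
      · rw [Finset.mem_union, Finset.mem_sdiff] at hx
        rw [Finset.mem_sdiff, Finset.mem_sdiff]
        rcases hx with hx | hx
        · exact ⟨hx.1, fun h => hx.2 h.1⟩
        · exact ⟨hKn hx, fun h => h.2 hx⟩
  · rw [ite_den_of_not (fun hh => hc (hcond.1 hh))]
    have hE1 : StageEnv B A dem s1 := hE0.frame
      (fun z hz => hf1.1 z (by revert z; decide)) (fun z hz => hf1.2 z (by revert z; decide))
    obtain ⟨r, hrK, hrt, hrep⟩ := findRoot_spec hE1 hn1 w56 hB'
      (by rw [hf1.2 24 (by decide)]; exact r24) hKn (W := W)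
      (by rw [hf1.2 23 (by decide)]; exact hI0.rep) hr
    have hf2 := den_frame findRoot s1
    refine ⟨W.erase r, L, ⟨hrep, (Finset.erase_subset _ _).trans hI.sub, hI0.out.congr
      ((hf2.1 3 (by decide)).trans (hf1.1 3 (by decide)))
      ((hf2.2 2 (by decide)).trans (hf1.2 2 (by decide)))
      ((hf2.2 3 (by decide)).trans (hf1.2 3 (by decide))),
      hI.packing.mono (Finset.sdiff_subset_sdiff le_rfl (Finset.erase_subset _ _))⟩,
      .inr ⟨r, hrK, rfl, hrt, rfl, ?_⟩⟩
    refine lt_of_lt_of_le (not_le.1 hc) (Nat.mul_le_mul_right _ ?_)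
    omega

end BCmd

/-! ### Rounds over all components, and the stage for a given depth -/

theorem rootOf_eq_iff {A : ℕ → ℕ → Prop} (hA : Symmetric A) {D : Finset ℕ} {r v : ℕ} (hr : r ∈ D)
    (hrr : rootOf A D r = r) : v ∈ D ∧ rootOf A D v = r ↔ v ∈ comp A D r := by
  rw [mem_comp]
  constructor
  · rintro ⟨hv, h⟩
    have := conn_rootOf (A := A) hv
    rw [h] at this
    exact this.symm hA
  · intro h
    exact ⟨h.mem.2, by rw [← rootOf_eq hA h, hrr]⟩

namespace BCmd

open BExpr

variable {s s' : RamState} {B n h : ℕ} {A dem : ℕ → ℕ → Prop} {W : Finset ℕ} {L : List (List ℕ)}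

/-- Handle the components with roots below `B`, one after the other. -/
def level : BCmd :=
  .seq (.setVar 56 (sub (var 52) (var 59)))
  (.seq (tab 4 [20] (get 23 (var 20)))
  (.seq conn
  (.seq (tab 34 [20] (BExpr.ite (get 23 (var 20)) (get 8 (var 20)) (var 4)))
  (.loop 57 (.ite (eq (get 34 (var 57)) (var 57)) handle .skip)))))

/-- Deleted roots lie in different components of `W`, and each of these components has optimum at
least `X`. Since optima of disjoint sets add up, the number `c` of deletions satisfies `c * X ≤
maxPacking A dem W`. -/
theorem level_spec {d i c₀ X : ℕ} (hE : StageEnv B A dem s) (hn : s.var 0 = n) (hd : s.var 52 = d)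
    (hi : s.var 59 = i) (hih : d = i + (h + 1)) (hB : 2 ^ (6 * 2 ^ (h + 1)) ≤ B)
    (hI : Partial B n A dem W L s) (htd : TdLe A (h + 1) W) (hX : X * 2 ^ (h + 1) = s.var 51)
    (hopt : maxPacking A dem (Finset.range n) ≤ L.length + maxPacking A dem W + c₀) :
    ∃ W' L' c, Partial B n A dem W' L' (level.den s) ∧ TdLe A h W' ∧
      maxPacking A dem (Finset.range n) ≤ L'.length + maxPacking A dem W' + (c₀ + c) ∧
      c * X ≤ maxPacking A dem W := by
  have hnB : n < B := hn ▸ hE.size_lt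
  have hWB : W ⊆ Finset.range B := hI.sub.trans (Finset.range_subset_range.2 hnB.le)
  have hA := hE.symm
  simp only [level, seq_den]
  set s0 := (tab 4 [20] (get 23 (var 20))).den ((setVar 56 (sub (var 52) (var 59))).den s) with hs0
  have b0 : s0.var 4 = B := by simp (disch := decide) only [hs0, den_var, hE.bound]
  have n0 : s0.var 0 = n := by simp (disch := decide) only [hs0, den_var, hn]
  have v56 : s0.var 56 = h + 1 := by
    simp (disch := decide) only [hs0, var_setVar, eval_sub, eval_var, den_var, hd, hi]
    omega
  have r4 : Represents B (s0.arr 4) W := by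
    intro v hv
    have hb := hE.bound
    simp
      (disch := first | assumption | decide | (simp (disch := decide) only [den_var]; assumption))
      only [hs0, arr_tab1_ne, holds_get, eval_var, Function.update_self, den_arr, hI.rep v hv]
  have hE0 : StageEnv B A dem s0 := hE.frame
    (fun z hz => by rw [hs0, den_var, den_var] <;> revert z <;> decide)
    (fun z hz => by rw [hs0, den_arr, den_arr] <;> revert z <;> decide)
  have hI0 : Partial B n A dem W L s0 := by
    refine ⟨?_, hI.sub, hI.out.congr ?_ ?_ ?_, hI.packing⟩
    · simp (disch := decide) only [hs0, den_arr]; exact hI.rep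
    all_goals simp (disch := decide) only [hs0, den_var, den_arr]
  have v51 : s0.var 51 = s.var 51 := by simp (disch := decide) only [hs0, den_var]
  rw [← v51] at hX
  clear_value s0
  have hT := conn_spec hA b0 hWB (by rw [n0]; exact hnB.le) hE0.adj r4
  have hf1 := den_frame conn s0
  set s1 := conn.den s0 with hs1
  set s2 := (tab 34 [20] (BExpr.ite (get 23 (var 20)) (get 8 (var 20)) (var 4))).den s1 with hs2
  have b1 : s1.var 4 = B := (hf1.1 4 (by decide)).trans b0
  -- Vertices outside `W` receive the value `B`, which no loop index equals.
  have r34 : ∀ v < B, s2.arr 34 v = if v ∈ W then rootOf A W v else B := by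
    classical
    intro v hv
    have h23 : s1.arr 23 v ≠ 0 ↔ v ∈ W := by rw [hf1.2 23 (by decide)]; exact hI0.rep v hv
    simp
      (disch := first | assumption | decide)
      only [hs2, arr_tab1, eval_ite, eval_get, holds_get, eval_var, Function.update_self,
        Function.update_of_ne, b1, h23]
    split_ifs with hvW
    · exact hT.root v hvW
    · rfl
  have hE2 : StageEnv B A dem s2 := hE0.frame
    (fun z hz => by rw [hs2, den_var, hf1.1] <;> revert z <;> decide)
    (fun z hz => by rw [hs2, den_arr, hf1.2] <;> revert z <;> decide)
  have n2 : s2.var 0 = n := by simp (disch := decide) only [hs2, den_var, hf1.1, n0]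
  have w56 : s2.var 56 = h + 1 := by simp (disch := decide) only [hs2, den_var, hf1.1, v56]
  have w51 : s2.var 51 = s0.var 51 := by simp (disch := decide) only [hs2, den_var, hf1.1]
  rw [← w51] at hX
  have hI2 : Partial B n A dem W L s2 := by
    refine ⟨?_, hI.sub, hI0.out.congr ?_ ?_ ?_, hI.packing⟩
    · simp (disch := decide) only [hs2, hf1.2, den_arr]; exact hI0.rep
    all_goals simp (disch := decide) only [hs2, den_var, den_arr, hf1.1, hf1.2]
  clear_value s2
  -- `U j` is the union of the components whose least vertex is below `j`, that is, of those already
  -- treated; deletions are charged to its optimum.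
  let U : ℕ → Finset ℕ := fun j => W.filter fun v => rootOf A W v < j
  have key := loop_inv (x := 57) (a := .ite (eq (get 34 (var 57)) (var 57)) handle .skip) (s := s2)
    (fun j s' => ∃ W' L' c, Partial B n A dem W' L' s' ∧ W' ⊆ W ∧
      (∀ v ∈ W, j ≤ rootOf A W v → v ∈ W') ∧
      (∀ v ∈ W, rootOf A W v < j → TdLe A h (W' ∩ comp A W v)) ∧
      maxPacking A dem (Finset.range n) ≤ L'.length + maxPacking A dem W' + (c₀ + c) ∧
      c * X ≤ maxPacking A dem (U j))
    ⟨W, L, 0, hI2, subset_rfl, fun v hv _ => hv, fun v _ hv => absurd hv (by omega), hopt, by omega⟩ (by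
    rintro j hj s' hf ⟨W', L', c, h1, h2, h3, h4, h5, h6⟩
    rw [hE2.bound] at hj
    have hEj : StageEnv B A dem (s'.setV 57 j) := hE2.frame
      (fun z hz => (RamState.setV_of_ne (by revert z; decide)).trans (hf.1 z (by revert z; decide)))
      (fun z hz => hf.2 z (by revert z; decide))
    have w57 : (s'.setV 57 j).var 57 = j := RamState.setV_self _ _ _
    have w34 : (s'.setV 57 j).arr 34 = s2.arr 34 := hf.2 34 (by decide)
    have n' : (s'.setV 57 j).var 0 = n :=
      (RamState.setV_of_ne (by decide)).trans ((hf.1 0 (by decide)).trans n2)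
    have x56 : (s'.setV 57 j).var 56 = h + 1 :=
      (RamState.setV_of_ne (by decide)).trans ((hf.1 56 (by decide)).trans w56)
    have x51 : (s'.setV 57 j).var 51 = s2.var 51 :=
      (RamState.setV_of_ne (by decide)).trans (hf.1 51 (by decide))
    have hI' : Partial B n A dem W' L' (s'.setV 57 j) :=
      ⟨h1.rep, h1.sub, h1.out.congr (RamState.setV_of_ne (by decide)) rfl rfl, h1.packing⟩
    set t := s'.setV 57 j with ht
    clear_value t
    have hcond : (eq (get 34 (var 57)) (var 57)).holds t.var t.arr ↔ j ∈ W ∧ rootOf A W j = j := by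
      simp only [holds_eq, eval_get, eval_var, w57, w34, r34 j hj]
      split_ifs with hjW
      · simp [hjW]
      · simp only [hjW, false_and, iff_false]; omega
    by_cases hroot : j ∈ W ∧ rootOf A W j = j
    swap
    · rw [ite_den_of_not (fun hh => hroot (hcond.1 hh))]
      have hnr : ∀ v ∈ W, rootOf A W v ≠ j := by
        rintro v hv rfl
        refine hroot ⟨(conn_rootOf hv).mem.2, (rootOf_eq hA (conn_rootOf hv)).symm⟩
      have hU : U (j + 1) = U j := by
        ext v
        simp only [U, Finset.mem_filter]
        refine and_congr_right fun hv => ?_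
        have := hnr v hv
        omega
      refine ⟨W', L', c, hI', h2, fun v hv hjv => h3 v hv (by omega), fun v hv hjv => ?_, h5, hU ▸ h6⟩
      have := hnr v hv
      exact h4 v hv (by omega)
    · rw [ite_den_of_ne (hcond.2 hroot)]
      obtain ⟨hjW, hjr⟩ := hroot
      have hKmem := fun v => rootOf_eq_iff (v := v) hA hjW hjr
      set K := comp A W j with hK
      have hKW : K ⊆ W := comp_subset
      have hKW' : K ⊆ W' := fun v hv => by
        obtain ⟨hvW, hvr⟩ := (hKmem v).2 hv
        exact h3 v hvW hvr.ge
      have htdK : TdLe A (h + 1) K := htd.mono hKW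
      obtain ⟨W'', L'', hI'', hcases⟩ := handle_spec hEj n' x56 hB (K := K) (fun v hv => by
        rw [w34, r34 v (by omega), w57, ← hKmem]
        split_ifs with hvW
        · simp [hvW]
        · simp only [hvW, false_and, iff_false]; omega) hKW' hI' htdK (htdK.exists_root hA hjW)
      have hdisj : Disjoint (U j) K := Finset.disjoint_left.2 fun v hv hvK => by
        have h1 := (Finset.mem_filter.1 hv).2
        rw [((hKmem v).2 hvK).2] at h1
        omega
      have hUK : U j ∪ K = U (j + 1) := by
        ext v
        rw [Finset.mem_union, ← hKmem]
        simp only [U, Finset.mem_filter, Nat.lt_succ_iff_lt_or_eq]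
        tauto
      have hUadd : maxPacking A dem (U j) + maxPacking A dem K ≤ maxPacking A dem (U (j + 1)) :=
        hUK ▸ maxPacking_add_le hdisj
      have hWW : W'' ⊆ W' := by
        rcases hcases with ⟨rfl, -⟩ | ⟨r, -, rfl, -⟩
        · exact Finset.sdiff_subset
        · exact Finset.erase_subset _ _
      have hother : ∀ v, v ∉ K → v ∈ W' → v ∈ W'' := by
        intro v hvK hv
        rcases hcases with ⟨rfl, -⟩ | ⟨r, hr, rfl, -⟩
        · exact Finset.mem_sdiff.2 ⟨hv, hvK⟩
        · exact Finset.mem_erase.2 ⟨by rintro rfl; exact hvK hr, hv⟩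
      have hKtd : TdLe A h (W'' ∩ K) := by
        rcases hcases with ⟨rfl, -⟩ | ⟨r, hr, rfl, hrt, -⟩
        · rw [show (W' \ K) ∩ K = ∅ by ext; simp]
          exact tdLe_empty h
        · refine hrt.mono fun v hv => ?_
          simp only [Finset.mem_inter, Finset.mem_erase] at hv ⊢
          exact ⟨hv.1.1, hv.2⟩
      have hsep : ∀ v ∈ W, j + 1 ≤ rootOf A W v → v ∈ W'' := by
        intro v hv hjv
        refine hother v (fun hvK => ?_) (h3 v hv (by omega))
        rw [((hKmem v).2 hvK).2] at hjv
        omega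
      have htdc : ∀ v ∈ W, rootOf A W v < j + 1 → TdLe A h (W'' ∩ comp A W v) := by
        intro v hv hjv
        rcases Nat.lt_succ_iff_lt_or_eq.1 hjv with hlt | heq
        · exact (h4 v hv hlt).mono (Finset.inter_subset_inter hWW subset_rfl)
        · have hvK := (hKmem v).1 ⟨hv, heq⟩
          rw [← (mem_comp.1 hvK).comp_eq hA]
          exact hKtd
      rcases hcases with ⟨rfl, hl⟩ | ⟨r, hr, rfl, hrt, rfl, hlt⟩
      · refine ⟨_, L'', c, hI'', hWW.trans h2, hsep, htdc, ?_, h6.trans (by omega)⟩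
        -- Although `W'` has lost vertices, `K` is still untouched and a component of the larger set
        -- `W`, so no edge of `W'` leaves it.
        have := maxPacking_le_add (dem := dem) hA hKW' (fun x hx y hy hxy =>
          mem_comp.2 ((mem_comp.1 hx).step (h2 hy) hxy))
        omega
      · refine ⟨_, _, c + 1, hI'', hWW.trans h2, hsep, htdc, ?_, ?_⟩
        · have := maxPacking_le_erase (A := A) (dem := dem) (D := W') r
          omega
        -- Cancelling `2^(h+1)` in the failed comparison gives `X < maxPacking K + 1`, the payment
        -- for one more deletion.
        · rw [x51, ← hX] at hlt
          have := Nat.lt_of_mul_lt_mul_right hlt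
          rw [Nat.succ_mul]
          omega)
  rw [hE2.bound] at key
  obtain ⟨W', L', c, h1, h2, h3, h4, h5, h6⟩ := key
  refine ⟨W', L', c, h1, ?_, h5, h6.trans (maxPacking_mono (Finset.filter_subset _ _))⟩
  rw [tdLe_iff_comp hA]
  intro v hv
  refine (h4 v (h2 hv) ?_).mono fun x hx => ?_
  · exact Finset.mem_range.1 (hWB (conn_rootOf (h2 hv)).mem.2)
  · exact Finset.mem_inter.2 ⟨comp_subset hx, comp_mono h2 hx⟩

/-- Pack paths in a graph whose tree-depth is at most the value of the variable `52`. -/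
def solve : BCmd :=
  .seq (.setVar 3 (const 0))
  (.seq (tab 23 [20] (lt (var 20) (var 0)))
  (.loop 59 (.ite (lt (var 59) (var 52)) level .skip)))

/-- The output is a packing from which at most `OPT / Q` paths are missing. -/
def Solved (n Q : ℕ) (A dem : ℕ → ℕ → Prop) (s : RamState) : Prop :=
  ∃ L c, OutRep n s L ∧ IsPacking A dem (Finset.range n) L ∧
    maxPacking A dem (Finset.range n) ≤ L.length + c ∧ c * Q ≤ maxPacking A dem (Finset.range n)

/-- In round `i` at most `OPT / (2 Q 2^i)` paths are lost. The invariant `c Q 2^i + OPT ≤ OPT 2^i`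
says that the total loss before round `i` is at most `(1 - 2^(-i)) OPT / Q`, free of fractions. -/
theorem solve_spec {d Q : ℕ} (hE : StageEnv B A dem s) (hn : s.var 0 = n) (hd : s.var 52 = d)
    (hB : 2 ^ (6 * 2 ^ d) ≤ B) (hQ : s.var 51 = 2 * Q * 2 ^ d) (htd : TdLe A d (Finset.range n)) :
    Solved n Q A dem (solve.den s) := by
  simp only [solve, seq_den]
  set s0 := (tab 23 [20] (lt (var 20) (var 0))).den ((setVar 3 (const 0)).den s) with hs0
  have hE0 : StageEnv B A dem s0 := hE.frame
    (fun z hz => by rw [hs0, den_var, den_var] <;> revert z <;> decide)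
    (fun z hz => by rw [hs0, den_arr, den_arr] <;> revert z <;> decide)
  have n0 : s0.var 0 = n := by simp (disch := decide) only [hs0, den_var, hn]
  have d0 : s0.var 52 = d := by simp (disch := decide) only [hs0, den_var, hd]
  have q0 : s0.var 51 = 2 * Q * 2 ^ d := by simp (disch := decide) only [hs0, den_var, hQ]
  have z0 : s0.var 3 = 0 := by simp (disch := decide) only [hs0, den_var, var_setVar, eval_const]
  have r23 : Represents B (s0.arr 23) (Finset.range n) := by
    intro v hv
    have hb := hE.bound
    simp
      (disch := first | assumption | decide | (simp (disch := decide) only [den_var]; assumption))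
      only [hs0, arr_tab1_ne, holds_lt, eval_var, Function.update_self, Function.update_of_ne,
        den_var, hn]
    rw [Finset.mem_range]
  clear_value s0
  have key := loop_inv (x := 59) (a := .ite (lt (var 59) (var 52)) level .skip) (s := s0)
    (fun i s' => ∃ W L c, Partial B n A dem W L s' ∧ TdLe A (d - min i d) W ∧
      maxPacking A dem (Finset.range n) ≤ L.length + maxPacking A dem W + c ∧
      c * Q * 2 ^ min i d + maxPacking A dem (Finset.range n) ≤
        maxPacking A dem (Finset.range n) * 2 ^ min i d)
    ⟨Finset.range n, [], 0, ⟨r23, subset_rfl, ⟨by simpa using z0, by simp⟩, .nil⟩, by simpa using htd,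
      by simp, by simp⟩ (by
    rintro i hi s' hf ⟨W, L, c, h1, h2, h3, h4⟩
    have hEj : StageEnv B A dem (s'.setV 59 i) := hE0.frame
      (fun z hz => (RamState.setV_of_ne (by revert z; decide)).trans (hf.1 z (by revert z; decide)))
      (fun z hz => hf.2 z (by revert z; decide))
    have w59 : (s'.setV 59 i).var 59 = i := RamState.setV_self _ _ _
    have n' : (s'.setV 59 i).var 0 = n :=
      (RamState.setV_of_ne (by decide)).trans ((hf.1 0 (by decide)).trans n0)
    have d' : (s'.setV 59 i).var 52 = d :=
      (RamState.setV_of_ne (by decide)).trans ((hf.1 52 (by decide)).trans d0)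
    have q' : (s'.setV 59 i).var 51 = 2 * Q * 2 ^ d :=
      (RamState.setV_of_ne (by decide)).trans ((hf.1 51 (by decide)).trans q0)
    have hI' : Partial B n A dem W L (s'.setV 59 i) :=
      ⟨h1.rep, h1.sub, h1.out.congr (RamState.setV_of_ne (by decide)) rfl rfl, h1.packing⟩
    generalize s'.setV 59 i = t at *
    by_cases hid : i < d
    · rw [ite_den_of_ne (by simpa only [holds_lt, eval_var, w59, d'] using hid)]
      obtain ⟨h, rfl⟩ : ∃ h, d = i + (h + 1) := ⟨d - i - 1, by omega⟩
      rw [min_eq_left (by omega), show i + (h + 1) - i = h + 1 by omega] at h2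
      rw [min_eq_left (by omega)] at h4
      rw [min_eq_left (by omega), show i + (h + 1) - (i + 1) = h by omega]
      obtain ⟨W', L', c', g1, g2, g3, g4⟩ := level_spec (X := 2 * Q * 2 ^ i) hEj n' d' w59 rfl
        ((Nat.pow_le_pow_right (by norm_num) (Nat.mul_le_mul_left _ (Nat.pow_le_pow_right (by norm_num)
          (by omega)))).trans hB) hI' h2 (by rw [q']; ring) h3
      refine ⟨W', L', c + c', g1, g2, g3, ?_⟩
      have hW : maxPacking A dem W ≤ maxPacking A dem (Finset.range n) := maxPacking_mono h1.sub
      calc (c + c') * Q * 2 ^ (i + 1) + maxPacking A dem (Finset.range n)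
          = 2 * (c * Q * 2 ^ i) + c' * (2 * Q * 2 ^ i) + maxPacking A dem (Finset.range n) := by ring
        _ ≤ 2 * (maxPacking A dem (Finset.range n) * 2 ^ i) := by omega
        _ = _ := by ring
    · rw [ite_den_of_not (by simpa only [holds_lt, eval_var, w59, d'] using hid)]
      rw [show min (i + 1) d = min i d by omega]
      exact ⟨W, L, c, hI', h2, h3, h4⟩)
  have hdB : d ≤ B := by
    refine le_trans ?_ hB
    have h1 : d < 2 ^ d := Nat.lt_two_pow_self
    have h2 : 6 * 2 ^ d < 2 ^ (6 * 2 ^ d) := Nat.lt_two_pow_self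
    omega
  rw [hE0.bound, min_eq_right hdB, Nat.sub_self] at key
  obtain ⟨W, L, c, h1, h2, h3, h4⟩ := key
  have hW : W = ∅ := h2
  rw [hW, maxPacking_empty, add_zero] at h3
  refine ⟨L, c, h1.out, h1.packing.mono Finset.sdiff_subset, h3, ?_⟩
  have h5 := Nat.le_of_add_right_le h4
  exact Nat.le_of_mul_le_mul_right h5 (by positivity)

/-- Find out whether the tree-depth is at most the value of the variable `52`, and if so, pack paths. -/
def stage : BCmd :=
  .seq tables
  (.seq (.setVar 7 (var 52))
  (.seq (tab 21 [20] (lt (var 20) (var 0)))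
  (.seq find
  (.seq (.setVar 55 (bool found))
  (.ite (var 55) .skip solve)))))

/-- The flag in variable `55` is zero exactly if the test accepts the depth `d`, and only then is
`solve` run, whose guarantee needs this depth. -/
theorem stage_spec {d Q : ℕ} (hb : s.var 4 = B) (hs : 2 * s.var 0 ≤ B) (hpos : 0 < B)
    (hN : 2 ^ s.var 51 ≤ B) (hA : A = adjRel (s.var 0) (s.arr 0))
    (hdem : dem = adjRel (s.var 0) (s.arr 1)) (hAs : Symmetric A) (hds : Symmetric dem)
    (hn : s.var 0 = n) (hd : s.var 52 = d)
    (hB : 2 ^ (6 * 2 ^ d) ≤ B) (hQ : s.var 51 = 2 * Q * 2 ^ d) :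
    ((stage.den s).var 55 = 0 ↔ TdLe A d (Finset.range n)) ∧
      ((stage.den s).var 55 = 0 → Solved n Q A dem (stage.den s)) := by
  classical
  simp only [stage, seq_den]
  set s0 := tables.den s with hs0
  have hE0 : StageEnv B A dem s0 := by
    refine ⟨⟨?_, ?_, hpos, tables_spec hb, ?_⟩, ?_, ?_, hAs, hds⟩ <;>
      simp (disch := decide) only [hs0, den_var, den_arr] <;> assumption
  set s1 := (tab 21 [20] (lt (var 20) (var 0))).den ((setVar 7 (var 52)).den s0) with hs1
  have hE1 : StageEnv B A dem s1 := hE0.frame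
    (fun z hz => by rw [hs1, den_var, den_var] <;> revert z <;> decide)
    (fun z hz => by rw [hs1, den_arr, den_arr] <;> revert z <;> decide)
  have n1 : s1.var 0 = n := by simp (disch := decide) only [hs1, hs0, den_var, hn]
  have d1 : s1.var 52 = d := by simp (disch := decide) only [hs1, hs0, den_var, hd]
  have q1 : s1.var 51 = 2 * Q * 2 ^ d := by simp (disch := decide) only [hs1, hs0, den_var, hQ]
  have v7 : s1.var 7 = d := by
    simp (disch := decide) only [hs1, hs0, den_var, var_setVar, eval_var, hd]
  have hnB : n < B := n1 ▸ hE1.size_lt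
  have r21 : Represents B (s1.arr 21) (Finset.range n) := by
    intro v hv
    simp
      (disch := first | assumption | decide | (simp (disch := decide) only [hs0, den_var]; assumption))
      only [hs1, hs0, arr_tab1_ne, holds_lt, eval_var, Function.update_self, Function.update_of_ne,
        den_var, hn]
    rw [Finset.mem_range]
  clear_value s1
  have hfs := find_spec hAs (hE1.tickEnv v7) hB (Finset.range_subset_range.2 hnB.le) r21
  have hf := den_frame find s1
  have hE2 : StageEnv B A dem ((setVar 55 (bool found)).den (find.den s1)) := hE1.frame
    (fun z hz => by rw [den_var, hf.1] <;> revert z <;> decide)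
    (fun z hz => by rw [den_arr, hf.2] <;> revert z <;> decide)
  have n2 : ((setVar 55 (bool found)).den (find.den s1)).var 0 = n := by
    simp (disch := decide) only [den_var, n1]
  have d2 : ((setVar 55 (bool found)).den (find.den s1)).var 52 = d := by
    simp (disch := decide) only [den_var, d1]
  have q2 : ((setVar 55 (bool found)).den (find.den s1)).var 51 = 2 * Q * 2 ^ d := by
    simp (disch := decide) only [den_var, q1]
  have v55 : ((setVar 55 (bool found)).den (find.den s1)).var 55 = 0 ↔
      TdLe A d (Finset.range n) := by
    rw [var_setVar, eval_bool, hfs]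
    split_ifs with h
    · simp [h]
    · simpa using h
  generalize (setVar 55 (bool found)).den (find.den s1) = s2 at *
  by_cases htd : TdLe A d (Finset.range n)
  · have h0 := v55.2 htd
    rw [ite_den_of_not (by simpa only [holds_var, not_not] using h0)]
    have e55 : (solve.den s2).var 55 = 0 := (den_var (by decide)).trans h0
    exact ⟨by simp [e55, htd], fun _ => solve_spec hE2 n2 d2 hB q2 htd⟩
  · have h0 : s2.var 55 ≠ 0 := fun h => htd (v55.1 h)
    rw [ite_den_of_ne (by simpa only [holds_var] using h0)]
    exact ⟨v55, fun h => absurd h h0⟩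

end BCmd

/-! ### The outer loop -/

section

variable {s : RamState} {n p q Q : ℕ}

/-- Add the product of the variables `e` and `b` to the variable `a`. -/
def mulAdd (a e b : ℕ) : RamProg :=
  .seq (.setVar 101 (.const 0)) (.loop (.sub (.var b) (.var 101))
    (.seq (.setVar a (.add (.var a) (.var e))) (.setVar 101 (.add (.var 101) (.const 1)))))

theorem runs_mulAdd {a e b : ℕ} (ha : a ≠ 101) (he : e ≠ 101) (hb : b ≠ 101) (hea : e ≠ a)
    (hba : b ≠ a) (s : RamState) :
    Runs (mulAdd a e b) s (s.var b * 12 + 6) (fun s' => s'.arr = s.arr ∧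
      s'.var a = s.var a + s.var b * s.var e ∧ ∀ x, x ≠ a → x ≠ 101 → s'.var x = s.var x) := by
  have key : ∀ k i (t : RamState), i + k = s.var b → t.arr = s.arr → t.var 101 = i →
      t.var a = s.var a + i * s.var e → (∀ x, x ≠ a → x ≠ 101 → t.var x = s.var x) →
      Runs (.loop (.sub (.var b) (.var 101))
        (.seq (.setVar a (.add (.var a) (.var e))) (.setVar 101 (.add (.var 101) (.const 1))))) t
        (k * 12 + 4) (fun s' => s'.arr = s.arr ∧
      s'.var a = s.var a + s.var b * s.var e ∧ ∀ x, x ≠ a → x ≠ 101 → s'.var x = s.var x) := by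
    intro k
    induction k with
    | zero =>
      intro i t hi h1 h2 h3 h4
      obtain rfl : i = s.var b := by omega
      exact ⟨_, t, .loop_done (by simp [RamExpr.eval, h2, h4 b hba hb]), by simp [RamExpr.cost],
        h1, h3, h4⟩
    | succ k ih =>
      intro i t hi h1 h2 h3 h4
      obtain ⟨T, s', he', hT, hq⟩ := ih (i + 1) ⟨Function.update (Function.update t.var a
        (t.var a + t.var e)) 101 (i + 1), t.arr⟩ (by omega) h1 (by simp)
        (by simp [Function.update_apply, ha, h3, h4 e hea he]; ring)
        (fun x hx hx' => by simp [Function.update_apply, hx, hx', h4 x hx hx'])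
      have hset := Exec.seq (Exec.setVar a (.add (.var a) (.var e)) t)
        (Exec.setVar 101 (.add (.var 101) (.const 1)) _)
      have e1 : RamExpr.eval ⟨Function.update t.var a (RamExpr.eval t (.add (.var a) (.var e))), t.arr⟩
          (.add (.var 101) (.const 1)) = i + 1 := by
        simp [RamExpr.eval, Function.update_apply, ha.symm, h2]
      rw [e1] at hset
      refine ⟨_, s', .loop_step ?_ hset he', ?_, hq⟩
      · simp only [RamExpr.eval, h2, h4 b hba hb]; omega
      · simp only [RamExpr.cost]; omega
  refine Runs.seq (T := 2) (T' := s.var b * 12 + 4) (Q := fun t => t.arr = s.arr ∧ t.var 101 = 0 ∧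
    ∀ x, x ≠ 101 → t.var x = s.var x) (.setVar (by simp [RamExpr.cost]) ⟨rfl, by simp [RamExpr.eval],
      fun x hx => by simp [Function.update_apply, hx]⟩) ?_ (by omega)
  rintro t ⟨h1, h2, h3⟩
  exact key _ 0 t (by omega) h1 h2 (by simp [h3 a ha]) fun x _ hx => h3 x hx

/-- Add `p` to the variable `53` and `2` to the variable `51`, multiply the variable `54` by `16`. -/
def precisionStep : RamProg :=
  .seq (.setVar 53 (.add (.var 53) (.var 1))) (.seq (.setVar 51 (.add (.var 51) (.const 2)))
    (.seq (.setVar 54 (.add (.var 54) (.var 54))) (.seq (.setVar 54 (.add (.var 54) (.var 54)))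
      (.seq (.setVar 54 (.add (.var 54) (.var 54))) (.setVar 54 (.add (.var 54) (.var 54)))))))

/-- The variables `51`, `54` hold `2 * Q` and `4 ^ (2 * Q)` for the least `Q` with `q ≤ Q * p`. -/
def precision : RamProg :=
  .seq (.setVar 53 (.const 0)) (.seq (.setVar 51 (.const 0)) (.seq (.setVar 54 (.const 1))
    (.loop (.sub (.var 2) (.var 53)) precisionStep)))

/-- The memory contains the input and the parameters for the stage `d`. -/
structure Ready (n N d : ℕ) (a : ℕ → ℕ → ℕ) (s : RamState) : Prop where
  size : s.var 0 = n
  adj : s.arr 0 = a 0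
  dem : s.arr 1 = a 1
  count : s.var 51 = N
  factor : s.var 54 = 4 ^ N

/-- Each pass adds one to the implicit quotient and multiplies variable `54` by `16` through four
doublings; no division is needed to find the least `Q` with `q ≤ Q * p`. -/
theorem runs_precision (hp : s.var 1 = p) (hq : s.var 2 = q) (hn : s.var 0 = n)
    (hQ : q ≤ Q * p) (hmin : ∀ i < Q, i * p < q) :
    Runs precision s (Q * 40 + 10) (Ready n (2 * Q) 0 s.arr) := by
  have key : ∀ k i (t : RamState), i + k = Q → t.arr = s.arr → t.var 0 = n → t.var 1 = p →
      t.var 2 = q → t.var 53 = i * p → t.var 51 = 2 * i → t.var 54 = 4 ^ (2 * i) →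
      Runs (.loop (.sub (.var 2) (.var 53)) precisionStep) t (k * 40 + 4) (Ready n (2 * Q) 0 s.arr) := by
    intro k
    induction k with
    | zero =>
      intro i t hi h0 h1 h2 h3 h4 h5 h6
      obtain rfl : i = Q := by omega
      exact ⟨_, t, .loop_done (by simp only [RamExpr.eval, h3, h4]; omega), by simp [RamExpr.cost],
        h1, by rw [h0], by rw [h0], h5, h6⟩
    | succ k ih =>
      intro i t hi h0 h1 h2 h3 h4 h5 h6
      have hset : Exec precisionStep t _ _ := (Exec.setVar 53 (.add (.var 53) (.var 1)) t).seq
        ((Exec.setVar 51 (.add (.var 51) (.const 2)) _).seq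
        ((Exec.setVar 54 (.add (.var 54) (.var 54)) _).seq
        ((Exec.setVar 54 (.add (.var 54) (.var 54)) _).seq
        ((Exec.setVar 54 (.add (.var 54) (.var 54)) _).seq
        (Exec.setVar 54 (.add (.var 54) (.var 54)) _)))))
      obtain ⟨t', τ, hset', hτ, g0, g1, g2, g3, g4, g5, g6⟩ : ∃ t' τ, Exec precisionStep t τ t' ∧ τ ≤ 30 ∧
          t'.arr = s.arr ∧ t'.var 0 = n ∧ t'.var 1 = p ∧ t'.var 2 = q ∧ t'.var 53 = (i + 1) * p ∧
          t'.var 51 = 2 * (i + 1) ∧ t'.var 54 = 4 ^ (2 * (i + 1)) := by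
        refine ⟨_, _, hset, by simp [RamExpr.cost], h0, ?_, ?_, ?_, ?_, ?_, ?_⟩ <;>
          simp [Function.update_apply, RamExpr.eval, h1, h2, h3, h4, h5, h6] <;> ring
      obtain ⟨T, s', he', hT, hr⟩ := ih (i + 1) t' (by omega) g0 g1 g2 g3 g4 g5 g6
      refine ⟨_, s', .loop_step ?_ hset' he', ?_, hr⟩
      · have := hmin i (by omega)
        simp only [RamExpr.eval, h3, h4]; omega
      · simp only [RamExpr.cost]; omega
  refine Runs.seq (T := 2) (T' := Q * 40 + 8) (.setVar (Q := fun t => t = ⟨_, _⟩)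
    (by simp [RamExpr.cost]) rfl) ?_ (by omega)
  rintro t rfl
  refine Runs.seq (T := 2) (T' := Q * 40 + 6) (.setVar (Q := fun t => t = ⟨_, _⟩)
    (by simp [RamExpr.cost]) rfl) ?_ (by omega)
  rintro t rfl
  refine Runs.seq (T := 2) (T' := Q * 40 + 4) (.setVar (Q := fun t => t = ⟨_, _⟩)
    (by simp [RamExpr.cost]) rfl) ?_ (by omega)
  rintro t rfl
  exact key Q 0 _ (by omega) rfl (by simp [Function.update_apply, hn])
    (by simp [Function.update_apply, hp]) (by simp [Function.update_apply, hq])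
    (by simp [Function.update_apply, RamExpr.eval]) (by simp [Function.update_apply, RamExpr.eval])
    (by simp [Function.update_apply, RamExpr.eval])

/-- One round: run the stage with the bound `4 ^ N * (n + 2)`, then double `N`. -/
def stageRound : RamProg :=
  .seq (.setVar 4 (.add (.var 54) (.var 54))) (.seq (mulAdd 4 54 0) (.seq (BCmd.stage.compile 100)
    (.seq (.setVar 51 (.add (.var 51) (.var 51))) (.seq (.setVar 102 (.const 0))
      (.seq (mulAdd 102 54 54) (.seq (.setVar 54 (.var 102))
        (.setVar 52 (.add (.var 52) (.const 1)))))))))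

theorem stage_wf : BCmd.stage.wf = true := by decide +kernel

theorem Runs.setVar' {x v : ℕ} {e : RamExpr} {s : RamState} (he : e.eval s = v) :
    Runs (.setVar x e) s (e.cost + 1) (fun s' => s'.arr = s.arr ∧ s'.var x = v ∧
      ∀ y, y ≠ x → s'.var y = s.var y) :=
  .setVar le_rfl ⟨rfl, by simp [he], fun y hy => by simp [Function.update_of_ne hy]⟩

/-- Going from `d` to `d + 1` doubles `N`, so `4^N` must be squared; repeated addition does this
within the time budget since `4^N ≤ B`. -/
theorem runs_round {A dem : ℕ → ℕ → Prop} {a : ℕ → ℕ → ℕ} {d : ℕ} (hA : A = adjRel n (a 0))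
    (hdem : dem = adjRel n (a 1)) (hAs : Symmetric A) (hds : Symmetric dem) (hQ : 2 ≤ Q)
    (hs : Ready n (2 * Q * 2 ^ d) d a s) (hd : s.var 52 = d) :
    Runs stageRound s (BCmd.stage.cost (4 ^ (2 * Q * 2 ^ d) * (n + 2)) + 24 * (4 ^ (2 * Q * 2 ^ d) * (n + 2)) + 40)
      (fun s' => Ready n (2 * Q * 2 ^ (d + 1)) (d + 1) a s' ∧ s'.var 52 = d + 1 ∧
        (s'.var 55 = 0 ↔ TdLe A d (Finset.range n)) ∧
        (s'.var 55 = 0 → BCmd.Solved n Q A dem s')) := by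
  set N := 2 * Q * 2 ^ d with hN
  set B := 4 ^ N * (n + 2) with hB
  have hnB : n ≤ B := by
    have : 0 < 4 ^ N := by positivity
    rw [hB]; nlinarith
  have hEB : 4 ^ N ≤ B := Nat.le_mul_of_pos_right _ (by omega)
  refine (Runs.setVar' (v := 4 ^ N + 4 ^ N) (by simp [RamExpr.eval, hs.factor])).seq
    (T' := BCmd.stage.cost B + 24 * B + 36) ?_ (by simp [RamExpr.cost]; omega)
  rintro s1 ⟨f1, v1, g1⟩
  refine (runs_mulAdd (by decide) (by decide) (by decide) (by decide) (by decide) s1).seq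
    (T' := BCmd.stage.cost B + 12 * B + 30) ?_ (by
      rw [g1 0 (by decide), hs.size]; omega)
  rintro s2 ⟨f2, v2, g2⟩
  have b2 : s2.var 4 = B := by
    rw [v2, v1, g1 0 (by decide), g1 54 (by decide), hs.size, hs.factor, hB]; ring
  have h2 : ∀ x, x ≠ 4 → x ≠ 101 → s2.var x = s.var x := fun x hx hx' => by
    rw [g2 x hx hx', g1 x hx]
  -- The bound `B = 4^N (n + 2)` exceeds `2 n`, `2^N` and the size needed by the tree-depth test;
  -- the last holds because `Q ≥ 2` gives `4^N ≥ 2^(8 * 2^d)`.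
  have hst := BCmd.stage_spec (s := s2) (B := B) (A := A) (dem := dem) (n := n) (d := d) (Q := Q) b2
    (by rw [h2 0 (by decide) (by decide), hs.size, hB]
        have : 1 < 4 ^ N := Nat.one_lt_pow (by positivity) (by norm_num)
        nlinarith)
    (by positivity)
    (by rw [h2 51 (by decide) (by decide), hs.count]
        exact (Nat.pow_le_pow_left (by norm_num) _).trans hEB)
    (by rw [h2 0 (by decide) (by decide), hs.size, f2, f1, hs.adj, hA])
    (by rw [h2 0 (by decide) (by decide), hs.size, f2, f1, hs.dem, hdem])
    hAs hds (by rw [h2 0 (by decide) (by decide), hs.size])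
    (by rw [h2 52 (by decide) (by decide), hd])
    (by
      refine le_trans ?_ hEB
      rw [show (4 : ℕ) = 2 ^ 2 by norm_num, ← pow_mul]
      refine Nat.pow_le_pow_right (by norm_num) ?_
      rw [hN]
      have : 0 < 2 ^ d := by positivity
      nlinarith)
    (by rw [h2 51 (by decide) (by decide), hs.count])
  have hrun := BCmd.runs_compile BCmd.stage stage_wf 100 le_rfl s2 s2 ⟨rfl, fun _ _ => rfl⟩
  rw [b2] at hrun
  refine hrun.seq (T' := 12 * B + 30) ?_ (by omega)
  rintro s3 ⟨⟨f3, g3⟩, -⟩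
  have hfr := BCmd.den_frame BCmd.stage s2
  have w0 : s3.var 0 = n := by
    rw [g3 0 (by decide), hfr.1 0 (by decide +kernel), h2 0 (by decide) (by decide), hs.size]
  have w51 : s3.var 51 = N := by
    rw [g3 51 (by decide), hfr.1 51 (by decide +kernel), h2 51 (by decide) (by decide), hs.count]
  have w52 : s3.var 52 = d := by
    rw [g3 52 (by decide), hfr.1 52 (by decide +kernel), h2 52 (by decide) (by decide), hd]
  have w54 : s3.var 54 = 4 ^ N := by
    rw [g3 54 (by decide), hfr.1 54 (by decide +kernel), h2 54 (by decide) (by decide), hs.factor]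
  have a0 : s3.arr 0 = a 0 := by rw [f3, hfr.2 0 (by decide +kernel), f2, f1, hs.adj]
  have a1 : s3.arr 1 = a 1 := by rw [f3, hfr.2 1 (by decide +kernel), f2, f1, hs.dem]
  refine (Runs.setVar' (v := N + N) (by simp [RamExpr.eval, w51])).seq
    (T' := 12 * B + 26) ?_ (by simp [RamExpr.cost]; omega)
  rintro s4 ⟨f4, v4, g4⟩
  refine (Runs.setVar' (v := 0) (by simp [RamExpr.eval])).seq (T' := 12 * B + 20) ?_
    (by simp [RamExpr.cost]; omega)
  rintro s5 ⟨f5, v5, g5⟩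
  have w5 : s5.var 54 = 4 ^ N := by rw [g5 54 (by decide), g4 54 (by decide), w54]
  refine (runs_mulAdd (by decide) (by decide) (by decide) (by decide) (by decide) s5).seq
    (T' := 14) ?_ (by rw [w5]; omega)
  rintro s6 ⟨f6, v6, g6⟩
  refine (Runs.setVar' (v := 4 ^ N * 4 ^ N) (by simp [RamExpr.eval, v6, v5, w5])).seq
    (T' := 10) ?_ (by simp [RamExpr.cost])
  rintro s7 ⟨f7, v7, g7⟩
  have hx : ∀ x, x < 100 → x ≠ 51 → x ≠ 54 → s7.var x = s3.var x := fun x hx h1 h2 => by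
    rw [g7 x h2, g6 x (by omega) (by omega), g5 x (by omega), g4 x h1]
  refine (Runs.setVar' (v := d + 1) (by
    simp [RamExpr.eval, hx 52 (by decide) (by decide) (by decide), w52])).mono
    (by simp [RamExpr.cost]) ?_
  rintro s8 ⟨f8, v8, g8⟩
  have hy : ∀ x, x < 100 → x ≠ 51 → x ≠ 54 → x ≠ 52 → s8.var x = s3.var x := fun x h h1 h2 h3 => by
    rw [g8 x h3, hx x h h1 h2]
  have fa : s8.arr = s3.arr := by rw [f8, f7, f6, f5, f4]
  have hNN : 2 * Q * 2 ^ (d + 1) = N + N := by rw [hN]; ring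
  have e55 : s8.var 55 = (BCmd.stage.den s2).var 55 := by
    rw [hy 55 (by decide) (by decide) (by decide) (by decide), g3 55 (by decide)]
  rw [e55]
  refine ⟨⟨?_, by rw [fa, a0], by rw [fa, a1], ?_, ?_⟩, v8, hst.1, fun h => ?_⟩
  · rw [hy 0 (by decide) (by decide) (by decide) (by decide), w0]
  · rw [g8 51 (by decide), g7 51 (by decide), g6 51 (by decide) (by decide), g5 51 (by decide), v4, hNN]
  · rw [g8 54 (by decide), v7, hNN, pow_add]
  · obtain ⟨L, c, hL, hr⟩ := hst.2 h
    refine ⟨L, c, hL.congr ?_ (by rw [fa, f3]) (by rw [fa, f3]), hr⟩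
    rw [hy 3 (by decide) (by decide) (by decide) (by decide), g3 3 (by decide)]

/-- The whole algorithm. -/
def mndpProg : RamProg :=
  .seq precision (.seq (.setVar 52 (.const 0)) (.seq (.setVar 55 (.const 1)) (.loop (.var 55) stageRound)))

/-- The test succeeds at `d = t` at the latest. It may stop earlier, and then the solution is
already valid; correctness does not need the exact tree-depth. -/
theorem runs_rounds {A dem : ℕ → ℕ → Prop} {a : ℕ → ℕ → ℕ} {t T : ℕ} (hA : A = adjRel n (a 0))
    (hdem : dem = adjRel n (a 1)) (hAs : Symmetric A) (hds : Symmetric dem) (hQ : 2 ≤ Q)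
    (ht : TdLe A t (Finset.range n)) (hT : ∀ d ≤ t, BCmd.stage.cost (4 ^ (2 * Q * 2 ^ d) * (n + 2)) +
      24 * (4 ^ (2 * Q * 2 ^ d) * (n + 2)) + 40 ≤ T) (k d : ℕ) (hk : d + k = t) (s : RamState)
    (hs : Ready n (2 * Q * 2 ^ d) d a s) (hd : s.var 52 = d) (h55 : s.var 55 ≠ 0) :
    Runs (.loop (.var 55) stageRound) s ((k + 1) * (T + 4) + 4) (BCmd.Solved n Q A dem) := by
  induction k generalizing d s with
  | zero =>
    obtain rfl : d = t := by omega
    obtain ⟨τ, s', he, hτ, -, -, h1, h2⟩ := runs_round hA hdem hAs hds hQ hs hd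
    have h0 := h1.2 ht
    refine ⟨_, s', .loop_step h55 he (.loop_done h0), ?_, h2 h0⟩
    have := hT d le_rfl
    simp only [RamExpr.cost]; omega
  | succ k ih =>
    obtain ⟨τ, s', he, hτ, hr, hd', h1, h2⟩ := runs_round hA hdem hAs hds hQ hs hd
    have hTd := hT d (by omega)
    have hkk : (k + 1 + 1) * (T + 4) = (k + 1) * (T + 4) + (T + 4) := by ring
    by_cases h0 : s'.var 55 = 0
    · refine ⟨_, s', .loop_step h55 he (.loop_done h0), ?_, h2 h0⟩
      simp only [RamExpr.cost]; omega
    · obtain ⟨τ', s'', he', hτ', hq⟩ := ih (d + 1) (by omega) s' hr hd' h0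
      refine ⟨_, s'', .loop_step h55 he he', ?_, hq⟩
      simp only [RamExpr.cost]; omega

/-- All rounds are dominated by the last possible one, and their number `t + 1`, as well as the time
for computing `Q`, is below the bound `M`; the extra powers of `M` absorb both. -/
theorem exists_time_bound : ∃ C D, ∀ (n p q Q t : ℕ) (A dem : ℕ → ℕ → Prop) (s : RamState), s.var 0 = n →
    s.var 1 = p → s.var 2 = q → A = adjRel n (s.arr 0) → dem = adjRel n (s.arr 1) → Symmetric A →
    Symmetric dem → 2 ≤ Q → q ≤ Q * p → (∀ i < Q, i * p < q) → TdLe A t (Finset.range n) →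
    Runs mndpProg s (C * (4 ^ (2 * Q * 2 ^ t) * (n + 2) + 1) ^ D) (BCmd.Solved n Q A dem) := by
  obtain ⟨C, D, hC⟩ := PolyBounded.cmd BCmd.stage
  refine ⟨C + 200, D + 2, fun n p q Q t A dem s h0 h1 h2 hA hdem hAs hds hQ hq hmin ht => ?_⟩
  set M := 4 ^ (2 * Q * 2 ^ t) * (n + 2) + 1 with hM
  have hE : 2 * Q * 2 ^ t < 4 ^ (2 * Q * 2 ^ t) := Nat.lt_pow_self (by norm_num)
  have hEM : 4 ^ (2 * Q * 2 ^ t) ≤ M :=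
    (Nat.le_mul_of_pos_right _ (by omega)).trans (Nat.le_succ _)
  have htt : t < 2 ^ t := Nat.lt_two_pow_self
  have hQM : Q + 1 ≤ M := by nlinarith
  have htM : t + 1 ≤ M := by nlinarith
  have hTd : ∀ d ≤ t, BCmd.stage.cost (4 ^ (2 * Q * 2 ^ d) * (n + 2)) +
      24 * (4 ^ (2 * Q * 2 ^ d) * (n + 2)) + 40 ≤ C * M ^ D + 64 * M := by
    intro d hd
    have hB : 4 ^ (2 * Q * 2 ^ d) * (n + 2) + 1 ≤ M := by
      rw [hM]
      gcongr
      · norm_num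
      · norm_num
    have h1 := (hC (4 ^ (2 * Q * 2 ^ d) * (n + 2))).trans
      (Nat.mul_le_mul_left C (Nat.pow_le_pow_left hB D))
    omega
  refine (runs_precision (Q := Q) h1 h2 h0 hq hmin).seq
    (T' := (t + 1) * (C * M ^ D + 64 * M + 4) + 8) ?_ ?_
  · intro s1 hs1
    refine (Runs.setVar' (v := 0) (by simp [RamExpr.eval])).seq
      (T' := (t + 1) * (C * M ^ D + 64 * M + 4) + 6) ?_ (by simp [RamExpr.cost]; omega)
    rintro s2 ⟨f2, v2, g2⟩
    refine (Runs.setVar' (v := 1) (by simp [RamExpr.eval])).seq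
      (T' := (t + 1) * (C * M ^ D + 64 * M + 4) + 4) ?_ (by simp [RamExpr.cost]; omega)
    rintro s3 ⟨f3, v3, g3⟩
    refine runs_rounds (a := s.arr) hA hdem hAs hds hQ ht hTd t 0 (by omega) s3 ⟨?_, ?_, ?_, ?_, ?_⟩
      (by rw [g3 52 (by decide), v2]) (by rw [v3]; decide)
    · rw [g3 0 (by decide), g2 0 (by decide), hs1.size]
    · rw [f3, f2, hs1.adj]
    · rw [f3, f2, hs1.dem]
    · rw [g3 51 (by decide), g2 51 (by decide), hs1.count]; simp
    · rw [g3 54 (by decide), g2 54 (by decide), hs1.factor]; simp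
  · have hM1 : 1 ≤ M := by omega
    have e1 : M ^ 2 ≤ M ^ (D + 2) := Nat.pow_le_pow_right hM1 (by omega)
    have e2 : M ^ (D + 1) ≤ M ^ (D + 2) := Nat.pow_le_pow_right hM1 (by omega)
    have e3 : M ≤ M ^ 2 := by nlinarith
    calc Q * 40 + 10 + ((t + 1) * (C * M ^ D + 64 * M + 4) + 8)
        ≤ M * 40 + 10 * M + (M * (C * M ^ D + 64 * M + 4 * M) + 8 * M) := by
          gcongr <;> omega
      _ = C * M ^ (D + 1) + 68 * M ^ 2 + 58 * M := by ring
      _ ≤ C * M ^ (D + 2) + 68 * M ^ (D + 2) + 58 * M ^ (D + 2) := by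
          gcongr; omega
      _ ≤ (C + 200) * M ^ (D + 2) := by rw [← add_mul, ← add_mul]; exact Nat.mul_le_mul_right _ (by omega)

end

/-! ### Vertices in `Fin n` -/

section

variable {n p q : ℕ} {G : SimpleGraph (Fin n)} {M : Set (Sym2 (Fin n))}

theorem address_inj {u v u' v' : Fin n} (h : u.1 * n + v.1 = u'.1 * n + v'.1) : u = u' ∧ v = v' := by
  have hn : 0 < n := u.pos
  have h1 := congrArg (· / n) h
  have h2 := congrArg (· % n) h
  simp only [Nat.mul_comm _ n, Nat.mul_add_div hn, Nat.div_eq_of_lt u.2, Nat.div_eq_of_lt v.2,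
    Nat.div_eq_of_lt v'.2, Nat.mul_add_mod, Nat.mod_eq_of_lt v.2, Nat.mod_eq_of_lt v'.2,
    add_zero] at h1 h2
  exact ⟨Fin.ext h1, Fin.ext h2⟩

theorem exists_address_iff {R : Fin n → Fin n → Prop} {u v : ℕ} (hu : u < n) (hv : v < n) :
    (∃ u' v' : Fin n, u * n + v = u'.1 * n + v'.1 ∧ R u' v') ↔ R ⟨u, hu⟩ ⟨v, hv⟩ := by
  constructor
  · rintro ⟨u', v', h, hR⟩
    obtain ⟨rfl, rfl⟩ := address_inj (u := ⟨u, hu⟩) (v := ⟨v, hv⟩) h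
    exact hR
  · exact fun h => ⟨_, _, rfl, h⟩

theorem adjRel_input (u v : ℕ) : adjRel n ((mndpInput G M p q).arr 0) u v ↔
    ∃ (hu : u < n) (hv : v < n), G.Adj ⟨u, hu⟩ ⟨v, hv⟩ := by
  classical
  unfold adjRel
  constructor
  · rintro ⟨hu, hv, h⟩
    refine ⟨hu, hv, (exists_address_iff hu hv).1 ?_⟩
    by_contra hne
    exact h (by simp only [mndpInput, if_true, if_neg hne])
  · rintro ⟨hu, hv, h⟩
    refine ⟨hu, hv, ?_⟩
    simp only [mndpInput, if_true, if_pos ((exists_address_iff hu hv).2 h)]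
    exact one_ne_zero

theorem demRel_input (u v : ℕ) : adjRel n ((mndpInput G M p q).arr 1) u v ↔
    ∃ (hu : u < n) (hv : v < n), s((⟨u, hu⟩ : Fin n), ⟨v, hv⟩) ∈ M := by
  classical
  unfold adjRel
  have h10 : (1 : ℕ) ≠ 0 := one_ne_zero
  constructor
  · rintro ⟨hu, hv, h⟩
    refine ⟨hu, hv, (exists_address_iff (R := fun u v => s(u, v) ∈ M) hu hv).1 ?_⟩
    by_contra hne
    exact h (by simp only [mndpInput, if_neg h10, if_true, if_neg hne])
  · rintro ⟨hu, hv, h⟩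
    refine ⟨hu, hv, ?_⟩
    simp only [mndpInput, if_neg h10, if_true,
      if_pos ((exists_address_iff (R := fun u v => s(u, v) ∈ M) hu hv).2 h)]
    exact one_ne_zero

variable {A dem : ℕ → ℕ → Prop}

theorem mndpOpt_le_maxPacking (hA : ∀ u v, A u v ↔ ∃ (hu : u < n) (hv : v < n), G.Adj ⟨u, hu⟩ ⟨v, hv⟩)
    (hdem : ∀ u v, dem u v ↔ ∃ (hu : u < n) (hv : v < n), s((⟨u, hu⟩ : Fin n), ⟨v, hv⟩) ∈ M) :
    mndpOpt G M ≤ maxPacking A dem (Finset.range n) := by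
  obtain ⟨L, hL, hl⟩ := (mndpOpt_isGreatest G M).1
  rw [← hl, ← List.length_map (as := L) (List.map Fin.val)]
  refine IsPacking.mem_le ⟨?_, ?_, ?_, ?_⟩
  · intro l hl
    obtain ⟨l, hl', rfl⟩ := List.mem_map.1 hl
    obtain ⟨s, t, w, -, -, rfl⟩ := hL.path l hl'
    rw [List.isChain_map]
    exact w.isChain_adj_support.imp fun a b h => (hA _ _).2 ⟨a.2, b.2, h⟩
  · intro l hl
    obtain ⟨l, hl', rfl⟩ := List.mem_map.1 hl
    obtain ⟨s, t, w, -, hst, rfl⟩ := hL.path l hl'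
    refine ⟨t, s, ?_, ?_, (hdem _ _).2 ⟨t.2, s.2, by rw [Sym2.eq_swap]; exact hst⟩⟩
    · rw [List.getLast?_map, List.getLast?_eq_some_getLast w.support_ne_nil, w.getLast_support]; rfl
    · rw [List.head?_map, List.head?_eq_some_head w.support_ne_nil, w.head_support]; rfl
  · rw [← List.map_flatten]
    refine List.Nodup.map Fin.val_injective (List.nodup_flatten.2 ⟨fun l hl => ?_, hL.disjoint⟩)
    obtain ⟨s, t, w, hw, -, rfl⟩ := hL.path l hl
    exact hw.support_nodup
  · intro x hx
    rw [← List.map_flatten] at hx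
    obtain ⟨y, -, rfl⟩ := List.mem_map.1 hx
    exact Finset.mem_range.2 y.2

/-- Distinctness of all vertices of the packing gives at once that each list is a path and that
different lists are disjoint; a non-empty chain of adjacent vertices is the support of a walk. -/
theorem exists_isFeasible (hA : ∀ u v, A u v ↔ ∃ (hu : u < n) (hv : v < n), G.Adj ⟨u, hu⟩ ⟨v, hv⟩)
    (hdem : ∀ u v, dem u v ↔ ∃ (hu : u < n) (hv : v < n), s((⟨u, hu⟩ : Fin n), ⟨v, hv⟩) ∈ M)
    {P : List (List ℕ)} (hP : IsPacking A dem (Finset.range n) P) :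
    ∃ L : List (List (Fin n)), L.map (List.map Fin.val) = P ∧ IsFeasible G M L := by
  obtain ⟨L, rfl⟩ : ∃ L : List (List (Fin n)), L.map (List.map Fin.val) = P := by
    have h1 : ∀ l : List ℕ, (∀ x ∈ l, x < n) → ∃ l' : List (Fin n), l'.map Fin.val = l := fun l hl =>
      ⟨l.attach.map fun x => ⟨x.1, hl x.1 x.2⟩, by simp⟩
    have h2 : ∀ l ∈ P, ∃ l' : List (Fin n), l'.map Fin.val = l := fun l hl => h1 l fun x hx =>
      Finset.mem_range.1 (hP.mem x (List.mem_flatten.2 ⟨l, hl, hx⟩))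
    choose! f hf using h2
    exact ⟨P.map f, by
      rw [List.map_map]
      conv_rhs => rw [← List.map_id P]
      exact List.map_congr_left fun l hl => hf l hl⟩
  have hn := hP.nodup
  rw [← List.map_flatten] at hn
  have hn' := List.nodup_flatten.1 hn.of_map
  refine ⟨L, rfl, fun l hl => ?_, hn'.2⟩
  have hl' : l.map Fin.val ∈ L.map (List.map Fin.val) := List.mem_map_of_mem hl
  have hne : l ≠ [] := fun h => hP.ne_nil hl' (by rw [h]; rfl)
  have hc := hP.chain _ hl'
  rw [List.isChain_map] at hc
  have hc' : l.IsChain G.Adj := hc.imp fun a b h => by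
    obtain ⟨_, _, h⟩ := (hA _ _).1 h
    exact h
  obtain ⟨s, x, hs, hx, hsx⟩ := hP.ends _ hl'
  rw [List.getLast?_map, List.getLast?_eq_some_getLast hne, Option.map_some, Option.some.injEq] at hs
  rw [List.head?_map, List.head?_eq_some_head hne, Option.map_some, Option.some.injEq] at hx
  subst hs hx
  obtain ⟨_, _, hM⟩ := (hdem _ _).1 hsx
  have hsup := SimpleGraph.Walk.support_ofSupport hne hc'
  refine ⟨_, _, SimpleGraph.Walk.ofSupport l hne hc', ?_, ?_, hsup⟩
  · rw [SimpleGraph.Walk.isPath_def, hsup]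
    exact hn'.1 l hl
  · rw [Sym2.eq_swap]; exact hM

theorem OutRep.isOutput {s : RamState} {L : List (List (Fin n))}
    (h : OutRep n s (L.map (List.map Fin.val))) : IsOutput s L := by
  refine ⟨by simpa using h.1, fun i hi => ?_⟩
  obtain ⟨h1, h2⟩ := h.2 i (by simpa using hi)
  simp only [List.getElem_map, List.length_map] at h1 h2
  exact ⟨h1, h2⟩

/-- From `c * Q ≤ O` and `q ≤ Q * p` follows `c ≤ (p / q) * O`, so the missing paths are at most an
`ε`-fraction of the maximum. -/
theorem approximation_le {k c Q o : ℕ} (hp : 0 < p) (hpq : p < q) (hQ : q ≤ Q * p) {O : ℕ} (hoO : o ≤ O)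
    (hO : O ≤ k + c) (hc : c * Q ≤ O) : (1 - (p : ℝ) / q) * o ≤ k := by
  have hq : (0 : ℝ) < q := by exact_mod_cast hp.trans hpq
  have h1 : (p : ℝ) / q ≤ 1 := (div_le_one hq).2 (by exact_mod_cast hpq.le)
  have h2 : (c : ℝ) ≤ (p : ℝ) / q * O := by
    rw [div_mul_eq_mul_div, le_div_iff₀ hq]
    have : c * q ≤ p * O := calc
      c * q ≤ c * (Q * p) := Nat.mul_le_mul_left _ hQ
      _ = p * (c * Q) := by ring
      _ ≤ p * O := Nat.mul_le_mul_left _ hc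
    exact_mod_cast this
  have h3 : (O : ℝ) ≤ k + c := by exact_mod_cast hO
  have h4 : (o : ℝ) ≤ O := by exact_mod_cast hoO
  calc (1 - (p : ℝ) / q) * o ≤ (1 - (p : ℝ) / q) * O :=
        mul_le_mul_of_nonneg_left h4 (by linarith)
    _ = O - (p : ℝ) / q * O := by ring
    _ ≤ k := by linarith

/-- Everything is a power of two with exponent a multiple of `X = Q * 2^t`, times a power of `n +
1`; the constant `C` is absorbed through `C ≤ 2^C`. The factor `2` in `2 * C + 12 * D` comes from `Q
≤ 2 / ε`. -/
theorem time_le {C D Q t : ℕ} (hp : 0 < p) (hpq : p < q) (hQ0 : 1 ≤ Q) (hQ : Q * p ≤ 2 * q) :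
    ((C * (4 ^ (2 * Q * 2 ^ t) * (n + 2) + 1) ^ D : ℕ) : ℝ) ≤
      (2 : ℝ) ^ (((2 * C + 12 * D : ℕ) : ℝ) * (2 : ℝ) ^ t / ((p : ℝ) / q)) *
        ((n : ℝ) + 1) ^ (2 * C + 12 * D) := by
  set X := Q * 2 ^ t with hX
  have hX1 : 1 ≤ X := Nat.mul_pos hQ0 (by positivity)
  have h1 : 4 ^ (2 * Q * 2 ^ t) * (n + 2) + 1 ≤ 2 ^ (6 * X) * (n + 1) := by
    have e1 : 4 ^ (2 * Q * 2 ^ t) = 2 ^ (4 * X) := by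
      rw [show (4 : ℕ) = 2 ^ 2 by norm_num, ← pow_mul]
      congr 1
      rw [hX]; ring
    have e2 : 2 ^ (6 * X) = 2 ^ (4 * X) * 2 ^ (2 * X) := by rw [← pow_add]; congr 1; ring
    have e3 : 2 ^ 2 ≤ 2 ^ (2 * X) := Nat.pow_le_pow_right (by norm_num) (by omega)
    have e4 : 1 ≤ 2 ^ (4 * X) := Nat.one_le_two_pow
    rw [e1, e2]
    calc 2 ^ (4 * X) * (n + 2) + 1 ≤ 2 ^ (4 * X) * (n + 2) + 2 ^ (4 * X) := by omega
      _ = 2 ^ (4 * X) * (n + 3) := by ring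
      _ ≤ 2 ^ (4 * X) * (2 ^ 2 * (n + 1)) := Nat.mul_le_mul_left _ (by omega)
      _ ≤ 2 ^ (4 * X) * (2 ^ (2 * X) * (n + 1)) := by gcongr
      _ = _ := by ring
  have h2 : C * (4 ^ (2 * Q * 2 ^ t) * (n + 2) + 1) ^ D ≤
      2 ^ ((C + 6 * D) * X) * (n + 1) ^ (2 * C + 12 * D) := by
    calc C * (4 ^ (2 * Q * 2 ^ t) * (n + 2) + 1) ^ D ≤ 2 ^ C * (2 ^ (6 * X) * (n + 1)) ^ D :=
          Nat.mul_le_mul Nat.lt_two_pow_self.le (Nat.pow_le_pow_left h1 D)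
      _ = 2 ^ (C + 6 * D * X) * (n + 1) ^ D := by rw [mul_pow, ← pow_mul, pow_add]; ring
      _ ≤ _ := by
        refine Nat.mul_le_mul (Nat.pow_le_pow_right (by norm_num) ?_)
          (Nat.pow_le_pow_right (by omega) (by omega))
        rw [add_mul]
        have := Nat.le_mul_of_pos_right C hX1
        omega
  have hp' : (0 : ℝ) < p := by exact_mod_cast hp
  have hq' : (0 : ℝ) < q := by exact_mod_cast hp.trans hpq
  have h3 : (((C + 6 * D) * X : ℕ) : ℝ) ≤
      ((2 * C + 12 * D : ℕ) : ℝ) * (2 : ℝ) ^ t / ((p : ℝ) / q) := by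
    rw [le_div_iff₀ (by positivity), ← mul_div_assoc, div_le_iff₀ hq']
    have : (C + 6 * D) * X * p ≤ (2 * C + 12 * D) * 2 ^ t * q := by
      calc (C + 6 * D) * X * p = (C + 6 * D) * 2 ^ t * (Q * p) := by rw [hX]; ring
        _ ≤ (C + 6 * D) * 2 ^ t * (2 * q) := Nat.mul_le_mul_left _ hQ
        _ = _ := by ring
    exact_mod_cast this
  calc ((C * (4 ^ (2 * Q * 2 ^ t) * (n + 2) + 1) ^ D : ℕ) : ℝ)
      ≤ ((2 ^ ((C + 6 * D) * X) * (n + 1) ^ (2 * C + 12 * D) : ℕ) : ℝ) := by exact_mod_cast h2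
    _ = (2 : ℝ) ^ (((C + 6 * D) * X : ℕ) : ℝ) * ((n : ℝ) + 1) ^ (2 * C + 12 * D) := by
        rw [Real.rpow_natCast]; push_cast; ring
    _ ≤ _ := by
        refine mul_le_mul_of_nonneg_right ?_ (by positivity)
        exact Real.rpow_le_rpow_of_exponent_le one_le_two h3

end

theorem mainTheorem1 :
    ∃ (A : RamProg) (c : ℕ),
      ∀ (n : ℕ) (G : SimpleGraph (Fin n)) (M : Set (Sym2 (Fin n))), (∀ d ∈ M, ¬ d.IsDiag) →
        ∀ (p q : ℕ), 0 < p → p < q → ∀ (ε : ℝ), ε = (p : ℝ) / (q : ℝ) →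
          ∃ (t : ℕ) (s : RamState) (L : List (List (Fin n))),
            Exec A (mndpInput G M p q) t s ∧
            (t : ℝ) ≤ (2 : ℝ) ^ ((c : ℝ) * (2 : ℝ) ^ treeDepth G / ε) * ((n : ℝ) + 1) ^ c ∧
            IsOutput s L ∧
            IsFeasible G M L ∧
            (1 - ε) * (mndpOpt G M : ℝ) ≤ (L.length : ℝ) := by
  obtain ⟨C, D, hCD⟩ := exists_time_bound
  refine ⟨mndpProg, 2 * C + 12 * D, fun n G M _ p q hp hpq ε hε => ?_⟩
  subst hε
  have hA := adjRel_input (G := G) (M := M) (p := p) (q := q)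
  have hdem := demRel_input (G := G) (M := M) (p := p) (q := q)
  have hex : ∃ Q, q ≤ Q * p := ⟨q, Nat.le_mul_of_pos_right _ hp⟩
  set Q := Nat.find hex with hQdef
  have hQ : q ≤ Q * p := Nat.find_spec hex
  have hmin : ∀ i < Q, i * p < q := fun i hi => not_le.1 (Nat.find_min hex hi)
  -- `ε < 1` excludes `Q = 1`.
  have hQ2 : 2 ≤ Q := by
    by_contra h
    have : Q * p ≤ 1 * p := Nat.mul_le_mul_right _ (by omega)
    omega
  -- Minimality gives `(Q - 1) * p < q`, and `p < q` accounts for the remaining `p`.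
  have hQq : Q * p ≤ 2 * q := by
    have := hmin (Q - 1) (by omega)
    rw [Nat.sub_mul] at this
    omega
  obtain ⟨F, hF⟩ := Nat.sInf_mem (treeDepth_set_nonempty G)
  have htd := F.tdLe hF hA
  obtain ⟨τ, s, he, hτ, P, c, hout, hP, h1, h2⟩ := hCD n p q Q (treeDepth G) _ _ (mndpInput G M p q)
    (by simp [mndpInput]) (by simp [mndpInput]) (by simp [mndpInput]) rfl rfl
    (fun u v h => by
      obtain ⟨hu, hv, h⟩ := (hA u v).1 h
      exact (hA v u).2 ⟨hv, hu, h.symm⟩)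
    (fun u v h => by
      obtain ⟨hu, hv, h⟩ := (hdem u v).1 h
      exact (hdem v u).2 ⟨hv, hu, by rw [Sym2.eq_swap]; exact h⟩) hQ2 hQ hmin htd
  obtain ⟨L, rfl, hL⟩ := exists_isFeasible hA hdem hP
  refine ⟨τ, s, L, he, ?_, hout.isOutput, hL, ?_⟩
  · exact le_trans (by exact_mod_cast hτ) (time_le hp hpq (by omega) hQq)
  · rw [List.length_map] at h1
    exact approximation_le hp hpq hQ (mndpOpt_le_maxPacking hA hdem) h1 h2
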